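/- Theorem (scattering on the curve $\beta=\beta_0(\varepsilon,\varepsilon\nu)$). **Setting.** Let $f:\mathbb R^2\to\mathbb R$ be smooth, $2\pi$-periodic in $y$, zero for $|x|>\rho$ (for some $\rho>0$), even in $x$ and in $y$, with $\int_{\mathbb R}\int_0^{2\pi} f\,dy\,dx>0$. Put $f_j(x)=\int_0^{2\pi}e^{-ijy}f(x,y)\,dy$ and $\tilde f_j(\xi)=\int_{\mathbb R} e^{-i\xi x}f_j(x)\,dx$. Let $\beta_{00}\in(0,1/2)$ satisfy $\tilde f_1(\kappa_0)=0$ and $\tilde f_1'(\kappa_0)\ne0$, where $\kappa_0=\sqrt{1-2\beta_{00}}$. For parameters $\varepsilon,\mu,\beta$ put $\omega^2=(1-\beta)^2-\mu^2$, $\gamma=\omega^2/4\pi$, $k_0=\sqrt{\omega^2-\beta^2}$, and $k_n=\sqrt{(\beta+n)^2-\omega^2}$ for $n\ne0,-1$. **Scattering problem.** Let $\Pi=\mathbb R\times(0,2\pi)$. Test functions are the smooth functions $\Phi$ on $\overline\Pi$ with $\Phi(x,2\pi)=e^{2\pi i\beta}\Phi(x,0)$ and $\Phi_y(x,2\pi)=e^{2\pi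 i\beta}\Phi_y(x,0)$ that vanish for large $|x|$; $H_1^\beta(\Pi)$ is their completion in the norm $\|\Phi\|_{L^2(\Pi)}+\|\nabla\Phi\|_{L^2(\Pi)}$. A function $\Psi$ solves the scattering problem with coefficients $\mathcal R,\mathcal T\in\mathbb C$ if $$\Psi-\chi(x)\mathcal T e^{i\beta y+ik_0x}-\chi(-x)\big(e^{i\beta y+ik_0x}+\mathcal R e^{i\beta y-ik_0x}\big)\in H_1^\beta(\Pi),$$ where $\chi$ is a smooth cut-off equal to $0$ for $x\le 0$ and to $1$ for $x\ge 1$, and $\int_\Pi\nabla\Psi\cdot\nabla\overline\Phi=\omega^2\int_\Pi(1+\varepsilon f)\Psi\overline\Phi$ for all test functions $\Phi$. Functions equal a.e. on $\Pi$ are identified. **Notation for the solution.** Let $G_0(x)=\frac{i}{2k_0}e^{ik_0|x|}$, $G_{-1}(x)=\frac1{2\mu}e^{-\mu|x|}$, and $G_n(x)=\frac1{2k_n}e^{-k_n|x|}$ otherwise. Let $H_n=G_n$ for $n\neq-1$ and $H_{-1}(x)=\frac{1}{2\mu}(e^{-\mu|x|}-1)$ (equal to $-|x|/2$ at $\mu=0$).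 Let $\mathcal A$ be the space of vectors $\mathbf A=(A_j)_{j\in\mathbb Z}$ with $A_j\in C[-\rho,\rho]$ (extended by zero) and $\sum_j(\sup|A_j|)^2<\infty$. Put $(\hat T\mathbf A)_m=2\gamma\sum_n(H_n*A_n)f_{m-n}$, $g^{(1)}_m=e^{ik_0x}f_m$, $g^{(2)}_m=f_{m+1}$, and $$F(\varepsilon,\mu,\beta)=\int_{\mathbb R}\big((1-\varepsilon\hat T)^{-1}\mathbf g^{(2)}\big)_{-1}dx,\qquad R(\varepsilon,\mu,\beta)=\int_{\mathbb R}\big((1-\varepsilon\hat T)^{-1}\mathbf g^{(2)}\big)_{0}\,e^{ik_0x}dx .$$ For $C\in\mathbb C$ put $\mathbf A^C=2\varepsilon\gamma(1-\varepsilon\hat T)^{-1}\big(\mathbf g^{(1)}+\tfrac{C}{2\mu}\mathbf g^{(2)}\big)$ and $\Psi^C=e^{i\beta y}\sum_n\Psi_n(x)e^{iny}$, with $\Psi_0=e^{ik_0x}+G_0*A^C_0$ and $\Psi_n=G_n*A^C_n$ for $n\ne0$. Finally put $$\mathcal R^C=\frac{i}{2k_0}\int_{\mathbb R} e^{ik_0\xi}A^C_0(\xi)\,d\xi,\qquad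 \mathcal T^C=1+\frac{i}{2k_0}\int_{\mathbb R} e^{-ik_0\xi}A^C_0(\xi)\,d\xi .$$ **Claim.** There are $\varepsilon_0,\mu_0,\eta>0$, a constant $K$, and functions $\beta_0(\varepsilon,\mu)$ and $\nu_{tr}(\varepsilon)$ with the following properties. * For $|\varepsilon|<\varepsilon_0$, $|\mu|<\mu_0$, $|\beta-\beta_{00}|<\eta$ one has $0<\beta<1/2$ and $\beta^2<\omega^2$, and $1-\varepsilon\hat T$ is a bijection of $\mathcal A$. * The function $\beta_0$ is continuous for $|\varepsilon|<\varepsilon_0$, $|\mu|<\mu_0$, takes values in $(\beta_{00}-\eta,\beta_{00}+\eta)$, satisfies $\beta_0(0,0)=\beta_{00}$, and for $|\varepsilon|<\varepsilon_0$, $|\mu|<\mu_0$, $|\beta-\beta_{00}|<\eta$ one has $R(\varepsilon,\mu,\beta)=0$ if and only if $\beta=\beta_0(\varepsilon,\mu)$. * For $0<\varepsilon<\varepsilon_0$, $\nu=\nu_{tr}(\varepsilon)$ is the only solution of $\nu-\gamma(\varepsilon\nu,\beta)F(\varepsilon,\varepsilon\nu,\beta)=0$, $\beta=\beta_0(\varepsilon,\varepsilon\nu)$,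 with $\nu>0$ and $\varepsilon\nu<\mu_0$; moreover $\nu_{tr}(\varepsilon)\to\frac{(1-\beta_{00})^2}{4\pi}\tilde f_0(0)$ as $\varepsilon\to0^+$. For all $0<\varepsilon<\varepsilon_0$ and $\nu>0$ with $\varepsilon\nu<\mu_0$, and with $\mu=\varepsilon\nu$, $\beta=\beta_0(\varepsilon,\varepsilon\nu)$: 1. If $\nu=\nu_{tr}(\varepsilon)$, the solutions of the scattering problem are exactly the functions $\Psi^C$, $C\in\mathbb C$ arbitrary, and these are pairwise different. The coefficients are nevertheless uniquely defined: every solution has the same $\mathcal R$ and $\mathcal T$, and $\mathcal R=\mathcal R^C$, $\mathcal T=\mathcal T^C$ for every $C$. 2. If $\nu\ne\nu_{tr}(\varepsilon)$, the scattering problem has the unique solution $\Psi^0$ (that is, $C=0$), with the unique coefficients $\mathcal R=\mathcal R^0$, $\mathcal T=\mathcal T^0$. In both cases $|\mathcal R|\le K\varepsilon$ and $|\mathcal T-1|\le K\varepsilon$, so there is no Breit–Wigner or Fano resonance on the curve. -/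

import Mathlib

open scoped ContDiff

noncomputable section

namespace RBScattering

open MeasureTheory Filter Topology Set

/-! The refractive index is `c⁻² = 1 + ε f`, with `f : ℝ × ℝ → ℝ` a function of `(x, y)`. The
frequency is `ω² = (1 - β)² - μ²`. Vectors `A = (…, A₋₁(x), A₀(x), A₁(x), …)` are functions
`ℤ → ℝ → ℂ`, the components being extended by zero outside `[-ρ, ρ]`. -/

/-- Fourier coefficient in `y`: `f_j(x) = ∫_0^{2π} e^{-ijy} f(x,y) dy`. -/
def fourierY (f : ℝ × ℝ → ℝ) (j : ℤ) (x : ℝ) : ℂ :=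
  ∫ y in (0 : ℝ)..(2 * Real.pi), Complex.exp (-(Complex.I * j * y)) * (f (x, y) : ℂ)

/-- Fourier transform of the coefficient: `∫ e^{-iξx} f_j(x) dx`. -/
def fourierXY (f : ℝ × ℝ → ℝ) (j : ℤ) (ξ : ℝ) : ℂ :=
  ∫ x : ℝ, Complex.exp (-(Complex.I * ξ * x)) * fourierY f j x

/-- `ω² = (1 - β)² - μ²`. -/
def omegaSq (μ β : ℝ) : ℝ := (1 - β) ^ 2 - μ ^ 2

/-- `γ = ω² / (4π)`. -/
def gam (μ β : ℝ) : ℝ := omegaSq μ β / (4 * Real.pi)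

/-- `k₀ = √(ω² - β²)`, the wave number of the propagating mode. -/
def kProp (μ β : ℝ) : ℝ := Real.sqrt (omegaSq μ β - β ^ 2)

/-- `k_n = √((β + n)² - ω²)`, used for `n ≠ 0, -1`. -/
def kEvan (n : ℤ) (μ β : ℝ) : ℝ := Real.sqrt ((β + n) ^ 2 - omegaSq μ β)

/-- The Green function `G_n` of the `n`-th mode: outgoing for `n = 0`, decaying otherwise. -/
def green (n : ℤ) (μ β x : ℝ) : ℂ :=
  if n = 0 then
    Complex.I / (2 * kProp μ β) * Complex.exp (Complex.I * kProp μ β * |x|)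
  else if n = -1 then
    ((Real.exp (-(μ * |x|)) / (2 * μ) : ℝ) : ℂ)
  else
    ((Real.exp (-(kEvan n μ β * |x|)) / (2 * kEvan n μ β) : ℝ) : ℂ)

/-- The regularised kernels: `H_n = G_n` for `n ≠ -1`, and
`H_{-1} = (e^{-μ|x|} - 1) / (2μ)`, with its limit `-|x|/2` at `μ = 0`. -/
def greenReg (n : ℤ) (μ β x : ℝ) : ℂ :=
  if n = -1 then
    (((if μ = 0 then -|x| / 2 else (Real.exp (-(μ * |x|)) - 1) / (2 * μ)) : ℝ) : ℂ)
  else green n μ β x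

/-- Convolution on the real line. -/
def lineConv (h a : ℝ → ℂ) (x : ℝ) : ℂ := ∫ ξ : ℝ, h (x - ξ) * a ξ

/-- The operator `(T A)_m = 2γ ∑_n (H_n ∗ A_n) f_{m-n}`. -/
def opT (f : ℝ × ℝ → ℝ) (μ β : ℝ) (A : ℤ → ℝ → ℂ) (m : ℤ) (x : ℝ) : ℂ :=
  2 * gam μ β * ∑' n : ℤ, lineConv (greenReg n μ β) (A n) x * fourierY f (m - n) x

/-- The space of vectors `A` with `A_j ∈ C[-ρ, ρ]` (extended by zero) and
`∑_j (sup |A_j|)² < ∞`. -/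
def MemA (ρ : ℝ) (A : ℤ → ℝ → ℂ) : Prop :=
  (∀ j, ContinuousOn (A j) (Icc (-ρ) ρ)) ∧
  (∀ j x, x ∉ Icc (-ρ) ρ → A j x = 0) ∧
  Summable (fun j : ℤ => (⨆ x : Icc (-ρ) ρ, ‖A j x‖) ^ 2)

/-- `A` belongs to the space above and `(1 - ε T) A = g`. -/
def SolvesA (f : ℝ × ℝ → ℝ) (ρ ε μ β : ℝ) (g A : ℤ → ℝ → ℂ) : Prop :=
  MemA ρ A ∧ ∀ m x, A m x - ε * opT f μ β A m x = g m x

/-- `1 - ε T` is a bijection of the space above. -/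
def OneSubOpTBijective (f : ℝ × ℝ → ℝ) (ρ ε μ β : ℝ) : Prop :=
  (∀ A, MemA ρ A → MemA ρ (fun m x => A m x - ε * opT f μ β A m x)) ∧
  (∀ g, MemA ρ g → ∃! A, SolvesA f ρ ε μ β g A)

/-- `(1 - ε T)⁻¹ g`, the solution `A` of `(1 - ε T) A = g`
(meaningful when `OneSubOpTBijective` holds). -/
def resolv (f : ℝ × ℝ → ℝ) (ρ ε μ β : ℝ) (g : ℤ → ℝ → ℂ) : ℤ → ℝ → ℂ :=
  Classical.epsilon (SolvesA f ρ ε μ β g)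

/-- `g⁽¹⁾_m = e^{ik₀x} f_m`. -/
def vecG1 (f : ℝ × ℝ → ℝ) (μ β : ℝ) (m : ℤ) (x : ℝ) : ℂ :=
  Complex.exp (Complex.I * kProp μ β * x) * fourierY f m x

/-- `g⁽²⁾_m = f_{m+1}`. -/
def vecG2 (f : ℝ × ℝ → ℝ) (m : ℤ) (x : ℝ) : ℂ := fourierY f (m + 1) x

/-- `F(ε, μ, β) = ⟨((1 - εT)⁻¹ g⁽²⁾)_{-1}⟩`. -/
def funF (f : ℝ × ℝ → ℝ) (ρ ε μ β : ℝ) : ℂ :=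
  ∫ x : ℝ, resolv f ρ ε μ β (vecG2 f) (-1) x

/-- `R(ε, μ, β) = ⟨((1 - εT)⁻¹ g⁽²⁾)_0 e^{ik₀x}⟩`. -/
def funR (f : ℝ × ℝ → ℝ) (ρ ε μ β : ℝ) : ℂ :=
  ∫ x : ℝ, resolv f ρ ε μ β (vecG2 f) 0 x * Complex.exp (Complex.I * kProp μ β * x)

/-- `A = 2εγ (1 - εT)⁻¹ (g⁽¹⁾ + (C / 2μ) g⁽²⁾)`. -/
def vecA (f : ℝ × ℝ → ℝ) (ρ ε μ β : ℝ) (C : ℂ) (m : ℤ) (x : ℝ) : ℂ :=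
  2 * ε * gam μ β *
    resolv f ρ ε μ β (fun m x => vecG1 f μ β m x + C / (2 * μ) * vecG2 f m x) m x

/-- `Ψ_0 = e^{ik₀x} + G_0 ∗ A_0`, `Ψ_m = G_m ∗ A_m` for `m ≠ 0`. -/
def modePsi (f : ℝ × ℝ → ℝ) (ρ ε μ β : ℝ) (C : ℂ) (m : ℤ) (x : ℝ) : ℂ :=
  (if m = 0 then Complex.exp (Complex.I * kProp μ β * x) else 0) +
    lineConv (green m μ β) (vecA f ρ ε μ β C m) x

/-- `Ψ(x, y) = e^{iβy} ∑_n Ψ_n(x) e^{iny}`, the function built from the constant `C`. -/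
def waveC (f : ℝ × ℝ → ℝ) (ρ ε μ β : ℝ) (C : ℂ) (p : ℝ × ℝ) : ℂ :=
  Complex.exp (Complex.I * β * p.2) *
    ∑' n : ℤ, modePsi f ρ ε μ β C n p.1 * Complex.exp (Complex.I * n * p.2)

/-- `(i / 2k₀) ∫ e^{ik₀ξ} A_0(ξ) dξ`. -/
def reflC (f : ℝ × ℝ → ℝ) (ρ ε μ β : ℝ) (C : ℂ) : ℂ :=
  Complex.I / (2 * kProp μ β) *
    ∫ ξ : ℝ, Complex.exp (Complex.I * kProp μ β * ξ) * vecA f ρ ε μ β C 0 ξ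

/-- `1 + (i / 2k₀) ∫ e^{-ik₀ξ} A_0(ξ) dξ`. -/
def transC (f : ℝ × ℝ → ℝ) (ρ ε μ β : ℝ) (C : ℂ) : ℂ :=
  1 + Complex.I / (2 * kProp μ β) *
    ∫ ξ : ℝ, Complex.exp (-(Complex.I * kProp μ β * ξ)) * vecA f ρ ε μ β C 0 ξ

/-! ### The scattering problem -/

/-- Lebesgue measure on the strip `Π = ℝ × (0, 2π)`. -/
def stripMeasure : Measure (ℝ × ℝ) :=
  volume.restrict (univ ×ˢ Ioo (0 : ℝ) (2 * Real.pi))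

/-- Partial derivative in `x`. -/
def dX (u : ℝ × ℝ → ℂ) (p : ℝ × ℝ) : ℂ := deriv (fun x : ℝ => u (x, p.2)) p.1

/-- Partial derivative in `y`. -/
def dY (u : ℝ × ℝ → ℂ) (p : ℝ × ℝ) : ℂ := deriv (fun y : ℝ => u (p.1, y)) p.2

/-- Smooth functions on the closed strip with quasiperiodic boundary conditions, vanishing for
large `|x|`. -/
def IsTest (β : ℝ) (φ : ℝ × ℝ → ℂ) : Prop :=
  ContDiff ℝ ∞ φ ∧
  (∀ x : ℝ, φ (x, 2 * Real.pi) =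
    Complex.exp (2 * Real.pi * Complex.I * β) * φ (x, 0)) ∧
  (∀ x : ℝ, dY φ (x, 2 * Real.pi) =
    Complex.exp (2 * Real.pi * Complex.I * β) * dY φ (x, 0)) ∧
  ∃ M : ℝ, ∀ x y : ℝ, M < |x| → y ∈ Icc 0 (2 * Real.pi) → φ (x, y) = 0

/-- `v ∈ H₁^β(Π)` with gradient `(vx, vy)`: `v` is a limit of test functions in the norm
`‖v‖_{L²(Π)} + ‖∇v‖_{L²(Π)}`. -/
def MemH1 (β : ℝ) (v vx vy : ℝ × ℝ → ℂ) : Prop :=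
  MemLp v 2 stripMeasure ∧ MemLp vx 2 stripMeasure ∧ MemLp vy 2 stripMeasure ∧
  ∃ φ : ℕ → ℝ × ℝ → ℂ, (∀ k, IsTest β (φ k)) ∧
    Tendsto (fun k => eLpNorm (φ k - v) 2 stripMeasure) atTop (𝓝 0) ∧
    Tendsto (fun k => eLpNorm (dX (φ k) - vx) 2 stripMeasure) atTop (𝓝 0) ∧
    Tendsto (fun k => eLpNorm (dY (φ k) - vy) 2 stripMeasure) atTop (𝓝 0)

/-- The prescribed behaviour at infinity,
`χ(x) 𝓣 e^{iβy + ik₀x} + χ(-x) (e^{iβy + ik₀x} + 𝓡 e^{iβy - ik₀x})`, with the smooth cut-off `χ`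
equal to `0` for `x ≤ 0` and to `1` for `x ≥ 1`. -/
def farField (μ β : ℝ) (refl trans : ℂ) (p : ℝ × ℝ) : ℂ :=
  Real.smoothTransition p.1 *
      (trans * Complex.exp (Complex.I * (β * p.2 + kProp μ β * p.1))) +
    Real.smoothTransition (-p.1) *
      (Complex.exp (Complex.I * (β * p.2 + kProp μ β * p.1)) +
        refl * Complex.exp (Complex.I * (β * p.2 - kProp μ β * p.1)))

/-- `Ψ` solves the scattering problem with reflection and transmission coefficients `refl`,
`trans`: its difference with the far field lies in `H₁^β(Π)`, and
`∫_Π ∇Ψ·∇Φ̄ = ω² ∫_Π (1 + ε f) Ψ Φ̄` for all test functions `Φ`. -/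
def IsScatteringSolution (f : ℝ × ℝ → ℝ) (ε μ β : ℝ) (Ψ : ℝ × ℝ → ℂ) (refl trans : ℂ) :
    Prop :=
  ∃ Ψx Ψy : ℝ × ℝ → ℂ,
    MemH1 β (Ψ - farField μ β refl trans) (Ψx - dX (farField μ β refl trans))
      (Ψy - dY (farField μ β refl trans)) ∧
    ∀ Φ : ℝ × ℝ → ℂ, IsTest β Φ →
      ∫ p, (Ψx p * starRingEnd ℂ (dX Φ p) + Ψy p * starRingEnd ℂ (dY Φ p)) ∂stripMeasure =
        omegaSq μ β * ∫ p, (1 + ε * f p) * Ψ p * starRingEnd ℂ (Φ p) ∂stripMeasure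

/-! ### The curve `β = β₀(ε, εν)` and the value `ν_tr(ε)` -/

/-- `β₀` is the implicit function defined by `R(ε, μ, β) = 0` near `(0, 0, β₀₀)`: on the box
`|ε| < ε₀`, `|μ| < μ₀`, `|β - β₀₀| < η` the equation holds exactly on the graph of `β₀`. -/
def IsCurve (f : ℝ × ℝ → ℝ) (ρ β00 ε₀ μ₀ η : ℝ) (β₀ : ℝ → ℝ → ℝ) : Prop :=
  β₀ 0 0 = β00 ∧
  ContinuousOn (fun q : ℝ × ℝ => β₀ q.1 q.2) {q | |q.1| < ε₀ ∧ |q.2| < μ₀} ∧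
  ∀ ε μ : ℝ, |ε| < ε₀ → |μ| < μ₀ →
    |β₀ ε μ - β00| < η ∧
    ∀ β : ℝ, |β - β00| < η → (funR f ρ ε μ β = 0 ↔ β = β₀ ε μ)

/-- `ν_tr(ε)` is the root on the curve of `ν - γ(εν, β) F(ε, εν, β) = 0`; it is the only one
with `0 < εν < μ₀` and tends to `ν₀₀ = (1 - β₀₀)² / (4π) ∫∫ f` as `ε → 0`. -/
def IsTrappedValue (f : ℝ × ℝ → ℝ) (ρ β00 ε₀ μ₀ : ℝ) (β₀ : ℝ → ℝ → ℝ) (νtr : ℝ → ℝ) : Prop :=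
  Tendsto νtr (𝓝[>] 0)
    (𝓝 ((1 - β00) ^ 2 / (4 * Real.pi) *
      ∫ x : ℝ, ∫ y in (0 : ℝ)..(2 * Real.pi), f (x, y))) ∧
  ∀ ε : ℝ, 0 < ε → ε < ε₀ →
    0 < νtr ε ∧ ε * νtr ε < μ₀ ∧
    ∀ ν : ℝ, 0 < ν → ε * ν < μ₀ →
      ((ν : ℂ) - gam (ε * ν) (β₀ ε (ε * ν)) * funF f ρ ε (ε * ν) (β₀ ε (ε * ν)) = 0 ↔
        ν = νtr ε)

/-- The scattering problem has, up to equality almost everywhere on the strip, precisely the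
solutions `waveC C`, `C ∈ ℂ`, which are pairwise different; all of them have the same reflection
and transmission coefficients, given by `reflC C` and `transC C` for every `C`, and these
coefficients are `O(ε)` and `1 + O(ε)` with constant `K`. -/
def NonuniqueScattering (f : ℝ × ℝ → ℝ) (ρ ε μ β K : ℝ) : Prop :=
  ∃ refl trans : ℂ,
    (∀ C : ℂ, refl = reflC f ρ ε μ β C ∧ trans = transC f ρ ε μ β C) ∧
    (∀ C : ℂ, IsScatteringSolution f ε μ β (waveC f ρ ε μ β C) refl trans) ∧
    (∀ C C' : ℂ, waveC f ρ ε μ β C =ᵐ[stripMeasure] waveC f ρ ε μ β C' → C = C') ∧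
    (∀ (Ψ : ℝ × ℝ → ℂ) (r t : ℂ), IsScatteringSolution f ε μ β Ψ r t →
      (∃ C : ℂ, Ψ =ᵐ[stripMeasure] waveC f ρ ε μ β C) ∧ r = refl ∧ t = trans) ∧
    ‖refl‖ ≤ K * ε ∧ ‖trans - 1‖ ≤ K * ε

/-- The scattering problem has, up to equality almost everywhere on the strip, the unique solution
`waveC 0`, with coefficients `reflC 0 = O(ε)` and `transC 0 = 1 + O(ε)`, with constant `K`. -/
def UniqueScattering (f : ℝ × ℝ → ℝ) (ρ ε μ β K : ℝ) : Prop :=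
  IsScatteringSolution f ε μ β (waveC f ρ ε μ β 0) (reflC f ρ ε μ β 0)
    (transC f ρ ε μ β 0) ∧
  (∀ (Ψ : ℝ × ℝ → ℂ) (r t : ℂ), IsScatteringSolution f ε μ β Ψ r t →
    Ψ =ᵐ[stripMeasure] waveC f ρ ε μ β 0 ∧
      r = reflC f ρ ε μ β 0 ∧ t = transC f ρ ε μ β 0) ∧
  ‖reflC f ρ ε μ β 0‖ ≤ K * ε ∧ ‖transC f ρ ε μ β 0 - 1‖ ≤ K * ε

end RBScattering

end

open scoped ContDiff

noncomputable section

namespace RBScattering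

open MeasureTheory Filter Topology Set

/-! ### Partial derivatives of smooth functions -/

/-! Expand a solution in quasiperiodic modes `Ψ_n(x) e^{i(β+n)y}` and let `A_n` be the modes of the
source `ε ω² f Ψ`. Each mode satisfies `-Ψ_n'' + s_n² Ψ_n = A_n` with `s_n² = (β+n)² - ω²`, so the
radiation condition forces `Ψ_n = δ_{n0} e^{ik₀x} + G_n * A_n`, and the scattering problem becomes
the self-consistency equation `A_m = 2εγ ∑ f_{m-n} Ψ_n` (`IsConsistent`). The only kernel that is
singular as `μ → 0` is `G_{-1} = H_{-1} + 1/(2μ)`. Its constant part sees `A` only through `C = ∫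
A_{-1}`, and the regular rest is inverted by a Neumann series. Hence `A = 2εγ (1 - εT)⁻¹ (g⁽¹⁾ +
(C/2μ) g⁽²⁾)`, and what remains is one scalar equation saying that `C` is the integral of its own
`A_{-1}` (`IsProfile.isConsistent_iff`).

Multiplication by `f` and convolution with even kernels are symmetric for the bilinear pairing `∑ ∫
a_n b_n`. This gives the reciprocity `∫ ((1-εT)⁻¹ g⁽¹⁾)_{-1} = R` (`pairing_reciprocity`). With `μ =
εν` the scalar equation reads `C (ν - γF) = 2εγν R`. On the curve `R = 0` it is homogeneous: `C = 0`
is forced unless `ν = γF`, when `C` is arbitrary. The contribution of `C` to the reflection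
coefficient is a multiple of `R`, and so is that to the transmission coefficient because the
response to `g⁽²⁾` is even in `x`. On the curve both coefficients are therefore independent of `C`
and differ from `0` and `1` by `O(ε)`.

The curve exists because the complex equation `R = 0` is equivalent to a real one. On even functions
`G_0` differs from its real part by a rank-one operator proportional to the cosine moment of the
argument, and `R` is the cosine moment of the zeroth component, so at a zero of `R` the problems
with `G_0` and `Re G_0` have the same solution (`funR_eq_zero_iff`). The real function equals
`f̃₁(k₀)` at `ε = 0`, has a simple zero there, and its correction has Lipschitz constant `O(ε)` in
`(μ, β)`. A monotonicity argument then replaces the implicit function theorem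
(`exists_lipschitz_curve`). On the curve `F` is real, and `ν = γF` is a contraction because `ν`
enters only through `εν` (`exists_fixed_value`).

The passage between the weak problem and the modes has two directions. A consistent vector gives a
series of exponentially decaying modes after the far field is removed, and such a series is
approximated by test functions in a weighted sup norm (`IsConsistent.isScatteringSolution`).
Conversely, a solution is tested with a cut-off times an outgoing solution of the mode equation. As
the cut-off is removed only the incident wave survives from infinity (`mode_identity`), so the modes
satisfy the integral equations, and Parseval's identity recovers the solution from them
(`IsScatteringSolution.exists_ae_eq`). The coefficients are determined because the difference of two
far fields is in `L²` only if it has equal coefficients. -/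

lemma hasDerivAt_dX {u : ℝ × ℝ → ℂ} (hu : ContDiff ℝ ∞ u) (x y : ℝ) :
    HasDerivAt (fun x : ℝ => u (x, y)) (fderiv ℝ u (x, y) (1, 0)) x := by
  have h1 : HasFDerivAt u (fderiv ℝ u (x, y)) (x, y) :=
    (hu.differentiable (by simp)).differentiableAt.hasFDerivAt
  have h2 : HasDerivAt (fun x : ℝ => (x, y)) ((1 : ℝ), (0 : ℝ)) x :=
    (hasDerivAt_id x).prodMk (hasDerivAt_const x y)
  exact h1.comp_hasDerivAt x h2

lemma hasDerivAt_dY {u : ℝ × ℝ → ℂ} (hu : ContDiff ℝ ∞ u) (x y : ℝ) :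
    HasDerivAt (fun y : ℝ => u (x, y)) (fderiv ℝ u (x, y) (0, 1)) y := by
  have h1 : HasFDerivAt u (fderiv ℝ u (x, y)) (x, y) :=
    (hu.differentiable (by simp)).differentiableAt.hasFDerivAt
  have h2 : HasDerivAt (fun y : ℝ => (x, y)) ((0 : ℝ), (1 : ℝ)) y :=
    (hasDerivAt_const y x).prodMk (hasDerivAt_id y)
  exact h1.comp_hasDerivAt y h2

lemma dX_eq_fderiv {u : ℝ × ℝ → ℂ} (hu : ContDiff ℝ ∞ u) :
    dX u = fun p => fderiv ℝ u p (1, 0) :=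
  funext fun p => (hasDerivAt_dX hu p.1 p.2).deriv

lemma dY_eq_fderiv {u : ℝ × ℝ → ℂ} (hu : ContDiff ℝ ∞ u) :
    dY u = fun p => fderiv ℝ u p (0, 1) :=
  funext fun p => (hasDerivAt_dY hu p.1 p.2).deriv

lemma contDiff_dX {u : ℝ × ℝ → ℂ} (hu : ContDiff ℝ ∞ u) : ContDiff ℝ ∞ (dX u) := by
  rw [dX_eq_fderiv hu]
  exact (hu.fderiv_right (m := ∞) (by simp)).clm_apply contDiff_const

lemma contDiff_dY {u : ℝ × ℝ → ℂ} (hu : ContDiff ℝ ∞ u) : ContDiff ℝ ∞ (dY u) := by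
  rw [dY_eq_fderiv hu]
  exact (hu.fderiv_right (m := ∞) (by simp)).clm_apply contDiff_const

lemma hasDerivAt_dX' {u : ℝ × ℝ → ℂ} (hu : ContDiff ℝ ∞ u) (x y : ℝ) :
    HasDerivAt (fun x : ℝ => u (x, y)) (dX u (x, y)) x := by
  rw [dX_eq_fderiv hu]; exact hasDerivAt_dX hu x y

lemma hasDerivAt_dY' {u : ℝ × ℝ → ℂ} (hu : ContDiff ℝ ∞ u) (x y : ℝ) :
    HasDerivAt (fun y : ℝ => u (x, y)) (dY u (x, y)) y := by
  rw [dY_eq_fderiv hu]; exact hasDerivAt_dY hu x y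

/-! ### The Fourier coefficients of the profile -/

/-- The standing assumptions on the perturbation of the refractive index. -/
structure IsProfile (f : ℝ × ℝ → ℝ) (ρ : ℝ) : Prop where
  pos : 0 < ρ
  smooth : ContDiff ℝ ∞ f
  periodic : ∀ x y : ℝ, f (x, y + 2 * Real.pi) = f (x, y)
  support : ∀ x y : ℝ, ρ < |x| → f (x, y) = 0
  even_fst : ∀ x y : ℝ, f (-x, y) = f (x, y)
  even_snd : ∀ x y : ℝ, f (x, -y) = f (x, y)

lemma hasDerivAt_cexp_mul (c : ℂ) (y : ℝ) :
    HasDerivAt (fun y : ℝ => Complex.exp (c * y)) (c * Complex.exp (c * y)) y := by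
  have h : HasDerivAt (fun y : ℝ => c * (y : ℂ)) c y := by
    simpa using (Complex.ofRealCLM.hasDerivAt (x := y)).const_mul c
  simpa [mul_comm] using h.cexp

lemma summable_div_one_add_sq (C : ℝ) : Summable (fun j : ℤ => C / (1 + (j : ℝ) ^ 2)) := by
  have h2 : Summable (fun j : ℤ => 1 / (j : ℝ) ^ 2) :=
    (Real.summable_one_div_int_pow (p := 2)).mpr (by norm_num)
  refine (Summable.of_norm_bounded_eventually (h2.mul_left |C|) ?_)
  filter_upwards [(Set.finite_singleton (0 : ℤ)).compl_mem_cofinite] with j hj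
  have hj : j ≠ 0 := by simpa using hj
  have : (0 : ℝ) < (j : ℝ) ^ 2 := by positivity
  rw [norm_div, Real.norm_eq_abs, Real.norm_of_nonneg (by positivity), mul_one_div]
  gcongr
  linarith

lemma exp_two_pi_int (j : ℤ) : Complex.exp (Complex.I * j * ((2 * Real.pi : ℝ) : ℂ)) = 1 := by
  rw [← Complex.exp_int_mul_two_pi_mul_I j]
  congr 1
  push_cast
  ring

lemma norm_exp_I_int_mul (j : ℤ) (y : ℝ) : ‖Complex.exp (Complex.I * j * y)‖ = 1 := by
  have : Complex.I * j * y = ((j * y : ℝ) : ℂ) * Complex.I := by push_cast; ring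
  rw [this, Complex.norm_exp_ofReal_mul_I]

lemma norm_exp_neg_I_int_mul (j : ℤ) (y : ℝ) :
    ‖Complex.exp (-(Complex.I * j * y))‖ = 1 := by
  have : -(Complex.I * j * y) = ((-(j * y) : ℝ) : ℂ) * Complex.I := by push_cast; ring
  rw [this, Complex.norm_exp_ofReal_mul_I]

/-- Integration by parts: the boundary terms cancel because both factors take equal values at the
two ends. Applied twice it yields the `1/j²` decay of the Fourier coefficients. -/
lemma integral_exp_mul_of_periodic {g g' : ℝ → ℂ} (hg : ∀ y, HasDerivAt g (g' y) y)
    (hg' : Continuous g') (hper : g (2 * Real.pi) = g 0) {j : ℤ} (hj : j ≠ 0) :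
    ∫ y in (0 : ℝ)..(2 * Real.pi), Complex.exp (-(Complex.I * j * y)) * g y =
      1 / (Complex.I * j) *
        ∫ y in (0 : ℝ)..(2 * Real.pi), Complex.exp (-(Complex.I * j * y)) * g' y := by
  have hIj : (Complex.I * j : ℂ) ≠ 0 := mul_ne_zero Complex.I_ne_zero (by exact_mod_cast hj)
  have hv : ∀ y : ℝ, HasDerivAt (fun y : ℝ => Complex.exp (-(Complex.I * j * y)))
      (-(Complex.I * j) * Complex.exp (-(Complex.I * j * y))) y := by
    intro y
    simpa only [neg_mul] using hasDerivAt_cexp_mul (-(Complex.I * j)) y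
  have key := intervalIntegral.integral_mul_deriv_eq_deriv_mul (a := 0) (b := 2 * Real.pi)
    (fun y _ => hv y) (fun y _ => hg y)
    (Continuous.intervalIntegrable (by fun_prop) _ _) (hg'.intervalIntegrable _ _)
  have h2 : Complex.exp (-(Complex.I * j * ((2 * Real.pi : ℝ) : ℂ))) = 1 := by
    rw [Complex.exp_neg, exp_two_pi_int, inv_one]
  rw [h2, hper] at key
  have h3 : ∫ y in (0 : ℝ)..(2 * Real.pi),
      -(Complex.I * j) * Complex.exp (-(Complex.I * j * y)) * g y =
      -(Complex.I * j) * ∫ y in (0 : ℝ)..(2 * Real.pi),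
        Complex.exp (-(Complex.I * j * y)) * g y := by
    rw [← intervalIntegral.integral_const_mul]
    congr 1
    ext y
    ring
  rw [h3] at key
  rw [key]
  simp only [one_mul, Complex.ofReal_zero, mul_zero, neg_zero, Complex.exp_zero, sub_self, zero_sub]
  field_simp

namespace IsProfile

variable {f : ℝ × ℝ → ℝ} {ρ : ℝ}

lemma smooth_complex (hf : IsProfile f ρ) : ContDiff ℝ ∞ (fun p => (f p : ℂ)) :=
  Complex.ofRealCLM.contDiff.comp hf.smooth

lemma continuous_fourierY (hf : IsProfile f ρ) (j : ℤ) : Continuous (fourierY f j) := by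
  have hc := hf.smooth.continuous
  unfold fourierY
  apply intervalIntegral.continuous_parametric_intervalIntegral_of_continuous'
  fun_prop

lemma fourierY_eq_zero (hf : IsProfile f ρ) (j : ℤ) {x : ℝ} (hx : x ∉ Icc (-ρ) ρ) :
    fourierY f j x = 0 := by
  have hx' : ρ < |x| := by
    rw [mem_Icc, ← abs_le] at hx
    exact not_le.mp hx
  simp [fourierY, hf.support x _ hx']

/-- Substitute `y ↦ -y`, use evenness, and move the interval back by periodicity. This symmetry
makes the coefficients real and makes multiplication by the profile symmetric for the bilinear
pairing. -/
lemma fourierY_neg (hf : IsProfile f ρ) (j : ℤ) (x : ℝ) : fourierY f (-j) x = fourierY f j x := by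
  have hper : Function.Periodic (fun y : ℝ =>
      Complex.exp (-(Complex.I * j * y)) * (f (x, y) : ℂ)) (2 * Real.pi) := by
    intro y
    simp only
    rw [hf.periodic x y]
    congr 1
    have : -(Complex.I * j * ((y + 2 * Real.pi : ℝ) : ℂ)) =
      -(Complex.I * j * y) + -(Complex.I * j * ((2 * Real.pi : ℝ) : ℂ)) := by push_cast; ring
    rw [this, Complex.exp_add, Complex.exp_neg (Complex.I * j * ((2 * Real.pi : ℝ) : ℂ)),
      exp_two_pi_int, inv_one, mul_one]
  have h1 := hper.intervalIntegral_add_eq 0 (-(2 * Real.pi))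
  have h2 := intervalIntegral.integral_comp_neg (a := 0) (b := 2 * Real.pi) (fun y : ℝ =>
      Complex.exp (-(Complex.I * j * y)) * (f (x, y) : ℂ))
  unfold fourierY
  rw [zero_add, neg_add_cancel] at h1
  rw [h1, ← neg_zero, ← h2, neg_zero]
  congr 1
  ext y
  rw [hf.even_snd]
  push_cast
  congr 2
  ring

lemma conj_fourierY (hf : IsProfile f ρ) (j : ℤ) (x : ℝ) :
    starRingEnd ℂ (fourierY f j x) = fourierY f j x := by
  conv_rhs => rw [← hf.fourierY_neg j x]
  have hpi : (0 : ℝ) ≤ 2 * Real.pi := by positivity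
  unfold fourierY
  rw [intervalIntegral.integral_of_le hpi, intervalIntegral.integral_of_le hpi, ← integral_conj]
  congr 1
  ext y
  rw [map_mul, Complex.conj_ofReal, ← Complex.exp_conj]
  congr 2
  simp

lemma fourierY_even (hf : IsProfile f ρ) (j : ℤ) (x : ℝ) :
    fourierY f j (-x) = fourierY f j x := by
  simp [fourierY, hf.even_fst]

/-- Two integrations by parts bring down `1/j²`. Uniformity in `x` comes from the compactness of the
support of `f` times one period. -/
lemma exists_fourierY_bound (hf : IsProfile f ρ) :
    ∃ C : ℝ, 0 ≤ C ∧ ∀ (j : ℤ) (x : ℝ), ‖fourierY f j x‖ ≤ C / (1 + (j : ℝ) ^ 2) := by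
  set u : ℝ × ℝ → ℂ := fun p => (f p : ℂ) with hu_def
  have hu : ContDiff ℝ ∞ u := hf.smooth_complex
  have hu1 := contDiff_dY hu
  have hu2 := contDiff_dY hu1
  have hper : ∀ x y, u (x, y + 2 * Real.pi) = u (x, y) := fun x y => by
    simp [hu_def, hf.periodic x y]
  have hper1 : ∀ x, dY u (x, 2 * Real.pi) = dY u (x, 0) := by
    intro x
    unfold dY
    have : (fun y : ℝ => u (x, y)) = fun y => u (x, y + 2 * Real.pi) :=
      funext fun y => (hper x y).symm
    simp only
    conv_rhs => rw [this]
    rw [deriv_comp_add_const (f := fun y => u (x, y))]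
    simp
  have hK : IsCompact (Icc (-ρ) ρ ×ˢ Icc (0 : ℝ) (2 * Real.pi)) := isCompact_Icc.prod isCompact_Icc
  obtain ⟨C0, hC0⟩ := hK.exists_bound_of_continuousOn hu.continuous.continuousOn
  obtain ⟨C2, hC2⟩ := hK.exists_bound_of_continuousOn hu2.continuous.continuousOn
  have hpi := Real.pi_pos
  have h00 : (0 : ℝ) ≤ max C0 C2 := by
    refine le_trans (norm_nonneg _) ((hC0 (0, 0) ?_).trans (le_max_left _ _))
    constructor
    · simp [hf.pos.le]
    · simp [hpi.le]
  -- The maximum treats `j = 0` (bound on `f`) and `j ≠ 0` (bound on `f_yy`) together; the factor 2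
  -- is `1 + j² ≤ 2 j²` for `j ≠ 0`.
  refine ⟨2 * (max C0 C2 * (2 * Real.pi)), by positivity, fun j x => ?_⟩
  by_cases hx : x ∈ Icc (-ρ) ρ
  swap
  · rw [hf.fourierY_eq_zero j hx]; simp; positivity
  have hbound : ∀ (g : ℝ × ℝ → ℂ) (C : ℝ), (∀ p ∈ Icc (-ρ) ρ ×ˢ Icc (0 : ℝ) (2 * Real.pi), ‖g p‖ ≤ C) →
      C ≤ max C0 C2 →
      ‖∫ y in (0 : ℝ)..(2 * Real.pi), Complex.exp (-(Complex.I * j * y)) * g (x, y)‖ ≤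
        max C0 C2 * (2 * Real.pi) := by
    intro g C hg hC
    have := intervalIntegral.norm_integral_le_of_norm_le_const (a := 0) (b := 2 * Real.pi)
      (C := max C0 C2) (f := fun y : ℝ => Complex.exp (-(Complex.I * j * y)) * g (x, y)) (by
      intro y hy
      rw [uIoc_of_le (by positivity)] at hy
      rw [norm_mul, norm_exp_neg_I_int_mul, one_mul]
      exact (hg (x, y) ⟨hx, hy.1.le, hy.2⟩).trans hC)
    rwa [sub_zero, abs_of_pos (by positivity)] at this
  have hb0 := hbound u C0 hC0 (le_max_left _ _)
  have hb2 := hbound _ C2 hC2 (le_max_right _ _)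
  rcases eq_or_ne j 0 with rfl | hj
  · have : ‖fourierY f 0 x‖ ≤ max C0 C2 * (2 * Real.pi) := hb0
    simp only [Int.cast_zero]
    rw [zero_pow two_ne_zero, add_zero, div_one]
    nlinarith [mul_nonneg h00 hpi.le]
  · have e1 : fourierY f j x = ∫ y in (0 : ℝ)..(2 * Real.pi),
        Complex.exp (-(Complex.I * j * y)) * u (x, y) := rfl
    have p1 := integral_exp_mul_of_periodic (fun y => hasDerivAt_dY' hu x y)
      (hu1.continuous.comp (by fun_prop)) (by simpa using hper x 0) hj
    have p2 := integral_exp_mul_of_periodic (fun y => hasDerivAt_dY' hu1 x y)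
      (hu2.continuous.comp (by fun_prop)) (hper1 x) hj
    rw [e1, p1, p2, norm_mul, norm_mul]
    have hj1 : (1 : ℝ) ≤ (j : ℝ) ^ 2 := by
      have : (1 : ℤ) ≤ j ^ 2 := by
        have := sq_abs j
        have h1 : 1 ≤ |j| := Int.one_le_abs hj
        nlinarith
      exact_mod_cast this
    have hn : ‖(1 : ℂ) / (Complex.I * j)‖ = 1 / |(j : ℝ)| := by
      simp
    rw [hn, ← mul_assoc, div_mul_div_comm, one_mul, abs_mul_abs_self, ← pow_two]
    rw [div_mul_eq_mul_div, one_mul, div_le_div_iff₀ (by positivity) (by positivity)]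
    calc _ ≤ max C0 C2 * (2 * Real.pi) * (1 + (j : ℝ) ^ 2) := by gcongr
      _ ≤ max C0 C2 * (2 * Real.pi) * (2 * (j : ℝ) ^ 2) := by gcongr; linarith
      _ = _ := by ring

/-- The coefficients are absolutely summable, so the Fourier series converges pointwise to the
continuous function. The factor `2π` is there because the coefficients are not normalised. -/
lemma hasSum_fourierY (hf : IsProfile f ρ) (x y : ℝ) :
    HasSum (fun j : ℤ => fourierY f j x * Complex.exp (Complex.I * j * y))
      (2 * Real.pi * f (x, y)) := by
  have : Fact (0 < 2 * Real.pi) := ⟨by positivity⟩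
  have hpi := Real.pi_pos
  have hper : Function.Periodic (fun y => (f (x, y) : ℂ)) (2 * Real.pi) := fun y => by
    simp [hf.periodic x y]
  let F : C(AddCircle (2 * Real.pi), ℂ) := ⟨hper.lift, by
    have : Continuous (fun y => (f (x, y) : ℂ)) := by
      have := hf.smooth.continuous
      fun_prop
    exact continuous_coinduced_dom.mpr this⟩
  have hcoef : ∀ j : ℤ, fourierCoeff F j = 1 / (2 * Real.pi) * fourierY f j x := by
    intro j
    rw [fourierCoeff_eq_intervalIntegral _ _ 0]
    simp only [zero_add, fourierY, Complex.real_smul]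
    push_cast
    congr 2
    ext z
    rw [fourier_coe_apply, smul_eq_mul]
    have : F (z : AddCircle (2 * Real.pi)) = (f (x, z) : ℂ) := hper.lift_coe z
    rw [this]
    congr 2
    push_cast
    field_simp
  obtain ⟨C, hC0, hC⟩ := hf.exists_fourierY_bound
  have hsum : Summable (fourierCoeff F) := by
    refine Summable.of_norm_bounded ((summable_div_one_add_sq C).mul_left (1 / (2 * Real.pi))) fun j => ?_
    rw [hcoef, norm_mul]
    have : ‖(1 : ℂ) / (2 * Real.pi)‖ = 1 / (2 * Real.pi) := by
      simp [abs_of_pos hpi]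
    rw [this]
    gcongr
    exact hC j x
  have key := (has_pointwise_sum_fourier_series_of_summable hsum (y : AddCircle (2 * Real.pi))).mul_left
    (2 * Real.pi : ℂ)
  have : F (y : AddCircle (2 * Real.pi)) = (f (x, y) : ℂ) := hper.lift_coe y
  rw [this] at key
  refine (congrArg (fun F => HasSum F (2 * Real.pi * f (x, y) : ℂ)) (funext fun j => ?_)).mpr key
  rw [hcoef, fourier_coe_apply, smul_eq_mul]
  have h1 : 2 * (Real.pi : ℂ) * Complex.I * j * y / ((2 * Real.pi : ℝ) : ℂ) =
      Complex.I * j * y := by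
    have : (Real.pi : ℂ) ≠ 0 := by exact_mod_cast hpi.ne'
    push_cast
    field_simp
  rw [h1]
  have : (Real.pi : ℂ) ≠ 0 := by exact_mod_cast hpi.ne'
  field_simp

end IsProfile
/-! ### The Banach space of vectors -/

/-- Square-summable sequences of continuous functions on `[-ρ, ρ]`. -/
abbrev Vec (ρ : ℝ) := lp (fun _ : ℤ => C(Icc (-ρ) ρ, ℂ)) 2

/-- Extension by zero of a function on `[-ρ, ρ]`. -/
def extZero {ρ : ℝ} (u : C(Icc (-ρ) ρ, ℂ)) (x : ℝ) : ℂ :=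
  if h : x ∈ Icc (-ρ) ρ then u ⟨x, h⟩ else 0

/-- The restriction to `[-ρ, ρ]` of a function continuous there. -/
def restrIcc {ρ : ℝ} (u : ℝ → ℂ) (hu : ContinuousOn u (Icc (-ρ) ρ)) : C(Icc (-ρ) ρ, ℂ) :=
  ⟨(Icc (-ρ) ρ).domRestrict u, hu.domRestrict⟩

/-! ### Continuous functions on `[-ρ, ρ]` extended by zero, integration and convolution. -/

section ExtZero

variable {ρ : ℝ}

lemma extZero_of_mem (u : C(Icc (-ρ) ρ, ℂ)) {x : ℝ} (h : x ∈ Icc (-ρ) ρ) :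
    extZero u x = u ⟨x, h⟩ := dif_pos h

lemma extZero_of_notMem (u : C(Icc (-ρ) ρ, ℂ)) {x : ℝ} (h : x ∉ Icc (-ρ) ρ) :
    extZero u x = 0 := dif_neg h

lemma extZero_coe (u : C(Icc (-ρ) ρ, ℂ)) (x : Icc (-ρ) ρ) : extZero u x = u x :=
  extZero_of_mem u x.2

lemma continuousOn_extZero (u : C(Icc (-ρ) ρ, ℂ)) : ContinuousOn (extZero u) (Icc (-ρ) ρ) := by
  rw [continuousOn_iff_continuous_domRestrict]
  convert u.continuous using 1
  ext x
  exact extZero_coe u x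

lemma extZero_restrIcc {u : ℝ → ℂ} (hu : ContinuousOn u (Icc (-ρ) ρ))
    (h0 : ∀ x, x ∉ Icc (-ρ) ρ → u x = 0) : extZero (restrIcc u hu) = u := by
  ext x
  by_cases hx : x ∈ Icc (-ρ) ρ
  · rw [extZero_of_mem _ hx]; rfl
  · rw [extZero_of_notMem _ hx, h0 x hx]

lemma extZero_injective : Function.Injective (extZero (ρ := ρ)) := fun u v h => by
  ext x
  rw [← extZero_coe u, ← extZero_coe v, h]

lemma extZero_add (u v : C(Icc (-ρ) ρ, ℂ)) (x : ℝ) :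
    extZero (u + v) x = extZero u x + extZero v x := by
  by_cases hx : x ∈ Icc (-ρ) ρ
  · simp [extZero_of_mem _ hx]
  · simp [extZero_of_notMem _ hx]

lemma extZero_sub (u v : C(Icc (-ρ) ρ, ℂ)) (x : ℝ) :
    extZero (u - v) x = extZero u x - extZero v x := by
  by_cases hx : x ∈ Icc (-ρ) ρ
  · simp [extZero_of_mem _ hx]
  · simp [extZero_of_notMem _ hx]

lemma extZero_smul (c : ℂ) (u : C(Icc (-ρ) ρ, ℂ)) (x : ℝ) :
    extZero (c • u) x = c * extZero u x := by
  by_cases hx : x ∈ Icc (-ρ) ρ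
  · simp [extZero_of_mem _ hx]
  · simp [extZero_of_notMem _ hx]

lemma extZero_mul (u v : C(Icc (-ρ) ρ, ℂ)) (x : ℝ) :
    extZero (u * v) x = extZero u x * extZero v x := by
  by_cases hx : x ∈ Icc (-ρ) ρ
  · simp [extZero_of_mem _ hx]
  · simp [extZero_of_notMem _ hx]

lemma norm_extZero_le (u : C(Icc (-ρ) ρ, ℂ)) (x : ℝ) : ‖extZero u x‖ ≤ ‖u‖ := by
  by_cases hx : x ∈ Icc (-ρ) ρ
  · rw [extZero_of_mem _ hx]; exact u.norm_coe_le_norm _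
  · rw [extZero_of_notMem _ hx]; simp

lemma integrable_of_continuousOn_Icc {u : ℝ → ℂ} (hu : ContinuousOn u (Icc (-ρ) ρ))
    (h0 : ∀ x, x ∉ Icc (-ρ) ρ → u x = 0) : Integrable u := by
  rw [← integrableOn_iff_integrable_of_support_subset (s := Icc (-ρ) ρ)]
  · exact hu.integrableOn_Icc
  · intro x hx
    by_contra h
    exact hx (h0 x h)

lemma integrable_mul_extZero {h : ℝ → ℂ} (hh : ContinuousOn h (Icc (-ρ) ρ))
    (u : C(Icc (-ρ) ρ, ℂ)) : Integrable (fun x => h x * extZero u x) :=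
  integrable_of_continuousOn_Icc (hh.mul (continuousOn_extZero u))
    fun x hx => by rw [extZero_of_notMem u hx, mul_zero]

lemma integrable_extZero (u : C(Icc (-ρ) ρ, ℂ)) : Integrable (extZero u) :=
  integrable_of_continuousOn_Icc (continuousOn_extZero u) fun _ => extZero_of_notMem u

/-- The absolute value in `2 * |ρ|` admits `ρ` of either sign; for negative `ρ` the interval is
empty. -/
lemma norm_integral_le_of_Icc {u : ℝ → ℂ} {C : ℝ} (hC : ∀ x ∈ Icc (-ρ) ρ, ‖u x‖ ≤ C)
    (h0 : ∀ x, x ∉ Icc (-ρ) ρ → u x = 0) (hC0 : 0 ≤ C) : ‖∫ x, u x‖ ≤ 2 * |ρ| * C := by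
  rw [← setIntegral_eq_integral_of_forall_compl_eq_zero h0]
  have h := norm_setIntegral_le_of_norm_le_const (μ := volume) (s := Icc (-ρ) ρ) (C := C)
    (by simp) hC
  refine h.trans ?_
  rw [mul_comm]
  gcongr
  rw [Measure.real, Real.volume_Icc]
  rw [ENNReal.toReal_ofReal']
  refine max_le ?_ (by positivity)
  linarith [le_abs_self ρ]

/-- Integration over `[-ρ, ρ]`. -/
def intIcc (ρ : ℝ) : C(Icc (-ρ) ρ, ℂ) →L[ℂ] ℂ :=
  LinearMap.mkContinuous
    { toFun := fun u => ∫ x, extZero u x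
      map_add' := fun u v => by
        simp_rw [extZero_add]
        exact integral_add (integrable_extZero u) (integrable_extZero v)
      map_smul' := fun c u => by
        simp_rw [extZero_smul, integral_const_mul, RingHom.id_apply, smul_eq_mul] }
    (2 * |ρ|)
    (fun u => norm_integral_le_of_Icc (fun x _ => norm_extZero_le u x)
      (fun _ => extZero_of_notMem u) (norm_nonneg _))

lemma intIcc_apply (u : C(Icc (-ρ) ρ, ℂ)) : intIcc ρ u = ∫ x, extZero u x := rfl

lemma norm_intIcc_apply_le (u : C(Icc (-ρ) ρ, ℂ)) : ‖intIcc ρ u‖ ≤ 2 * |ρ| * ‖u‖ :=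
  norm_integral_le_of_Icc (fun x _ => norm_extZero_le u x)
    (fun _ => extZero_of_notMem u) (norm_nonneg _)

lemma continuous_lineConv_extZero (h : C(ℝ, ℂ)) (u : C(Icc (-ρ) ρ, ℂ)) :
    Continuous (lineConv h (extZero u)) := by
  rcases le_or_gt (-ρ) ρ with hρ | hρ
  swap
  · have : lineConv h (extZero u) = fun _ => 0 := by
      ext x
      unfold lineConv
      have : ∀ ξ, extZero u ξ = 0 := fun ξ => extZero_of_notMem u (by simp [hρ])
      simp [this]
    rw [this]
    exact continuous_const
  -- The extension by zero jumps at `±ρ`. Replacing it by the extension with constant end values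
  -- changes nothing on `[-ρ, ρ]` and makes the integrand jointly continuous.
  have : lineConv h (extZero u) =
      fun x => ∫ ξ in Icc (-ρ) ρ, h (x - ξ) * IccExtend hρ u ξ := by
    ext x
    unfold lineConv
    rw [← setIntegral_eq_integral_of_forall_compl_eq_zero (s := Icc (-ρ) ρ)]
    · refine setIntegral_congr_fun measurableSet_Icc fun ξ hξ => ?_
      rw [extZero_of_mem u hξ, IccExtend_of_mem _ _ hξ]
    · intro ξ hξ
      rw [extZero_of_notMem u hξ, mul_zero]
  rw [this]
  have hc : Continuous (IccExtend hρ u) := u.continuous.Icc_extend'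
  exact continuous_parametric_integral_of_continuous
    (f := fun x ξ => h (x - ξ) * IccExtend hρ u ξ) (by unfold Function.uncurry; fun_prop)
    isCompact_Icc

/-- Convolution with the kernel `h`, as an operator on `C[-ρ, ρ]`. -/
def convOp (ρ : ℝ) (h : C(ℝ, ℂ)) : C(Icc (-ρ) ρ, ℂ) →ₗ[ℂ] C(Icc (-ρ) ρ, ℂ) where
  toFun u := restrIcc (lineConv h (extZero u)) (continuous_lineConv_extZero h u).continuousOn
  map_add' u v := by
    ext x
    change lineConv h (extZero (u + v)) x = lineConv h (extZero u) x + lineConv h (extZero v) x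
    unfold lineConv
    simp_rw [extZero_add, mul_add]
    exact integral_add (integrable_mul_extZero (by fun_prop) u)
      (integrable_mul_extZero (by fun_prop) v)
  map_smul' c u := by
    ext x
    change lineConv h (extZero (c • u)) x = c * lineConv h (extZero u) x
    unfold lineConv
    rw [← integral_const_mul]
    congr 1
    ext ξ
    rw [extZero_smul]
    ring

lemma convOp_apply (h : C(ℝ, ℂ)) (u : C(Icc (-ρ) ρ, ℂ)) (x : Icc (-ρ) ρ) :
    convOp ρ h u x = lineConv h (extZero u) x := rfl

lemma norm_convOp_apply_le {h : C(ℝ, ℂ)} {B : ℝ} (hB0 : 0 ≤ B)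
    (hB : ∀ x, |x| ≤ 2 * ρ → ‖h x‖ ≤ B) (u : C(Icc (-ρ) ρ, ℂ)) :
    ‖convOp ρ h u‖ ≤ 2 * |ρ| * B * ‖u‖ := by
  rw [ContinuousMap.norm_le _ (by positivity)]
  intro x
  rw [convOp_apply, mul_assoc]
  refine norm_integral_le_of_Icc (fun ξ hξ => ?_) (fun ξ hξ => ?_) (by positivity)
  · rw [norm_mul]
    gcongr
    · refine hB _ ?_
      have := x.2
      rw [mem_Icc] at this hξ
      rw [abs_le]
      constructor <;> linarith
    · exact norm_extZero_le u ξ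
  · rw [extZero_of_notMem u hξ, mul_zero]

end ExtZero

/-! ### Vectors as functions on the line, and operators acting componentwise. -/

section VecFn

variable {ρ : ℝ}

/-- The vector of functions on `ℝ` given by an element of `Vec ρ`. -/
def vecFn (a : Vec ρ) (n : ℤ) : ℝ → ℂ := extZero (a n)

lemma vecFn_injective : Function.Injective (vecFn (ρ := ρ)) := fun a b h => by
  ext1
  ext1 n
  exact extZero_injective (congrFun h n)

lemma vecFn_add (a b : Vec ρ) (n : ℤ) (x : ℝ) : vecFn (a + b) n x = vecFn a n x + vecFn b n x :=
  extZero_add _ _ _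

lemma vecFn_sub (a b : Vec ρ) (n : ℤ) (x : ℝ) : vecFn (a - b) n x = vecFn a n x - vecFn b n x :=
  extZero_sub _ _ _

lemma vecFn_smul (c : ℂ) (a : Vec ρ) (n : ℤ) (x : ℝ) : vecFn (c • a) n x = c * vecFn a n x :=
  extZero_smul _ _ _

lemma memA_vecFn (a : Vec ρ) : MemA ρ (vecFn a) := by
  refine ⟨fun j => continuousOn_extZero _, fun j x => extZero_of_notMem _, ?_⟩
  have h := (lp.memℓp a).summable (by norm_num)
  convert h using 2 with j
  rw [ContinuousMap.norm_eq_iSup_norm]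
  simp [vecFn, extZero_of_mem]

/-- Together with `memA_vecFn` and `vecFn_injective` this identifies the space described by `MemA`
with the Banach space `Vec ρ`, where Neumann series are available. -/
lemma exists_vecFn_eq {A : ℤ → ℝ → ℂ} (hA : MemA ρ A) : ∃ a : Vec ρ, vecFn a = A := by
  obtain ⟨h1, h2, h3⟩ := hA
  refine ⟨⟨fun j => restrIcc (A j) (h1 j), ?_⟩, ?_⟩
  · refine memℓp_gen ?_
    convert h3 using 2 with j
    rw [ContinuousMap.norm_eq_iSup_norm]
    simp only [ENNReal.toReal_ofNat, Real.rpow_ofNat]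
    rfl
  · ext j x
    exact congrFun (extZero_restrIcc (h1 j) (h2 j)) x

/-- The operator `(L a)_m = L_m a_{e m}`. -/
def blockOp (e : ℤ ≃ ℤ) (L : ℤ → C(Icc (-ρ) ρ, ℂ) →ₗ[ℂ] C(Icc (-ρ) ρ, ℂ)) (c : ℝ)
    (hL : ∀ m u, ‖L m u‖ ≤ c * ‖u‖) : Vec ρ →L[ℂ] Vec ρ :=
  LinearMap.mkContinuous
    { toFun := fun a => ⟨fun m => L m (a (e m)), by
        have h := (lp.memℓp a).summable (p := 2) (by norm_num)
        refine memℓp_gen ?_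
        have h2 := ((e.summable_iff.mpr h).mul_left (|c| ^ (2 : ENNReal).toReal))
        refine Summable.of_nonneg_of_le (fun m => by positivity) (fun m => ?_) h2
        simp only [Function.comp]
        rw [← Real.mul_rpow (abs_nonneg _) (norm_nonneg _)]
        gcongr
        exact (hL _ _).trans (by gcongr; exact le_abs_self c)⟩
      map_add' := fun a b => by
        ext1
        funext m
        exact map_add (L m) _ _
      map_smul' := fun z a => by
        ext1
        funext m
        exact map_smul (L m) _ _ }
    |c| (fun a => by
      refine lp.norm_le_of_tsum_le (by norm_num) (by positivity) ?_
      have h := (lp.memℓp a).summable (p := 2) (by norm_num)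
      rw [Real.mul_rpow (abs_nonneg _) (norm_nonneg _), lp.norm_rpow_eq_tsum (by norm_num) a,
        ← e.tsum_eq (fun i => ‖a i‖ ^ (2 : ENNReal).toReal), ← tsum_mul_left]
      have h2 := ((e.summable_iff.mpr h).mul_left (|c| ^ (2 : ENNReal).toReal))
      have hle : ∀ m, ‖L m (a (e m))‖ ^ (2 : ENNReal).toReal ≤
          |c| ^ (2 : ENNReal).toReal * ‖a (e m)‖ ^ (2 : ENNReal).toReal := fun m => by
        rw [← Real.mul_rpow (abs_nonneg _) (norm_nonneg _)]
        gcongr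
        exact (hL _ _).trans (by gcongr; exact le_abs_self c)
      exact Summable.tsum_le_tsum hle
        (Summable.of_nonneg_of_le (fun m => by positivity) hle h2) h2)

lemma norm_blockOp_le (e : ℤ ≃ ℤ) (L : ℤ → C(Icc (-ρ) ρ, ℂ) →ₗ[ℂ] C(Icc (-ρ) ρ, ℂ)) {c : ℝ}
    (hc : 0 ≤ c) (hL : ∀ m u, ‖L m u‖ ≤ c * ‖u‖) : ‖blockOp e L c hL‖ ≤ c :=
  (LinearMap.mkContinuous_norm_le _ (abs_nonneg c) _).trans_eq (abs_of_nonneg hc)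

/-! ### The operators of convolution and of multiplication by the profile -/

/-- The kernels `h_n` are bounded by `B` on `[-2ρ, 2ρ]`. -/
def KernelBound (ρ B : ℝ) (h : ℤ → C(ℝ, ℂ)) : Prop :=
  0 ≤ B ∧ ∀ n x, |x| ≤ 2 * ρ → ‖h n x‖ ≤ B

/-- The diagonal operator of convolution with the kernels `h_n`. -/
def convVec {B : ℝ} {h : ℤ → C(ℝ, ℂ)} (hB : KernelBound ρ B h) : Vec ρ →L[ℂ] Vec ρ :=
  blockOp (Equiv.refl ℤ) (fun n => convOp ρ (h n)) (2 * |ρ| * B)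
    fun n u => norm_convOp_apply_le hB.1 (hB.2 n) u

lemma convVec_apply {B : ℝ} {h : ℤ → C(ℝ, ℂ)} (hB : KernelBound ρ B h) (a : Vec ρ) (n : ℤ)
    (x : Icc (-ρ) ρ) : convVec hB a n x = lineConv (h n) (vecFn a n) x := rfl

lemma norm_convVec_le {B : ℝ} {h : ℤ → C(ℝ, ℂ)} (hB : KernelBound ρ B h) :
    ‖convVec hB‖ ≤ 2 * |ρ| * B :=
  norm_blockOp_le _ _ (mul_nonneg (by positivity) hB.1) _

lemma lineConv_sub_left (h h' : C(ℝ, ℂ)) (u : C(Icc (-ρ) ρ, ℂ)) (x : ℝ) :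
    lineConv (h - h' : C(ℝ, ℂ)) (extZero u) x =
      lineConv h (extZero u) x - lineConv h' (extZero u) x := by
  unfold lineConv
  rw [← integral_sub (integrable_mul_extZero (by fun_prop) u)
    (integrable_mul_extZero (by fun_prop) u)]
  congr 1
  ext ξ
  simp [sub_mul]

lemma convVec_sub {B B' D : ℝ} {h h' : ℤ → C(ℝ, ℂ)} (hB : KernelBound ρ B h)
    (hB' : KernelBound ρ B' h') (hD : KernelBound ρ D (fun n => h n - h' n)) :
    convVec hB - convVec hB' = convVec hD := by
  refine ContinuousLinearMap.ext fun a => ?_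
  ext1
  funext n
  ext x
  exact (lineConv_sub_left (h n) (h' n) (a n) x).symm

end VecFn

lemma summable_of_opNorm_le {X : Type*} [NormedAddCommGroup X] [NormedSpace ℂ X] [CompleteSpace X]
    {u : ℤ → X →L[ℂ] X} {c : ℤ → ℝ} (hc : Summable c) (h : ∀ j, ‖u j‖ ≤ c j) : Summable u :=
  Summable.of_norm_bounded hc h

/-! ### Multiplication by the profile as a norm-convergent sum of shifts. -/

namespace IsProfile

variable {f : ℝ × ℝ → ℝ} {ρ : ℝ}

/-- The Fourier coefficient of the profile as an element of `C[-ρ, ρ]`. -/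
def coeff (hf : IsProfile f ρ) (j : ℤ) : C(Icc (-ρ) ρ, ℂ) :=
  restrIcc (fourierY f j) (hf.continuous_fourierY j).continuousOn

lemma extZero_coeff (hf : IsProfile f ρ) (j : ℤ) : extZero (hf.coeff j) = fourierY f j :=
  extZero_restrIcc _ fun _ hx => hf.fourierY_eq_zero j hx

lemma summable_norm_coeff (hf : IsProfile f ρ) : Summable fun j => ‖hf.coeff j‖ := by
  obtain ⟨C, hC0, hC⟩ := hf.exists_fourierY_bound
  refine Summable.of_nonneg_of_le (fun j => norm_nonneg _) (fun j => ?_)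
    (summable_div_one_add_sq C)
  rw [ContinuousMap.norm_le _ (by positivity)]
  exact fun x => hC j x

/-- The operator `(L a)_m = f_j a_{m-j}`. -/
def shiftMul (hf : IsProfile f ρ) (j : ℤ) : Vec ρ →L[ℂ] Vec ρ :=
  blockOp (Equiv.subRight j) (fun _ => LinearMap.mulLeft ℂ (hf.coeff j)) ‖hf.coeff j‖
    fun _ u => norm_mul_le _ u

lemma shiftMul_apply (hf : IsProfile f ρ) (j : ℤ) (a : Vec ρ) (m : ℤ) :
    hf.shiftMul j a m = hf.coeff j * a (m - j) := rfl

lemma norm_shiftMul_le (hf : IsProfile f ρ) (j : ℤ) : ‖hf.shiftMul j‖ ≤ ‖hf.coeff j‖ :=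
  norm_blockOp_le _ _ (norm_nonneg _) _

/-- `(M a)_m = ∑_n f_{m-n} a_n`. -/
def mulVec (hf : IsProfile f ρ) : Vec ρ →L[ℂ] Vec ρ := ∑' j : ℤ, hf.shiftMul j

/-- The series of shifts converges in operator norm, hence survives the continuous linear map that
evaluates at `a` and takes the component `m`. -/
lemma hasSum_mulVec (hf : IsProfile f ρ) (a : Vec ρ) (m : ℤ) :
    HasSum (fun j => hf.coeff j * a (m - j)) (hf.mulVec a m) := by
  have h1 : Summable hf.shiftMul :=
    summable_of_opNorm_le hf.summable_norm_coeff hf.norm_shiftMul_le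
  let φ : (Vec ρ →L[ℂ] Vec ρ) →L[ℂ] C(Icc (-ρ) ρ, ℂ) :=
    (lp.evalCLM ℂ (fun _ : ℤ => C(Icc (-ρ) ρ, ℂ)) 2 m).comp (ContinuousLinearMap.apply ℂ (Vec ρ) a)
  have e1 : hf.mulVec a m = φ hf.mulVec := rfl
  have e2 : (fun j => hf.coeff j * a (m - j)) = fun j => φ (hf.shiftMul j) :=
    funext fun j => (hf.shiftMul_apply j a m).symm
  rw [e1, e2]
  exact h1.hasSum.mapL φ

lemma hasSum_mulVec' (hf : IsProfile f ρ) (a : Vec ρ) (m : ℤ) :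
    HasSum (fun n => hf.coeff (m - n) * a n) (hf.mulVec a m) := by
  have h := (Equiv.subLeft m).hasSum_iff.mpr (hf.hasSum_mulVec a m)
  refine (congrArg (fun F => HasSum F (hf.mulVec a m)) (funext fun n => ?_)).mp h
  simp

lemma vecFn_mulVec (hf : IsProfile f ρ) (a : Vec ρ) (m : ℤ) (x : ℝ) :
    vecFn (hf.mulVec a) m x = ∑' n, vecFn a n x * fourierY f (m - n) x := by
  by_cases hx : x ∈ Icc (-ρ) ρ
  · have h := (hf.hasSum_mulVec' a m).mapL (ContinuousMap.evalCLM ℂ ⟨x, hx⟩)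
    simp only [ContinuousMap.evalCLM_apply] at h
    rw [vecFn, extZero_of_mem _ hx, ← h.tsum_eq]
    congr 1
    ext n
    rw [vecFn, extZero_of_mem _ hx, mul_comm]
    rfl
  · simp [vecFn, extZero_of_notMem _ hx, hf.fourierY_eq_zero _ hx]

lemma vecFn_mulVec_convVec (hf : IsProfile f ρ) {B : ℝ} {h : ℤ → C(ℝ, ℂ)}
    (hB : KernelBound ρ B h) (a : Vec ρ) (m : ℤ) (x : ℝ) :
    vecFn (hf.mulVec (convVec hB a)) m x =
      ∑' n, lineConv (h n) (vecFn a n) x * fourierY f (m - n) x := by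
  rw [hf.vecFn_mulVec]
  congr 1
  ext n
  by_cases hx : x ∈ Icc (-ρ) ρ
  · rw [vecFn, extZero_of_mem _ hx, convVec_apply]
  · simp [hf.fourierY_eq_zero _ hx]

end IsProfile

/-! ### The bilinear pairing -/

section Pairing

variable {ρ : ℝ}

lemma holder_two : ENNReal.toReal 2 |>.HolderConjugate (ENNReal.toReal 2) := by
  simpa using Real.HolderConjugate.two_two

lemma norm_intIcc_mul_le (u v : C(Icc (-ρ) ρ, ℂ)) :
    ‖intIcc ρ (u * v)‖ ≤ 2 * |ρ| * (‖u‖ * ‖v‖) :=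
  (norm_intIcc_apply_le _).trans (by gcongr; exact norm_mul_le u v)

lemma summable_intIcc_mul (a b : Vec ρ) : Summable fun n => intIcc ρ (a n * b n) :=
  Summable.of_norm_bounded ((lp.summable_mul holder_two a b).mul_left (2 * |ρ|))
    fun n => norm_intIcc_mul_le (a n) (b n)

/-- The bilinear form `∑_n ∫ a_n b_n`. -/
def pairing (ρ : ℝ) : Vec ρ →L[ℂ] Vec ρ →L[ℂ] ℂ :=
  LinearMap.mkContinuous₂
    (LinearMap.mk₂ ℂ (fun a b : Vec ρ => ∑' n, intIcc ρ (a n * b n))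
      (fun a a' b => by
        rw [← (summable_intIcc_mul a b).tsum_add (summable_intIcc_mul a' b)]
        congr 1
        ext n
        rw [← map_add, ← add_mul]
        rfl)
      (fun c a b => by
        rw [smul_eq_mul, ← tsum_mul_left]
        congr 1
        ext n
        change intIcc ρ ((c • a n) * b n) = c * intIcc ρ (a n * b n)
        rw [smul_mul_assoc, map_smul, smul_eq_mul])
      (fun a b b' => by
        rw [← (summable_intIcc_mul a b).tsum_add (summable_intIcc_mul a b')]
        congr 1
        ext n
        rw [← map_add, ← mul_add]
        rfl)
      (fun c a b => by
        rw [smul_eq_mul, ← tsum_mul_left]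
        congr 1
        ext n
        change intIcc ρ (a n * (c • b n)) = c * intIcc ρ (a n * b n)
        rw [mul_smul_comm, map_smul, smul_eq_mul]))
    (2 * |ρ|) (fun a b => by
      have h1 := (lp.summable_mul holder_two a b).mul_left (2 * |ρ|)
      refine (tsum_of_norm_bounded h1.hasSum fun n => norm_intIcc_mul_le (a n) (b n)).trans ?_
      rw [tsum_mul_left, mul_assoc (2 * |ρ|)]
      gcongr
      exact lp.tsum_mul_le_mul_norm' holder_two a b)

lemma pairing_apply (a b : Vec ρ) : pairing ρ a b = ∑' n, intIcc ρ (a n * b n) := rfl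

lemma pairing_single_right (a : Vec ρ) (n : ℤ) (v : C(Icc (-ρ) ρ, ℂ)) :
    pairing ρ a (lp.single 2 n v) = intIcc ρ (a n * v) := by
  rw [pairing_apply, tsum_eq_single n]
  · rw [lp.single_apply_self]
  · intro m hm
    rw [lp.single_apply_ne _ _ _ hm, mul_zero, map_zero]

lemma pairing_comm (a b : Vec ρ) : pairing ρ a b = pairing ρ b a := by
  simp_rw [pairing_apply, mul_comm]

/-- Fubini exchanges the two variables, and evenness of the kernel turns `h(x - ξ)` into `h(ξ - x)`.
-/
lemma pairing_convVec_comm {B : ℝ} {h : ℤ → C(ℝ, ℂ)} (hB : KernelBound ρ B h)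
    (heven : ∀ n x, h n (-x) = h n x) (a b : Vec ρ) :
    pairing ρ (convVec hB a) b = pairing ρ a (convVec hB b) := by
  rw [pairing_apply, pairing_apply]
  congr 1
  ext n
  have e1 : ∀ u v : C(Icc (-ρ) ρ, ℂ), intIcc ρ (convOp ρ (h n) u * v) =
      ∫ x, ∫ ξ, h n (x - ξ) * extZero u ξ * extZero v x := by
    intro u v
    rw [intIcc_apply]
    congr 1
    ext x
    rw [extZero_mul, integral_mul_const]
    by_cases hx : x ∈ Icc (-ρ) ρ
    · rw [extZero_of_mem _ hx, convOp_apply]; rfl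
    · simp [extZero_of_notMem _ hx]
  change intIcc ρ (convOp ρ (h n) (a n) * b n) = intIcc ρ (a n * convOp ρ (h n) (b n))
  rw [mul_comm (a n), e1, e1, integral_integral_swap]
  · congr 1
    ext ξ
    congr 1
    ext x
    rw [← heven, neg_sub]
    ring
  · have h0 := (integrable_extZero (b n)).mul_prod (integrable_extZero (a n))
    have h1 : IntegrableOn (fun p : ℝ × ℝ => extZero (b n) p.1 * extZero (a n) p.2)
      (Icc (-ρ) ρ ×ˢ Icc (-ρ) ρ) (volume.prod volume) := h0.integrableOn
    have h2 := h1.continuousOn_mul (g := fun p : ℝ × ℝ => h n (p.1 - p.2))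
      (by fun_prop) (isCompact_Icc.prod isCompact_Icc)
    rw [integrableOn_iff_integrable_of_support_subset] at h2
    · refine h2.congr (Eventually.of_forall fun p => ?_)
      simp only [Function.uncurry]
      ring
    · intro p hp
      by_contra hc
      apply hp
      rw [mem_prod, not_and_or] at hc
      rcases hc with hc | hc <;> simp [extZero_of_notMem _ hc]

/-- The matrix `f_{m-n}` is symmetric because `f_{-j} = f_j`. Both sides are continuous and
bilinear, so it suffices to compare them on vectors with one nonzero component. -/
lemma IsProfile.pairing_mulVec_comm {f : ℝ × ℝ → ℝ} (hf : IsProfile f ρ) (a b : Vec ρ) :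
    pairing ρ (hf.mulVec a) b = pairing ρ a (hf.mulVec b) := by
  have hcoeff : ∀ j, hf.coeff (-j) = hf.coeff j := fun j => by
    ext x
    exact hf.fourierY_neg j x
  have hsingle : ∀ (i : ℤ) (u : C(Icc (-ρ) ρ, ℂ)) (k : ℤ),
      hf.mulVec (lp.single 2 i u) k = hf.coeff (k - i) * u := by
    intro i u k
    rw [← (hf.hasSum_mulVec' (lp.single 2 i u) k).tsum_eq, tsum_eq_single i]
    · rw [lp.single_apply_self]
    · intro n hn
      rw [lp.single_apply_ne _ _ _ hn, mul_zero]
  have key : (pairing ρ).comp hf.mulVec = ((pairing ρ).flip.comp hf.mulVec).flip := by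
    refine lp.ext_continuousLinearMap (by simp) fun i => ?_
    ext1 u
    refine lp.ext_continuousLinearMap (by simp) fun k => ?_
    ext1 v
    change pairing ρ (hf.mulVec (lp.single 2 i u)) (lp.single 2 k v) =
      pairing ρ (lp.single 2 i u) (hf.mulVec (lp.single 2 k v))
    rw [pairing_comm (lp.single 2 i u), pairing_single_right, pairing_single_right, hsingle,
      hsingle, ← hcoeff, neg_sub]
    congr 1
    ring
  exact DFunLike.congr_fun (DFunLike.congr_fun key a) b

end Pairing

/-! ### Inversion of `1 - T` for small `T` -/

lemma existsUnique_sub_eq {X : Type*} [NormedAddCommGroup X] [NormedSpace ℂ X] [CompleteSpace X]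
    {T : X →L[ℂ] X} (hT : ‖T‖ ≤ 1 / 2) (g : X) : ∃! a, a - T a = g := by
  obtain ⟨u, hu⟩ := isUnit_one_sub_of_norm_lt_one (x := T) (by linarith)
  have h1 : ∀ a, (u : X →L[ℂ] X) a = a - T a := fun a => by rw [hu]; rfl
  refine ⟨(↑u⁻¹ : X →L[ℂ] X) g, ?_, fun a ha => ?_⟩
  · simp only
    rw [← h1, ← mul_apply_eq_comp, Units.mul_inv]
    rfl
  · rw [← ha]
    rw [← h1, ← mul_apply_eq_comp, Units.inv_mul]
    rfl

lemma norm_le_of_sub_eq {X : Type*} [NormedAddCommGroup X] [NormedSpace ℂ X]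
    {T : X →L[ℂ] X} (hT : ‖T‖ ≤ 1 / 2) {a g : X} (h : a - T a = g) : ‖a‖ ≤ 2 * ‖g‖ := by
  have h1 : ‖T a‖ ≤ 1 / 2 * ‖a‖ := T.le_of_opNorm_le hT a
  have h2 : a = g + T a := by rw [← h]; abel
  have h3 : ‖a‖ ≤ ‖g‖ + ‖T a‖ := (congrArg norm h2).le.trans (norm_add_le _ _)
  linarith
/-! ### Estimates for the Green functions -/

/-- A compact range of parameters in which there is exactly one propagating mode. -/
structure GoodParam (b d μ β : ℝ) : Prop where
  b_pos : 0 < b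
  d_pos : 0 < d
  le_beta : b ≤ β
  le_gap : d ≤ 1 - 2 * β - μ ^ 2
  abs_mu : |μ| ≤ 1

lemma omegaSq_sub_sq (μ β : ℝ) : omegaSq μ β - β ^ 2 = 1 - 2 * β - μ ^ 2 := by
  unfold omegaSq; ring

lemma abs_exp_sub_exp_le {a b M : ℝ} (ha : a ≤ M) (hb : b ≤ M) :
    |Real.exp a - Real.exp b| ≤ Real.exp M * |a - b| := by
  wlog h : b ≤ a generalizing a b
  · rw [abs_sub_comm, abs_sub_comm a]
    exact this hb ha (not_le.mp h).le
  rw [abs_of_nonneg (sub_nonneg.mpr (Real.exp_le_exp.mpr h)), abs_of_nonneg (sub_nonneg.mpr h)]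
  have h1 : Real.exp b = Real.exp a * Real.exp (b - a) := by rw [← Real.exp_add]; congr 1; ring
  have h2 := Real.add_one_le_exp (b - a)
  have h3 := Real.exp_le_exp.mpr ha
  have h4 := Real.exp_pos a
  calc Real.exp a - Real.exp b = Real.exp a * (1 - Real.exp (b - a)) := by rw [h1]; ring
    _ ≤ Real.exp a * (a - b) := mul_le_mul_of_nonneg_left (by linarith) h4.le
    _ ≤ Real.exp M * (a - b) := by gcongr

lemma abs_sqrt_sub_sqrt_le {a b m : ℝ} (hm : 0 < m) (ha : m ^ 2 ≤ a) (hb : m ^ 2 ≤ b) :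
    |Real.sqrt a - Real.sqrt b| ≤ |a - b| / (2 * m) := by
  have h1 : m ≤ Real.sqrt a := Real.le_sqrt_of_sq_le ha
  have h2 : m ≤ Real.sqrt b := Real.le_sqrt_of_sq_le hb
  have h3 : a - b = (Real.sqrt a - Real.sqrt b) * (Real.sqrt a + Real.sqrt b) := by
    have e1 := Real.sq_sqrt (le_trans (sq_nonneg m) ha)
    have e2 := Real.sq_sqrt (le_trans (sq_nonneg m) hb)
    nlinarith
  rw [le_div_iff₀ (by positivity), h3, abs_mul]
  gcongr
  rw [abs_of_nonneg (by positivity)]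
  linarith

/-- Covers the kernels `sin(k|x|)/(2k)` and `e^{-k|x|}/(2k)` at once, with `u` the numerator as a
function of `k`. -/
lemma abs_div_sub_div_le {u u' k k' c r : ℝ} (hc : 0 < c) (hk : c ≤ k) (hk' : c ≤ k')
    (hu : |u - u'| ≤ r * |k - k'|) (hu' : |u'| ≤ 1) :
    |u / (2 * k) - u' / (2 * k')| ≤ (r / (2 * c) + 1 / (2 * c ^ 2)) * |k - k'| := by
  have hk0 : 0 < k := hc.trans_le hk
  have hk0' : 0 < k' := hc.trans_le hk'
  have e : u / (2 * k) - u' / (2 * k') = (u - u') / (2 * k) + u' * (k' - k) / (2 * (k * k')) := by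
    field_simp; ring
  rw [e]
  refine (abs_add_le _ _).trans ?_
  rw [add_mul, abs_div, abs_div, abs_mul u', abs_of_pos (show 0 < 2 * k by positivity),
    abs_of_pos (show 0 < 2 * (k * k') by positivity), abs_sub_comm k' k]
  have h0 : 0 ≤ r * |k - k'| := (abs_nonneg _).trans hu
  apply add_le_add
  · rw [div_mul_eq_mul_div]
    exact (div_le_div_of_nonneg_right hu (by positivity)).trans
      (div_le_div_of_nonneg_left h0 (by positivity) (by linarith))
  · rw [div_mul_eq_mul_div, pow_two]
    apply div_le_div₀ (by positivity) (by gcongr) (by positivity)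
    gcongr

/-! ### Wave numbers on the parameter range: lower bounds and Lipschitz estimates. -/

namespace GoodParam

variable {b d μ β μ' β' : ℝ}

lemma gap_pos (h : GoodParam b d μ β) : 0 < 1 - 2 * β - μ ^ 2 := h.d_pos.trans_le h.le_gap

lemma beta_pos (h : GoodParam b d μ β) : 0 < β := h.b_pos.trans_le h.le_beta

lemma beta_lt (h : GoodParam b d μ β) : β < 1 / 2 := by
  nlinarith [h.gap_pos, sq_nonneg μ]

lemma sq_lt_omegaSq (h : GoodParam b d μ β) : β ^ 2 < omegaSq μ β := by
  have := omegaSq_sub_sq μ β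
  linarith [h.gap_pos]

lemma omegaSq_pos (h : GoodParam b d μ β) : 0 < omegaSq μ β :=
  (sq_nonneg β).trans_lt h.sq_lt_omegaSq

lemma gam_pos (h : GoodParam b d μ β) : 0 < gam μ β :=
  div_pos h.omegaSq_pos (by positivity)

lemma gam_le (h : GoodParam b d μ β) : gam μ β ≤ 1 := by
  unfold gam omegaSq
  rw [div_le_one (by positivity)]
  nlinarith [Real.pi_gt_three, sq_nonneg μ, h.beta_pos, h.beta_lt]

lemma kProp_eq (μ β : ℝ) : kProp μ β = Real.sqrt (1 - 2 * β - μ ^ 2) := by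
  rw [kProp, omegaSq_sub_sq]

lemma le_kProp (h : GoodParam b d μ β) : Real.sqrt d ≤ kProp μ β := by
  rw [kProp_eq]
  exact Real.sqrt_le_sqrt h.le_gap

lemma sqrt_d_pos (h : GoodParam b d μ β) : 0 < Real.sqrt d := Real.sqrt_pos.mpr h.d_pos

lemma sqrt_b_pos (h : GoodParam b d μ β) : 0 < Real.sqrt b := Real.sqrt_pos.mpr h.b_pos

lemma kProp_pos (h : GoodParam b d μ β) : 0 < kProp μ β := h.sqrt_d_pos.trans_le h.le_kProp

lemma kProp_sq (h : GoodParam b d μ β) : kProp μ β ^ 2 = 1 - 2 * β - μ ^ 2 := by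
  rw [kProp_eq, Real.sq_sqrt h.gap_pos.le]

/-- The factorisation `(n+1)(2β+n-1) + μ²` shows which modes are exceptional: it equals `μ²` at `n =
-1` and `-k₀²` at `n = 0`. For all other integers both factors have the same sign and the product
grows quadratically. -/
lemma evan_sq_ge (h : GoodParam b d μ β) {n : ℤ} (h0 : n ≠ 0) (h1 : n ≠ -1) :
    b * (n : ℝ) ^ 2 ≤ (β + n) ^ 2 - omegaSq μ β := by
  have e : (β + n) ^ 2 - omegaSq μ β = (n + 1) * (2 * β + n - 1) + μ ^ 2 := by
    unfold omegaSq; ring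
  have hb : b * (n : ℝ) ^ 2 ≤ β * (n : ℝ) ^ 2 := by
    have := h.le_beta
    gcongr
  rw [e]
  have hβ := h.beta_pos
  have hβ' := h.beta_lt
  rcases lt_or_gt_of_ne h0 with hn | hn
  · have hn2 : (n : ℝ) ≤ -2 := by exact_mod_cast (by omega : n ≤ -2)
    nlinarith [sq_nonneg μ, mul_nonneg (by linarith : (0 : ℝ) ≤ -n - 2) (by linarith : 0 ≤ 1 - 2 * β),
      mul_nonneg (by linarith : (0 : ℝ) ≤ -n - 2) (by linarith : (0 : ℝ) ≤ -n)]
  · have hn1 : (1 : ℝ) ≤ n := by exact_mod_cast hn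
    nlinarith [sq_nonneg μ, mul_nonneg (by linarith : (0 : ℝ) ≤ n - 1) (by linarith : 0 ≤ 1 - 2 * β),
      mul_nonneg (by linarith : (0 : ℝ) ≤ n - 1) (by linarith : (0 : ℝ) ≤ n)]

lemma one_le_abs_cast {n : ℤ} (h0 : n ≠ 0) : 1 ≤ |(n : ℝ)| := by
  exact_mod_cast Int.one_le_abs h0

lemma le_kEvan (h : GoodParam b d μ β) {n : ℤ} (h0 : n ≠ 0) (h1 : n ≠ -1) :
    Real.sqrt b * |(n : ℝ)| ≤ kEvan n μ β := by
  unfold kEvan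
  rw [← Real.sqrt_sq_eq_abs, ← Real.sqrt_mul h.b_pos.le]
  exact Real.sqrt_le_sqrt (h.evan_sq_ge h0 h1)

lemma sqrt_b_le_kEvan (h : GoodParam b d μ β) {n : ℤ} (h0 : n ≠ 0) (h1 : n ≠ -1) :
    Real.sqrt b ≤ kEvan n μ β := by
  refine le_trans ?_ (h.le_kEvan h0 h1)
  have := one_le_abs_cast h0
  nlinarith [h.sqrt_b_pos]

lemma kEvan_pos (h : GoodParam b d μ β) {n : ℤ} (h0 : n ≠ 0) (h1 : n ≠ -1) : 0 < kEvan n μ β :=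
  h.sqrt_b_pos.trans_le (h.sqrt_b_le_kEvan h0 h1)

lemma kEvan_sq (h : GoodParam b d μ β) {n : ℤ} (h0 : n ≠ 0) (h1 : n ≠ -1) :
    kEvan n μ β ^ 2 = (β + n) ^ 2 - omegaSq μ β :=
  Real.sq_sqrt ((mul_nonneg h.b_pos.le (sq_nonneg _)).trans (h.evan_sq_ge h0 h1))

lemma abs_mu_add_le (h : GoodParam b d μ β) (h' : GoodParam b d μ' β') : |μ + μ'| ≤ 2 :=
  (abs_add_le _ _).trans (by linarith [h.abs_mu, h'.abs_mu])

lemma abs_kProp_sub_le (h : GoodParam b d μ β) (h' : GoodParam b d μ' β') :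
    |kProp μ β - kProp μ' β'| ≤ 1 / Real.sqrt d * (|μ - μ'| + |β - β'|) := by
  rw [kProp_eq, kProp_eq]
  have hd := Real.sq_sqrt h.d_pos.le
  refine (abs_sqrt_sub_sqrt_le h.sqrt_d_pos (hd.le.trans h.le_gap) (hd.le.trans h'.le_gap)).trans ?_
  have e : 1 - 2 * β - μ ^ 2 - (1 - 2 * β' - μ' ^ 2) = -(2 * (β - β')) - (μ + μ') * (μ - μ') := by
    ring
  have h1 : |1 - 2 * β - μ ^ 2 - (1 - 2 * β' - μ' ^ 2)| ≤ 2 * (|μ - μ'| + |β - β'|) := by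
    rw [e]
    refine (abs_sub _ _).trans ?_
    rw [abs_neg, abs_mul, abs_mul, abs_two]
    have := mul_le_mul_of_nonneg_right (h.abs_mu_add_le h') (abs_nonneg (μ - μ'))
    linarith
  rw [div_mul_eq_mul_div, one_mul, div_le_div_iff₀ (by linarith [h.sqrt_d_pos]) h.sqrt_d_pos]
  nlinarith [h.sqrt_d_pos]

/-- The squares differ by at most a multiple of `|n|`, but the square roots themselves are at least
`√b |n|`. The two factors cancel, which makes the Lipschitz constant uniform in `n`. -/
lemma abs_kEvan_sub_le (h : GoodParam b d μ β) (h' : GoodParam b d μ' β') {n : ℤ} (h0 : n ≠ 0)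
    (h1 : n ≠ -1) :
    |kEvan n μ β - kEvan n μ' β'| ≤ 2 / Real.sqrt b * (|μ - μ'| + |β - β'|) := by
  unfold kEvan
  have hb := Real.sq_sqrt h.b_pos.le
  have hn := one_le_abs_cast h0
  have hm : 0 < Real.sqrt b * |(n : ℝ)| := mul_pos h.sqrt_b_pos (by linarith)
  have hm2 : (Real.sqrt b * |(n : ℝ)|) ^ 2 = b * (n : ℝ) ^ 2 := by rw [mul_pow, hb, sq_abs]
  refine (abs_sqrt_sub_sqrt_le hm (hm2.le.trans (h.evan_sq_ge h0 h1))
    (hm2.le.trans (h'.evan_sq_ge h0 h1))).trans ?_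
  have e : (β + n) ^ 2 - omegaSq μ β - ((β' + n) ^ 2 - omegaSq μ' β') =
      2 * (n + 1) * (β - β') + (μ + μ') * (μ - μ') := by unfold omegaSq; ring
  have h2 : |(β + n) ^ 2 - omegaSq μ β - ((β' + n) ^ 2 - omegaSq μ' β')| ≤
      4 * |(n : ℝ)| * (|μ - μ'| + |β - β'|) := by
    rw [e]
    refine (abs_add_le _ _).trans ?_
    rw [abs_mul, abs_mul, abs_mul, abs_two]
    have a1 := mul_le_mul_of_nonneg_right (h.abs_mu_add_le h') (abs_nonneg (μ - μ'))
    have a2 : |(n : ℝ) + 1| ≤ 2 * |(n : ℝ)| := (abs_add_le _ _).trans (by rw [abs_one]; linarith)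
    have a3 := mul_le_mul_of_nonneg_right a2 (abs_nonneg (β - β'))
    nlinarith [abs_nonneg (μ - μ'), abs_nonneg (β - β')]
  rw [div_mul_eq_mul_div, div_le_div_iff₀ (by positivity) h.sqrt_b_pos]
  have := h.sqrt_b_pos
  calc _ ≤ 4 * |(n : ℝ)| * (|μ - μ'| + |β - β'|) * Real.sqrt b := by gcongr
    _ = _ := by ring

lemma abs_gam_sub_le (h : GoodParam b d μ β) (h' : GoodParam b d μ' β') :
    |gam μ β - gam μ' β'| ≤ |μ - μ'| + |β - β'| := by
  unfold gam omegaSq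
  have e : ((1 - β) ^ 2 - μ ^ 2) / (4 * Real.pi) - ((1 - β') ^ 2 - μ' ^ 2) / (4 * Real.pi) =
      (-((2 - β - β') * (β - β')) - (μ + μ') * (μ - μ')) / (4 * Real.pi) := by ring
  rw [e, abs_div, abs_of_pos (show 0 < 4 * Real.pi by positivity), div_le_iff₀ (by positivity)]
  refine (abs_sub _ _).trans ?_
  rw [abs_neg, abs_mul, abs_mul]
  have a1 := mul_le_mul_of_nonneg_right (h.abs_mu_add_le h') (abs_nonneg (μ - μ'))
  have a2 : |2 - β - β'| ≤ 2 := by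
    rw [abs_le]
    constructor <;> linarith [h.beta_pos, h'.beta_pos, h.beta_lt, h'.beta_lt]
  have a3 := mul_le_mul_of_nonneg_right a2 (abs_nonneg (β - β'))
  nlinarith [abs_nonneg (μ - μ'), abs_nonneg (β - β'), Real.pi_gt_three]

end GoodParam

/-- The regularised kernel of the mode `n = -1`. -/
lemma greenReg_neg_one (μ β x : ℝ) :
    greenReg (-1) μ β x = ((-(1 / 2) * ∫ τ in (0 : ℝ)..|x|, Real.exp (-(μ * τ)) : ℝ) : ℂ) := by
  unfold greenReg
  rw [if_pos rfl]
  congr 1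
  split_ifs with h
  · simp [h]; ring
  · have hd : ∀ τ ∈ uIcc 0 |x|, HasDerivAt (fun τ : ℝ => -(1 / μ) * Real.exp (-(μ * τ)))
        (Real.exp (-(μ * τ))) τ := by
      intro τ _
      have h1 : HasDerivAt (fun τ : ℝ => -(μ * τ)) (-(μ * 1)) τ := ((hasDerivAt_id τ).const_mul μ).neg
      have h2 := h1.exp.const_mul (-(1 / μ))
      refine h2.congr_deriv ?_
      rw [mul_one, mul_neg, neg_mul_neg, mul_left_comm, one_div, inv_mul_cancel₀ h, mul_one]
    rw [intervalIntegral.integral_eq_sub_of_hasDerivAt hd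
      (Continuous.intervalIntegrable (by fun_prop) _ _)]
    simp
    field_simp
    ring

lemma continuous_greenReg (n : ℤ) (μ β : ℝ) : Continuous (greenReg n μ β) := by
  unfold greenReg green
  split_ifs <;> fun_prop

/-- The regularised Green functions as continuous functions. -/
def greenRegC (μ β : ℝ) (n : ℤ) : C(ℝ, ℂ) := ⟨greenReg n μ β, continuous_greenReg n μ β⟩

/-- The regularised Green functions with the kernel of the propagating mode replaced by its real
part. -/
def greenReal (μ β : ℝ) (n : ℤ) : C(ℝ, ℂ) :=
  if n = 0 then ⟨fun x => ((-Real.sin (kProp μ β * |x|) / (2 * kProp μ β) : ℝ) : ℂ), by fun_prop⟩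
  else greenRegC μ β n

lemma greenReal_zero (μ β x : ℝ) :
    greenReal μ β 0 x = ((-Real.sin (kProp μ β * |x|) / (2 * kProp μ β) : ℝ) : ℂ) := rfl

lemma greenReal_of_ne (μ β : ℝ) {n : ℤ} (hn : n ≠ 0) : greenReal μ β n = greenRegC μ β n :=
  if_neg hn

lemma greenRegC_apply (μ β : ℝ) (n : ℤ) (x : ℝ) : greenRegC μ β n x = greenReg n μ β x := rfl

lemma greenReg_of_ne {n : ℤ} (h0 : n ≠ 0) (h1 : n ≠ -1) (μ β x : ℝ) :
    greenReg n μ β x = ((Real.exp (-(kEvan n μ β * |x|)) / (2 * kEvan n μ β) : ℝ) : ℂ) := by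
  simp [greenReg, green, h0, h1]

lemma greenReg_even (n : ℤ) (μ β x : ℝ) : greenReg n μ β (-x) = greenReg n μ β x := by
  simp [greenReg, green]

lemma greenReal_even (n : ℤ) (μ β x : ℝ) : greenReal μ β n (-x) = greenReal μ β n x := by
  rcases eq_or_ne n 0 with rfl | h
  · simp [greenReal_zero]
  · rw [greenReal_of_ne _ _ h]; exact greenReg_even n μ β x

lemma conj_greenReal (n : ℤ) (μ β x : ℝ) :
    starRingEnd ℂ (greenReal μ β n x) = greenReal μ β n x := by
  rcases eq_or_ne n 0 with rfl | h
  · rw [greenReal_zero, Complex.conj_ofReal]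
  · rw [greenReal_of_ne _ _ h, greenRegC_apply]
    rcases eq_or_ne n (-1) with rfl | h1
    · rw [greenReg_neg_one, Complex.conj_ofReal]
    · rw [greenReg_of_ne h h1, Complex.conj_ofReal]

/-- The imaginary part of the outgoing kernel is the smooth function `cos(k₀x)/(2k₀)`. By the
addition theorem convolution with it has finite rank, which is what later reduces the complex
problem to a real one. -/
lemma greenReg_zero (μ β x : ℝ) : greenReg 0 μ β x =
    greenReal μ β 0 x + Complex.I / (2 * kProp μ β) * (Real.cos (kProp μ β * x) : ℂ) := by
  rw [greenReal_zero, ← Real.cos_abs (kProp μ β * x), abs_mul, abs_of_nonneg (a := kProp μ β)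
    (Real.sqrt_nonneg _)]
  simp only [greenReg, green, if_true, show (0 : ℤ) ≠ -1 by norm_num, if_false]
  have : Complex.I * kProp μ β * ((|x| : ℝ) : ℂ) = ((kProp μ β * |x| : ℝ) : ℂ) * Complex.I := by
    push_cast; ring
  rw [this, Complex.exp_mul_I, ← Complex.ofReal_cos, ← Complex.ofReal_sin]
  push_cast
  rw [mul_add, div_mul_eq_mul_div _ _ (_ * _), mul_left_comm Complex.I, Complex.I_mul_I]
  ring

/-! ### Bounds for the regularised kernels and their variation, uniform in the mode. -/

section Bounds

variable {b d μ β μ' β' ρ : ℝ}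

/-- A bound for the regularised kernels. -/
def kerBound (b d ρ : ℝ) : ℝ :=
  1 / (2 * Real.sqrt d) + 1 / (2 * Real.sqrt b) + ρ * Real.exp (2 * ρ)

lemma norm_greenReg_neg_one_le (hρ : 0 < ρ) (hμ : |μ| ≤ 1) {x : ℝ} (hx : |x| ≤ 2 * ρ) :
    ‖greenReg (-1) μ β x‖ ≤ ρ * Real.exp (2 * ρ) := by
  rw [greenReg_neg_one, Complex.norm_real, norm_mul]
  have h := intervalIntegral.norm_integral_le_of_norm_le_const (a := 0) (b := |x|)
    (C := Real.exp (2 * ρ)) (f := fun τ : ℝ => Real.exp (-(μ * τ))) (by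
    intro τ hτ
    rw [uIoc_of_le (abs_nonneg x)] at hτ
    rw [Real.norm_of_nonneg (Real.exp_pos _).le]
    apply Real.exp_le_exp.mpr
    have := neg_le_of_abs_le hμ
    nlinarith [hτ.1, hτ.2])
  rw [sub_zero, abs_abs] at h
  have h2 : ‖(-(1 / 2) : ℝ)‖ = 1 / 2 := by norm_num
  rw [h2]
  nlinarith [Real.exp_pos (2 * ρ)]

lemma norm_real_exp_div_le {k c t : ℝ} (hc : 0 < c) (hk : c ≤ k) (ht : 0 ≤ t) :
    ‖((Real.exp (-(k * t)) / (2 * k) : ℝ) : ℂ)‖ ≤ 1 / (2 * c) := by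
  have hk0 := hc.trans_le hk
  rw [Complex.norm_real, Real.norm_of_nonneg (by positivity)]
  have : Real.exp (-(k * t)) ≤ 1 := Real.exp_le_one_iff.mpr (by nlinarith)
  gcongr

lemma kerBound_terms (h : GoodParam b d μ β) (hρ : 0 < ρ) :
    0 < 1 / (2 * Real.sqrt d) ∧ 0 < 1 / (2 * Real.sqrt b) ∧ 0 < ρ * Real.exp (2 * ρ) := by
  have h1 := h.sqrt_d_pos
  have h2 := h.sqrt_b_pos
  refine ⟨?_, ?_, ?_⟩ <;> positivity

lemma kernelBound_greenRegC (h : GoodParam b d μ β) (hρ : 0 < ρ) :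
    KernelBound ρ (kerBound b d ρ) (greenRegC μ β) := by
  obtain ⟨t1, t2, t3⟩ := kerBound_terms h hρ
  unfold kerBound
  refine ⟨by positivity, fun n x hx => ?_⟩
  rw [greenRegC_apply]
  rcases eq_or_ne n 0 with rfl | h0
  · simp only [greenReg, green, if_true, show (0 : ℤ) ≠ -1 by norm_num, if_false]
    have : Complex.I * kProp μ β * ((|x| : ℝ) : ℂ) = ((kProp μ β * |x| : ℝ) : ℂ) * Complex.I := by
      push_cast; ring
    rw [this, norm_mul, Complex.norm_exp_ofReal_mul_I, mul_one, norm_div, Complex.norm_I, norm_mul,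
      Complex.norm_real, Real.norm_of_nonneg h.kProp_pos.le, Complex.norm_ofNat]
    have : 1 / (2 * kProp μ β) ≤ 1 / (2 * Real.sqrt d) := by
      have h1 := h.sqrt_d_pos
      have := h.le_kProp
      gcongr
    linarith
  · rcases eq_or_ne n (-1) with rfl | h1
    · have := norm_greenReg_neg_one_le (β := β) hρ h.abs_mu hx
      linarith
    · rw [greenReg_of_ne h0 h1]
      have := norm_real_exp_div_le h.sqrt_b_pos (h.sqrt_b_le_kEvan h0 h1) (abs_nonneg x)
      linarith

lemma kernelBound_greenReal (h : GoodParam b d μ β) (hρ : 0 < ρ) :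
    KernelBound ρ (kerBound b d ρ) (greenReal μ β) := by
  have hk := kernelBound_greenRegC h hρ
  refine ⟨hk.1, fun n x hx => ?_⟩
  rcases eq_or_ne n 0 with rfl | h0
  · obtain ⟨t1, t2, t3⟩ := kerBound_terms h hρ
    rw [greenReal_zero, Complex.norm_real, norm_div, norm_neg,
      Real.norm_of_nonneg (show 0 ≤ 2 * kProp μ β by linarith [h.kProp_pos])]
    have : ‖Real.sin (kProp μ β * |x|)‖ / (2 * kProp μ β) ≤ 1 / (2 * Real.sqrt d) := by
      have h1 := h.sqrt_d_pos
      have := h.le_kProp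
      have h2 := Real.abs_sin_le_one (kProp μ β * |x|)
      rw [← Real.norm_eq_abs] at h2
      gcongr
    unfold kerBound
    linarith
  · rw [greenReal_of_ne _ _ h0]
    exact hk.2 n x hx

/-- A Lipschitz constant for the regularised kernels. -/
def kerLip (b d ρ : ℝ) : ℝ :=
  (2 * ρ / (2 * Real.sqrt d) + 1 / (2 * Real.sqrt d ^ 2)) * (1 / Real.sqrt d) +
    (2 * ρ / (2 * Real.sqrt b) + 1 / (2 * Real.sqrt b ^ 2)) * (2 / Real.sqrt b) +
    2 * ρ ^ 2 * Real.exp (2 * ρ)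

/-- The three summands of `kerLip` serve the modes `n = 0`, `n ≠ 0, -1` and `n = -1` in this order.
For `n = -1` the integral form of the kernel avoids dividing by `μ`, so the estimate holds across `μ
= 0`. -/
lemma kernelBound_greenReal_sub (h : GoodParam b d μ β) (h' : GoodParam b d μ' β') (hρ : 0 < ρ) :
    KernelBound ρ (kerLip b d ρ * (|μ - μ'| + |β - β'|))
      (fun n => greenReal μ β n - greenReal μ' β' n) := by
  have hd := h.sqrt_d_pos
  have hb := h.sqrt_b_pos
  set δ := |μ - μ'| + |β - β'| with hδ
  have hδ0 : 0 ≤ δ := by positivity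
  unfold kerLip
  have t1 : 0 ≤ (2 * ρ / (2 * Real.sqrt d) + 1 / (2 * Real.sqrt d ^ 2)) * (1 / Real.sqrt d) * δ := by
    positivity
  have t2 : 0 ≤ (2 * ρ / (2 * Real.sqrt b) + 1 / (2 * Real.sqrt b ^ 2)) * (2 / Real.sqrt b) * δ := by
    positivity
  have t3 : 0 ≤ 2 * ρ ^ 2 * Real.exp (2 * ρ) * δ := by positivity
  refine ⟨by positivity, fun n x hx => ?_⟩
  rw [ContinuousMap.sub_apply, add_mul, add_mul]
  rcases eq_or_ne n 0 with rfl | h0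
  · rw [greenReal_zero, greenReal_zero, ← Complex.ofReal_sub, Complex.norm_real, Real.norm_eq_abs]
    have h1 := abs_div_sub_div_le (r := 2 * ρ) hd h.le_kProp h'.le_kProp
      (u := -Real.sin (kProp μ β * |x|)) (u' := -Real.sin (kProp μ' β' * |x|)) (by
        have := Real.abs_sin_sub_sin_le (kProp μ' β' * |x|) (kProp μ β * |x|)
        rw [← sub_mul, abs_mul, abs_abs, abs_sub_comm (kProp μ' β'), mul_comm |kProp μ β - _|] at this
        rw [neg_sub_neg]
        refine this.trans ?_
        gcongr) (by rw [abs_neg]; exact Real.abs_sin_le_one _)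
    have h2 := h.abs_kProp_sub_le h'
    have : |-Real.sin (kProp μ β * |x|) / (2 * kProp μ β) -
        -Real.sin (kProp μ' β' * |x|) / (2 * kProp μ' β')| ≤
        (2 * ρ / (2 * Real.sqrt d) + 1 / (2 * Real.sqrt d ^ 2)) * (1 / Real.sqrt d) * δ := by
      rw [mul_assoc _ _ δ]
      exact h1.trans (by gcongr)
    linarith
  · rw [greenReal_of_ne _ _ h0, greenReal_of_ne _ _ h0, greenRegC_apply, greenRegC_apply]
    rcases eq_or_ne n (-1) with rfl | hm
    · rw [greenReg_neg_one, greenReg_neg_one, ← Complex.ofReal_sub, Complex.norm_real, ← mul_sub,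
        ← intervalIntegral.integral_sub (Continuous.intervalIntegrable (by fun_prop) _ _)
        (Continuous.intervalIntegrable (by fun_prop) _ _), norm_mul]
      have h1 := intervalIntegral.norm_integral_le_of_norm_le_const (a := 0) (b := |x|)
        (C := Real.exp (2 * ρ) * (2 * ρ * δ))
        (f := fun τ : ℝ => Real.exp (-(μ * τ)) - Real.exp (-(μ' * τ))) (by
        intro τ hτ
        rw [uIoc_of_le (abs_nonneg x)] at hτ
        have a1 := neg_le_of_abs_le h.abs_mu
        have a2 := neg_le_of_abs_le h'.abs_mu
        rw [Real.norm_eq_abs]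
        refine (abs_exp_sub_exp_le (M := 2 * ρ) (by nlinarith [hτ.1, hτ.2])
          (by nlinarith [hτ.1, hτ.2])).trans ?_
        gcongr
        rw [neg_sub_neg, ← sub_mul, abs_mul, abs_of_pos hτ.1, mul_comm, abs_sub_comm]
        have : |μ - μ'| ≤ δ := by rw [hδ]; linarith [abs_nonneg (β - β')]
        gcongr
        exact hτ.2.trans hx)
      rw [sub_zero, abs_abs] at h1
      have h2 : ‖(-(1 / 2) : ℝ)‖ = 1 / 2 := by norm_num
      rw [h2]
      have h3 : Real.exp (2 * ρ) * (2 * ρ * δ) * |x| ≤ Real.exp (2 * ρ) * (2 * ρ * δ) * (2 * ρ) := by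
        gcongr
      nlinarith
    · rw [greenReg_of_ne h0 hm, greenReg_of_ne h0 hm, ← Complex.ofReal_sub, Complex.norm_real,
        Real.norm_eq_abs]
      have h1 := abs_div_sub_div_le (r := 2 * ρ) hb (h.sqrt_b_le_kEvan h0 hm)
        (h'.sqrt_b_le_kEvan h0 hm)
        (u := Real.exp (-(kEvan n μ β * |x|))) (u' := Real.exp (-(kEvan n μ' β' * |x|))) (by
          have p1 := h.kEvan_pos h0 hm
          have p2 := h'.kEvan_pos h0 hm
          have := abs_exp_sub_exp_le (a := -(kEvan n μ β * |x|)) (b := -(kEvan n μ' β' * |x|))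
            (M := 0) (by nlinarith [abs_nonneg x]) (by nlinarith [abs_nonneg x])
          rw [neg_sub_neg, ← sub_mul, abs_mul, abs_abs, abs_sub_comm (kEvan n μ' β'),
            Real.exp_zero, one_mul, mul_comm |kEvan n μ β - _|] at this
          refine this.trans ?_
          gcongr) (by
          rw [abs_of_pos (Real.exp_pos _)]
          have p2 := h'.kEvan_pos h0 hm
          exact Real.exp_le_one_iff.mpr (by nlinarith [abs_nonneg x]))
      have h2 := h.abs_kEvan_sub_le h' h0 hm
      have : |Real.exp (-(kEvan n μ β * |x|)) / (2 * kEvan n μ β) -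
          Real.exp (-(kEvan n μ' β' * |x|)) / (2 * kEvan n μ' β')| ≤
          (2 * ρ / (2 * Real.sqrt b) + 1 / (2 * Real.sqrt b ^ 2)) * (2 / Real.sqrt b) * δ := by
        rw [mul_assoc _ _ δ]
        exact h1.trans (by gcongr)
      linarith

end Bounds
/-! ### Linear equations with small operators -/

section Generic

variable {X : Type*} [NormedAddCommGroup X] [NormedSpace ℂ X]

lemma norm_smul_comp_le {M K : X →L[ℂ] X} {z : ℂ} {κ : ℝ} (hK : ‖K‖ ≤ κ)
    (hz : ‖z‖ * (‖M‖ * κ) ≤ 1 / 2) : ‖z • (M.comp K)‖ ≤ 1 / 2 := by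
  rw [norm_smul]
  refine le_trans ?_ hz
  gcongr
  exact (M.opNorm_comp_le K).trans (by gcongr)

lemma existsUnique_sub_smul_eq [CompleteSpace X] {M K : X →L[ℂ] X} {z : ℂ} {κ : ℝ} (hK : ‖K‖ ≤ κ)
    (hz : ‖z‖ * (‖M‖ * κ) ≤ 1 / 2) (g : X) : ∃! a, a - z • M (K a) = g :=
  existsUnique_sub_eq (norm_smul_comp_le hK hz) g

lemma norm_le_of_sub_smul_eq {M K : X →L[ℂ] X} {z : ℂ} {κ : ℝ} (hK : ‖K‖ ≤ κ)
    (hz : ‖z‖ * (‖M‖ * κ) ≤ 1 / 2) {a g : X} (h : a - z • M (K a) = g) : ‖a‖ ≤ 2 * ‖g‖ :=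
  norm_le_of_sub_eq (norm_smul_comp_le hK hz) h

/-- The difference `a - a'` solves the primed equation with the change of the operator applied to
`a` as right-hand side, so only `z'` has to be small. -/
lemma norm_sub_le_of_sub_smul_eq {M K K' : X →L[ℂ] X} {z z' : ℂ} {κ δ : ℝ}
    (hK : ‖K‖ ≤ κ) (hK' : ‖K'‖ ≤ κ) (hz' : ‖z'‖ * (‖M‖ * κ) ≤ 1 / 2) (hD : ‖K - K'‖ ≤ δ)
    {a a' g : X} (h : a - z • M (K a) = g) (h' : a' - z' • M (K' a') = g) :
    ‖a - a'‖ ≤ 2 * (‖z - z'‖ * (‖M‖ * κ) + ‖z'‖ * (‖M‖ * δ)) * ‖a‖ := by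
  have e : (a - a') - z' • M (K' (a - a')) = (z - z') • M (K a) + z' • M ((K - K') a) := by
    rw [sub_apply, map_sub, map_sub, map_sub, smul_sub, smul_sub, sub_smul]
    rw [sub_eq_iff_eq_add] at h h'
    generalize M (K a) = p at *
    generalize M (K' a') = r at *
    generalize M (K' a) = q at *
    rw [h, h']
    abel
  have h1 := norm_le_of_sub_smul_eq hK' hz' e
  refine h1.trans ?_
  have b1 : ‖M (K a)‖ ≤ ‖M‖ * κ * ‖a‖ := by
    rw [mul_assoc]; exact M.le_opNorm_of_le (K.le_of_opNorm_le hK a)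
  have b2 : ‖M ((K - K') a)‖ ≤ ‖M‖ * δ * ‖a‖ := by
    rw [mul_assoc]; exact M.le_opNorm_of_le ((K - K').le_of_opNorm_le hD a)
  rw [mul_assoc]
  gcongr
  refine (norm_add_le _ _).trans ?_
  rw [norm_smul, norm_smul, add_mul, mul_assoc ‖z - z'‖, mul_assoc ‖z'‖]
  exact add_le_add (mul_le_mul_of_nonneg_left b1 (norm_nonneg _))
    (mul_le_mul_of_nonneg_left b2 (norm_nonneg _))

lemma norm_map_sub_map_le {M K K' : X →L[ℂ] X} {κ δ η : ℝ} (hK' : ‖K'‖ ≤ κ) (hD : ‖K - K'‖ ≤ δ)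
    {a a' : X} (ha : ‖a - a'‖ ≤ η) :
    ‖M (K a) - M (K' a')‖ ≤ ‖M‖ * (δ * ‖a‖ + κ * η) := by
  have e : M (K a) - M (K' a') = M ((K - K') a + K' (a - a')) := by
    rw [sub_apply, map_sub K', ← map_sub]
    congr 1
    abel
  rw [e]
  refine M.le_opNorm_of_le ((norm_add_le _ _).trans ?_)
  exact add_le_add ((K - K').le_of_opNorm_le hD a) (K'.le_of_opNorm_le_of_le hK' ha)

end Generic

/-! ### The equation `(1 - z M K) a = g` for functions -/

variable {f : ℝ × ℝ → ℝ} {ρ : ℝ}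

/-- The vector `a` solves `a_m - z ∑_n (h_n ∗ a_n) f_{m-n} = g_m`. -/
def SolvesKernel (f : ℝ × ℝ → ℝ) (z : ℂ) (h : ℤ → C(ℝ, ℂ)) (g : Vec ρ) (a : Vec ρ) : Prop :=
  ∀ m x, vecFn a m x - z * ∑' n, lineConv (h n) (vecFn a n) x * fourierY f (m - n) x = vecFn g m x

lemma IsProfile.solvesKernel_iff (hf : IsProfile f ρ) {B : ℝ} {h : ℤ → C(ℝ, ℂ)}
    (hB : KernelBound ρ B h) {z : ℂ} {g a : Vec ρ} :
    SolvesKernel f z h g a ↔ a - z • hf.mulVec (convVec hB a) = g := by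
  have key : ∀ m x, vecFn (a - z • hf.mulVec (convVec hB a)) m x =
      vecFn a m x - z * ∑' n, lineConv (h n) (vecFn a n) x * fourierY f (m - n) x := by
    intro m x
    rw [vecFn_sub, vecFn_smul, hf.vecFn_mulVec_convVec]
  constructor
  · intro H
    apply vecFn_injective
    ext m x
    rw [key, H m x]
  · intro H m x
    rw [← key, H]

/-- Smallness of `z` relative to the kernel bound `B`. -/
def IsProfile.Small (hf : IsProfile f ρ) (B : ℝ) (z : ℂ) : Prop :=
  ‖z‖ * (‖hf.mulVec‖ * (2 * |ρ| * B)) ≤ 1 / 2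

lemma IsProfile.existsUnique_solvesKernel (hf : IsProfile f ρ) {B : ℝ} {h : ℤ → C(ℝ, ℂ)}
    (hB : KernelBound ρ B h) {z : ℂ} (hz : hf.Small B z) (g : Vec ρ) :
    ∃! a : Vec ρ, SolvesKernel f z h g a := by
  simp_rw [hf.solvesKernel_iff hB]
  exact existsUnique_sub_smul_eq (norm_convVec_le hB) hz g

lemma IsProfile.norm_le_of_solvesKernel (hf : IsProfile f ρ) {B : ℝ} {h : ℤ → C(ℝ, ℂ)}
    (hB : KernelBound ρ B h) {z : ℂ} (hz : hf.Small B z) {g a : Vec ρ}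
    (ha : SolvesKernel f z h g a) : ‖a‖ ≤ 2 * ‖g‖ :=
  norm_le_of_sub_smul_eq (norm_convVec_le hB) hz ((hf.solvesKernel_iff hB).mp ha)

/-! #### Symmetries -/

/-- The reflection `x ↦ -x` on `C[-ρ, ρ]`. -/
def reflIcc (ρ : ℝ) : C(Icc (-ρ) ρ, ℂ) →ₗ[ℂ] C(Icc (-ρ) ρ, ℂ) where
  toFun u := ⟨fun x => u ⟨-x, by have := x.2; rw [mem_Icc] at this ⊢; constructor <;> linarith⟩,
    by fun_prop⟩
  map_add' _ _ := rfl
  map_smul' _ _ := rfl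

lemma extZero_reflIcc (u : C(Icc (-ρ) ρ, ℂ)) (x : ℝ) :
    extZero (reflIcc ρ u) x = extZero u (-x) := by
  by_cases hx : x ∈ Icc (-ρ) ρ
  · have hx' : -x ∈ Icc (-ρ) ρ := by rw [mem_Icc] at hx ⊢; constructor <;> linarith
    rw [extZero_of_mem _ hx, extZero_of_mem _ hx']; rfl
  · have hx' : -x ∉ Icc (-ρ) ρ := by
      intro h; apply hx; rw [mem_Icc] at h ⊢; constructor <;> linarith
    rw [extZero_of_notMem _ hx, extZero_of_notMem _ hx']

/-- The reflection `x ↦ -x` of vectors. -/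
def reflVec (a : Vec ρ) : Vec ρ :=
  blockOp (Equiv.refl ℤ) (fun _ => reflIcc ρ) 1 (fun _ u => by
    rw [one_mul, ContinuousMap.norm_le _ (norm_nonneg _)]
    exact fun x => u.norm_coe_le_norm _) a

lemma vecFn_reflVec (a : Vec ρ) (n : ℤ) (x : ℝ) : vecFn (reflVec a) n x = vecFn a n (-x) :=
  extZero_reflIcc _ _

lemma vecFn_star (a : Vec ρ) (n : ℤ) (x : ℝ) :
    vecFn (star a) n x = starRingEnd ℂ (vecFn a n x) := by
  by_cases hx : x ∈ Icc (-ρ) ρ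
  · rw [vecFn, vecFn, extZero_of_mem _ hx, extZero_of_mem _ hx]; rfl
  · rw [vecFn, vecFn, extZero_of_notMem _ hx, extZero_of_notMem _ hx, map_zero]

lemma lineConv_reflect {h u : ℝ → ℂ} (hh : ∀ x, h (-x) = h x) (x : ℝ) :
    lineConv h (fun ξ => u (-ξ)) x = lineConv h u (-x) := by
  unfold lineConv
  rw [← integral_neg_eq_self]
  congr 1
  ext ξ
  simp only [neg_neg]
  rw [← hh]
  congr 2
  ring

lemma conj_lineConv (h u : ℝ → ℂ) (x : ℝ) :
    starRingEnd ℂ (lineConv h u x) =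
      lineConv (fun x => starRingEnd ℂ (h x)) (fun x => starRingEnd ℂ (u x)) x := by
  unfold lineConv
  rw [← integral_conj]
  simp_rw [map_mul]

/-- The reflection `x ↦ -x` commutes with even kernels and with the even profile, so the reflected
solution solves the same equation and uniqueness identifies the two. The lemma on complex
conjugation rests on the same argument. -/
lemma IsProfile.solvesKernel_even (hf : IsProfile f ρ) {B : ℝ} {h : ℤ → C(ℝ, ℂ)}
    (hB : KernelBound ρ B h) {z : ℂ} (hz : hf.Small B z) (hh : ∀ n x, h n (-x) = h n x)
    {g a : Vec ρ} (hg : ∀ n x, vecFn g n (-x) = vecFn g n x) (ha : SolvesKernel f z h g a)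
    (n : ℤ) (x : ℝ) : vecFn a n (-x) = vecFn a n x := by
  have h2 : SolvesKernel f z h g (reflVec a) := by
    intro m x
    rw [vecFn_reflVec, ← hg, ← ha m (-x)]
    congr 3
    ext n
    rw [hf.fourierY_even, ← lineConv_reflect (hh n)]
    congr 2
    ext ξ
    rw [vecFn_reflVec]
  rw [← vecFn_reflVec, (hf.existsUnique_solvesKernel hB hz g).unique h2 ha]

lemma IsProfile.solvesKernel_conj (hf : IsProfile f ρ) {B : ℝ} {h : ℤ → C(ℝ, ℂ)}
    (hB : KernelBound ρ B h) {z : ℂ} (hz : hf.Small B z)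
    (hh : ∀ n x, starRingEnd ℂ (h n x) = h n x) (hzr : starRingEnd ℂ z = z)
    {g a : Vec ρ} (hg : ∀ n x, starRingEnd ℂ (vecFn g n x) = vecFn g n x)
    (ha : SolvesKernel f z h g a) (n : ℤ) (x : ℝ) :
    starRingEnd ℂ (vecFn a n x) = vecFn a n x := by
  have h2 : SolvesKernel f z h g (star a) := by
    intro m x
    rw [vecFn_star, ← hg, ← ha m x, map_sub, map_mul, hzr, Complex.conj_tsum]
    congr 3
    ext n
    rw [map_mul, hf.conj_fourierY, conj_lineConv]
    congr 2
    · ext ξ; exact (hh n ξ).symm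
    · ext ξ; exact vecFn_star a n ξ
  rw [← vecFn_star, (hf.existsUnique_solvesKernel hB hz g).unique h2 ha]

/-! #### The right-hand sides -/

/-- The vector `e^{ik₀x} e_0`. -/
def unitProp (ρ μ β : ℝ) : Vec ρ :=
  lp.single 2 0 (restrIcc (fun x : ℝ => Complex.exp (Complex.I * kProp μ β * x))
    (by fun_prop))

/-- The vector `e_{-1}`. -/
def unitMinus (ρ : ℝ) : Vec ρ := lp.single 2 (-1) 1

lemma IsProfile.mulVec_single (hf : IsProfile f ρ) (i : ℤ) (u : C(Icc (-ρ) ρ, ℂ)) (k : ℤ) :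
    hf.mulVec (lp.single 2 i u) k = hf.coeff (k - i) * u := by
  rw [← (hf.hasSum_mulVec' (lp.single 2 i u) k).tsum_eq, tsum_eq_single i]
  · rw [lp.single_apply_self]
  · intro n hn
    rw [lp.single_apply_ne _ _ _ hn, mul_zero]

lemma IsProfile.vecFn_mulVec_unitProp (hf : IsProfile f ρ) (μ β : ℝ) :
    vecFn (hf.mulVec (unitProp ρ μ β)) = vecG1 f μ β := by
  ext m x
  unfold unitProp vecG1 vecFn
  rw [hf.mulVec_single, extZero_mul, hf.extZero_coeff, sub_zero]
  by_cases hx : x ∈ Icc (-ρ) ρ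
  · rw [extZero_of_mem _ hx, mul_comm]; rfl
  · simp [hf.fourierY_eq_zero _ hx]

lemma IsProfile.vecFn_mulVec_unitMinus (hf : IsProfile f ρ) :
    vecFn (hf.mulVec (unitMinus ρ)) = vecG2 f := by
  ext m x
  unfold unitMinus vecG2 vecFn
  rw [hf.mulVec_single, mul_one, hf.extZero_coeff, sub_neg_eq_add]

lemma norm_unitProp_le (ρ μ β : ℝ) : ‖unitProp ρ μ β‖ ≤ 1 := by
  rw [unitProp, lp.norm_single (by norm_num), ContinuousMap.norm_le _ zero_le_one]
  intro x
  change ‖Complex.exp (Complex.I * kProp μ β * (x : ℝ))‖ ≤ 1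
  have : Complex.I * kProp μ β * (x : ℝ) = ((kProp μ β * x : ℝ) : ℂ) * Complex.I := by
    push_cast; ring
  rw [this, Complex.norm_exp_ofReal_mul_I]

/-! #### The operator of the problem -/

/-- The coefficient `2 γ ε`. -/
def zCoef (ε μ β : ℝ) : ℂ := ((2 * gam μ β * ε : ℝ) : ℂ)

lemma conj_zCoef (ε μ β : ℝ) : starRingEnd ℂ (zCoef ε μ β) = zCoef ε μ β := Complex.conj_ofReal _

lemma solvesA_vecFn_iff {ε μ β : ℝ} {g a : Vec ρ} :
    SolvesA f ρ ε μ β (vecFn g) (vecFn a) ↔ SolvesKernel f (zCoef ε μ β) (greenRegC μ β) g a := by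
  unfold SolvesA SolvesKernel opT zCoef
  refine ⟨fun h m x => ?_, fun h => ⟨memA_vecFn a, fun m x => ?_⟩⟩
  · rw [← h.2 m x]
    push_cast
    simp only [greenRegC, ContinuousMap.coe_mk]
    ring
  · rw [← h m x]
    push_cast
    simp only [greenRegC, ContinuousMap.coe_mk]
    ring

variable {b d ε μ β : ℝ}

lemma IsProfile.existsUnique_solvesA (hf : IsProfile f ρ) (h : GoodParam b d μ β)
    (hz : hf.Small (kerBound b d ρ) (zCoef ε μ β)) {g : ℤ → ℝ → ℂ} (hg : MemA ρ g) :
    ∃! A, SolvesA f ρ ε μ β g A := by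
  obtain ⟨g, rfl⟩ := exists_vecFn_eq hg
  obtain ⟨a, ha, hu⟩ := hf.existsUnique_solvesKernel (kernelBound_greenRegC h hf.pos) hz g
  refine ⟨vecFn a, solvesA_vecFn_iff.mpr ha, fun A hA => ?_⟩
  obtain ⟨a', rfl⟩ := exists_vecFn_eq hA.1
  rw [hu a' (solvesA_vecFn_iff.mp hA)]

lemma IsProfile.oneSubOpTBijective (hf : IsProfile f ρ) (h : GoodParam b d μ β)
    (hz : hf.Small (kerBound b d ρ) (zCoef ε μ β)) : OneSubOpTBijective f ρ ε μ β := by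
  refine ⟨fun A hA => ?_, fun g hg => hf.existsUnique_solvesA h hz hg⟩
  obtain ⟨a, rfl⟩ := exists_vecFn_eq hA
  have hB := kernelBound_greenRegC h hf.pos
  have h1 := (hf.solvesKernel_iff hB (z := zCoef ε μ β) (a := a)).mpr rfl
  have h2 := (solvesA_vecFn_iff.mpr h1).2
  have h3 : (fun m x => vecFn a m x - ε * opT f μ β (vecFn a) m x) =
      vecFn (a - zCoef ε μ β • hf.mulVec (convVec hB a)) := by
    ext m x
    exact h2 m x
  rw [h3]
  exact memA_vecFn _

/-- `resolv` is an arbitrary choice among solutions; uniqueness makes it equal to any solution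
exhibited in `Vec ρ`. -/
lemma IsProfile.resolv_eq (hf : IsProfile f ρ) (h : GoodParam b d μ β)
    (hz : hf.Small (kerBound b d ρ) (zCoef ε μ β)) {g a : Vec ρ}
    (ha : SolvesKernel f (zCoef ε μ β) (greenRegC μ β) g a) :
    resolv f ρ ε μ β (vecFn g) = vecFn a := by
  have hex := hf.existsUnique_solvesA h hz (memA_vecFn g)
  exact hex.unique (Classical.epsilon_spec hex.exists) (solvesA_vecFn_iff.mpr ha)

/-! #### The real kernel -/

/-- The solution with right-hand side `g⁽²⁾` for the real kernels. -/
def IsProfile.realSol (hf : IsProfile f ρ) (ε μ β : ℝ) : Vec ρ :=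
  Classical.epsilon
    (SolvesKernel f (zCoef ε μ β) (greenReal μ β) (hf.mulVec (unitMinus ρ)))

lemma IsProfile.realSol_spec (hf : IsProfile f ρ) (h : GoodParam b d μ β)
    (hz : hf.Small (kerBound b d ρ) (zCoef ε μ β)) :
    SolvesKernel f (zCoef ε μ β) (greenReal μ β) (hf.mulVec (unitMinus ρ)) (hf.realSol ε μ β) :=
  Classical.epsilon_spec
    (hf.existsUnique_solvesKernel (kernelBound_greenReal h hf.pos) hz _).exists

lemma IsProfile.vecG2_even (hf : IsProfile f ρ) (n : ℤ) (x : ℝ) :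
    vecFn (hf.mulVec (unitMinus ρ)) n (-x) = vecFn (hf.mulVec (unitMinus ρ)) n x := by
  rw [hf.vecFn_mulVec_unitMinus]
  exact hf.fourierY_even _ _

lemma IsProfile.vecG2_conj (hf : IsProfile f ρ) (n : ℤ) (x : ℝ) :
    starRingEnd ℂ (vecFn (hf.mulVec (unitMinus ρ)) n x) = vecFn (hf.mulVec (unitMinus ρ)) n x := by
  rw [hf.vecFn_mulVec_unitMinus]
  exact hf.conj_fourierY _ _

/-- `∫ u(x) cos(kx) dx`. -/
def cosInt (k : ℝ) (u : ℝ → ℂ) : ℂ := ∫ x : ℝ, (Real.cos (k * x) : ℂ) * u x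

lemma integral_mul_exp_of_even {u : C(Icc (-ρ) ρ, ℂ)} (hu : ∀ x, extZero u (-x) = extZero u x)
    (k : ℝ) : ∫ x : ℝ, extZero u x * Complex.exp (Complex.I * k * x) = cosInt k (extZero u) := by
  have hs : ∫ x : ℝ, (Real.sin (k * x) : ℂ) * extZero u x = 0 := by
    have h1 := integral_neg_eq_self (fun x : ℝ => (Real.sin (k * x) : ℂ) * extZero u x) volume
    simp only [hu, mul_neg, Real.sin_neg, Complex.ofReal_neg, neg_mul, integral_neg] at h1
    exact self_eq_neg.mp h1.symm
  have e : ∀ x : ℝ, extZero u x * Complex.exp (Complex.I * k * x) =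
      (Real.cos (k * x) : ℂ) * extZero u x +
        Complex.I * ((Real.sin (k * x) : ℂ) * extZero u x) := by
    intro x
    have : Complex.I * k * x = ((k * x : ℝ) : ℂ) * Complex.I := by push_cast; ring
    rw [this, Complex.exp_mul_I, ← Complex.ofReal_cos, ← Complex.ofReal_sin]
    ring
  simp_rw [e]
  rw [integral_add (integrable_mul_extZero (by fun_prop) u)
    ((integrable_mul_extZero (by fun_prop) u).const_mul _), integral_const_mul, hs, mul_zero,
    add_zero, cosInt]

/-- Expand `cos k(x - ξ)`. The sine half integrates to zero against an even function, leaving a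
rank-one term proportional to the cosine moment. -/
lemma lineConv_greenReg_zero_of_even {u : C(Icc (-ρ) ρ, ℂ)}
    (hu : ∀ x, extZero u (-x) = extZero u x) (x : ℝ) :
    lineConv (greenRegC μ β 0) (extZero u) x = lineConv (greenReal μ β 0) (extZero u) x +
      Complex.I / (2 * kProp μ β) * (Real.cos (kProp μ β * x) : ℂ) *
        cosInt (kProp μ β) (extZero u) := by
  set k := kProp μ β
  have hs : ∫ x : ℝ, (Real.sin (k * x) : ℂ) * extZero u x = 0 := by
    have h1 := integral_neg_eq_self (fun x : ℝ => (Real.sin (k * x) : ℂ) * extZero u x) volume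
    simp only [hu, mul_neg, Real.sin_neg, Complex.ofReal_neg, neg_mul, integral_neg] at h1
    exact self_eq_neg.mp h1.symm
  have e : ∀ ξ : ℝ, greenRegC μ β 0 (x - ξ) * extZero u ξ =
      greenReal μ β 0 (x - ξ) * extZero u ξ +
      (Complex.I / (2 * k) * (Real.cos (k * x) : ℂ) * ((Real.cos (k * ξ) : ℂ) * extZero u ξ) +
      Complex.I / (2 * k) * (Real.sin (k * x) : ℂ) * ((Real.sin (k * ξ) : ℂ) * extZero u ξ)) := by
    intro ξ
    rw [greenRegC_apply, greenReg_zero, mul_sub, Real.cos_sub]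
    push_cast
    ring
  unfold lineConv
  simp_rw [e]
  have i1 : ∀ c : ℂ, Integrable fun ξ : ℝ => c * ((Real.cos (k * ξ) : ℂ) * extZero u ξ) :=
    fun c => (integrable_mul_extZero (by fun_prop) u).const_mul c
  have i2 : ∀ c : ℂ, Integrable fun ξ : ℝ => c * ((Real.sin (k * ξ) : ℂ) * extZero u ξ) :=
    fun c => (integrable_mul_extZero (by fun_prop) u).const_mul c
  have i3 : ∀ c c' : ℂ, Integrable fun ξ : ℝ => c * ((Real.cos (k * ξ) : ℂ) * extZero u ξ) +
    c' * ((Real.sin (k * ξ) : ℂ) * extZero u ξ) := fun c c' => (i1 c).add (i2 c')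
  rw [integral_add (integrable_mul_extZero (by fun_prop) u) (i3 _ _),
    integral_add (i1 _) (i2 _), integral_const_mul, integral_const_mul, hs, mul_zero, add_zero]
  rfl

/-- If the cosine moment of the zeroth component vanishes, so does the rank-one difference between
the complex and the real kernels. -/
lemma solvesKernel_greenReg_iff {z : ℂ} {g a : Vec ρ}
    (ha : ∀ n x, vecFn a n (-x) = vecFn a n x) (h0 : cosInt (kProp μ β) (vecFn a 0) = 0) :
    SolvesKernel f z (greenRegC μ β) g a ↔ SolvesKernel f z (greenReal μ β) g a := by
  have : ∀ n x, lineConv (greenRegC μ β n) (vecFn a n) x =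
      lineConv (greenReal μ β n) (vecFn a n) x := by
    intro n x
    rcases eq_or_ne n 0 with rfl | hn
    · have := lineConv_greenReg_zero_of_even (μ := μ) (β := β) (ha 0) x
      rw [vecFn] at h0 ⊢
      rw [this, h0, mul_zero, add_zero]
    · rw [greenReal_of_ne _ _ hn]
  unfold SolvesKernel
  simp_rw [this]

lemma IsProfile.greenReg_solution_even (hf : IsProfile f ρ) (h : GoodParam b d μ β)
    (hz : hf.Small (kerBound b d ρ) (zCoef ε μ β)) {a : Vec ρ}
    (ha : SolvesKernel f (zCoef ε μ β) (greenRegC μ β) (hf.mulVec (unitMinus ρ)) a) (n : ℤ)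
    (x : ℝ) : vecFn a n (-x) = vecFn a n x :=
  hf.solvesKernel_even (kernelBound_greenRegC h hf.pos) hz
    (fun n x => greenReg_even n μ β x) hf.vecG2_even ha n x

lemma IsProfile.realSol_even (hf : IsProfile f ρ) (h : GoodParam b d μ β)
    (hz : hf.Small (kerBound b d ρ) (zCoef ε μ β)) (n : ℤ) (x : ℝ) :
    vecFn (hf.realSol ε μ β) n (-x) = vecFn (hf.realSol ε μ β) n x :=
  hf.solvesKernel_even (kernelBound_greenReal h hf.pos) hz
    (fun n x => greenReal_even n μ β x) hf.vecG2_even (hf.realSol_spec h hz) n x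

lemma IsProfile.realSol_conj (hf : IsProfile f ρ) (h : GoodParam b d μ β)
    (hz : hf.Small (kerBound b d ρ) (zCoef ε μ β)) (n : ℤ) (x : ℝ) :
    starRingEnd ℂ (vecFn (hf.realSol ε μ β) n x) = vecFn (hf.realSol ε μ β) n x :=
  hf.solvesKernel_conj (kernelBound_greenReal h hf.pos) hz
    (fun n x => conj_greenReal n μ β x) (conj_zCoef ε μ β) hf.vecG2_conj (hf.realSol_spec h hz) n x

/-- The analogue of `R` for the real kernels. -/
def IsProfile.realR (hf : IsProfile f ρ) (ε μ β : ℝ) : ℝ :=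
  (cosInt (kProp μ β) (vecFn (hf.realSol ε μ β) 0)).re

/-- The analogue of `F` for the real kernels. -/
def IsProfile.realF (hf : IsProfile f ρ) (ε μ β : ℝ) : ℝ :=
  (∫ x : ℝ, vecFn (hf.realSol ε μ β) (-1) x).re

lemma conj_cosInt {k : ℝ} {u : ℝ → ℂ} (hu : ∀ x, starRingEnd ℂ (u x) = u x) :
    starRingEnd ℂ (cosInt k u) = cosInt k u := by
  unfold cosInt
  rw [← integral_conj]
  simp_rw [map_mul, hu, Complex.conj_ofReal]

lemma IsProfile.cosInt_realSol (hf : IsProfile f ρ) (h : GoodParam b d μ β)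
    (hz : hf.Small (kerBound b d ρ) (zCoef ε μ β)) :
    cosInt (kProp μ β) (vecFn (hf.realSol ε μ β) 0) = (hf.realR ε μ β : ℂ) :=
  (Complex.conj_eq_iff_re.mp (conj_cosInt (hf.realSol_conj h hz 0))).symm

lemma IsProfile.integral_realSol (hf : IsProfile f ρ) (h : GoodParam b d μ β)
    (hz : hf.Small (kerBound b d ρ) (zCoef ε μ β)) :
    ∫ x : ℝ, vecFn (hf.realSol ε μ β) (-1) x = (hf.realF ε μ β : ℂ) := by
  refine (Complex.conj_eq_iff_re.mp ?_).symm
  rw [← integral_conj]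
  simp_rw [hf.realSol_conj h hz (-1)]

lemma IsProfile.funR_eq (hf : IsProfile f ρ) (h : GoodParam b d μ β)
    (hz : hf.Small (kerBound b d ρ) (zCoef ε μ β)) {a : Vec ρ}
    (ha : SolvesKernel f (zCoef ε μ β) (greenRegC μ β) (hf.mulVec (unitMinus ρ)) a) :
    funR f ρ ε μ β = cosInt (kProp μ β) (vecFn a 0) := by
  rw [funR, ← hf.vecFn_mulVec_unitMinus, hf.resolv_eq h hz ha]
  exact integral_mul_exp_of_even (hf.greenReg_solution_even h hz ha 0) _

lemma IsProfile.realSol_solves (hf : IsProfile f ρ) (h : GoodParam b d μ β)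
    (hz : hf.Small (kerBound b d ρ) (zCoef ε μ β)) (hR : hf.realR ε μ β = 0) :
    SolvesKernel f (zCoef ε μ β) (greenRegC μ β) (hf.mulVec (unitMinus ρ)) (hf.realSol ε μ β) := by
  rw [solvesKernel_greenReg_iff (hf.realSol_even h hz)
    (by rw [hf.cosInt_realSol h hz, hR, Complex.ofReal_zero])]
  exact hf.realSol_spec h hz

/-- A zero of either function is a vanishing cosine moment for the solution of its problem. That
solution then solves the other problem as well, and uniqueness makes the two coincide. A complex
equation for the single real unknown `β` is thereby replaced by a real one. -/
lemma IsProfile.funR_eq_zero_iff (hf : IsProfile f ρ) (h : GoodParam b d μ β)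
    (hz : hf.Small (kerBound b d ρ) (zCoef ε μ β)) :
    funR f ρ ε μ β = 0 ↔ hf.realR ε μ β = 0 := by
  constructor
  · intro hR
    obtain ⟨a, ha, -⟩ := hf.existsUnique_solvesKernel (kernelBound_greenRegC h hf.pos) hz
      (hf.mulVec (unitMinus ρ))
    rw [hf.funR_eq h hz ha] at hR
    have ha' := (solvesKernel_greenReg_iff (hf.greenReg_solution_even h hz ha) hR).mp ha
    have : a = hf.realSol ε μ β :=
      (hf.existsUnique_solvesKernel (kernelBound_greenReal h hf.pos) hz _).unique ha'
        (hf.realSol_spec h hz)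
    rw [IsProfile.realR, ← this, hR, Complex.zero_re]
  · intro hR
    rw [hf.funR_eq h hz (hf.realSol_solves h hz hR), hf.cosInt_realSol h hz, hR,
      Complex.ofReal_zero]

/-- On the zero set of `R` the resolvent solution is the real-valued one, so `F` is real there and
`ν = γF` is one real equation. -/
lemma IsProfile.funF_eq (hf : IsProfile f ρ) (h : GoodParam b d μ β)
    (hz : hf.Small (kerBound b d ρ) (zCoef ε μ β)) (hR : hf.realR ε μ β = 0) :
    funF f ρ ε μ β = (hf.realF ε μ β : ℂ) := by
  rw [funF, ← hf.vecFn_mulVec_unitMinus, hf.resolv_eq h hz (hf.realSol_solves h hz hR),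
    hf.integral_realSol h hz]
/-! ### A Lipschitz implicit function theorem and a fixed point on the curve -/

/-- A substitute for the implicit function theorem that needs only Lipschitz dependence and strict
growth in `β` at rate `c`. The intermediate value theorem gives a root, growth gives its uniqueness,
and comparing `S` at the two roots gives the Lipschitz constant `L / c`. -/
lemma exists_lipschitz_curve {S : ℝ → ℝ → ℝ → ℝ} {b₀ e m h L c : ℝ} (he : 0 < e) (hm : 0 < m)
    (hh : 0 < h) (hL : 0 ≤ L) (hc : 0 < c)
    (hLip : ∀ ε ε' μ μ' β β' : ℝ, |ε| ≤ e → |ε'| ≤ e → |μ| ≤ m → |μ'| ≤ m → |β - b₀| ≤ h →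
      |β' - b₀| ≤ h → |S ε μ β - S ε' μ' β'| ≤ L * (|ε - ε'| + (|μ - μ'| + |β - β'|)))
    (hmono : ∀ ε μ β β' : ℝ, |ε| ≤ e → |μ| ≤ m → |β - b₀| ≤ h → |β' - b₀| ≤ h → β ≤ β' →
      c * (β' - β) ≤ S ε μ β' - S ε μ β)
    (h0 : S 0 0 b₀ = 0) :
    ∃ (ε₀ μ₀ : ℝ) (β₀ : ℝ → ℝ → ℝ), 0 < ε₀ ∧ ε₀ ≤ e ∧ 0 < μ₀ ∧ μ₀ ≤ m ∧ β₀ 0 0 = b₀ ∧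
      (∀ ε μ : ℝ, |ε| < ε₀ → |μ| < μ₀ → |β₀ ε μ - b₀| < h ∧
        ∀ β : ℝ, |β - b₀| < h → (S ε μ β = 0 ↔ β = β₀ ε μ)) ∧
      ∀ ε ε' μ μ' : ℝ, |ε| < ε₀ → |ε'| < ε₀ → |μ| < μ₀ → |μ'| < μ₀ →
        |β₀ ε μ - β₀ ε' μ'| ≤ L / c * (|ε - ε'| + |μ - μ'|) := by
  -- With `|ε|, |μ| < r` the value at `b₀` is at most `ch/4` in modulus, while moving `β` by `h/2`
  -- changes `S` by at least `ch/2`. The signs at `b₀ ± h/2` are therefore opposite.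
  set r : ℝ := c * h / (8 * (L + 1)) with hr
  have hr0 : 0 < r := by positivity
  have hLr : L * r ≤ c * h / 8 := by
    rw [hr, mul_div_assoc', div_le_div_iff₀ (by positivity) (by norm_num)]
    nlinarith [mul_pos hc hh]
  have hinj : ∀ ε μ β β' : ℝ, |ε| ≤ e → |μ| ≤ m → |β - b₀| ≤ h → |β' - b₀| ≤ h →
      c * |β - β'| ≤ |S ε μ β - S ε μ β'| := by
    intro ε μ β β' h1 h2 h3 h4
    rcases le_total β β' with hle | hle
    · have := hmono ε μ β β' h1 h2 h3 h4 hle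
      rw [abs_sub_comm, abs_of_nonneg (sub_nonneg.mpr hle), abs_sub_comm]
      exact this.trans (le_abs_self _)
    · have := hmono ε μ β' β h1 h2 h4 h3 hle
      rw [abs_of_nonneg (sub_nonneg.mpr hle)]
      exact this.trans (le_abs_self _)
  have hroot : ∀ ε μ : ℝ, |ε| < min e r → |μ| < min m r →
      ∃ β, |β - b₀| < h ∧ S ε μ β = 0 := by
    intro ε μ hε hμ
    have hε1 := (hε.trans_le (min_le_left _ _)).le
    have hε2 := (hε.trans_le (min_le_right _ _)).le
    have hμ1 := (hμ.trans_le (min_le_left _ _)).le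
    have hμ2 := (hμ.trans_le (min_le_right _ _)).le
    have hz : |(0 : ℝ)| ≤ e := by simpa using he.le
    have hz' : |(0 : ℝ)| ≤ m := by simpa using hm.le
    have hb : |b₀ - b₀| ≤ h := by simpa using hh.le
    have hS0 : |S ε μ b₀| ≤ c * h / 4 := by
      have := hLip ε 0 μ 0 b₀ b₀ hε1 hz hμ1 hz' hb hb
      rw [h0, sub_zero, sub_zero, sub_zero, sub_self, abs_zero, add_zero] at this
      refine this.trans ?_
      have : L * (|ε| + |μ|) ≤ L * (r + r) := by gcongr
      linarith
    have hu : |b₀ + h / 2 - b₀| ≤ h := by rw [add_sub_cancel_left, abs_of_pos (by positivity)]; linarith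
    have hl : |b₀ - h / 2 - b₀| ≤ h := by
      rw [sub_sub_cancel_left, abs_neg, abs_of_pos (by positivity)]; linarith
    have hup := hmono ε μ b₀ (b₀ + h / 2) hε1 hμ1 hb hu (by linarith)
    have hlo := hmono ε μ (b₀ - h / 2) b₀ hε1 hμ1 hl hb (by linarith)
    have hb' := abs_le.mp hS0
    have hch : 0 < c * h := by positivity
    have hcont : ContinuousOn (fun β => S ε μ β) (Icc (b₀ - h / 2) (b₀ + h / 2)) := by
      have hlipon : LipschitzOnWith (Real.toNNReal L) (fun β => S ε μ β)
          (Icc (b₀ - h / 2) (b₀ + h / 2)) := by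
        refine LipschitzOnWith.of_dist_le_mul fun x hx y hy => ?_
        rw [Real.dist_eq, Real.dist_eq, Real.coe_toNNReal _ hL]
        have := hLip ε ε μ μ x y hε1 hε1 hμ1 hμ1
          (abs_le.mpr ⟨by linarith [hx.1], by linarith [hx.2]⟩)
          (abs_le.mpr ⟨by linarith [hy.1], by linarith [hy.2]⟩)
        simpa using this
      exact hlipon.continuousOn
    have hmem : (0 : ℝ) ∈ Icc (S ε μ (b₀ - h / 2)) (S ε μ (b₀ + h / 2)) :=
      ⟨by nlinarith, by nlinarith⟩
    obtain ⟨β, hβ, hβ0⟩ := intermediate_value_Icc (by linarith) hcont hmem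
    exact ⟨β, abs_lt.mpr ⟨by linarith [hβ.1], by linarith [hβ.2]⟩, hβ0⟩
  choose! B hB using hroot
  have huniq : ∀ ε μ : ℝ, |ε| < min e r → |μ| < min m r → ∀ β : ℝ, |β - b₀| < h →
      (S ε μ β = 0 ↔ β = B ε μ) := by
    intro ε μ hε hμ β hβ
    have h1 := hB ε μ hε hμ
    constructor
    · intro hS
      have := hinj ε μ β (B ε μ) (hε.trans_le (min_le_left _ _)).le
        (hμ.trans_le (min_le_left _ _)).le hβ.le h1.1.le
      rw [hS, h1.2, sub_zero, abs_zero] at this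
      have h3 : |β - B ε μ| ≤ 0 := by
        by_contra hcon
        push Not at hcon
        nlinarith
      exact sub_eq_zero.mp (abs_nonpos_iff.mp h3)
    · rintro rfl
      exact h1.2
  refine ⟨min e r, min m r, B, lt_min he hr0, min_le_left _ _, lt_min hm hr0, min_le_left _ _,
    ?_, fun ε μ hε hμ => ⟨(hB ε μ hε hμ).1, huniq ε μ hε hμ⟩, ?_⟩
  · refine ((huniq 0 0 ?_ ?_ b₀ ?_).mp h0).symm <;> simp [he, hm, hr0, hh]
  · intro ε ε' μ μ' h1 h2 h3 h4
    have g1 := (h1.trans_le (min_le_left _ _)).le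
    have g2 := (h2.trans_le (min_le_left _ _)).le
    have g3 := (h3.trans_le (min_le_left _ _)).le
    have g4 := (h4.trans_le (min_le_left _ _)).le
    have k1 := hB ε μ h1 h3
    have k2 := hB ε' μ' h2 h4
    have a1 := hinj ε μ (B ε μ) (B ε' μ') g1 g3 k1.1.le k2.1.le
    have a2 := hLip ε' ε μ' μ (B ε' μ') (B ε' μ') g2 g1 g4 g3 k2.1.le k2.1.le
    rw [k1.2, zero_sub, abs_neg] at a1
    rw [k2.2, zero_sub, abs_neg, sub_self, abs_zero, add_zero, abs_sub_comm ε', abs_sub_comm μ']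
      at a2
    rw [div_mul_eq_mul_div, le_div_iff₀ hc, mul_comm _ c]
    exact a1.trans a2

/-- As a function of `ν`, `G ε (ε ν)` has Lipschitz constant `L ε ≤ 1/2`, so there is at most one
fixed point in the whole range `ε ν < μ₀`. Existence follows from the intermediate value theorem on
`[0, 2ν₀]`, since `G` is close to `ν₀` there. -/
lemma exists_fixed_value {G : ℝ → ℝ → ℝ} {ε₀ μ₀ L ν₀ : ℝ} (hε₀ : 0 < ε₀) (hμ₀ : 0 < μ₀)
    (hL : 0 ≤ L) (hν₀ : 0 < ν₀)
    (hLip : ∀ ε ε' μ μ' : ℝ, |ε| < ε₀ → |ε'| < ε₀ → |μ| < μ₀ → |μ'| < μ₀ →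
      |G ε μ - G ε' μ'| ≤ L * (|ε - ε'| + |μ - μ'|)) (h0 : G 0 0 = ν₀) :
    ∃ (ε₁ : ℝ) (νtr : ℝ → ℝ), 0 < ε₁ ∧ ε₁ ≤ ε₀ ∧ Tendsto νtr (𝓝[>] 0) (𝓝 ν₀) ∧
      ∀ ε : ℝ, 0 < ε → ε < ε₁ → 0 < νtr ε ∧ ε * νtr ε < μ₀ ∧
        ∀ ν : ℝ, 0 < ν → ε * ν < μ₀ → (ν = G ε (ε * ν) ↔ ν = νtr ε) := by
  -- The first entry keeps `ε ν < μ₀` for `ν ≤ 2ν₀`; the second makes `L (1 + 2ν₀) ε ≤ ν₀/4`.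
  set r : ℝ := min (μ₀ / (4 * ν₀)) (ν₀ / (4 * (L + 1) * (1 + 2 * ν₀))) with hr
  have hr0 : 0 < r := by positivity
  have hr1 : r * (4 * ν₀) ≤ μ₀ := by
    rw [← le_div_iff₀ (by positivity)]; exact min_le_left _ _
  have hr2 : r * (4 * (L + 1) * (1 + 2 * ν₀)) ≤ ν₀ := by
    rw [← le_div_iff₀ (by positivity)]; exact min_le_right _ _
  have hz : |(0 : ℝ)| < ε₀ := by simpa using hε₀
  have hz' : |(0 : ℝ)| < μ₀ := by simpa using hμ₀
  have hclose : ∀ ε ν : ℝ, 0 < ε → ε < min ε₀ r → 0 ≤ ν → ν ≤ 2 * ν₀ →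
      ε * ν < μ₀ ∧ |G ε (ε * ν) - ν₀| ≤ L * (1 + 2 * ν₀) * ε := by
    intro ε ν hε hε1 hν hν1
    have hεr := hε1.trans_le (min_le_right _ _)
    have hlt : ε * ν < μ₀ := by
      have : ε * ν ≤ r * (2 * ν₀) := by gcongr
      nlinarith
    refine ⟨hlt, ?_⟩
    have h1 := hLip ε 0 (ε * ν) 0 (by rw [abs_of_pos hε]; exact hε1.trans_le (min_le_left _ _)) hz
      (by rw [abs_of_nonneg (by positivity)]; exact hlt) hz'
    rw [h0, sub_zero, sub_zero, abs_of_pos hε, abs_of_nonneg (a := ε * ν) (by positivity)] at h1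
    refine h1.trans ?_
    rw [mul_assoc]
    gcongr
    nlinarith
  have hsmall : ∀ ε : ℝ, 0 < ε → ε < r → L * (1 + 2 * ν₀) * ε ≤ ν₀ / 4 := by
    intro ε hε hεr
    have : L * (1 + 2 * ν₀) * ε ≤ (L + 1) * (1 + 2 * ν₀) * r := by gcongr; linarith
    nlinarith
  have hcontr : ∀ ε ν ν' : ℝ, 0 < ε → ε < min ε₀ r → 0 ≤ ν → 0 ≤ ν' → ε * ν < μ₀ → ε * ν' < μ₀ →
      |G ε (ε * ν) - G ε (ε * ν')| ≤ 1 / 2 * |ν - ν'| := by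
    intro ε ν ν' hε hε1 hν hν' h1 h2
    have hεa : |ε| < ε₀ := by rw [abs_of_pos hε]; exact hε1.trans_le (min_le_left _ _)
    have h3 := hLip ε ε (ε * ν) (ε * ν') hεa hεa (by rwa [abs_of_nonneg (by positivity)])
      (by rwa [abs_of_nonneg (by positivity)])
    rw [sub_self, abs_zero, zero_add, ← mul_sub, abs_mul, abs_of_pos hε, ← mul_assoc] at h3
    refine h3.trans ?_
    gcongr
    have h4 := hsmall ε hε (hε1.trans_le (min_le_right _ _))
    have h5 : 0 ≤ L * ε := by positivity
    nlinarith
  have hroot : ∀ ε : ℝ, 0 < ε → ε < min ε₀ r → ∃ ν, 0 < ν ∧ ν ≤ 2 * ν₀ ∧ ν = G ε (ε * ν) := by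
    intro ε hε hε1
    have hs := hsmall ε hε (hε1.trans_le (min_le_right _ _))
    have hcont : ContinuousOn (fun ν => ν - G ε (ε * ν)) (Icc 0 (2 * ν₀)) := by
      refine continuousOn_id.sub ?_
      have hlipon : LipschitzOnWith (Real.toNNReal (1 / 2)) (fun ν => G ε (ε * ν))
          (Icc 0 (2 * ν₀)) := by
        refine LipschitzOnWith.of_dist_le_mul fun x hx y hy => ?_
        rw [Real.dist_eq, Real.dist_eq, Real.coe_toNNReal _ (by norm_num)]
        exact hcontr ε x y hε hε1 hx.1 hy.1 (hclose ε x hε hε1 hx.1 hx.2).1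
          (hclose ε y hε hε1 hy.1 hy.2).1
      exact hlipon.continuousOn
    have a1 := abs_le.mp (hclose ε 0 hε hε1 le_rfl (by linarith)).2
    have a2 := abs_le.mp (hclose ε (2 * ν₀) hε hε1 (by linarith) le_rfl).2
    have hmem : (0 : ℝ) ∈ Icc (0 - G ε (ε * 0)) (2 * ν₀ - G ε (ε * (2 * ν₀))) :=
      ⟨by linarith, by linarith⟩
    obtain ⟨ν, hν, hν0⟩ := intermediate_value_Icc (by linarith) hcont hmem
    have hν0' : ν = G ε (ε * ν) := sub_eq_zero.mp hν0
    refine ⟨ν, ?_, hν.2, hν0'⟩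
    have a3 := abs_le.mp (hclose ε ν hε hε1 hν.1 hν.2).2
    rw [hν0']
    linarith
  choose! N hN using hroot
  refine ⟨min ε₀ r, N, lt_min hε₀ hr0, min_le_left _ _, ?_, fun ε hε hε1 => ?_⟩
  · rw [tendsto_iff_dist_tendsto_zero]
    have hlim : Tendsto (fun ε : ℝ => L * (1 + 2 * ν₀) * ε) (𝓝[>] 0) (𝓝 0) := by
      have : Tendsto (fun ε : ℝ => L * (1 + 2 * ν₀) * ε) (𝓝 0) (𝓝 (L * (1 + 2 * ν₀) * 0)) :=
        tendsto_id.const_mul _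
      rw [mul_zero] at this
      exact this.mono_left nhdsWithin_le_nhds
    refine squeeze_zero' (Eventually.of_forall fun _ => dist_nonneg) ?_ hlim
    have hev : Ioo (0 : ℝ) (min ε₀ r) ∈ 𝓝[>] (0 : ℝ) := Ioo_mem_nhdsGT (lt_min hε₀ hr0)
    filter_upwards [hev] with ε hε
    have h1 := hN ε hε.1 hε.2
    rw [Real.dist_eq, h1.2.2]
    exact (hclose ε (N ε) hε.1 hε.2 h1.1.le h1.2.1).2
  · have h1 := hN ε hε hε1
    have hlt := (hclose ε (N ε) hε hε1 h1.1.le h1.2.1).1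
    refine ⟨h1.1, hlt, fun ν hν hν1 => ⟨fun h => ?_, fun h => ?_⟩⟩
    · have h2 := hcontr ε ν (N ε) hε hε1 hν.le h1.1.le hν1 hlt
      rw [← h, ← h1.2.2] at h2
      have h3 : |ν - N ε| ≤ 0 := by linarith
      exact sub_eq_zero.mp (abs_nonpos_iff.mp h3)
    · rw [h]
      exact h1.2.2

/-! ### Smoothness of the Fourier transform of the first coefficient -/

namespace IsProfile

variable {f : ℝ × ℝ → ℝ} {ρ : ℝ}

lemma fourierXY_eq_cosInt (hf : IsProfile f ρ) (j : ℤ) (ξ : ℝ) :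
    fourierXY f j ξ = cosInt ξ (fourierY f j) := by
  have h := integral_mul_exp_of_even (u := hf.coeff j)
    (fun x => by rw [hf.extZero_coeff, hf.fourierY_even]) (-ξ)
  rw [hf.extZero_coeff] at h
  have h2 : cosInt (-ξ) (fourierY f j) = cosInt ξ (fourierY f j) := by
    unfold cosInt
    simp_rw [neg_mul, Real.cos_neg]
  rw [← h2, ← h]
  unfold fourierXY
  congr 1
  ext x
  rw [mul_comm]
  push_cast
  congr 2
  ring

lemma conj_fourierXY (hf : IsProfile f ρ) (j : ℤ) (ξ : ℝ) :
    starRingEnd ℂ (fourierXY f j ξ) = fourierXY f j ξ := by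
  rw [hf.fourierXY_eq_cosInt]
  exact conj_cosInt (hf.conj_fourierY j)

/-- The coefficient is continuous with compact support, so all its moments are integrable and its
Fourier transform is smooth. The two normalisations differ by the rescaling `ξ / 2π`. -/
lemma contDiff_fourierXY (hf : IsProfile f ρ) (j : ℤ) : ContDiff ℝ 1 (fourierXY f j) := by
  have h1 : ContDiff ℝ (1 : ℕ∞) (FourierTransform.fourier (fourierY f j)) := by
    refine Real.contDiff_fourier fun n _ => ?_
    have hi : Integrable (fun v : ℝ => ((‖v‖ ^ n : ℝ) : ℂ) * fourierY f j v) := by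
      refine integrable_of_continuousOn_Icc (ρ := ρ) ?_ fun x hx => ?_
      · have := hf.continuous_fourierY j
        fun_prop
      · rw [hf.fourierY_eq_zero j hx, mul_zero]
    exact hi.norm.congr (Eventually.of_forall fun v => by simp)
  have h2 : fourierXY f j = fun ξ => FourierTransform.fourier (fourierY f j) (ξ / (2 * Real.pi)) := by
    ext ξ
    rw [Real.fourier_real_eq_integral_exp_smul, fourierXY]
    congr 1
    ext x
    rw [smul_eq_mul]
    congr 2
    have : (Real.pi : ℂ) ≠ 0 := by exact_mod_cast Real.pi_ne_zero
    push_cast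
    field_simp
  rw [h2]
  exact h1.comp (contDiff_id.div_const _)

/-- The variable `s = k²` is used because `k₀² = 1 - 2β - μ²` is polynomial in the parameters. The
transform is real on the real line, so its real part inherits the nonzero derivative. -/
lemma exists_strictDeriv_re (hf : IsProfile f ρ) {s₀ : ℝ} (hs₀ : 0 < s₀)
    (hd : deriv (fourierXY f 1) (Real.sqrt s₀) ≠ 0) :
    ∃ q : ℝ, q ≠ 0 ∧ HasStrictDerivAt (fun s => (fourierXY f 1 (Real.sqrt s)).re) q s₀ := by
  have h1 : HasStrictDerivAt (fourierXY f 1) (deriv (fourierXY f 1) (Real.sqrt s₀)) (Real.sqrt s₀) :=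
    (hf.contDiff_fourierXY 1).contDiffAt.hasStrictDerivAt (by simp)
  have h2 : HasStrictDerivAt Real.sqrt (1 / (2 * Real.sqrt s₀)) s₀ :=
    Real.hasStrictDerivAt_sqrt hs₀.ne'
  have h3 : HasStrictDerivAt (fun s => (fourierXY f 1 s).re)
      (deriv (fourierXY f 1) (Real.sqrt s₀)).re (Real.sqrt s₀) :=
    Complex.reCLM.hasStrictFDerivAt.comp_hasStrictDerivAt _ h1
  have h4 : HasStrictDerivAt (fun s => (fourierXY f 1 s).im)
      (deriv (fourierXY f 1) (Real.sqrt s₀)).im (Real.sqrt s₀) :=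
    Complex.imCLM.hasStrictFDerivAt.comp_hasStrictDerivAt _ h1
  have h5 : (fun s => (fourierXY f 1 s).im) = fun _ => 0 :=
    funext fun s => Complex.conj_eq_iff_im.mp (hf.conj_fourierXY 1 s)
  rw [h5] at h4
  have h6 : (deriv (fourierXY f 1) (Real.sqrt s₀)).im = 0 :=
    h4.hasDerivAt.unique (hasDerivAt_const _ _)
  refine ⟨_, ?_, h3.comp s₀ h2⟩
  refine mul_ne_zero (fun h => hd (Complex.ext h h6)) ?_
  have := Real.sqrt_pos.mpr hs₀
  positivity

end IsProfile
/-! ### Lipschitz dependence of `R` and `F` on the parameters -/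

section

variable {ρ : ℝ}

lemma norm_cosInt_le (k : ℝ) (u : C(Icc (-ρ) ρ, ℂ)) : ‖cosInt k (extZero u)‖ ≤ 2 * |ρ| * ‖u‖ := by
  refine norm_integral_le_of_Icc (fun x _ => ?_)
    (fun x hx => by rw [extZero_of_notMem u hx, mul_zero]) (norm_nonneg _)
  rw [norm_mul, Complex.norm_real, Real.norm_eq_abs]
  calc _ ≤ 1 * ‖u‖ := by
        gcongr
        · exact Real.abs_cos_le_one _
        · exact norm_extZero_le u x
    _ = _ := one_mul _

lemma norm_cosInt_sub_le (hρ : 0 < ρ) (k k' : ℝ) (u u' : C(Icc (-ρ) ρ, ℂ)) :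
    ‖cosInt k (extZero u) - cosInt k' (extZero u')‖ ≤
      2 * |ρ| * (‖u - u'‖ + ρ * |k - k'| * ‖u'‖) := by
  have i1 : ∀ k (u : C(Icc (-ρ) ρ, ℂ)), Integrable fun x : ℝ => (Real.cos (k * x) : ℂ) * extZero u x :=
    fun k u => integrable_mul_extZero (by fun_prop) u
  unfold cosInt
  rw [← integral_sub (i1 k u) (i1 k' u')]
  refine norm_integral_le_of_Icc (fun x hx => ?_)
    (fun x hx => by simp [extZero_of_notMem _ hx]) (by positivity)
  have e : (Real.cos (k * x) : ℂ) * extZero u x - (Real.cos (k' * x) : ℂ) * extZero u' x =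
      (Real.cos (k * x) : ℂ) * extZero (u - u') x +
        ((Real.cos (k * x) - Real.cos (k' * x) : ℝ) : ℂ) * extZero u' x := by
    rw [extZero_sub]; push_cast; ring
  rw [e]
  refine (norm_add_le _ _).trans ?_
  rw [norm_mul, norm_mul, Complex.norm_real, Complex.norm_real, Real.norm_eq_abs, Real.norm_eq_abs]
  have h1 := Real.abs_cos_le_one (k * x)
  have h2 := Real.abs_cos_sub_cos_le (k * x) (k' * x)
  rw [← sub_mul, abs_mul, mul_comm |k - k'|] at h2
  have hx' : |x| ≤ ρ := abs_le.mpr hx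
  have h3 : |Real.cos (k * x) - Real.cos (k' * x)| ≤ ρ * |k - k'| := h2.trans (by gcongr)
  have h4 := norm_extZero_le (u - u') x
  have h5 := norm_extZero_le u' x
  calc _ ≤ 1 * ‖u - u'‖ + ρ * |k - k'| * ‖u'‖ := by gcongr
    _ = _ := by rw [one_mul]

lemma norm_vec_apply_le (a : Vec ρ) (n : ℤ) : ‖a n‖ ≤ ‖a‖ :=
  lp.norm_apply_le_norm (by norm_num) a n

lemma norm_vec_sub_apply_le (a b : Vec ρ) (n : ℤ) : ‖a n - b n‖ ≤ ‖a - b‖ :=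
  norm_vec_apply_le (a - b) n

end

namespace IsProfile

variable {f : ℝ × ℝ → ℝ} {ρ b d ε ε' μ μ' β β' : ℝ}

lemma norm_zCoef_le (h : GoodParam b d μ β) : ‖zCoef ε μ β‖ ≤ 2 * |ε| := by
  rw [zCoef, Complex.norm_real, norm_mul, norm_mul, Real.norm_of_nonneg h.gam_pos.le,
    Real.norm_eq_abs, Real.norm_eq_abs, abs_two]
  have := h.gam_le
  have := abs_nonneg ε
  nlinarith

lemma norm_zCoef_sub_le (h : GoodParam b d μ β) (h' : GoodParam b d μ' β') :
    ‖zCoef ε μ β - zCoef ε' μ' β'‖ ≤ 2 * |ε - ε'| + 2 * |ε'| * (|μ - μ'| + |β - β'|) := by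
  rw [zCoef, zCoef, ← Complex.ofReal_sub, Complex.norm_real, Real.norm_eq_abs]
  have e : 2 * gam μ β * ε - 2 * gam μ' β' * ε' =
      2 * (gam μ β * (ε - ε')) + 2 * ((gam μ β - gam μ' β') * ε') := by ring
  rw [e]
  refine (abs_add_le _ _).trans ?_
  rw [abs_mul, abs_mul, abs_mul, abs_mul, abs_two, abs_of_pos h.gam_pos]
  have h1 := h.gam_le
  have h2 := h.abs_gam_sub_le h'
  have h3 := mul_le_mul_of_nonneg_right h1 (abs_nonneg (ε - ε'))
  have h4 := mul_le_mul_of_nonneg_right h2 (abs_nonneg ε')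
  nlinarith

lemma kerBound_nonneg (b d : ℝ) {ρ : ℝ} (hρ : 0 < ρ) : 0 ≤ kerBound b d ρ := by
  unfold kerBound; positivity

lemma kerLip_nonneg (b d : ℝ) {ρ : ℝ} (hρ : 0 < ρ) : 0 ≤ kerLip b d ρ := by
  unfold kerLip; positivity

lemma exists_small (hf : IsProfile f ρ) (b d : ℝ) : ∃ e : ℝ, 0 < e ∧ e ≤ 1 ∧
    ∀ ε μ β : ℝ, |ε| ≤ e → GoodParam b d μ β → hf.Small (kerBound b d ρ) (zCoef ε μ β) := by
  have hρ := hf.pos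
  have hB := kerBound_nonneg b d hρ
  set κ := ‖hf.mulVec‖ * (2 * |ρ| * kerBound b d ρ) with hκ
  have hκ0 : 0 ≤ κ := by positivity
  -- Since `‖z‖ ≤ 2|ε|`, this choice gives `‖z‖ κ ≤ 1/2`.
  refine ⟨1 / (4 * (κ + 1)), by positivity, ?_, fun ε μ β hε h => ?_⟩
  · rw [div_le_one (by positivity)]; linarith
  · unfold Small
    rw [← hκ]
    have h1 := norm_zCoef_le (ε := ε) h
    rw [le_div_iff₀ (by positivity)] at hε
    have h2 : ‖zCoef ε μ β‖ * κ ≤ 2 * |ε| * κ := by gcongr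
    nlinarith [abs_nonneg ε]

/-- `M K a` for the real kernels and the solution `a`. -/
lemma realSol_eq (hf : IsProfile f ρ) (h : GoodParam b d μ β)
    (hz : hf.Small (kerBound b d ρ) (zCoef ε μ β)) :
    hf.realSol ε μ β - zCoef ε μ β •
      hf.mulVec (convVec (kernelBound_greenReal h hf.pos) (hf.realSol ε μ β)) =
      hf.mulVec (unitMinus ρ) :=
  (hf.solvesKernel_iff _).mp (hf.realSol_spec h hz)

/-- A Lipschitz constant for the solution. -/
def solLip (hf : IsProfile f ρ) (b d : ℝ) : ℝ :=
  2 * (2 * (‖hf.mulVec‖ * (2 * |ρ| * kerBound b d ρ)) +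
    2 * (‖hf.mulVec‖ * (2 * |ρ| * kerLip b d ρ))) * (2 * ‖hf.mulVec (unitMinus ρ)‖)

lemma solLip_nonneg (hf : IsProfile f ρ) (b d : ℝ) : 0 ≤ hf.solLip b d := by
  have := kerBound_nonneg b d hf.pos
  have := kerLip_nonneg b d hf.pos
  unfold solLip
  positivity

lemma norm_convVec_sub_le (hf : IsProfile f ρ) (h : GoodParam b d μ β) (h' : GoodParam b d μ' β') :
    ‖convVec (kernelBound_greenReal h hf.pos) - convVec (kernelBound_greenReal h' hf.pos)‖ ≤
      2 * |ρ| * (kerLip b d ρ * (|μ - μ'| + |β - β'|)) := by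
  rw [convVec_sub _ _ (kernelBound_greenReal_sub h h' hf.pos)]
  exact norm_convVec_le _

lemma norm_realSol_le (hf : IsProfile f ρ) (h : GoodParam b d μ β)
    (hz : hf.Small (kerBound b d ρ) (zCoef ε μ β)) :
    ‖hf.realSol ε μ β‖ ≤ 2 * ‖hf.mulVec (unitMinus ρ)‖ :=
  hf.norm_le_of_solvesKernel (kernelBound_greenReal h hf.pos) hz (hf.realSol_spec h hz)

lemma norm_realSol_sub_le (hf : IsProfile f ρ) (h : GoodParam b d μ β) (h' : GoodParam b d μ' β')
    (hz : hf.Small (kerBound b d ρ) (zCoef ε μ β))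
    (hz' : hf.Small (kerBound b d ρ) (zCoef ε' μ' β')) (hε' : |ε'| ≤ 1) :
    ‖hf.realSol ε μ β - hf.realSol ε' μ' β'‖ ≤
      hf.solLip b d * (|ε - ε'| + (|μ - μ'| + |β - β'|)) := by
  have h1 := norm_sub_le_of_sub_smul_eq (norm_convVec_le (kernelBound_greenReal h hf.pos))
    (norm_convVec_le (kernelBound_greenReal h' hf.pos)) hz' (hf.norm_convVec_sub_le h h')
    (hf.realSol_eq h hz) (hf.realSol_eq h' hz')
  refine h1.trans ?_
  have hs := hf.norm_realSol_le h hz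
  have hB := kerBound_nonneg b d hf.pos
  have hL := kerLip_nonneg b d hf.pos
  set δ := |μ - μ'| + |β - β'| with hδ
  have hδ0 : 0 ≤ δ := by positivity
  have b1 : ‖zCoef ε μ β - zCoef ε' μ' β'‖ ≤ 2 * (|ε - ε'| + δ) := by
    refine (norm_zCoef_sub_le h h').trans ?_
    rw [← hδ]
    nlinarith
  have b2 : ‖zCoef ε' μ' β'‖ ≤ 2 := (norm_zCoef_le h').trans (by linarith)
  have hη : δ ≤ |ε - ε'| + δ := by linarith [abs_nonneg (ε - ε')]
  calc _ ≤ 2 * (2 * (|ε - ε'| + δ) * (‖hf.mulVec‖ * (2 * |ρ| * kerBound b d ρ)) +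
        2 * (‖hf.mulVec‖ * (2 * |ρ| * (kerLip b d ρ * (|ε - ε'| + δ))))) *
        (2 * ‖hf.mulVec (unitMinus ρ)‖) := by gcongr
    _ = _ := by unfold solLip; ring

lemma abs_realF_sub_le (hf : IsProfile f ρ) (h : GoodParam b d μ β) (h' : GoodParam b d μ' β')
    (hz : hf.Small (kerBound b d ρ) (zCoef ε μ β))
    (hz' : hf.Small (kerBound b d ρ) (zCoef ε' μ' β')) (hε' : |ε'| ≤ 1) :
    |hf.realF ε μ β - hf.realF ε' μ' β'| ≤
      2 * |ρ| * hf.solLip b d * (|ε - ε'| + (|μ - μ'| + |β - β'|)) := by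
  unfold realF
  rw [← Complex.sub_re]
  refine (Complex.abs_re_le_norm _).trans ?_
  have e : (∫ x : ℝ, vecFn (hf.realSol ε μ β) (-1) x) - ∫ x : ℝ, vecFn (hf.realSol ε' μ' β') (-1) x =
      intIcc ρ (hf.realSol ε μ β (-1) - hf.realSol ε' μ' β' (-1)) := by
    rw [map_sub]; rfl
  rw [e, mul_assoc]
  refine (norm_intIcc_apply_le _).trans ?_
  gcongr
  exact (norm_vec_sub_apply_le _ _ _).trans (hf.norm_realSol_sub_le h h' hz hz' hε')

lemma abs_realR_sub_le (hf : IsProfile f ρ) (h : GoodParam b d μ β) (h' : GoodParam b d μ' β')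
    (hz : hf.Small (kerBound b d ρ) (zCoef ε μ β))
    (hz' : hf.Small (kerBound b d ρ) (zCoef ε' μ' β')) (hε' : |ε'| ≤ 1) :
    |hf.realR ε μ β - hf.realR ε' μ' β'| ≤
      2 * |ρ| * (hf.solLip b d + ρ * (1 / Real.sqrt d) * (2 * ‖hf.mulVec (unitMinus ρ)‖)) *
        (|ε - ε'| + (|μ - μ'| + |β - β'|)) := by
  unfold realR
  rw [← Complex.sub_re]
  refine (Complex.abs_re_le_norm _).trans ((norm_cosInt_sub_le hf.pos _ _ _ _).trans ?_)
  have hρ := hf.pos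
  have h1 := (norm_vec_sub_apply_le _ _ 0).trans (hf.norm_realSol_sub_le h h' hz hz' hε')
  have h2 := h.abs_kProp_sub_le h'
  have h3 := (norm_vec_apply_le _ 0).trans (hf.norm_realSol_le h' hz')
  have h4 : |μ - μ'| + |β - β'| ≤ |ε - ε'| + (|μ - μ'| + |β - β'|) := by
    linarith [abs_nonneg (ε - ε')]
  rw [mul_assoc (2 * |ρ|) (hf.solLip b d + _)]
  refine mul_le_mul_of_nonneg_left ?_ (by positivity)
  rw [add_mul]
  refine add_le_add h1 ?_
  calc _ ≤ ρ * (1 / Real.sqrt d * (|ε - ε'| + (|μ - μ'| + |β - β'|))) *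
        (2 * ‖hf.mulVec (unitMinus ρ)‖) := by gcongr; exact h2.trans (by gcongr)
    _ = _ := by ring

/-- Separates the value `f̃₁(k₀)` of the unperturbed problem from a remainder carrying the factor
`ε`. -/
lemma realR_eq (hf : IsProfile f ρ) (h : GoodParam b d μ β)
    (hz : hf.Small (kerBound b d ρ) (zCoef ε μ β)) :
    hf.realR ε μ β = (fourierXY f 1 (kProp μ β)).re + (zCoef ε μ β * cosInt (kProp μ β)
      (extZero (hf.mulVec (convVec (kernelBound_greenReal h hf.pos) (hf.realSol ε μ β)) 0))).re := by
  have e := sub_eq_iff_eq_add.mp (hf.realSol_eq h hz)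
  set w := hf.mulVec (convVec (kernelBound_greenReal h hf.pos) (hf.realSol ε μ β))
  have e2 : ∀ x, vecFn (hf.realSol ε μ β) 0 x = fourierY f 1 x + zCoef ε μ β * extZero (w 0) x := by
    intro x
    rw [e, vecFn_add, vecFn_smul, hf.vecFn_mulVec_unitMinus]
    rfl
  rw [realR, hf.fourierXY_eq_cosInt, ← Complex.add_re]
  congr 1
  unfold cosInt
  simp_rw [e2, mul_add]
  rw [integral_add, ← integral_const_mul]
  · congr 2
    ext x
    ring
  · simpa only [hf.extZero_coeff] using integrable_mul_extZero (by fun_prop) (hf.coeff 1)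
  · refine ((integrable_mul_extZero (h := fun x : ℝ => (Real.cos (kProp μ β * x) : ℂ))
      (by fun_prop) (w 0)).const_mul (zCoef ε μ β)).congr (Eventually.of_forall fun x => ?_)
    simp only
    ring

/-- It matters that the constant is `O(ε)` and not merely bounded: only then does the correction
leave the monotonicity in `β` inherited from `f̃₁` intact. -/
lemma exists_realR_correction_lipschitz (hf : IsProfile f ρ) (b d : ℝ) : ∃ L : ℝ, 0 ≤ L ∧
    ∀ ε μ μ' β β' : ℝ, GoodParam b d μ β → GoodParam b d μ' β' →
      hf.Small (kerBound b d ρ) (zCoef ε μ β) → hf.Small (kerBound b d ρ) (zCoef ε μ' β') →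
      |ε| ≤ 1 →
      |(hf.realR ε μ β - (fourierXY f 1 (kProp μ β)).re) -
        (hf.realR ε μ' β' - (fourierXY f 1 (kProp μ' β')).re)| ≤
        L * |ε| * (|μ - μ'| + |β - β'|) := by
  have hρ := hf.pos
  have hB := kerBound_nonneg b d hρ
  have hL := kerLip_nonneg b d hρ
  have hS := hf.solLip_nonneg b d
  set κ := 2 * |ρ| * kerBound b d ρ with hκ
  set l := 2 * |ρ| * kerLip b d ρ with hl
  set N := 2 * ‖hf.mulVec (unitMinus ρ)‖ with hN
  set M := ‖hf.mulVec‖ with hM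
  set W := M * (κ * N) with hW
  set D := M * (l * N + κ * hf.solLip b d) with hD
  have hκ0 : 0 ≤ κ := by positivity
  have hl0 : 0 ≤ l := by positivity
  refine ⟨2 * (2 * |ρ| * W) + 2 * (2 * |ρ| * (D + ρ * (1 / Real.sqrt d) * W)), by positivity,
    fun ε μ μ' β β' h h' hz hz' hε => ?_⟩
  set δ := |μ - μ'| + |β - β'| with hδ
  have hδ0 : 0 ≤ δ := by positivity
  rw [hf.realR_eq h hz, hf.realR_eq h' hz', add_sub_cancel_left, add_sub_cancel_left,
    ← Complex.sub_re]
  refine (Complex.abs_re_le_norm _).trans ?_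
  set a := hf.realSol ε μ β
  set a' := hf.realSol ε μ' β'
  set w := hf.mulVec (convVec (kernelBound_greenReal h hf.pos) a) with hw
  set w' := hf.mulVec (convVec (kernelBound_greenReal h' hf.pos) a') with hw'
  set z := zCoef ε μ β
  set z' := zCoef ε μ' β'
  have bz : ‖z - z'‖ ≤ 2 * |ε| * δ := by
    have := norm_zCoef_sub_le (ε := ε) (ε' := ε) h h'
    simpa using this
  have bz' : ‖z'‖ ≤ 2 * |ε| := norm_zCoef_le h'
  have ba := hf.norm_realSol_le h hz
  have ba' := hf.norm_realSol_le h' hz'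
  have bw : ∀ {μ β : ℝ} (h : GoodParam b d μ β) (a : Vec ρ), ‖a‖ ≤ N →
      ‖hf.mulVec (convVec (kernelBound_greenReal h hf.pos) a)‖ ≤ W := by
    intro μ β h a ha
    exact (hf.mulVec.le_opNorm_of_le ((convVec _).le_of_opNorm_le_of_le
      (norm_convVec_le (kernelBound_greenReal h hf.pos)) ha))
  have baa : ‖a - a'‖ ≤ hf.solLip b d * δ := by
    have := hf.norm_realSol_sub_le h h' hz hz' hε
    simpa using this
  have bww : ‖w - w'‖ ≤ D * δ := by
    have := norm_map_sub_map_le (M := hf.mulVec)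
      (norm_convVec_le (kernelBound_greenReal h' hf.pos)) (hf.norm_convVec_sub_le h h') baa
    refine this.trans ?_
    calc _ ≤ M * (2 * |ρ| * (kerLip b d ρ * δ) * N + κ * (hf.solLip b d * δ)) := by gcongr
      _ = _ := by rw [hD, hl]; ring
  have bc : ‖cosInt (kProp μ β) (extZero (w 0))‖ ≤ 2 * |ρ| * W :=
    (norm_cosInt_le _ _).trans (by gcongr; exact (norm_vec_apply_le _ _).trans (bw h a ba))
  have bcc : ‖cosInt (kProp μ β) (extZero (w 0)) - cosInt (kProp μ' β') (extZero (w' 0))‖ ≤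
      2 * |ρ| * (D + ρ * (1 / Real.sqrt d) * W) * δ := by
    refine (norm_cosInt_sub_le hρ _ _ _ _).trans ?_
    have c1 := (norm_vec_sub_apply_le w w' 0).trans bww
    have c2 := h.abs_kProp_sub_le h'
    have c3 := (norm_vec_apply_le w' 0).trans (bw h' a' ba')
    rw [mul_assoc (2 * |ρ|)]
    gcongr
    rw [add_mul]
    refine add_le_add c1 ?_
    calc _ ≤ ρ * (1 / Real.sqrt d * δ) * W := by gcongr
      _ = _ := by ring
  have e : z * cosInt (kProp μ β) (extZero (w 0)) - z' * cosInt (kProp μ' β') (extZero (w' 0)) =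
      (z - z') * cosInt (kProp μ β) (extZero (w 0)) +
      z' * (cosInt (kProp μ β) (extZero (w 0)) - cosInt (kProp μ' β') (extZero (w' 0))) := by ring
  rw [e]
  refine (norm_add_le _ _).trans ?_
  rw [norm_mul, norm_mul]
  calc _ ≤ 2 * |ε| * δ * (2 * |ρ| * W) +
        2 * |ε| * (2 * |ρ| * (D + ρ * (1 / Real.sqrt d) * W) * δ) := by gcongr
    _ = _ := by ring

lemma realSol_zero (hf : IsProfile f ρ) (h : GoodParam b d μ β)
    (hz : hf.Small (kerBound b d ρ) (zCoef 0 μ β)) :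
    hf.realSol 0 μ β = hf.mulVec (unitMinus ρ) := by
  have := hf.realSol_eq h hz
  have h0 : zCoef 0 μ β = 0 := by simp [zCoef]
  rwa [h0, zero_smul, sub_zero] at this

lemma realF_zero (hf : IsProfile f ρ) (h : GoodParam b d μ β)
    (hz : hf.Small (kerBound b d ρ) (zCoef 0 μ β)) :
    hf.realF 0 μ β = ∫ x : ℝ, ∫ y in (0 : ℝ)..(2 * Real.pi), f (x, y) := by
  rw [realF, hf.realSol_zero h hz, hf.vecFn_mulVec_unitMinus]
  have : ∀ x, vecG2 f (-1) x = ((∫ y in (0 : ℝ)..(2 * Real.pi), f (x, y) : ℝ) : ℂ) := by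
    intro x
    rw [vecG2, fourierY, ← intervalIntegral.integral_ofReal]
    simp
  simp_rw [this]
  rw [integral_complex_ofReal, Complex.ofReal_re]

end IsProfile
/-! ### The curve and the trapped value -/

namespace IsProfile

variable {f : ℝ × ℝ → ℝ} {ρ : ℝ}

/-- Near the simple zero of `f̃₁` the real function is strictly monotone in `β`, so
`exists_lipschitz_curve` applies after a choice of sign. The trapped value comes from
`exists_fixed_value` applied to `γF` along the curve, whose value at the origin is positive because
`∫∫ f` is. -/
theorem exists_curve (hf : IsProfile f ρ)
    (hpos : 0 < ∫ x : ℝ, ∫ y in (0 : ℝ)..(2 * Real.pi), f (x, y))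
    {β00 : ℝ} (hβ0 : 0 < β00) (hβ1 : β00 < 1 / 2)
    (hroot : fourierXY f 1 (Real.sqrt (1 - 2 * β00)) = 0)
    (hsimple : deriv (fourierXY f 1) (Real.sqrt (1 - 2 * β00)) ≠ 0) :
    ∃ (β₀ : ℝ → ℝ → ℝ) (νtr : ℝ → ℝ) (ε₀ μ₀ η b d : ℝ), 0 < ε₀ ∧ 0 < μ₀ ∧ 0 < η ∧
      (∀ ε μ β : ℝ, |ε| < ε₀ → |μ| < μ₀ → |β - β00| < η →
        GoodParam b d μ β ∧ hf.Small (kerBound b d ρ) (zCoef ε μ β)) ∧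
      IsCurve f ρ β00 ε₀ μ₀ η β₀ ∧ IsTrappedValue f ρ β00 ε₀ μ₀ β₀ νtr := by
  set s₀ := 1 - 2 * β00 with hs₀
  have hs₀pos : 0 < s₀ := by rw [hs₀]; linarith
  obtain ⟨q, hq, hqd⟩ := hf.exists_strictDeriv_re hs₀pos hsimple
  set φ : ℝ → ℝ := fun s => (fourierXY f 1 (Real.sqrt s)).re with hφ
  -- quantitative form of the strict differentiability
  have hstrict : ∃ r > 0, ∀ s s' : ℝ, |s - s₀| < r → |s' - s₀| < r →
      |φ s - φ s' - (s - s') * q| ≤ |q| / 2 * |s - s'| := by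
    have h1 := hqd.isLittleO
    -- Strict differentiability with half the slope as tolerance.
    have h2 := h1.def (c := |q| / 2) (by positivity)
    rw [Metric.eventually_nhds_iff] at h2
    obtain ⟨r, hr, h3⟩ := h2
    refine ⟨r, hr, fun s s' hs hs' => ?_⟩
    have := @h3 (s, s') (by
      rw [Prod.dist_eq, max_lt_iff]
      exact ⟨hs, hs'⟩)
    simpa [mul_comm] using this
  obtain ⟨r, hr, hstrict⟩ := hstrict
  set b := β00 / 2 with hb
  set d := s₀ / 2 with hd
  obtain ⟨e₁, he₁, he₁1, hsmall⟩ := hf.exists_small b d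
  obtain ⟨L₂, hL₂, hcorr⟩ := hf.exists_realR_correction_lipschitz b d
  -- The three entries keep `β ≥ b`, keep the gap `1 - 2β - μ²` above `d = s₀/2`, and keep it within
  -- `r` of `s₀`; in the last two cases `2η + m` is what has to be small.
  set η := min (β00 / 2) (min (s₀ / 8) (r / 8)) with hη
  set m := min 1 (min (s₀ / 8) (r / 4)) with hm
  -- The second entry ensures `L₂ ε ≤ |q|/2`.
  set e := min e₁ (|q| / (2 * (L₂ + 1))) with he
  have hq0 : 0 < |q| := abs_pos.mpr hq
  have hη0 : 0 < η := by positivity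
  have hm0 : 0 < m := by positivity
  have he0 : 0 < e := by positivity
  have η1 : η ≤ β00 / 2 := min_le_left _ _
  have η2 : η ≤ s₀ / 8 := (min_le_right _ _).trans (min_le_left _ _)
  have η3 : η ≤ r / 8 := (min_le_right _ _).trans (min_le_right _ _)
  have m1 : m ≤ 1 := min_le_left _ _
  have m2 : m ≤ s₀ / 8 := (min_le_right _ _).trans (min_le_left _ _)
  have m3 : m ≤ r / 4 := (min_le_right _ _).trans (min_le_right _ _)
  have e1 : e ≤ e₁ := min_le_left _ _
  have e2 : e * (2 * (L₂ + 1)) ≤ |q| := by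
    rw [← le_div_iff₀ (by positivity)]; exact min_le_right _ _
  have hsq : ∀ μ : ℝ, |μ| ≤ m → μ ^ 2 ≤ m := fun μ hμ => by
    rw [← sq_abs]
    nlinarith [abs_nonneg μ]
  have hgood : ∀ μ β : ℝ, |μ| ≤ m → |β - β00| ≤ η → GoodParam b d μ β := by
    intro μ β hμ hβ
    have h1 := abs_le.mp hβ
    have h2 := hsq μ hμ
    exact ⟨by positivity, by positivity, by linarith, by linarith, hμ.trans m1⟩
  have hnear : ∀ μ β : ℝ, |μ| ≤ m → |β - β00| ≤ η → |1 - 2 * β - μ ^ 2 - s₀| < r := by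
    intro μ β hμ hβ
    have h1 := abs_le.mp hβ
    have h2 := hsq μ hμ
    have h3 := sq_nonneg μ
    rw [abs_lt]
    constructor <;> linarith
  have hSm : ∀ ε μ β : ℝ, |ε| ≤ e → |μ| ≤ m → |β - β00| ≤ η →
      hf.Small (kerBound b d ρ) (zCoef ε μ β) :=
    fun ε μ β h1 h2 h3 => hsmall ε μ β (h1.trans e1) (hgood μ β h2 h3)
  -- The argument `s = 1 - 2β - μ²` decreases in `β`, so the sign of `-q` is what makes `σ R`
  -- increasing.
  set σ : ℝ := -(q / |q|) with hσ
  have hσ1 : |σ| = 1 := by rw [hσ, abs_neg, abs_div, abs_abs, div_self hq0.ne']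
  have hσ0 : σ ≠ 0 := by
    intro h
    rw [h, abs_zero] at hσ1
    exact zero_ne_one hσ1
  have hσq : σ * q = -|q| := by
    rw [hσ, neg_mul, div_mul_eq_mul_div, ← abs_mul_abs_self q, mul_div_assoc, div_self hq0.ne', mul_one]
  set L₁ := 2 * |ρ| * (hf.solLip b d + ρ * (1 / Real.sqrt d) * (2 * ‖hf.mulVec (unitMinus ρ)‖))
    with hL₁
  have hL₁0 : 0 ≤ L₁ := by
    have := hf.solLip_nonneg b d
    have := hf.pos
    positivity
  have hLip : ∀ ε ε' μ μ' β β' : ℝ, |ε| ≤ e → |ε'| ≤ e → |μ| ≤ m → |μ'| ≤ m → |β - β00| ≤ η →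
      |β' - β00| ≤ η → |σ * hf.realR ε μ β - σ * hf.realR ε' μ' β'| ≤
        L₁ * (|ε - ε'| + (|μ - μ'| + |β - β'|)) := by
    intro ε ε' μ μ' β β' h1 h2 h3 h4 h5 h6
    rw [← mul_sub, abs_mul, hσ1, one_mul]
    exact hf.abs_realR_sub_le (hgood μ β h3 h5) (hgood μ' β' h4 h6) (hSm ε μ β h1 h3 h5)
      (hSm ε' μ' β' h2 h4 h6) ((h2.trans e1).trans he₁1)
  have hmono : ∀ ε μ β β' : ℝ, |ε| ≤ e → |μ| ≤ m → |β - β00| ≤ η → |β' - β00| ≤ η → β ≤ β' →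
      |q| / 2 * (β' - β) ≤ σ * hf.realR ε μ β' - σ * hf.realR ε μ β := by
    intro ε μ β β' h1 h2 h3 h4 hle
    have hc := hcorr ε μ μ β' β (hgood μ β' h2 h4) (hgood μ β h2 h3) (hSm ε μ β' h1 h2 h4)
      (hSm ε μ β h1 h2 h3) ((h1.trans e1).trans he₁1)
    rw [sub_self, abs_zero, zero_add, abs_of_nonneg (sub_nonneg.mpr hle)] at hc
    have hs := hstrict _ _ (hnear μ β' h2 h4) (hnear μ β h2 h3)
    have hds : 1 - 2 * β' - μ ^ 2 - (1 - 2 * β - μ ^ 2) = -(2 * (β' - β)) := by ring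
    rw [hds, abs_neg, abs_of_nonneg (a := 2 * (β' - β)) (by linarith)] at hs
    rw [GoodParam.kProp_eq, GoodParam.kProp_eq] at hc
    set A := hf.realR ε μ β' - φ (1 - 2 * β' - μ ^ 2) -
      (hf.realR ε μ β - φ (1 - 2 * β - μ ^ 2)) with hA
    set D := φ (1 - 2 * β' - μ ^ 2) - φ (1 - 2 * β - μ ^ 2) - -(2 * (β' - β)) * q with hD
    -- The slope is at least `2|q| - |q| - |q|/2 = |q|/2`: the main term, minus the error of
    -- linearisation, minus the correction of order `ε`.
    have hAD : σ * hf.realR ε μ β' - σ * hf.realR ε μ β = σ * A + σ * D + 2 * (β' - β) * |q| := by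
      have : 2 * (β' - β) * |q| = σ * (-(2 * (β' - β)) * q) := by
        linear_combination (2 * (β' - β)) * hσq
      rw [this, hA, hD]
      ring
    have hσA : -(L₂ * |ε| * (β' - β)) ≤ σ * A := by
      have : |σ * A| ≤ L₂ * |ε| * (β' - β) := by rw [abs_mul, hσ1, one_mul]; exact hc
      exact (abs_le.mp this).1
    have hσD : -(|q| / 2 * (2 * (β' - β))) ≤ σ * D := by
      have : |σ * D| ≤ |q| / 2 * (2 * (β' - β)) := by rw [abs_mul, hσ1, one_mul]; exact hs
      exact (abs_le.mp this).1
    have hε : L₂ * |ε| * (β' - β) ≤ |q| / 2 * (β' - β) := by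
      have : L₂ * |ε| ≤ |q| / 2 := by
        have : L₂ * |ε| ≤ (L₂ + 1) * e := by gcongr; linarith
        linarith
      exact mul_le_mul_of_nonneg_right this (sub_nonneg.mpr hle)
    rw [hAD]
    linarith
  have hz0 : |(0 : ℝ)| ≤ m := by simpa using hm0.le
  have hze : |(0 : ℝ)| ≤ e := by simpa using he0.le
  have hzb : |β00 - β00| ≤ η := by simpa using hη0.le
  have h0 : σ * hf.realR 0 0 β00 = 0 := by
    have : hf.realR 0 0 β00 = 0 := by
      rw [hf.realR_eq (hgood 0 β00 hz0 hzb) (hSm 0 0 β00 hze hz0 hzb), GoodParam.kProp_eq]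
      have hzz : zCoef 0 0 β00 = 0 := by simp [zCoef]
      rw [hzz, zero_mul]
      norm_num
      rw [hroot, Complex.zero_re]
    rw [this, mul_zero]
  obtain ⟨ε₀, μ₀, β₀, hε₀, hε₀e, hμ₀, hμ₀m, hb0, hcurve, hβLip⟩ :=
    exists_lipschitz_curve (S := fun ε μ β => σ * hf.realR ε μ β) he0 hm0 hη0 hL₁0
      (half_pos hq0) hLip hmono h0
  have hbox : ∀ ε μ β : ℝ, |ε| < ε₀ → |μ| < μ₀ → |β - β00| < η →
        GoodParam b d μ β ∧ hf.Small (kerBound b d ρ) (zCoef ε μ β) := fun ε μ β h1 h2 h3 =>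
    ⟨hgood μ β (h2.le.trans hμ₀m) h3.le, hSm ε μ β (h1.le.trans hε₀e) (h2.le.trans hμ₀m) h3.le⟩
  have hon : ∀ ε μ : ℝ, |ε| < ε₀ → |μ| < μ₀ → hf.realR ε μ (β₀ ε μ) = 0 := by
    intro ε μ h1 h2
    have h3 := hcurve ε μ h1 h2
    exact (mul_eq_zero.mp ((h3.2 _ h3.1).mpr rfl)).resolve_left hσ0
  -- the function whose fixed point is the trapped value
  set Lβ := L₁ / (|q| / 2) with hLβ
  have hLβ0 : 0 ≤ Lβ := by positivity
  set LF := 2 * |ρ| * hf.solLip b d with hLF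
  have hLF0 : 0 ≤ LF := by
    have := hf.solLip_nonneg b d
    positivity
  set MF := 2 * |ρ| * (2 * ‖hf.mulVec (unitMinus ρ)‖) with hMF
  have hMF0 : 0 ≤ MF := by positivity
  -- The Lipschitz constant is the product rule for `γF`, with `γ ≤ 1` and `|F| ≤ MF`, composed with
  -- the curve, whose own constant is `Lβ`.
  obtain ⟨ε₁, νtr, hε₁, hε₁0, hlim, htr⟩ := exists_fixed_value
    (G := fun ε μ => gam μ (β₀ ε μ) * hf.realF ε μ (β₀ ε μ)) (L := (MF + LF) * (1 + Lβ))
    (ν₀ := (1 - β00) ^ 2 / (4 * Real.pi) *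
      ∫ x : ℝ, ∫ y in (0 : ℝ)..(2 * Real.pi), f (x, y))
    hε₀ hμ₀ (by positivity) (by
      have : 0 < 1 - β00 := by linarith
      have := Real.pi_pos
      positivity) (by
      intro ε ε' μ μ' h1 h2 h3 h4
      have k1 := (hcurve ε μ h1 h3).1
      have k2 := (hcurve ε' μ' h2 h4).1
      obtain ⟨g1, s1⟩ := hbox ε μ _ h1 h3 k1
      obtain ⟨g2, s2⟩ := hbox ε' μ' _ h2 h4 k2
      have hβ := hβLip ε ε' μ μ' h1 h2 h3 h4
      have hF := hf.abs_realF_sub_le g1 g2 s1 s2 ((h2.le.trans hε₀e).trans (e1.trans he₁1))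
      have hG := g1.abs_gam_sub_le g2
      have hF1 : |hf.realF ε μ (β₀ ε μ)| ≤ MF := by
        refine (Complex.abs_re_le_norm _).trans ((norm_intIcc_apply_le _).trans ?_)
        rw [hMF]
        gcongr
        exact (norm_vec_apply_le _ _).trans (hf.norm_realSol_le g1 s1)
      set t := |ε - ε'| + |μ - μ'| with ht
      have hε' := abs_nonneg (ε - ε')
      have t1 : |μ - μ'| + |β₀ ε μ - β₀ ε' μ'| ≤ (1 + Lβ) * t := by
        rw [add_mul, one_mul]
        have : |μ - μ'| ≤ t := by linarith
        exact add_le_add this hβ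
      have t2 : |ε - ε'| + (|μ - μ'| + |β₀ ε μ - β₀ ε' μ'|) ≤ (1 + Lβ) * t := by
        rw [add_mul, one_mul]
        linarith
      have e : gam μ (β₀ ε μ) * hf.realF ε μ (β₀ ε μ) -
          gam μ' (β₀ ε' μ') * hf.realF ε' μ' (β₀ ε' μ') =
          (gam μ (β₀ ε μ) - gam μ' (β₀ ε' μ')) * hf.realF ε μ (β₀ ε μ) +
          gam μ' (β₀ ε' μ') * (hf.realF ε μ (β₀ ε μ) - hf.realF ε' μ' (β₀ ε' μ')) := by ring
      rw [e]
      refine (abs_add_le _ _).trans ?_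
      rw [abs_mul, abs_mul, abs_of_pos g2.gam_pos]
      have hg := g2.gam_le
      calc _ ≤ ((1 + Lβ) * t) * MF + 1 * (LF * ((1 + Lβ) * t)) := by
            refine add_le_add (mul_le_mul (hG.trans t1) hF1 (abs_nonneg _) (by positivity)) ?_
            refine mul_le_mul hg (hF.trans ?_) (abs_nonneg _) zero_le_one
            gcongr
        _ = _ := by ring) (by
      have h1 : |(0 : ℝ)| < ε₀ := by simpa using hε₀
      have h2 : |(0 : ℝ)| < μ₀ := by simpa using hμ₀
      have h3 := hbox 0 0 β00 h1 h2 (by simpa using hη0)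
      rw [hb0, hf.realF_zero h3.1 h3.2, gam, omegaSq]
      norm_num)
  have hlt : ∀ {ε : ℝ}, |ε| < ε₁ → |ε| < ε₀ := fun h => h.trans_le hε₁0
  refine ⟨β₀, νtr, ε₁, μ₀, η, b, d, hε₁, hμ₀, hη0, fun ε μ β h1 => hbox ε μ β (hlt h1), ?_, ?_⟩
  · refine ⟨hb0, ?_, fun ε μ h1 h2 => ⟨(hcurve ε μ (hlt h1) h2).1, fun β hβ => ?_⟩⟩
    · have hlip : LipschitzOnWith (Real.toNNReal (Lβ * 2)) (fun q : ℝ × ℝ => β₀ q.1 q.2)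
          {q | |q.1| < ε₁ ∧ |q.2| < μ₀} := by
        refine LipschitzOnWith.of_dist_le_mul fun x hx y hy => ?_
        rw [Real.dist_eq, Real.coe_toNNReal _ (by positivity)]
        refine (hβLip _ _ _ _ (hlt hx.1) (hlt hy.1) hx.2 hy.2).trans ?_
        rw [mul_assoc, Prod.dist_eq, Real.dist_eq, Real.dist_eq]
        gcongr
        linarith [le_max_left |x.1 - y.1| |x.2 - y.2|, le_max_right |x.1 - y.1| |x.2 - y.2|]
      exact hlip.continuousOn
    · obtain ⟨g, s⟩ := hbox ε μ β (hlt h1) h2 hβ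
      rw [hf.funR_eq_zero_iff g s, ← (hcurve ε μ (hlt h1) h2).2 β hβ]
      simp [hσ0]
  · refine ⟨hlim, fun ε hε hε1 => ?_⟩
    obtain ⟨t1, t2, t3⟩ := htr ε hε hε1
    refine ⟨t1, t2, fun ν hν hν1 => ?_⟩
    have h1 : |ε| < ε₀ := hlt (by rwa [abs_of_pos hε])
    have h2 : |ε * ν| < μ₀ := by rwa [abs_of_pos (by positivity)]
    obtain ⟨g, s⟩ := hbox ε (ε * ν) _ h1 h2 (hcurve ε (ε * ν) h1 h2).1
    rw [← t3 ν hν hν1, hf.funF_eq g s (hon ε (ε * ν) h1 h2), sub_eq_zero]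
    norm_cast

end IsProfile
/-! ### Reciprocity and the consistency condition -/

section Generic

variable {ρ : ℝ} {f : ℝ × ℝ → ℝ}

/-- Each equation reads `a_i = M(e_i + zK a_i)`. Symmetry of `M` equates `⟨a₁, e₂ + zK a₂⟩` with
`⟨e₁ + zK a₁, a₂⟩`, and symmetry of `K` cancels the terms with `z`. -/
lemma IsProfile.pairing_reciprocity (hf : IsProfile f ρ) {B : ℝ} {h : ℤ → C(ℝ, ℂ)}
    (hB : KernelBound ρ B h) (heven : ∀ n x, h n (-x) = h n x) {z : ℂ} {e₁ e₂ a₁ a₂ : Vec ρ}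
    (h₁ : SolvesKernel f z h (hf.mulVec e₁) a₁) (h₂ : SolvesKernel f z h (hf.mulVec e₂) a₂) :
    pairing ρ a₁ e₂ = pairing ρ a₂ e₁ := by
  rw [hf.solvesKernel_iff hB, sub_eq_iff_eq_add, ← map_smul, ← map_add] at h₁ h₂
  have key : pairing ρ a₁ (e₂ + z • convVec hB a₂) = pairing ρ (e₁ + z • convVec hB a₁) a₂ := by
    conv_lhs => rw [h₁]
    conv_rhs => rw [h₂]
    exact hf.pairing_mulVec_comm _ _
  have hK := pairing_convVec_comm hB heven a₁ a₂
  have e1 : pairing ρ a₁ (e₂ + z • convVec hB a₂) =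
      pairing ρ a₁ e₂ + z * pairing ρ a₁ (convVec hB a₂) := by
    rw [map_add, map_smul, smul_eq_mul]
  have e2 : pairing ρ (e₁ + z • convVec hB a₁) a₂ =
      pairing ρ e₁ a₂ + z * pairing ρ (convVec hB a₁) a₂ := by
    rw [map_add, map_smul]; rfl
  rw [e1, e2, hK] at key
  rw [pairing_comm a₂]
  exact add_right_cancel key

lemma pairing_unitMinus (a : Vec ρ) : pairing ρ a (unitMinus ρ) = ∫ x, vecFn a (-1) x := by
  rw [unitMinus, pairing_single_right, mul_one]
  rfl

lemma pairing_unitProp (a : Vec ρ) (μ β : ℝ) : pairing ρ a (unitProp ρ μ β) =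
    ∫ x : ℝ, vecFn a 0 x * Complex.exp (Complex.I * kProp μ β * x) := by
  rw [unitProp, pairing_single_right, intIcc_apply]
  congr 1
  ext x
  rw [extZero_mul, vecFn]
  by_cases hx : x ∈ Icc (-ρ) ρ
  · congr 1
    rw [extZero_of_mem _ hx]
    rfl
  · rw [extZero_of_notMem _ hx, extZero_of_notMem _ hx, zero_mul, zero_mul]

end Generic

namespace IsProfile

variable {f : ℝ × ℝ → ℝ} {ρ b d ε μ β : ℝ}

/-- The solution of `(1 - εT) a = M e`. -/
def cSol (hf : IsProfile f ρ) (ε μ β : ℝ) (e : Vec ρ) : Vec ρ :=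
  Classical.epsilon (SolvesKernel f (zCoef ε μ β) (greenRegC μ β) (hf.mulVec e))

lemma cSol_spec (hf : IsProfile f ρ) (h : GoodParam b d μ β)
    (hz : hf.Small (kerBound b d ρ) (zCoef ε μ β)) (e : Vec ρ) :
    SolvesKernel f (zCoef ε μ β) (greenRegC μ β) (hf.mulVec e) (hf.cSol ε μ β e) :=
  Classical.epsilon_spec
    (hf.existsUnique_solvesKernel (kernelBound_greenRegC h hf.pos) hz _).exists

lemma cSol_add_smul (hf : IsProfile f ρ) (h : GoodParam b d μ β)
    (hz : hf.Small (kerBound b d ρ) (zCoef ε μ β)) (e e' : Vec ρ) (c : ℂ) :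
    hf.cSol ε μ β (e + c • e') = hf.cSol ε μ β e + c • hf.cSol ε μ β e' := by
  have hB := kernelBound_greenRegC h hf.pos
  refine (hf.existsUnique_solvesKernel hB hz _).unique (hf.cSol_spec h hz _) ?_
  have h1 := (hf.solvesKernel_iff hB).mp (hf.cSol_spec h hz e)
  have h2 := (hf.solvesKernel_iff hB).mp (hf.cSol_spec h hz e')
  rw [hf.solvesKernel_iff hB, map_add hf.mulVec e, map_smul hf.mulVec, ← h1, ← h2, map_add, map_add,
    map_smul, map_smul, smul_add, smul_sub, smul_comm c]
  abel

lemma norm_cSol_le (hf : IsProfile f ρ) (h : GoodParam b d μ β)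
    (hz : hf.Small (kerBound b d ρ) (zCoef ε μ β)) (e : Vec ρ) :
    ‖hf.cSol ε μ β e‖ ≤ 2 * (‖hf.mulVec‖ * ‖e‖) :=
  (hf.norm_le_of_solvesKernel (kernelBound_greenRegC h hf.pos) hz (hf.cSol_spec h hz e)).trans
    (mul_le_mul_of_nonneg_left (hf.mulVec.le_opNorm e) zero_le_two)

lemma funF_eq_integral (hf : IsProfile f ρ) (h : GoodParam b d μ β)
    (hz : hf.Small (kerBound b d ρ) (zCoef ε μ β)) :
    funF f ρ ε μ β = ∫ x, vecFn (hf.cSol ε μ β (unitMinus ρ)) (-1) x := by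
  rw [funF, ← hf.vecFn_mulVec_unitMinus, hf.resolv_eq h hz (hf.cSol_spec h hz _)]

lemma funR_eq_integral (hf : IsProfile f ρ) (h : GoodParam b d μ β)
    (hz : hf.Small (kerBound b d ρ) (zCoef ε μ β)) :
    funR f ρ ε μ β = ∫ x : ℝ, vecFn (hf.cSol ε μ β (unitMinus ρ)) 0 x *
      Complex.exp (Complex.I * kProp μ β * x) := by
  rw [funR, ← hf.vecFn_mulVec_unitMinus, hf.resolv_eq h hz (hf.cSol_spec h hz _)]

/-- The vector `A` built from the constant `C`, as an element of `Vec ρ`. -/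
def ampVec (hf : IsProfile f ρ) (ε μ β : ℝ) (C : ℂ) : Vec ρ :=
  zCoef ε μ β • hf.cSol ε μ β (unitProp ρ μ β + (C / (2 * μ)) • unitMinus ρ)

lemma vecA_eq (hf : IsProfile f ρ) (h : GoodParam b d μ β)
    (hz : hf.Small (kerBound b d ρ) (zCoef ε μ β)) (C : ℂ) :
    vecA f ρ ε μ β C = vecFn (hf.ampVec ε μ β C) := by
  ext m x
  have e : (fun m x => vecG1 f μ β m x + C / (2 * μ) * vecG2 f m x) =
      vecFn (hf.mulVec (unitProp ρ μ β + (C / (2 * μ)) • unitMinus ρ)) := by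
    ext m x
    rw [map_add, map_smul, vecFn_add, vecFn_smul, hf.vecFn_mulVec_unitProp,
      hf.vecFn_mulVec_unitMinus]
  rw [vecA, e, hf.resolv_eq h hz (hf.cSol_spec h hz _), ampVec, vecFn_smul, zCoef]
  push_cast
  ring

lemma integral_vecFn_add_smul (a a' : Vec ρ) (n : ℤ) (c : ℂ) {g : ℝ → ℂ} (hg : Continuous g) :
    ∫ x, g x * vecFn (a + c • a') n x = (∫ x, g x * vecFn a n x) + c * ∫ x, g x * vecFn a' n x := by
  rw [← integral_const_mul, ← integral_add]
  · congr 1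
    ext x
    rw [vecFn_add, vecFn_smul]
    ring
  · exact integrable_mul_extZero hg.continuousOn _
  · exact (integrable_mul_extZero hg.continuousOn _).const_mul c

lemma integral_ampVec (hf : IsProfile f ρ) (h : GoodParam b d μ β)
    (hz : hf.Small (kerBound b d ρ) (zCoef ε μ β)) (C : ℂ) (n : ℤ) {g : ℝ → ℂ}
    (hg : Continuous g) : ∫ x, g x * vecFn (hf.ampVec ε μ β C) n x =
      zCoef ε μ β * ((∫ x, g x * vecFn (hf.cSol ε μ β (unitProp ρ μ β)) n x) +
        C / (2 * μ) * ∫ x, g x * vecFn (hf.cSol ε μ β (unitMinus ρ)) n x) := by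
  rw [ampVec, hf.cSol_add_smul h hz, ← integral_vecFn_add_smul _ _ _ _ hg, ← integral_const_mul]
  congr 1
  ext x
  rw [vecFn_smul]
  ring

/-- Reciprocity converts the channel `-1` response to the incident wave into the channel `0`
response to `g⁽²⁾`, which is `R`. -/
lemma integral_ampVec_neg_one (hf : IsProfile f ρ) (h : GoodParam b d μ β)
    (hz : hf.Small (kerBound b d ρ) (zCoef ε μ β)) (C : ℂ) :
    ∫ x, vecFn (hf.ampVec ε μ β C) (-1) x =
      zCoef ε μ β * (funR f ρ ε μ β + C / (2 * μ) * funF f ρ ε μ β) := by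
  have h1 := hf.integral_ampVec h hz C (-1) (g := fun _ => 1) continuous_const
  simp only [one_mul] at h1
  rw [h1, ← hf.funF_eq_integral h hz, ← pairing_unitMinus, hf.pairing_reciprocity
    (kernelBound_greenRegC h hf.pos) (fun n x => greenReg_even n μ β x)
    (hf.cSol_spec h hz _) (hf.cSol_spec h hz _), pairing_unitProp, ← hf.funR_eq_integral h hz]

/-- The constant `C` enters the reflection coefficient only multiplied by `R`, which vanishes on the
curve. -/
lemma reflC_eq (hf : IsProfile f ρ) (h : GoodParam b d μ β)
    (hz : hf.Small (kerBound b d ρ) (zCoef ε μ β)) (hR : funR f ρ ε μ β = 0) (C : ℂ) :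
    reflC f ρ ε μ β C = Complex.I / (2 * kProp μ β) * (zCoef ε μ β *
      ∫ x : ℝ, Complex.exp (Complex.I * kProp μ β * x) *
        vecFn (hf.cSol ε μ β (unitProp ρ μ β)) 0 x) := by
  have h0 : ∫ x : ℝ, Complex.exp (Complex.I * kProp μ β * x) *
      vecFn (hf.cSol ε μ β (unitMinus ρ)) 0 x = 0 := by
    rw [← hR, hf.funR_eq_integral h hz]
    congr 1
    ext x
    rw [mul_comm]
  rw [reflC, hf.vecA_eq h hz, hf.integral_ampVec h hz C 0 (by fun_prop), h0, mul_zero, add_zero]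

/-- Here the moment is taken against `e^{-ik₀x}`. The response to `g⁽²⁾` is even, so this moment
equals `R` again and the dependence on `C` disappears. -/
lemma transC_eq (hf : IsProfile f ρ) (h : GoodParam b d μ β)
    (hz : hf.Small (kerBound b d ρ) (zCoef ε μ β)) (hR : funR f ρ ε μ β = 0) (C : ℂ) :
    transC f ρ ε μ β C = 1 + Complex.I / (2 * kProp μ β) * (zCoef ε μ β *
      ∫ x : ℝ, Complex.exp (-(Complex.I * kProp μ β * x)) *
        vecFn (hf.cSol ε μ β (unitProp ρ μ β)) 0 x) := by
  have heven := hf.greenReg_solution_even h hz (hf.cSol_spec h hz (unitMinus ρ)) 0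
  have h0 : ∫ x : ℝ, Complex.exp (-(Complex.I * kProp μ β * x)) *
      vecFn (hf.cSol ε μ β (unitMinus ρ)) 0 x = 0 := by
    rw [← hR, hf.funR_eq_integral h hz, ← integral_neg_eq_self]
    congr 1
    ext x
    rw [heven, mul_comm]
    congr 2
    push_cast
    ring
  rw [transC, hf.vecA_eq h hz, hf.integral_ampVec h hz C 0 (by fun_prop), h0, mul_zero, add_zero]

/-- The constant in the bounds for the reflection and transmission coefficients. -/
def coefBound (hf : IsProfile f ρ) (d : ℝ) : ℝ :=
  1 / (2 * Real.sqrt d) * (2 * (2 * |ρ| * (2 * (‖hf.mulVec‖ * 1))))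

lemma norm_coef_le (hf : IsProfile f ρ) (h : GoodParam b d μ β)
    (hz : hf.Small (kerBound b d ρ) (zCoef ε μ β)) (hε : 0 < ε) {g : ℝ → ℂ}
    (hg : ∀ x, ‖g x‖ = 1) :
    ‖Complex.I / (2 * kProp μ β) * (zCoef ε μ β *
      ∫ x : ℝ, g x * vecFn (hf.cSol ε μ β (unitProp ρ μ β)) 0 x)‖ ≤ hf.coefBound d * ε := by
  have b1 : ‖Complex.I / (2 * kProp μ β)‖ ≤ 1 / (2 * Real.sqrt d) := by
    rw [norm_div, Complex.norm_I, norm_mul, Complex.norm_real, Real.norm_of_nonneg h.kProp_pos.le,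
      Complex.norm_ofNat]
    have h1 := h.sqrt_d_pos
    have := h.le_kProp
    gcongr
  have b2 : ‖zCoef ε μ β‖ ≤ 2 * ε := by
    have := norm_zCoef_le (ε := ε) h
    rwa [abs_of_pos hε] at this
  have b3 : ‖∫ x : ℝ, g x * vecFn (hf.cSol ε μ β (unitProp ρ μ β)) 0 x‖ ≤
      2 * |ρ| * (2 * (‖hf.mulVec‖ * 1)) := by
    refine norm_integral_le_of_Icc (fun x _ => ?_)
      (fun x hx => by rw [vecFn, extZero_of_notMem _ hx, mul_zero]) (by positivity)
    rw [norm_mul, hg, one_mul]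
    refine (norm_extZero_le _ _).trans ((norm_vec_apply_le _ _).trans
      ((hf.norm_cSol_le h hz _).trans ?_))
    gcongr
    exact norm_unitProp_le ρ μ β
  rw [norm_mul, norm_mul]
  calc _ ≤ 1 / (2 * Real.sqrt d) * (2 * ε * (2 * |ρ| * (2 * (‖hf.mulVec‖ * 1)))) := by gcongr
    _ = _ := by unfold coefBound; ring

end IsProfile

/-! ### The self-consistent system for the modes -/

/-- The mode `Ψ_n` determined by the vector `A`. -/
def modeOf (μ β : ℝ) (A : ℤ → ℝ → ℂ) (n : ℤ) (x : ℝ) : ℂ :=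
  (if n = 0 then Complex.exp (Complex.I * kProp μ β * x) else 0) + lineConv (green n μ β) (A n) x

/-- `A_m = 2εγ ∑_n f_{m-n} Ψ_n`, with the modes `Ψ_n` determined by `A`. -/
def IsConsistent (f : ℝ × ℝ → ℝ) (ε μ β : ℝ) (A : ℤ → ℝ → ℂ) : Prop :=
  ∀ m x, A m x = zCoef ε μ β * ∑' n, modeOf μ β A n x * fourierY f (m - n) x

lemma green_eq_greenReg {n : ℤ} (hn : n ≠ -1) (μ β x : ℝ) : green n μ β x = greenReg n μ β x := by
  rw [greenReg, if_neg hn]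

lemma green_neg_one {μ : ℝ} (hμ : μ ≠ 0) (β x : ℝ) :
    green (-1) μ β x = greenReg (-1) μ β x + 1 / (2 * μ) := by
  have : (μ : ℂ) ≠ 0 := by exact_mod_cast hμ
  simp only [green, greenReg, if_true, if_neg hμ, show (-1 : ℤ) ≠ 0 by norm_num, if_false]
  push_cast
  field_simp
  ring

section Consistency

variable {f : ℝ × ℝ → ℝ} {ρ b d ε μ β : ℝ}

lemma lineConv_green_neg_one (hμ : μ ≠ 0) (a : Vec ρ) (x : ℝ) :
    lineConv (green (-1) μ β) (vecFn a (-1)) x =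
      lineConv (greenRegC μ β (-1)) (vecFn a (-1)) x + 1 / (2 * μ) * ∫ ξ, vecFn a (-1) ξ := by
  unfold lineConv
  rw [← integral_const_mul, ← integral_add]
  · congr 1
    ext ξ
    rw [green_neg_one hμ, greenRegC_apply, add_mul]
  · exact integrable_mul_extZero (by fun_prop) _
  · exact (integrable_extZero _).const_mul _

/-- The singular constant `1/(2μ)` in `G_{-1}` contributes the constant function `∫ a_{-1} / (2μ)`
to the mode `-1`, that is, an additional source in the direction `e_{-1}`. -/
lemma modeOf_vecFn (h : GoodParam b d μ β) (hρ : 0 < ρ) (hμ : μ ≠ 0) (a : Vec ρ) (n : ℤ) {x : ℝ}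
    (hx : x ∈ Icc (-ρ) ρ) :
    modeOf μ β (vecFn a) n x = vecFn (unitProp ρ μ β +
      ((∫ ξ, vecFn a (-1) ξ) / (2 * μ)) • unitMinus ρ + convVec (kernelBound_greenRegC h hρ) a)
      n x := by
  have hconv : vecFn (convVec (kernelBound_greenRegC h hρ) a) n x =
      lineConv (greenRegC μ β n) (vecFn a n) x := by
    rw [vecFn, extZero_of_mem _ hx, convVec_apply]
  rw [vecFn_add, vecFn_add, vecFn_smul, hconv, modeOf]
  rcases eq_or_ne n 0 with rfl | h0
  · have e1 : vecFn (unitProp ρ μ β) 0 x = Complex.exp (Complex.I * kProp μ β * x) := by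
      rw [vecFn, extZero_of_mem _ hx, unitProp, lp.single_apply_self]; rfl
    have e2 : vecFn (unitMinus ρ) 0 x = 0 := by
      rw [vecFn, extZero_of_mem _ hx, unitMinus, lp.single_apply_ne _ _ _ (by norm_num)]; rfl
    rw [e1, e2, mul_zero, add_zero, if_pos rfl]
    congr 1
  · have e1 : vecFn (unitProp ρ μ β) n x = 0 := by
      rw [vecFn, extZero_of_mem _ hx, unitProp, lp.single_apply_ne _ _ _ h0]; rfl
    rw [e1, if_neg h0, zero_add, zero_add]
    rcases eq_or_ne n (-1) with rfl | h1
    · have e2 : vecFn (unitMinus ρ) (-1) x = 1 := by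
        rw [vecFn, extZero_of_mem _ hx, unitMinus, lp.single_apply_self]; rfl
      rw [e2, lineConv_green_neg_one hμ]
      ring
    · have e2 : vecFn (unitMinus ρ) n x = 0 := by
        rw [vecFn, extZero_of_mem _ hx, unitMinus, lp.single_apply_ne _ _ _ h1]; rfl
      rw [e2, mul_zero, zero_add]
      have : green n μ β = greenRegC μ β n := by
        ext x; exact green_eq_greenReg h1 μ β x
      rw [this]

/-- With `C = ∫ a_{-1}` treated as given, consistency is the equation for `1 - εT` with source
`M(e^{ik₀x} e_0 + (C/2μ) e_{-1})`, which has a unique solution. The infinite system is thus reduced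
to the scalar condition that the solution reproduces `C`. -/
lemma IsProfile.isConsistent_iff (hf : IsProfile f ρ) (h : GoodParam b d μ β) (hμ : μ ≠ 0)
    (hz : hf.Small (kerBound b d ρ) (zCoef ε μ β)) (a : Vec ρ) :
    IsConsistent f ε μ β (vecFn a) ↔
      a = hf.ampVec ε μ β (∫ ξ, vecFn a (-1) ξ) := by
  set C := ∫ ξ, vecFn a (-1) ξ with hC
  have hB := kernelBound_greenRegC h hf.pos
  set e := unitProp ρ μ β + (C / (2 * μ)) • unitMinus ρ with he
  have e1 : IsConsistent f ε μ β (vecFn a) ↔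
      a = zCoef ε μ β • hf.mulVec (e + convVec hB a) := by
    have key : ∀ m x, vecFn (zCoef ε μ β • hf.mulVec (e + convVec hB a)) m x =
        zCoef ε μ β * ∑' n, modeOf μ β (vecFn a) n x * fourierY f (m - n) x := by
      intro m x
      rw [vecFn_smul, hf.vecFn_mulVec]
      congr 2
      ext n
      by_cases hx : x ∈ Icc (-ρ) ρ
      · rw [modeOf_vecFn h hf.pos hμ a n hx]
      · rw [hf.fourierY_eq_zero _ hx, mul_zero, mul_zero]
    constructor
    · intro H
      apply vecFn_injective
      ext m x
      rw [H m x, key]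
    · intro H m x
      rw [← key, ← H]
  rw [e1]
  have h2 := (hf.solvesKernel_iff hB).mp (hf.cSol_spec h hz e)
  have h3 : hf.ampVec ε μ β C - zCoef ε μ β • hf.mulVec (convVec hB (hf.ampVec ε μ β C)) =
      zCoef ε μ β • hf.mulVec e := by
    rw [← h2, ampVec, map_smul, map_smul, smul_sub]
  rw [map_add, smul_add, ← sub_eq_iff_eq_add]
  constructor
  · intro H
    exact (existsUnique_sub_smul_eq (norm_convVec_le hB) hz _).unique H h3
  · intro H
    rw [← H] at h3
    exact h3

end Consistency

/-! ### Convolution with exponential kernels -/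

/-- The Green function `e^{-s|x|} / (2s)` of `-u'' + s² u`. -/
def expKer (s : ℂ) (x : ℝ) : ℂ := Complex.exp (-(s * |x|)) / (2 * s)

/-- `∫_{-R}^x e^{sξ} a(ξ) dξ`. -/
def leftInt (s : ℂ) (R : ℝ) (a : ℝ → ℂ) (x : ℝ) : ℂ :=
  ∫ ξ in (-R)..x, Complex.exp (s * ξ) * a ξ

/-- `∫_x^R e^{-sξ} a(ξ) dξ`. -/
def rightInt (s : ℂ) (R : ℝ) (a : ℝ → ℂ) (x : ℝ) : ℂ :=
  ∫ ξ in x..R, Complex.exp (-(s * ξ)) * a ξ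

/-- The convolution of `expKer s` with a function supported in `[-R, R]`. -/
def expSol (s : ℂ) (R : ℝ) (a : ℝ → ℂ) (x : ℝ) : ℂ :=
  1 / (2 * s) * (Complex.exp (-(s * x)) * leftInt s R a x + Complex.exp (s * x) * rightInt s R a x)

/-- The derivative of `expSol`. -/
def expSolDeriv (s : ℂ) (R : ℝ) (a : ℝ → ℂ) (x : ℝ) : ℂ :=
  1 / 2 * (Complex.exp (s * x) * rightInt s R a x - Complex.exp (-(s * x)) * leftInt s R a x)

section ExpKer

variable {s : ℂ} {R : ℝ} {a : ℝ → ℂ}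

lemma intervalIntegral_eq_zero_of_forall {g : ℝ → ℂ} {p q : ℝ}
    (h : ∀ x, (p < x ∧ x < q) ∨ (q < x ∧ x < p) → g x = 0) : ∫ x in p..q, g x = 0 := by
  have aux : ∀ p q : ℝ, p ≤ q → (∀ x, p < x ∧ x < q → g x = 0) → ∫ x in p..q, g x = 0 := by
    intro p q hpq h
    rw [intervalIntegral.integral_of_le hpq, ← integral_Ioc_eq_integral_Ioo.symm]
    refine setIntegral_eq_zero_of_forall_eq_zero fun x hx => h x ⟨hx.1, hx.2⟩
  rcases le_total p q with hpq | hpq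
  · exact aux p q hpq fun x hx => h x (Or.inl hx)
  · rw [intervalIntegral.integral_symm, aux q p hpq fun x hx => h x (Or.inr hx), neg_zero]

lemma leftInt_of_le (hsupp : ∀ x, x ∉ Icc (-R) R → a x = 0) {x : ℝ} (hx : x ≤ -R) :
    leftInt s R a x = 0 := by
  refine intervalIntegral_eq_zero_of_forall fun ξ hξ => ?_
  rw [hsupp ξ fun h => ?_, mul_zero]
  rcases hξ with hξ | hξ <;> linarith [h.1, hξ.1, hξ.2]

lemma rightInt_of_ge (hsupp : ∀ x, x ∉ Icc (-R) R → a x = 0) {x : ℝ} (hx : R ≤ x) :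
    rightInt s R a x = 0 := by
  refine intervalIntegral_eq_zero_of_forall fun ξ hξ => ?_
  rw [hsupp ξ fun h => ?_, mul_zero]
  rcases hξ with hξ | hξ <;> linarith [h.2, hξ.1, hξ.2]

lemma leftInt_of_ge (ha : Continuous a) (hsupp : ∀ x, x ∉ Icc (-R) R → a x = 0) {x : ℝ}
    (hx : R ≤ x) : leftInt s R a x = leftInt s R a R := by
  have hc : Continuous fun ξ : ℝ => Complex.exp (s * ξ) * a ξ := by fun_prop
  have h0 : ∫ ξ in R..x, Complex.exp (s * ξ) * a ξ = 0 := by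
    refine intervalIntegral_eq_zero_of_forall fun ξ hξ => ?_
    rw [hsupp ξ fun h => ?_, mul_zero]
    rcases hξ with hξ | hξ <;> linarith [h.2, hξ.1, hξ.2]
  rw [leftInt, leftInt, ← intervalIntegral.integral_add_adjacent_intervals
    (hc.intervalIntegrable _ R) (hc.intervalIntegrable _ _), h0, add_zero]

lemma rightInt_of_le (ha : Continuous a) (hsupp : ∀ x, x ∉ Icc (-R) R → a x = 0) {x : ℝ}
    (hx : x ≤ -R) : rightInt s R a x = rightInt s R a (-R) := by
  have hc : Continuous fun ξ : ℝ => Complex.exp (-(s * ξ)) * a ξ := by fun_prop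
  have h0 : ∫ ξ in x..(-R), Complex.exp (-(s * ξ)) * a ξ = 0 := by
    refine intervalIntegral_eq_zero_of_forall fun ξ hξ => ?_
    rw [hsupp ξ fun h => ?_, mul_zero]
    rcases hξ with hξ | hξ <;> linarith [h.1, hξ.1, hξ.2]
  rw [rightInt, rightInt, ← intervalIntegral.integral_add_adjacent_intervals
    (hc.intervalIntegrable _ (-R)) (hc.intervalIntegrable _ _), h0, zero_add]

lemma integral_eq_intervalIntegral_of_Icc {g : ℝ → ℂ} {L : ℝ} (hL : 0 ≤ L)
    (h : ∀ x, x ∉ Icc (-L) L → g x = 0) : ∫ x, g x = ∫ x in (-L)..L, g x := by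
  rw [intervalIntegral.integral_of_le (by linarith), ← integral_Icc_eq_integral_Ioc,
    setIntegral_eq_integral_of_forall_compl_eq_zero h]

/-- Splitting the integral at `ξ = x` removes the absolute value from the exponent, which then
factors into functions of `x` and of `ξ`. -/
lemma lineConv_expKer (ha : Continuous a) (hsupp : ∀ x, x ∉ Icc (-R) R → a x = 0) (x : ℝ) :
    lineConv (expKer s) a x = expSol s R a x := by
  -- An interval containing both the support and `x`, so that the point of splitting need not be
  -- located relative to the support.
  set L := max |R| |x| with hL
  have hR : |R| ≤ L := le_max_left _ _
  have hx : |x| ≤ L := le_max_right _ _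
  have hL0 : 0 ≤ L := (abs_nonneg _).trans hR
  rw [abs_le] at hR hx
  have hk : Continuous (expKer s) := by
    unfold expKer
    fun_prop
  have hc : Continuous fun ξ => expKer s (x - ξ) * a ξ := by fun_prop
  have h1 : ∫ ξ in (-L)..x, expKer s (x - ξ) * a ξ =
      1 / (2 * s) * Complex.exp (-(s * x)) * leftInt s R a x := by
    have hc' : Continuous fun ξ : ℝ => Complex.exp (s * ξ) * a ξ := by fun_prop
    have h0 : ∫ ξ in (-L)..(-R), Complex.exp (s * ξ) * a ξ = 0 := by
      refine intervalIntegral_eq_zero_of_forall fun ξ hξ => ?_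
      rw [hsupp ξ fun h => ?_, mul_zero]
      rcases hξ with hξ | hξ <;> linarith [h.1, hξ.1, hξ.2]
    have h00 : leftInt s R a x = ∫ ξ in (-L)..x, Complex.exp (s * ξ) * a ξ := by
      rw [leftInt, ← intervalIntegral.integral_add_adjacent_intervals
        (hc'.intervalIntegrable (-L) (-R)) (hc'.intervalIntegrable _ _), h0, zero_add]
    rw [h00, ← intervalIntegral.integral_const_mul]
    refine intervalIntegral.integral_congr fun ξ hξ => ?_
    rw [uIcc_of_le hx.1] at hξ
    simp only [expKer]
    rw [abs_of_nonneg (sub_nonneg.mpr hξ.2), mul_assoc, ← mul_assoc (Complex.exp _),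
      ← Complex.exp_add]
    push_cast
    rw [show -(s * x) + s * ξ = -(s * ((x : ℂ) - ξ)) by ring]
    ring
  have h2 : ∫ ξ in x..L, expKer s (x - ξ) * a ξ =
      1 / (2 * s) * Complex.exp (s * x) * rightInt s R a x := by
    have hc' : Continuous fun ξ : ℝ => Complex.exp (-(s * ξ)) * a ξ := by fun_prop
    have h0 : ∫ ξ in R..L, Complex.exp (-(s * ξ)) * a ξ = 0 := by
      refine intervalIntegral_eq_zero_of_forall fun ξ hξ => ?_
      rw [hsupp ξ fun h => ?_, mul_zero]
      rcases hξ with hξ | hξ <;> linarith [h.2, hξ.1, hξ.2]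
    have h00 : rightInt s R a x = ∫ ξ in x..L, Complex.exp (-(s * ξ)) * a ξ := by
      rw [rightInt, ← intervalIntegral.integral_add_adjacent_intervals
        (hc'.intervalIntegrable x R) (hc'.intervalIntegrable R L), h0, add_zero]
    rw [h00, ← intervalIntegral.integral_const_mul]
    refine intervalIntegral.integral_congr fun ξ hξ => ?_
    rw [uIcc_of_le hx.2] at hξ
    simp only [expKer]
    rw [abs_of_nonpos (sub_nonpos.mpr hξ.1), mul_assoc, ← mul_assoc (Complex.exp _),
      ← Complex.exp_add]
    push_cast
    rw [show s * x + -(s * ξ) = -(s * -((x : ℂ) - ξ)) by ring]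
    ring
  rw [lineConv, integral_eq_intervalIntegral_of_Icc hL0, ←
    intervalIntegral.integral_add_adjacent_intervals (hc.intervalIntegrable (-L) x)
    (hc.intervalIntegrable x L), h1, h2, expSol]
  · ring
  · intro ξ hξ
    rw [hsupp ξ fun h => hξ ⟨by linarith [h.1], by linarith [h.2]⟩, mul_zero]

lemma hasDerivAt_leftInt (ha : Continuous a) (x : ℝ) :
    HasDerivAt (leftInt s R a) (Complex.exp (s * x) * a x) x := by
  have hc : Continuous fun ξ : ℝ => Complex.exp (s * ξ) * a ξ := by fun_prop
  exact intervalIntegral.integral_hasDerivAt_right (hc.intervalIntegrable _ _)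
    (hc.stronglyMeasurableAtFilter _ _) hc.continuousAt

lemma hasDerivAt_rightInt (ha : Continuous a) (x : ℝ) :
    HasDerivAt (rightInt s R a) (-(Complex.exp (-(s * x)) * a x)) x := by
  have hc : Continuous fun ξ : ℝ => Complex.exp (-(s * ξ)) * a ξ := by fun_prop
  exact intervalIntegral.integral_hasDerivAt_left (hc.intervalIntegrable _ _)
    (hc.stronglyMeasurableAtFilter _ _) hc.continuousAt

lemma hasDerivAt_expSol (hs : s ≠ 0) (ha : Continuous a) (x : ℝ) :
    HasDerivAt (expSol s R a) (expSolDeriv s R a x) x := by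
  have e1 := hasDerivAt_cexp_mul s x
  have e2 := hasDerivAt_cexp_mul (-s) x
  simp only [neg_mul] at e2
  have := ((e2.mul (hasDerivAt_leftInt (s := s) (R := R) ha x)).add
    (e1.mul (hasDerivAt_rightInt (s := s) (R := R) ha x))).const_mul (1 / (2 * s))
  refine HasDerivAt.congr_deriv this ?_
  rw [expSolDeriv]
  field_simp
  ring

lemma hasDerivAt_expSolDeriv (hs : s ≠ 0) (ha : Continuous a) (x : ℝ) :
    HasDerivAt (expSolDeriv s R a) (s ^ 2 * expSol s R a x - a x) x := by
  have e1 := hasDerivAt_cexp_mul s x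
  have e2 := hasDerivAt_cexp_mul (-s) x
  simp only [neg_mul] at e2
  have := ((e1.mul (hasDerivAt_rightInt (s := s) (R := R) ha x)).sub
    (e2.mul (hasDerivAt_leftInt (s := s) (R := R) ha x))).const_mul (1 / 2)
  refine HasDerivAt.congr_deriv this ?_
  have h3 : Complex.exp (s * x) * Complex.exp (-(s * x)) = 1 := by
    rw [← Complex.exp_add, add_neg_cancel, Complex.exp_zero]
  rw [expSol]
  field_simp
  linear_combination (-2 * a x) * h3

lemma expSol_of_ge (ha : Continuous a) (hsupp : ∀ x, x ∉ Icc (-R) R → a x = 0) {x : ℝ}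
    (hx : R ≤ x) : expSol s R a x = 1 / (2 * s) * (Complex.exp (-(s * x)) * leftInt s R a R) := by
  rw [expSol, leftInt_of_ge ha hsupp hx, rightInt_of_ge hsupp hx, mul_zero, add_zero]

lemma expSol_of_le (ha : Continuous a) (hsupp : ∀ x, x ∉ Icc (-R) R → a x = 0) {x : ℝ}
    (hx : x ≤ -R) :
    expSol s R a x = 1 / (2 * s) * (Complex.exp (s * x) * rightInt s R a (-R)) := by
  rw [expSol, rightInt_of_le ha hsupp hx, leftInt_of_le hsupp hx, mul_zero, zero_add]

lemma expSolDeriv_of_ge (hs : s ≠ 0) (hsupp : ∀ x, x ∉ Icc (-R) R → a x = 0)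
    {x : ℝ} (hx : R ≤ x) : expSolDeriv s R a x = -s * expSol s R a x := by
  rw [expSol, expSolDeriv, rightInt_of_ge hsupp hx]
  field_simp
  ring

lemma expSolDeriv_of_le (hs : s ≠ 0) (hsupp : ∀ x, x ∉ Icc (-R) R → a x = 0)
    {x : ℝ} (hx : x ≤ -R) : expSolDeriv s R a x = s * expSol s R a x := by
  rw [expSol, expSolDeriv, leftInt_of_le hsupp hx]
  field_simp
  ring

lemma leftInt_self (hsupp : ∀ x, x ∉ Icc (-R) R → a x = 0) (hR : 0 ≤ R) :
    leftInt s R a R = ∫ ξ : ℝ, Complex.exp (s * ξ) * a ξ :=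
  (integral_eq_intervalIntegral_of_Icc hR fun x hx => by rw [hsupp x hx, mul_zero]).symm

lemma rightInt_neg_self (hsupp : ∀ x, x ∉ Icc (-R) R → a x = 0) (hR : 0 ≤ R) :
    rightInt s R a (-R) = ∫ ξ : ℝ, Complex.exp (-(s * ξ)) * a ξ :=
  (integral_eq_intervalIntegral_of_Icc hR fun x hx => by rw [hsupp x hx, mul_zero]).symm

/-- Bootstrapping in `u'' = s² u - a`: the induction carries `u` and `u'` together, since the
derivative of each is expressed through the other and `a`. -/
lemma contDiff_expSol (hs : s ≠ 0) (ha : ContDiff ℝ ∞ a) : ContDiff ℝ ∞ (expSol s R a) := by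
  have hd := hasDerivAt_expSol (R := R) hs ha.continuous
  have hd2 := hasDerivAt_expSolDeriv (R := R) hs ha.continuous
  have key : ∀ n : ℕ, ContDiff ℝ n (expSol s R a) ∧ ContDiff ℝ n (expSolDeriv s R a) := by
    intro n
    induction n with
    | zero =>
      simp only [Nat.cast_zero, contDiff_zero]
      exact ⟨continuous_iff_continuousAt.mpr fun x => (hd x).continuousAt,
        continuous_iff_continuousAt.mpr fun x => (hd2 x).continuousAt⟩
    | succ n ih =>
      have e1 : deriv (expSol s R a) = expSolDeriv s R a := funext fun x => (hd x).deriv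
      have e2 : deriv (expSolDeriv s R a) = fun x => s ^ 2 * expSol s R a x - a x :=
        funext fun x => (hd2 x).deriv
      push_cast
      rw [contDiff_succ_iff_deriv, contDiff_succ_iff_deriv, e1, e2]
      refine ⟨⟨fun x => (hd x).differentiableAt, by simp, ih.2⟩,
        ⟨fun x => (hd2 x).differentiableAt, by simp, ?_⟩⟩
      exact (contDiff_const.mul ih.1).sub (ha.of_le (by exact_mod_cast le_top))
  exact contDiff_infty.mpr fun n => (key n).1

end ExpKer

/-! ### Exponential decay for real exponents. -/

section ExpKerReal

variable {k c N R : ℝ} {a : ℝ → ℂ}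

/-- The integral vanishes to the left of the support, is controlled by `∫ e^{kξ}` inside it, and is
constant to the right, where the prefactor decays. The true rate `k` is weakened to any `c ≤ k` so
that all modes can share one weight. -/
lemma norm_exp_mul_leftInt_le (hR : 0 ≤ R) (hk : 0 < k) (hc0 : 0 ≤ c) (hc : c ≤ k) (ha : Continuous a)
    (hsupp : ∀ x, x ∉ Icc (-R) R → a x = 0) (hN : ∀ x, ‖a x‖ ≤ N) (x : ℝ) :
    ‖Complex.exp (-(k * x)) * leftInt k R a x‖ ≤ N / k * Real.exp (c * (R - |x|)) := by
  have hN0 : 0 ≤ N := (norm_nonneg _).trans (hN 0)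
  have hne : ∀ x : ℝ, ‖Complex.exp (k * x)‖ = Real.exp (k * x) := fun x => by
    rw [Complex.norm_exp]; simp
  have hne' : ∀ x : ℝ, ‖Complex.exp (-(k * x))‖ = Real.exp (-(k * x)) := fun x => by
    rw [Complex.norm_exp]; simp
  have base : ∀ x, -R ≤ x → ‖leftInt k R a x‖ ≤ N / k * Real.exp (k * x) := by
    intro x hx
    have h1 : ‖leftInt k R a x‖ ≤ ∫ ξ in (-R)..x, N * Real.exp (k * ξ) := by
      refine intervalIntegral.norm_integral_le_of_norm_le hx
        (Eventually.of_forall fun ξ _ => ?_) (Continuous.intervalIntegrable (by fun_prop) _ _)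
      rw [norm_mul, hne, mul_comm]
      exact mul_le_mul_of_nonneg_right (hN ξ) (Real.exp_nonneg _)
    refine h1.trans ?_
    rw [intervalIntegral.integral_const_mul,
      intervalIntegral.integral_comp_mul_left (fun x => Real.exp x) hk.ne', integral_exp,
      smul_eq_mul, div_mul_eq_mul_div, mul_div_assoc, inv_mul_eq_div]
    have := Real.exp_pos (k * -R)
    gcongr
    linarith
  rcases le_total x (-R) with hx | hx
  · rw [leftInt_of_le hsupp hx, mul_zero, norm_zero]
    positivity
  · rw [norm_mul, hne']
    rcases le_total R x with hx' | hx'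
    · rw [leftInt_of_ge ha hsupp hx']
      calc _ ≤ Real.exp (-(k * x)) * (N / k * Real.exp (k * R)) := by
            gcongr
            exact base R (by linarith)
        _ = N / k * Real.exp (k * (R - x)) := by
            rw [mul_left_comm, ← Real.exp_add]; ring_nf
        _ ≤ _ := by
            rw [abs_of_nonneg (hR.trans hx')]
            refine mul_le_mul_of_nonneg_left (Real.exp_le_exp.mpr ?_) (by positivity)
            nlinarith
    · calc _ ≤ Real.exp (-(k * x)) * (N / k * Real.exp (k * x)) := by
            gcongr
            exact base x hx
        _ = N / k * Real.exp 0 := by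
            rw [mul_left_comm, ← Real.exp_add]; ring_nf
        _ ≤ _ := by
            gcongr
            exact mul_nonneg hc0 (sub_nonneg.mpr (abs_le.mpr ⟨hx, hx'⟩))

lemma rightInt_eq_leftInt (s : ℂ) (x : ℝ) :
    rightInt s R a x = leftInt s R (fun ξ => a (-ξ)) (-x) := by
  rw [rightInt, leftInt, ← intervalIntegral.integral_comp_neg]
  simp

lemma norm_exp_mul_rightInt_le (hR : 0 ≤ R) (hk : 0 < k) (hc0 : 0 ≤ c) (hc : c ≤ k) (ha : Continuous a)
    (hsupp : ∀ x, x ∉ Icc (-R) R → a x = 0) (hN : ∀ x, ‖a x‖ ≤ N) (x : ℝ) :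
    ‖Complex.exp (k * x) * rightInt k R a x‖ ≤ N / k * Real.exp (c * (R - |x|)) := by
  have := norm_exp_mul_leftInt_le hR hk hc0 hc (a := fun ξ => a (-ξ)) (by fun_prop)
    (R := R)
    (fun x hx => hsupp _ fun h => hx ⟨by linarith [h.2], by linarith [h.1]⟩) (fun x => hN _) (-x)
  rw [rightInt_eq_leftInt]
  simpa using this

lemma norm_expSol_le (hR : 0 ≤ R) (hk : 0 < k) (hc0 : 0 ≤ c) (hc : c ≤ k) (ha : Continuous a)
    (hsupp : ∀ x, x ∉ Icc (-R) R → a x = 0) (hN : ∀ x, ‖a x‖ ≤ N) (x : ℝ) :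
    ‖expSol k R a x‖ ≤ N / k ^ 2 * Real.exp (c * (R - |x|)) := by
  rw [expSol, norm_mul]
  have e : ‖1 / (2 * (k : ℂ))‖ = 1 / (2 * k) := by
    rw [norm_div, norm_one, norm_mul, Complex.norm_real, Real.norm_of_nonneg hk.le,
      Complex.norm_ofNat]
  calc _ ≤ 1 / (2 * k) * (N / k * Real.exp (c * (R - |x|)) + N / k * Real.exp (c * (R - |x|))) := by
        rw [e]
        gcongr
        exact (norm_add_le _ _).trans (add_le_add (norm_exp_mul_leftInt_le hR hk hc0 hc ha hsupp hN x)
          (norm_exp_mul_rightInt_le hR hk hc0 hc ha hsupp hN x))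
    _ = _ := by field_simp; ring

lemma norm_expSolDeriv_le (hR : 0 ≤ R) (hk : 0 < k) (hc0 : 0 ≤ c) (hc : c ≤ k) (ha : Continuous a)
    (hsupp : ∀ x, x ∉ Icc (-R) R → a x = 0) (hN : ∀ x, ‖a x‖ ≤ N) (x : ℝ) :
    ‖expSolDeriv k R a x‖ ≤ N / k * Real.exp (c * (R - |x|)) := by
  rw [expSolDeriv, norm_mul]
  calc _ ≤ 1 / 2 * (N / k * Real.exp (c * (R - |x|)) + N / k * Real.exp (c * (R - |x|))) := by
        gcongr
        · simp
        · exact (norm_sub_le _ _).trans (add_le_add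
            (norm_exp_mul_rightInt_le hR hk hc0 hc ha hsupp hN x)
            (norm_exp_mul_leftInt_le hR hk hc0 hc ha hsupp hN x))
    _ = _ := by ring

end ExpKerReal

/-! ### The exponents of the modes -/

/-- The decay rate of the mode `n ≠ 0`. -/
def decayRate (μ β : ℝ) (n : ℤ) : ℝ := if n = -1 then μ else kEvan n μ β

/-- The exponent `s_n` of the `n`-th Green function. -/
def modeExp (μ β : ℝ) (n : ℤ) : ℂ :=
  if n = 0 then -(Complex.I * kProp μ β) else (decayRate μ β n : ℂ)

lemma modeExp_zero (μ β : ℝ) : modeExp μ β 0 = -(Complex.I * kProp μ β) := if_pos rfl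

lemma modeExp_of_ne {n : ℤ} (hn : n ≠ 0) (μ β : ℝ) : modeExp μ β n = decayRate μ β n := if_neg hn

section ModeExp

variable {b d μ β : ℝ}

lemma GoodParam.modeExp_ne_zero (h : GoodParam b d μ β) (hμ : 0 < μ) (n : ℤ) :
    modeExp μ β n ≠ 0 := by
  rcases eq_or_ne n 0 with rfl | h0
  · rw [modeExp_zero]
    have : (kProp μ β : ℂ) ≠ 0 := by exact_mod_cast h.kProp_pos.ne'
    simp [this]
  · rw [modeExp_of_ne h0, decayRate]
    split_ifs with h1
    · exact_mod_cast hμ.ne'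
    · exact_mod_cast (h.kEvan_pos h0 h1).ne'

/-- The propagating mode becomes the exponential kernel with imaginary exponent `-ik₀`, so that one
calculus of `expSol` treats every mode. -/
lemma green_eq_expKer (h : GoodParam b d μ β) (n : ℤ) (x : ℝ) :
    green n μ β x = expKer (modeExp μ β n) x := by
  have hk : (kProp μ β : ℂ) ≠ 0 := by exact_mod_cast h.kProp_pos.ne'
  rw [green, expKer]
  split_ifs with h0 h1
  · rw [h0, modeExp_zero]
    have e : Complex.I / (2 * kProp μ β) = 1 / (2 * -(Complex.I * kProp μ β)) := by
      field_simp
      rw [Complex.I_sq]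
    rw [e]
    ring_nf
  · rw [modeExp_of_ne h0, decayRate, if_pos h1]
    push_cast
    rfl
  · rw [modeExp_of_ne h0, decayRate, if_neg h1]
    push_cast
    rfl

lemma GoodParam.modeExp_sq (h : GoodParam b d μ β) (n : ℤ) :
    modeExp μ β n ^ 2 = (((β + n) ^ 2 - omegaSq μ β : ℝ) : ℂ) := by
  rcases eq_or_ne n 0 with rfl | h0
  · rw [modeExp_zero, neg_sq, mul_pow, Complex.I_sq, ← Complex.ofReal_pow, h.kProp_sq, omegaSq]
    push_cast
    ring
  · rw [modeExp_of_ne h0, decayRate, ← Complex.ofReal_pow]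
    congr 1
    split_ifs with h1
    · rw [h1, omegaSq]
      push_cast
      ring
    · exact h.kEvan_sq h0 h1

/-- A common decay rate. -/
def minRate (b μ : ℝ) : ℝ := min μ (Real.sqrt b)

lemma GoodParam.minRate_pos (h : GoodParam b d μ β) (hμ : 0 < μ) : 0 < minRate b μ :=
  lt_min hμ h.sqrt_b_pos

lemma GoodParam.minRate_mul_le (h : GoodParam b d μ β) {n : ℤ} (hn : n ≠ 0) :
    minRate b μ * |(n : ℝ)| ≤ decayRate μ β n := by
  rw [decayRate]
  split_ifs with h1
  · rw [h1]
    simp [minRate]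
  · exact (mul_le_mul_of_nonneg_right (min_le_right _ _) (abs_nonneg _)).trans (h.le_kEvan hn h1)

end ModeExp

/-! ### Cut-off functions and mollification on the line -/

lemma contDiff_smoothTransition : ContDiff ℝ ∞ Real.smoothTransition :=
  Real.smoothTransition.contDiff

lemma hasCompactSupport_deriv_smoothTransition :
    HasCompactSupport (deriv Real.smoothTransition) := by
  refine HasCompactSupport.intro (isCompact_Icc (a := (0 : ℝ)) (b := 1)) fun x hx => ?_
  have : x < 0 ∨ 1 < x := by
    by_contra! h
    exact hx ⟨h.1, h.2⟩
  rcases this with h | h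
  · have : Real.smoothTransition =ᶠ[𝓝 x] fun _ => 0 := by
      filter_upwards [Iio_mem_nhds h] with y hy
      exact Real.smoothTransition.zero_of_nonpos (le_of_lt hy)
    rw [this.deriv_eq, deriv_const]
  · have : Real.smoothTransition =ᶠ[𝓝 x] fun _ => 1 := by
      filter_upwards [Ioi_mem_nhds h] with y hy
      exact Real.smoothTransition.one_of_one_le (le_of_lt hy)
    rw [this.deriv_eq, deriv_const]

lemma contDiff_deriv_smoothTransition : ContDiff ℝ ∞ (deriv Real.smoothTransition) :=
  ((contDiff_infty_iff_deriv (𝕜 := ℝ)).mp contDiff_smoothTransition).2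

/-- A smooth cut-off function, equal to `1` on `[-N, N]` and to `0` outside `[-N-1, N+1]`. -/
def cutoff (N x : ℝ) : ℝ :=
  Real.smoothTransition (N + 1 - x) * Real.smoothTransition (N + 1 + x)

lemma contDiff_cutoff (N : ℝ) : ContDiff ℝ ∞ (cutoff N) :=
  (contDiff_smoothTransition.comp (contDiff_const.sub contDiff_id)).mul
    (contDiff_smoothTransition.comp (contDiff_const.add contDiff_id))

lemma contDiff_deriv_cutoff (N : ℝ) : ContDiff ℝ ∞ (deriv (cutoff N)) :=
  ((contDiff_infty_iff_deriv (𝕜 := ℝ)).mp (contDiff_cutoff N)).2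

lemma cutoff_eq_one {N x : ℝ} (h : |x| ≤ N) : cutoff N x = 1 := by
  rw [abs_le] at h
  rw [cutoff, Real.smoothTransition.one_of_one_le (by linarith [h.2]),
    Real.smoothTransition.one_of_one_le (by linarith [h.1]), one_mul]

lemma cutoff_eq_zero {N x : ℝ} (h : N + 1 ≤ |x|) : cutoff N x = 0 := by
  rw [cutoff]
  rcases le_abs.mp h with h | h
  · rw [Real.smoothTransition.zero_of_nonpos (by linarith), zero_mul]
  · rw [Real.smoothTransition.zero_of_nonpos (x := N + 1 + x) (by linarith), mul_zero]

lemma cutoff_nonneg (N x : ℝ) : 0 ≤ cutoff N x :=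
  mul_nonneg (Real.smoothTransition.nonneg _) (Real.smoothTransition.nonneg _)

lemma cutoff_le_one (N x : ℝ) : cutoff N x ≤ 1 :=
  mul_le_one₀ (Real.smoothTransition.le_one _) (Real.smoothTransition.nonneg _)
    (Real.smoothTransition.le_one _)

lemma hasDerivAt_cutoff (N x : ℝ) : HasDerivAt (cutoff N) (deriv (cutoff N) x) x :=
  ((contDiff_cutoff N).differentiable (by simp) x).hasDerivAt

lemma hasDerivAt_deriv_cutoff (N x : ℝ) :
    HasDerivAt (deriv (cutoff N)) (deriv (deriv (cutoff N)) x) x :=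
  ((contDiff_deriv_cutoff N).differentiable (by simp) x).hasDerivAt

lemma deriv_cutoff_eq_zero_of_lt {N x : ℝ} (h : |x| < N) : deriv (cutoff N) x = 0 := by
  have : cutoff N =ᶠ[𝓝 x] fun _ => 1 := by
    filter_upwards [(isOpen_lt continuous_abs continuous_const).mem_nhds h] with y hy
    exact cutoff_eq_one (le_of_lt hy)
  rw [this.deriv_eq, deriv_const]

lemma deriv_cutoff_eq_zero_of_gt {N x : ℝ} (h : N + 1 < |x|) : deriv (cutoff N) x = 0 := by
  have : cutoff N =ᶠ[𝓝 x] fun _ => 0 := by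
    filter_upwards [(isOpen_lt continuous_const continuous_abs).mem_nhds h] with y hy
    exact cutoff_eq_zero (le_of_lt hy)
  rw [this.deriv_eq, deriv_const]

lemma deriv_deriv_cutoff_eq_zero_of_lt {N x : ℝ} (h : |x| < N) :
    deriv (deriv (cutoff N)) x = 0 := by
  have : deriv (cutoff N) =ᶠ[𝓝 x] fun _ => 0 := by
    filter_upwards [(isOpen_lt continuous_abs continuous_const).mem_nhds h] with y hy
    exact deriv_cutoff_eq_zero_of_lt hy
  rw [this.deriv_eq, deriv_const]

lemma deriv_deriv_cutoff_eq_zero_of_gt {N x : ℝ} (h : N + 1 < |x|) :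
    deriv (deriv (cutoff N)) x = 0 := by
  have : deriv (cutoff N) =ᶠ[𝓝 x] fun _ => 0 := by
    filter_upwards [(isOpen_lt continuous_const continuous_abs).mem_nhds h] with y hy
    exact deriv_cutoff_eq_zero_of_gt hy
  rw [this.deriv_eq, deriv_const]

/-- The cut-off is a product of a reflected translate and a translate of one fixed transition
function, whose first and second derivatives are bounded; hence the bound does not depend on `N`. -/
lemma exists_bound_deriv_cutoff : ∃ D : ℝ, 0 ≤ D ∧ ∀ N x : ℝ,
    |deriv (cutoff N) x| ≤ D ∧ |deriv (deriv (cutoff N)) x| ≤ D := by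
  set τ := Real.smoothTransition with hτ
  obtain ⟨D₁, h₁⟩ := hasCompactSupport_deriv_smoothTransition.exists_bound_of_continuous
    contDiff_deriv_smoothTransition.continuous
  obtain ⟨D₂, h₂⟩ := hasCompactSupport_deriv_smoothTransition.deriv.exists_bound_of_continuous
    ((contDiff_infty_iff_deriv (𝕜 := ℝ)).mp contDiff_deriv_smoothTransition).2.continuous
  simp only [Real.norm_eq_abs] at h₁ h₂
  have h₀ : ∀ x, |τ x| ≤ 1 := fun x => by
    rw [abs_of_nonneg (Real.smoothTransition.nonneg x)]; exact Real.smoothTransition.le_one x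
  have hD₁ : 0 ≤ D₁ := (abs_nonneg _).trans (h₁ 0)
  have hD₂ : 0 ≤ D₂ := (abs_nonneg _).trans (h₂ 0)
  have d0 : ∀ x, HasDerivAt τ (deriv τ x) x := fun x =>
    (contDiff_smoothTransition.differentiable (by simp) x).hasDerivAt
  have d1 : ∀ x, HasDerivAt (deriv τ) (deriv (deriv τ) x) x := fun x =>
    (contDiff_deriv_smoothTransition.differentiable (by simp) x).hasDerivAt
  have sub : ∀ {g g' : ℝ → ℝ} (_ : ∀ x, HasDerivAt g (g' x) x) (N x : ℝ),
      HasDerivAt (fun x => g (N + 1 - x)) (-g' (N + 1 - x)) x := fun hg N x => by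
    exact HasDerivAt.comp_const_sub (N + 1) x (hg _)
  have add : ∀ {g g' : ℝ → ℝ} (_ : ∀ x, HasDerivAt g (g' x) x) (N x : ℝ),
      HasDerivAt (fun x => g (N + 1 + x)) (g' (N + 1 + x)) x := fun hg N x => by
    exact HasDerivAt.comp_const_add (N + 1) x (hg _)
  have e1 : ∀ N, deriv (cutoff N) = fun x =>
      -deriv τ (N + 1 - x) * τ (N + 1 + x) + τ (N + 1 - x) * deriv τ (N + 1 + x) := fun N =>
    funext fun x => ((sub d0 N x).mul (add d0 N x)).deriv
  have e2 : ∀ N x, deriv (deriv (cutoff N)) x =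
      (deriv (deriv τ) (N + 1 - x) * τ (N + 1 + x) + -deriv τ (N + 1 - x) * deriv τ (N + 1 + x)) +
      (-deriv τ (N + 1 - x) * deriv τ (N + 1 + x) + τ (N + 1 - x) * deriv (deriv τ) (N + 1 + x)) := by
    intro N x
    rw [e1]
    have h := (((sub d1 N x).neg.mul (add d0 N x)).add ((sub d0 N x).mul (add d1 N x))).deriv
    rw [neg_neg] at h
    exact h
  have mb : ∀ {p q P Q : ℝ}, |p| ≤ P → |q| ≤ Q → |p * q| ≤ P * Q := fun hp hq => by
    rw [abs_mul]
    exact mul_le_mul hp hq (abs_nonneg _) ((abs_nonneg _).trans hp)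
  refine ⟨2 * D₁ + 2 * D₂ + 2 * D₁ ^ 2, by positivity, fun N x => ⟨?_, ?_⟩⟩
  · rw [e1]
    have a1 := mb ((abs_neg _).trans_le (h₁ (N + 1 - x))) (h₀ (N + 1 + x))
    have a2 := mb (h₀ (N + 1 - x)) (h₁ (N + 1 + x))
    refine (abs_add_le _ _).trans ?_
    nlinarith [sq_nonneg D₁]
  · rw [e2]
    have a1 := mb (h₂ (N + 1 - x)) (h₀ (N + 1 + x))
    have a2 := mb ((abs_neg _).trans_le (h₁ (N + 1 - x))) (h₁ (N + 1 + x))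
    have a3 := mb (h₀ (N + 1 - x)) (h₂ (N + 1 + x))
    refine (abs_add_le _ _).trans ((add_le_add (abs_add_le _ _) (abs_add_le _ _)).trans ?_)
    nlinarith

open scoped Convolution in
-- Mollification. The derivative of the convolution falls on `v`, and `v`, `v'` are uniformly
-- continuous as they have compact support, so both are approximated uniformly.
lemma exists_smooth_approx {v v' : ℝ → ℂ} {R : ℝ} (hv : ∀ x, HasDerivAt v (v' x) x)
    (hv' : Continuous v') (hR : ∀ x, R < |x| → v x = 0) {δ : ℝ} (hδ : 0 < δ) :
    ∃ u : ℝ → ℂ, ContDiff ℝ ∞ u ∧ (∀ x, R + 1 < |x| → u x = 0) ∧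
      ∀ x, ‖u x - v x‖ ≤ δ ∧ ‖deriv u x - v' x‖ ≤ δ := by
  have hder : deriv v = v' := funext fun x => (hv x).deriv
  have hvc : Continuous v := continuous_iff_continuousAt.mpr fun x => (hv x).continuousAt
  have hcs : HasCompactSupport v := by
    refine HasCompactSupport.intro (isCompact_Icc (a := -R) (b := R)) fun x hx => hR x ?_
    by_contra! h
    exact hx (abs_le.mp h)
  have hcs' : HasCompactSupport v' := hder ▸ hcs.deriv
  have huc := hcs.uniformContinuous_of_continuous hvc
  have huc' := hcs'.uniformContinuous_of_continuous hv'
  rw [Metric.uniformContinuous_iff] at huc huc'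
  obtain ⟨r₁, hr₁, h₁⟩ := huc δ hδ
  obtain ⟨r₂, hr₂, h₂⟩ := huc' δ hδ
  -- The bound by 1 keeps the support from growing by more than 1.
  set r := min 1 (min r₁ r₂) with hr
  have hrpos : 0 < r := lt_min one_pos (lt_min hr₁ hr₂)
  let φ : ContDiffBump (0 : ℝ) := ⟨r / 2, r, by positivity, by linarith⟩
  have hloc : LocallyIntegrable (φ.normed volume) volume :=
    φ.continuous_normed.locallyIntegrable
  set u : ℝ → ℂ := (φ.normed volume ⋆[ContinuousLinearMap.lsmul ℝ ℝ, volume] v : ℝ → ℂ) with hu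
  have hu' : ∀ x, HasDerivAt u
      ((φ.normed volume ⋆[ContinuousLinearMap.lsmul ℝ ℝ, volume] v' : ℝ → ℂ) x) x := by
    intro x
    rw [← hder]
    refine HasCompactSupport.hasDerivAt_convolution_right _ hloc hcs ?_ x
    rw [show (1 : WithTop ℕ∞) = 0 + 1 from rfl, contDiff_succ_iff_deriv]
    exact ⟨fun x => (hv x).differentiableAt, by simp, by rw [hder, contDiff_zero]; exact hv'⟩
  have hball : ∀ {x x₀ : ℝ}, x ∈ Metric.ball x₀ φ.rOut → dist x x₀ < r := fun h => h
  refine ⟨u, ?_, fun x hx => ?_, fun x => ⟨?_, ?_⟩⟩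
  · exact HasCompactSupport.contDiff_convolution_left _ φ.hasCompactSupport_normed
      φ.contDiff_normed hvc.locallyIntegrable
  · have h0 : v x = 0 := hR x (by linarith)
    -- Tolerance zero: `v` vanishes on the whole ball over which the average is taken.
    have := φ.dist_normed_convolution_le (μ := volume) (g := v) (x₀ := x) (ε := 0)
      hvc.aestronglyMeasurable fun y hy => by
        have hy1 : dist y x < 1 := (hball hy).trans_le (min_le_left _ _)
        have : R < |y| := by
          rw [Real.dist_eq, abs_sub_comm] at hy1
          have := abs_sub_abs_le_abs_sub x y
          linarith
        rw [h0, hR y this, dist_self]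
    rw [h0, dist_zero_right] at this
    exact norm_le_zero_iff.mp this
  · rw [← dist_eq_norm]
    refine φ.dist_normed_convolution_le hvc.aestronglyMeasurable fun y hy => ?_
    exact (h₁ ((hball hy).trans_le ((min_le_right _ _).trans (min_le_left _ _)))).le
  · rw [← dist_eq_norm, (hu' x).deriv]
    refine φ.dist_normed_convolution_le hv'.aestronglyMeasurable fun y hy => ?_
    exact (h₂ ((hball hy).trans_le ((min_le_right _ _).trans (min_le_right _ _)))).le

/-! ### Weighted approximation by test functions -/

/-- The quasiperiodic exponential `e^{i(β+n)y}`. -/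
def eMode (β : ℝ) (n : ℤ) (y : ℝ) : ℂ := Complex.exp (Complex.I * (β + n) * y)

lemma norm_eMode (β : ℝ) (n : ℤ) (y : ℝ) : ‖eMode β n y‖ = 1 := by
  have : Complex.I * (β + n) * y = ((β + n) * y : ℝ) * Complex.I := by push_cast; ring
  rw [eMode, this, Complex.norm_exp_ofReal_mul_I]

lemma contDiff_eMode (β : ℝ) (n : ℤ) : ContDiff ℝ ∞ (eMode β n) := by
  unfold eMode
  exact (contDiff_const.mul Complex.ofRealCLM.contDiff).cexp

@[fun_prop]
lemma continuous_eMode (β : ℝ) (n : ℤ) : Continuous (eMode β n) := (contDiff_eMode β n).continuous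

lemma hasDerivAt_eMode (β : ℝ) (n : ℤ) (y : ℝ) :
    HasDerivAt (eMode β n) (Complex.I * (β + n) * eMode β n y) y :=
  hasDerivAt_cexp_mul _ y

lemma eMode_two_pi (β : ℝ) (n : ℤ) :
    eMode β n (2 * Real.pi) = Complex.exp (2 * Real.pi * Complex.I * β) * eMode β n 0 := by
  rw [eMode, eMode]
  push_cast
  rw [mul_zero, Complex.exp_zero, mul_one, show Complex.I * ((β : ℂ) + n) * (2 * Real.pi) =
    2 * Real.pi * Complex.I * β + n * (2 * Real.pi * Complex.I) by ring, Complex.exp_add,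
    Complex.exp_int_mul_two_pi_mul_I, mul_one]

section Separated

variable {v : ℝ → ℂ} {β : ℝ} {n : ℤ}

lemma dX_mul_eMode (v : ℝ → ℂ) (β : ℝ) (n : ℤ) :
    dX (fun p => v p.1 * eMode β n p.2) = fun p => deriv v p.1 * eMode β n p.2 :=
  funext fun p => by simp only [dX, deriv_mul_const_field]

lemma dY_mul_eMode (v : ℝ → ℂ) (β : ℝ) (n : ℤ) :
    dY (fun p => v p.1 * eMode β n p.2) =
      fun p => Complex.I * (β + n) * v p.1 * eMode β n p.2 :=
  funext fun p => by
    rw [dY, ((hasDerivAt_eMode β n p.2).const_mul (v p.1)).deriv]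
    ring

lemma isTest_mul_eMode (hv : ContDiff ℝ ∞ v) {M : ℝ} (hM : ∀ x, M < |x| → v x = 0) :
    IsTest β (fun p => v p.1 * eMode β n p.2) := by
  refine ⟨(hv.comp contDiff_fst).mul ((contDiff_eMode β n).comp contDiff_snd), fun x => ?_,
    fun x => ?_, M, fun x y hx _ => ?_⟩
  · simp only [eMode_two_pi]
    ring
  · rw [dY_mul_eMode]
    simp only [eMode_two_pi]
    ring
  · simp only [hM x hx, zero_mul]

end Separated

section IsTest

variable {β : ℝ}

lemma isTest_zero (β : ℝ) : IsTest β (fun _ => 0) :=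
  ⟨contDiff_const, by simp, by simp [dY], 0, by simp⟩

lemma IsTest.add {φ ψ : ℝ × ℝ → ℂ} (hφ : IsTest β φ) (hψ : IsTest β ψ) :
    IsTest β (fun p => φ p + ψ p) ∧ dX (fun p => φ p + ψ p) = (fun p => dX φ p + dX ψ p) ∧
      dY (fun p => φ p + ψ p) = (fun p => dY φ p + dY ψ p) := by
  have e1 : dX (fun p => φ p + ψ p) = (fun p => dX φ p + dX ψ p) := funext fun p =>
    ((hasDerivAt_dX' hφ.1 p.1 p.2).add (hasDerivAt_dX' hψ.1 p.1 p.2)).deriv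
  have e2 : dY (fun p => φ p + ψ p) = (fun p => dY φ p + dY ψ p) := funext fun p =>
    ((hasDerivAt_dY' hφ.1 p.1 p.2).add (hasDerivAt_dY' hψ.1 p.1 p.2)).deriv
  refine ⟨⟨hφ.1.add hψ.1, fun x => ?_, fun x => ?_, ?_⟩, e1, e2⟩
  · simp only [hφ.2.1, hψ.2.1]
    ring
  · simp only [e2, hφ.2.2.1, hψ.2.2.1]
    ring
  · obtain ⟨M₁, h₁⟩ := hφ.2.2.2
    obtain ⟨M₂, h₂⟩ := hψ.2.2.2
    exact ⟨max M₁ M₂, fun x y hx hy => by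
      simp only [h₁ x y ((le_max_left _ _).trans_lt hx) hy, h₂ x y ((le_max_right _ _).trans_lt hx) hy,
        add_zero]⟩

lemma IsTest.sum {ι : Type*} (S : Finset ι) {φ : ι → ℝ × ℝ → ℂ} (hφ : ∀ i, IsTest β (φ i)) :
    IsTest β (fun p => ∑ i ∈ S, φ i p) ∧
      dX (fun p => ∑ i ∈ S, φ i p) = (fun p => ∑ i ∈ S, dX (φ i) p) ∧
      dY (fun p => ∑ i ∈ S, φ i p) = (fun p => ∑ i ∈ S, dY (φ i) p) := by
  classical
  induction S using Finset.induction_on with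
  | empty => exact ⟨isTest_zero β, by ext p; simp [dX], by ext p; simp [dY]⟩
  | insert i S hi ih =>
    simp only [Finset.sum_insert hi]
    obtain ⟨h1, h2, h3⟩ := (hφ i).add ih.1
    exact ⟨h1, h2.trans (by rw [ih.2.1]), h3.trans (by rw [ih.2.2])⟩

lemma IsTest.exists_support {φ : ℝ × ℝ → ℂ} (hφ : IsTest β φ) : ∃ M, 0 ≤ M ∧
    ∀ x y : ℝ, M < |x| → y ∈ Ioo 0 (2 * Real.pi) →
      φ (x, y) = 0 ∧ dX φ (x, y) = 0 ∧ dY φ (x, y) = 0 := by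
  obtain ⟨M, hM⟩ := hφ.2.2.2
  refine ⟨max M 0, le_max_right _ _, fun x y hx hy => ?_⟩
  have hx : M < |x| := (le_max_left _ _).trans_lt hx
  refine ⟨hM x y hx ⟨hy.1.le, hy.2.le⟩, ?_, ?_⟩
  · have : (fun x : ℝ => φ (x, y)) =ᶠ[𝓝 x] fun _ => 0 := by
      filter_upwards [(isOpen_lt continuous_const continuous_abs).mem_nhds hx] with t ht
      exact hM t y ht ⟨hy.1.le, hy.2.le⟩
    rw [dX, this.deriv_eq, deriv_const]
  · have : (fun y : ℝ => φ (x, y)) =ᶠ[𝓝 y] fun _ => 0 := by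
      filter_upwards [Ioo_mem_nhds hy.1 hy.2] with t ht
      exact hM x t hx ⟨ht.1.le, ht.2.le⟩
    rw [dY, this.deriv_eq, deriv_const]

end IsTest

/-! ### The strip measure -/

lemma stripMeasure_eq_prod :
    stripMeasure = (volume : Measure ℝ).prod (volume.restrict (Ioo 0 (2 * Real.pi))) := by
  rw [stripMeasure, Measure.volume_eq_prod, ← Measure.prod_restrict, Measure.restrict_univ]

lemma ae_stripMeasure_mem : ∀ᵐ p ∂stripMeasure, p.2 ∈ Ioo (0 : ℝ) (2 * Real.pi) := by
  have : ∀ᵐ p ∂stripMeasure, p ∈ univ ×ˢ Ioo (0 : ℝ) (2 * Real.pi) :=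
    ae_restrict_mem (MeasurableSet.univ.prod measurableSet_Ioo)
  filter_upwards [this] with p hp using hp.2

/-- The weight `e^{-c|x|}`. -/
def expWeight (c : ℝ) (p : ℝ × ℝ) : ℝ := Real.exp (-(c * |p.1|))

lemma continuous_expWeight (c : ℝ) : Continuous (expWeight c) := by
  unfold expWeight
  fun_prop

lemma expWeight_pos (c : ℝ) (p : ℝ × ℝ) : 0 < expWeight c p := Real.exp_pos _

lemma integrable_expWeight {c : ℝ} (hc : 0 < c) : Integrable (expWeight c) stripMeasure := by
  rw [stripMeasure_eq_prod]
  have h1 : Integrable (fun x : ℝ => Real.exp (-(c * |x|))) := by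
    rw [← integrableOn_univ, ← Iic_union_Ioi (a := (0 : ℝ))]
    refine IntegrableOn.union ?_ ?_
    · refine (integrableOn_exp_mul_Iic hc 0).congr_fun (fun x hx => ?_) measurableSet_Iic
      simp only [abs_of_nonpos (mem_Iic.mp hx)]
      ring_nf
    · refine (integrableOn_exp_mul_Ioi (neg_neg_of_pos hc) 0).congr_fun (fun x hx => ?_)
        measurableSet_Ioi
      simp only [abs_of_pos (mem_Ioi.mp hx)]
      ring_nf
  have := h1.mul_prod (integrable_const (μ := volume.restrict (Ioo 0 (2 * Real.pi))) (1 : ℝ))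
  simp only [mul_one] at this
  exact this

lemma memLp_expWeight {c : ℝ} (hc : 0 < c) : MemLp (expWeight c) 2 stripMeasure := by
  rw [memLp_two_iff_integrable_sq (continuous_expWeight c).aestronglyMeasurable]
  have : (fun p => expWeight c p ^ 2) = expWeight (2 * c) := by
    ext p
    rw [expWeight, expWeight, ← Real.exp_nat_mul]
    push_cast
    ring_nf
  rw [this]
  exact integrable_expWeight (by positivity)

lemma exists_le_expWeight {g : ℝ × ℝ → ℂ} (hg : Continuous g) {M : ℝ}
    (hM : ∀ x y : ℝ, M < |x| → y ∈ Ioo 0 (2 * Real.pi) → g (x, y) = 0) (c : ℝ) :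
    ∃ C, 0 ≤ C ∧ ∀ p : ℝ × ℝ, p.2 ∈ Ioo 0 (2 * Real.pi) → ‖g p‖ ≤ C * expWeight c p := by
  have hcomp : IsCompact (Icc (-M) M ×ˢ Icc (0 : ℝ) (2 * Real.pi)) := isCompact_Icc.prod isCompact_Icc
  obtain ⟨C, hC⟩ := hcomp.exists_bound_of_continuousOn
    (f := fun p => g p / (expWeight c p : ℂ)) (Continuous.continuousOn (hg.div
      (Complex.continuous_ofReal.comp (continuous_expWeight c))
      fun p => by exact_mod_cast (expWeight_pos c p).ne'))
  refine ⟨max C 0, le_max_right _ _, fun p hp => ?_⟩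
  rcases lt_or_ge M |p.1| with h | h
  · rw [show p = (p.1, p.2) from rfl, hM _ _ h hp, norm_zero]
    exact mul_nonneg (le_max_right _ _) (expWeight_pos c p).le
  · have := hC p ⟨abs_le.mp h, hp.1.le, hp.2.le⟩
    rw [norm_div, Complex.norm_real, Real.norm_of_nonneg (expWeight_pos c p).le,
      div_le_iff₀ (expWeight_pos c p)] at this
    exact this.trans (mul_le_mul_of_nonneg_right (le_max_left _ _) (expWeight_pos c p).le)

lemma memLp_of_le_expWeight {g : ℝ × ℝ → ℂ} (hg : AEStronglyMeasurable g stripMeasure) {c C : ℝ}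
    (hc : 0 < c) (h : ∀ p : ℝ × ℝ, p.2 ∈ Ioo 0 (2 * Real.pi) → ‖g p‖ ≤ C * expWeight c p) :
    MemLp g 2 stripMeasure := by
  refine ((memLp_expWeight hc).const_mul C).of_le hg ?_
  filter_upwards [ae_stripMeasure_mem] with p hp
  exact (h p hp).trans (le_abs_self _)

/-- Approximability by test functions, together with first derivatives, in a weighted sup norm. -/
def WApprox (β c : ℝ) (v vx vy : ℝ × ℝ → ℂ) : Prop :=
  ∀ δ > 0, ∃ φ, IsTest β φ ∧ ∀ p, ‖φ p - v p‖ ≤ δ * expWeight c p ∧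
    ‖dX φ p - vx p‖ ≤ δ * expWeight c p ∧ ‖dY φ p - vy p‖ ≤ δ * expWeight c p

lemma tendsto_eLpNorm_of_le_expWeight {c : ℝ} (hc : 0 < c) {g : ℕ → ℝ × ℝ → ℂ}
    (h : ∀ k p, ‖g k p‖ ≤ 1 / ((k : ℝ) + 1) * expWeight c p) :
    Tendsto (fun k => eLpNorm (g k) 2 stripMeasure) atTop (𝓝 0) := by
  have hW := (memLp_expWeight hc).eLpNorm_ne_top
  have hle : ∀ k, eLpNorm (g k) 2 stripMeasure ≤
      ENNReal.ofReal (1 / ((k : ℝ) + 1)) * eLpNorm (expWeight c) 2 stripMeasure := fun k =>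
    eLpNorm_le_mul_eLpNorm_of_ae_le_mul (Eventually.of_forall fun p => by
      rw [Real.norm_of_nonneg (expWeight_pos c p).le]; exact h k p) 2
  have h0 : Tendsto (fun k : ℕ => ENNReal.ofReal (1 / ((k : ℝ) + 1)) *
      eLpNorm (expWeight c) 2 stripMeasure) atTop (𝓝 0) := by
    have h1 : Tendsto (fun k : ℕ => ENNReal.ofReal (1 / ((k : ℝ) + 1))) atTop (𝓝 0) := by
      have := ENNReal.tendsto_ofReal (tendsto_one_div_add_atTop_nhds_zero_nat (𝕜 := ℝ))
      rwa [ENNReal.ofReal_zero] at this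
    have := ENNReal.Tendsto.mul_const h1 (Or.inr hW)
    rwa [zero_mul] at this
  exact tendsto_of_tendsto_of_tendsto_of_le_of_le tendsto_const_nhds h0 (fun _ => zero_le) hle

/-- The weight is square integrable on the strip, so smallness relative to it in sup norm gives `L²`
convergence. Square integrability of the limit comes from any one approximant, here the first. -/
lemma WApprox.memH1 {β c : ℝ} (hc : 0 < c) {v vx vy : ℝ × ℝ → ℂ} (h : WApprox β c v vx vy)
    (hv : Continuous v) (hvx : Continuous vx) (hvy : Continuous vy) : MemH1 β v vx vy := by
  choose φ hφ hφv using fun k : ℕ => h (1 / ((k : ℝ) + 1)) (by positivity)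
  obtain ⟨M, -, hM⟩ := (hφ 0).exists_support
  have mem : ∀ {g w : ℝ × ℝ → ℂ}, Continuous g → Continuous w →
      (∀ x y : ℝ, M < |x| → y ∈ Ioo 0 (2 * Real.pi) → g (x, y) = 0) →
      (∀ p, ‖g p - w p‖ ≤ 1 / (((0 : ℕ) : ℝ) + 1) * expWeight c p) → MemLp w 2 stripMeasure := by
    intro g w hg hw hgM hgw
    obtain ⟨C, -, hC⟩ := exists_le_expWeight hg hgM c
    refine memLp_of_le_expWeight hw.aestronglyMeasurable hc
      (C := C + 1 / (((0 : ℕ) : ℝ) + 1)) fun p hp => ?_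
    have h1 : ‖w p‖ ≤ ‖g p‖ + ‖g p - w p‖ := by
      simpa using norm_sub_le (g p) (g p - w p)
    rw [add_mul]
    exact h1.trans (add_le_add (hC p hp) (hgw p))
  refine ⟨mem (hφ 0).1.continuous hv (fun x y hx hy => (hM x y hx hy).1) fun p => (hφv 0 p).1,
    mem (contDiff_dX (hφ 0).1).continuous hvx (fun x y hx hy => (hM x y hx hy).2.1)
      fun p => (hφv 0 p).2.1,
    mem (contDiff_dY (hφ 0).1).continuous hvy (fun x y hx hy => (hM x y hx hy).2.2)
      fun p => (hφv 0 p).2.2, φ, hφ, ?_, ?_, ?_⟩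
  · exact tendsto_eLpNorm_of_le_expWeight hc fun k p => (hφv k p).1
  · exact tendsto_eLpNorm_of_le_expWeight hc fun k p => (hφv k p).2.1
  · exact tendsto_eLpNorm_of_le_expWeight hc fun k p => (hφv k p).2.2

lemma expWeight_eq (c : ℝ) (p : ℝ × ℝ) : expWeight c p = Real.exp (-(c * |p.1|)) := rfl

/-- Truncate with a cut-off, then mollify. Half of the decay rate is given up: `e^{-c|x|} ≤
e^{-cN/2} e^{-c|x|/2}` for `|x| ≥ N` turns the remaining half into smallness of the truncation
error. -/
lemma wApprox_mode {β c K : ℝ} {n : ℤ} {w w' : ℝ → ℂ} (hc : 0 < c)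
    (hw : ∀ x, HasDerivAt w (w' x) x) (hw' : Continuous w')
    (hK : ∀ x, ‖w x‖ ≤ K * Real.exp (-(c * |x|))) (hK' : ∀ x, ‖w' x‖ ≤ K * Real.exp (-(c * |x|))) :
    WApprox β (c / 2) (fun p => w p.1 * eMode β n p.2) (fun p => w' p.1 * eMode β n p.2)
      (fun p => Complex.I * (β + n) * w p.1 * eMode β n p.2) := by
  obtain ⟨D, hD0, hD⟩ := exists_bound_deriv_cutoff
  have hK0 : 0 ≤ K := by
    have := (norm_nonneg _).trans (hK 0)
    simpa using this
  -- approximation on the line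
  have line : ∀ δ > 0, ∃ u : ℝ → ℂ, ContDiff ℝ ∞ u ∧ (∃ M, ∀ x, M < |x| → u x = 0) ∧
      ∀ x, ‖u x - w x‖ ≤ δ * Real.exp (-(c / 2 * |x|)) ∧
        ‖deriv u x - w' x‖ ≤ δ * Real.exp (-(c / 2 * |x|)) := by
    intro δ hδ
    obtain ⟨N, hN⟩ : ∃ N : ℝ, K * (D + 1) * Real.exp (-(c / 2 * N)) ≤ δ / 2 := by
      have h1 : Tendsto (fun N : ℝ => K * (D + 1) * Real.exp (-(c / 2 * N))) atTop
          (𝓝 (K * (D + 1) * 0)) := by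
        refine Tendsto.const_mul _ (Real.tendsto_exp_neg_atTop_nhds_zero.comp ?_)
        exact tendsto_id.const_mul_atTop (by positivity)
      rw [mul_zero] at h1
      exact (h1.eventually_le_const (by positivity)).exists
    have hsplit : ∀ x, N ≤ |x| → Real.exp (-(c * |x|)) ≤
        Real.exp (-(c / 2 * N)) * Real.exp (-(c / 2 * |x|)) := by
      intro x hx
      rw [← Real.exp_add, Real.exp_le_exp]
      nlinarith
    set v : ℝ → ℂ := fun x => (cutoff N x : ℂ) * w x with hv
    set v' : ℝ → ℂ := fun x => ((deriv (cutoff N) x : ℝ) : ℂ) * w x + (cutoff N x : ℂ) * w' x with hv'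
    have hvd : ∀ x, HasDerivAt v (v' x) x := fun x => (hasDerivAt_cutoff N x).ofReal_comp.mul (hw x)
    have hwc : Continuous w := continuous_iff_continuousAt.mpr fun x => (hw x).continuousAt
    have hvc : Continuous v' := by
      have h1 := (contDiff_cutoff N).continuous
      have h2 := (contDiff_deriv_cutoff N).continuous
      fun_prop
    have hv0 : ∀ x, N + 1 < |x| → v x = 0 := fun x hx => by
      simp only [hv, cutoff_eq_zero hx.le, Complex.ofReal_zero, zero_mul]
    have hv0' : ∀ x, N + 1 < |x| → v' x = 0 := fun x hx => by
      simp only [hv', cutoff_eq_zero hx.le, deriv_cutoff_eq_zero_of_gt hx, Complex.ofReal_zero,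
        zero_mul, add_zero]
    have hcut : ∀ x, ‖((cutoff N x : ℝ) : ℂ) - 1‖ ≤ 1 := fun x => by
      rw [← Complex.ofReal_one, ← Complex.ofReal_sub, Complex.norm_real, Real.norm_eq_abs, abs_le]
      constructor <;> linarith [cutoff_nonneg N x, cutoff_le_one N x]
    have hvw : ∀ x, ‖v x - w x‖ ≤ δ / 2 * Real.exp (-(c / 2 * |x|)) ∧
        ‖v' x - w' x‖ ≤ δ / 2 * Real.exp (-(c / 2 * |x|)) := by
      intro x
      have e1 : v x - w x = ((cutoff N x : ℂ) - 1) * w x := by simp only [hv]; ring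
      have e2 : v' x - w' x = ((deriv (cutoff N) x : ℝ) : ℂ) * w x + ((cutoff N x : ℂ) - 1) * w' x := by
        simp only [hv']; ring
      rcases lt_or_ge |x| N with hx | hx
      · rw [e1, e2, cutoff_eq_one hx.le, deriv_cutoff_eq_zero_of_lt hx]
        simp only [Complex.ofReal_zero, Complex.ofReal_one, sub_self, zero_mul, add_zero, norm_zero]
        have : 0 ≤ δ / 2 * Real.exp (-(c / 2 * |x|)) := by positivity
        exact ⟨this, this⟩
      · have b : K * (D + 1) * Real.exp (-(c * |x|)) ≤ δ / 2 * Real.exp (-(c / 2 * |x|)) := by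
          calc _ ≤ K * (D + 1) * (Real.exp (-(c / 2 * N)) * Real.exp (-(c / 2 * |x|))) := by
                gcongr
                exact hsplit x hx
            _ = K * (D + 1) * Real.exp (-(c / 2 * N)) * Real.exp (-(c / 2 * |x|)) := by ring
            _ ≤ _ := by gcongr
        have c1 : ‖((cutoff N x : ℂ) - 1) * w x‖ ≤ K * Real.exp (-(c * |x|)) := by
          rw [norm_mul]
          exact (mul_le_of_le_one_left (norm_nonneg _) (hcut x)).trans (hK x)
        have c2 : ‖((cutoff N x : ℂ) - 1) * w' x‖ ≤ K * Real.exp (-(c * |x|)) := by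
          rw [norm_mul]
          exact (mul_le_of_le_one_left (norm_nonneg _) (hcut x)).trans (hK' x)
        have c3 : ‖((deriv (cutoff N) x : ℝ) : ℂ) * w x‖ ≤ D * (K * Real.exp (-(c * |x|))) := by
          rw [norm_mul, Complex.norm_real]
          exact mul_le_mul (hD N x).1 (hK x) (norm_nonneg _) hD0
        have c4 : 0 ≤ D * (K * Real.exp (-(c * |x|))) := by positivity
        rw [e1, e2]
        exact ⟨by linarith, (norm_add_le _ _).trans (by linarith)⟩
    -- The weight is smallest at the edge `|x| = N + 2` of the mollified support, so a uniform error
    -- of this size is below the weight everywhere on it.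
    set δ' := δ / 2 * Real.exp (-(c / 2 * (N + 2))) with hδ'
    obtain ⟨u, hu, hu0, huv⟩ := exists_smooth_approx hvd hvc hv0 (show 0 < δ' by positivity)
    have hsmall : ∀ x {z : ℂ}, ‖z‖ ≤ δ' → (N + 2 < |x| → z = 0) →
        ‖z‖ ≤ δ / 2 * Real.exp (-(c / 2 * |x|)) := by
      intro x z hz hz0
      rcases lt_or_ge (N + 2) |x| with hx | hx
      · rw [hz0 hx, norm_zero]
        positivity
      · refine hz.trans ?_
        rw [hδ']
        gcongr
    have hder0 : ∀ x, N + 2 < |x| → deriv u x = 0 := fun x hx => by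
      have : u =ᶠ[𝓝 x] fun _ => 0 := by
        filter_upwards [(isOpen_lt continuous_const continuous_abs).mem_nhds hx] with t ht
        have ht : N + 2 < |t| := ht
        exact hu0 t (by linarith)
      rw [this.deriv_eq, deriv_const]
    refine ⟨u, hu, ⟨N + 1 + 1, hu0⟩, fun x => ⟨?_, ?_⟩⟩
    · have h1 := hsmall x (huv x).1 fun hx => by
        rw [hu0 x (by linarith), hv0 x (by linarith), sub_self]
      have h2 := norm_add_le (u x - v x) (v x - w x)
      rw [sub_add_sub_cancel] at h2
      linarith [(hvw x).1]
    · have h1 := hsmall x (huv x).2 fun hx => by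
        rw [hder0 x hx, hv0' x (by linarith), sub_self]
      have h2 := norm_add_le (deriv u x - v' x) (v' x - w' x)
      rw [sub_add_sub_cancel] at h2
      linarith [(hvw x).2]
  intro δ hδ
  -- Differentiation in `y` multiplies the error by `|β + n|`, which this factor absorbs.
  set L := 1 + ‖Complex.I * ((β : ℂ) + n)‖ with hL
  have hL1 : 1 ≤ L := by
    rw [hL]
    linarith [norm_nonneg (Complex.I * ((β : ℂ) + n))]
  obtain ⟨u, hu, ⟨M, hM⟩, huw⟩ := line (δ / L) (by positivity)
  have hle : δ / L ≤ δ := div_le_self hδ.le hL1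
  refine ⟨fun p => u p.1 * eMode β n p.2, isTest_mul_eMode hu hM, fun p => ⟨?_, ?_, ?_⟩⟩
  · rw [← sub_mul, norm_mul, norm_eMode, mul_one]
    exact (huw p.1).1.trans (mul_le_mul_of_nonneg_right hle (Real.exp_nonneg _))
  · rw [dX_mul_eMode, ← sub_mul, norm_mul, norm_eMode, mul_one]
    exact (huw p.1).2.trans (mul_le_mul_of_nonneg_right hle (Real.exp_nonneg _))
  · rw [dY_mul_eMode, ← sub_mul, ← mul_sub, norm_mul, norm_mul, norm_eMode, mul_one]
    calc _ ≤ L * (δ / L * Real.exp (-(c / 2 * |p.1|))) := by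
          gcongr
          · rw [hL]; linarith
          · exact (huw p.1).1
      _ = δ * expWeight (c / 2) p := by
          rw [expWeight_eq]
          field_simp

/-! ### Series of decaying modes. -/

section Series

variable {β c : ℝ} {C : ℤ → ℝ}

/-- A function given by its modes. -/
def modeSeries (β : ℝ) (g : ℤ → ℝ → ℂ) (p : ℝ × ℝ) : ℂ := ∑' n, g n p.1 * eMode β n p.2

lemma norm_mode_le (hc : 0 < c) {g : ℤ → ℝ → ℂ}
    (hg : ∀ n x, ‖g n x‖ ≤ C n * Real.exp (-(c * |x|))) (n : ℤ) (p : ℝ × ℝ) :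
    ‖g n p.1 * eMode β n p.2‖ ≤ C n * expWeight (c / 2) p := by
  have hC0 : 0 ≤ C n := by
    have := (norm_nonneg _).trans (hg n 0)
    simpa using this
  rw [norm_mul, norm_eMode, mul_one]
  refine (hg n p.1).trans (mul_le_mul_of_nonneg_left (Real.exp_le_exp.mpr ?_) hC0)
  nlinarith [abs_nonneg p.1]

lemma hasSum_modeSeries (hc : 0 < c) (hC : Summable C) {g : ℤ → ℝ → ℂ}
    (hg : ∀ n x, ‖g n x‖ ≤ C n * Real.exp (-(c * |x|))) (p : ℝ × ℝ) :
    HasSum (fun n => g n p.1 * eMode β n p.2) (modeSeries β g p) :=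
  (Summable.of_norm_bounded (hC.mul_right _) fun n => norm_mode_le hc hg n p).hasSum

lemma continuous_modeSeries (hc : 0 < c) (hC : Summable C) {g : ℤ → ℝ → ℂ}
    (hgc : ∀ n, Continuous (g n)) (hg : ∀ n x, ‖g n x‖ ≤ C n * Real.exp (-(c * |x|))) :
    Continuous (modeSeries β g) := by
  refine continuous_tsum (fun n => ((hgc n).comp continuous_fst).mul
    ((continuous_eMode β n).comp continuous_snd)) hC fun n p => ?_
  have hC0 : 0 ≤ C n := by
    have := (norm_nonneg _).trans (hg n 0)
    simpa using this
  refine (norm_mode_le hc hg n p).trans (mul_le_of_le_one_right hC0 ?_)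
  rw [expWeight_eq, Real.exp_le_one_iff, neg_nonpos]
  positivity

/-- A finite partial sum is approximated mode by mode, and the tail is small relative to the weight
by summability of the bounds. -/
lemma wApprox_modeSeries (hc : 0 < c) (hC : Summable C) {w w' : ℤ → ℝ → ℂ}
    (hw : ∀ n x, HasDerivAt (w n) (w' n x) x) (hw' : ∀ n, Continuous (w' n))
    (h0 : ∀ n x, ‖w n x‖ ≤ C n * Real.exp (-(c * |x|)))
    (h1 : ∀ n x, ‖w' n x‖ ≤ C n * Real.exp (-(c * |x|)))
    (h2 : ∀ n x, ‖Complex.I * (β + n) * w n x‖ ≤ C n * Real.exp (-(c * |x|))) :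
    WApprox β (c / 2) (modeSeries β w) (modeSeries β w')
      (modeSeries β fun n x => Complex.I * (β + n) * w n x) := by
  intro δ hδ
  have htail : ∃ S : Finset ℤ, ∑' n : {n // n ∉ S}, C n < δ / 2 :=
    ((tendsto_order.mp (tendsto_tsum_compl_atTop_zero C)).2 _ (by positivity)).exists
  obtain ⟨S, hS⟩ := htail
  -- The tolerance for each mode, so that the errors over `S` add up to at most `δ/2`; the `+ 1`
  -- covers the empty set.
  have hpos : 0 < δ / (2 * (S.card + 1)) := by positivity
  choose φ hφ hφw using fun n => wApprox_mode (β := β) (n := n) hc (hw n) (hw' n) (h0 n) (h1 n) _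
    hpos
  obtain ⟨ht, htx, hty⟩ := IsTest.sum S hφ
  have key : ∀ {g : ℤ → ℝ → ℂ} {ψ : ℤ → ℝ × ℝ → ℂ},
      (∀ n x, ‖g n x‖ ≤ C n * Real.exp (-(c * |x|))) →
      (∀ n p, ‖ψ n p - g n p.1 * eMode β n p.2‖ ≤
        δ / (2 * (S.card + 1)) * expWeight (c / 2) p) → ∀ p,
      ‖∑ n ∈ S, ψ n p - modeSeries β g p‖ ≤ δ * expWeight (c / 2) p := by
    intro g ψ hg hψ p
    have hs := hasSum_modeSeries (β := β) hc hC hg p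
    have e1 : modeSeries β g p = ∑ n ∈ S, g n p.1 * eMode β n p.2 +
        ∑' n : {n // n ∉ S}, g n p.1 * eMode β n p.2 := by
      rw [← hs.tsum_eq]
      exact (hs.summable.sum_add_tsum_subtype_compl S).symm
    have e2 : ‖∑' n : {n // n ∉ S}, g n p.1 * eMode β n p.2‖ ≤
        (∑' n : {n // n ∉ S}, C n) * expWeight (c / 2) p := by
      rw [← tsum_mul_right]
      exact tsum_of_norm_bounded ((hC.subtype _).mul_right _).hasSum
        fun n => norm_mode_le hc hg n p
    have e3 : ‖∑ n ∈ S, (ψ n p - g n p.1 * eMode β n p.2)‖ ≤ δ / 2 * expWeight (c / 2) p := by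
      refine (norm_sum_le_of_le S fun n _ => hψ n p).trans ?_
      rw [Finset.sum_const, nsmul_eq_mul, ← mul_assoc]
      refine mul_le_mul_of_nonneg_right ?_ (expWeight_pos _ _).le
      rw [mul_div_assoc', div_le_div_iff₀ (by positivity) (by positivity)]
      nlinarith
    have e4 := mul_le_mul_of_nonneg_right hS.le (expWeight_pos (c / 2) p).le
    have e5 : ∑ n ∈ S, ψ n p - modeSeries β g p =
        ∑ n ∈ S, (ψ n p - g n p.1 * eMode β n p.2) -
          ∑' n : {n // n ∉ S}, g n p.1 * eMode β n p.2 := by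
      rw [e1, Finset.sum_sub_distrib]
      ring
    rw [e5]
    refine (norm_sub_le _ _).trans ?_
    linarith
  refine ⟨_, ht, fun p => ⟨key h0 (fun n p => (hφw n p).1) p, ?_, ?_⟩⟩
  · rw [htx]
    exact key h1 (fun n p => (hφw n p).2.1) p
  · rw [hty]
    exact key h2 (fun n p => (hφw n p).2.2) p

end Series

/-! ### Integration by parts on the strip -/

lemma integrable_strip_of_support {g : ℝ × ℝ → ℂ} (hg : Continuous g) {M : ℝ}
    (hM : ∀ x y : ℝ, M < |x| → y ∈ Ioo 0 (2 * Real.pi) → g (x, y) = 0) :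
    Integrable g stripMeasure := by
  obtain ⟨C, -, hC⟩ := exists_le_expWeight hg hM 1
  refine ((integrable_expWeight one_pos).const_mul C).mono' hg.aestronglyMeasurable ?_
  filter_upwards [ae_stripMeasure_mem] with p hp using hC p hp

lemma integral_strip {g : ℝ × ℝ → ℂ} (hg : Integrable g stripMeasure) :
    ∫ p, g p ∂stripMeasure = ∫ x : ℝ, ∫ y in (0 : ℝ)..(2 * Real.pi), g (x, y) := by
  rw [stripMeasure_eq_prod] at hg ⊢
  rw [integral_prod _ hg]
  congr 1
  ext x
  rw [intervalIntegral.integral_of_le (by positivity), integral_Ioc_eq_integral_Ioo]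

lemma integral_strip_symm {g : ℝ × ℝ → ℂ} (hg : Integrable g stripMeasure) :
    ∫ p, g p ∂stripMeasure = ∫ y in Ioo 0 (2 * Real.pi), ∫ x : ℝ, g (x, y) := by
  rw [stripMeasure_eq_prod] at hg ⊢
  rw [integral_prod_symm _ hg]

lemma integral_deriv_eq_zero_of_support {g g' : ℝ → ℂ} (hg : ∀ x, HasDerivAt g (g' x) x)
    (hc : Continuous g') {M : ℝ} (hM : ∀ x, M < |x| → g x = 0 ∧ g' x = 0) : ∫ x, g' x = 0 := by
  have hgc : Continuous g := continuous_iff_continuousAt.mpr fun x => (hg x).continuousAt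
  have aux : ∀ h : ℝ → ℂ, Continuous h → (∀ x, M < |x| → h x = 0) → Integrable h := by
    intro h hh h0
    refine hh.integrable_of_hasCompactSupport
      (HasCompactSupport.intro (isCompact_Icc (a := -M) (b := M)) fun x hx => h0 x ?_)
    by_contra! h
    exact hx (abs_le.mp h)
  exact integral_eq_zero_of_hasDerivAt_of_integrable hg (aux _ hc fun x hx => (hM x hx).2)
    (aux _ hgc fun x hx => (hM x hx).1)

lemma conj_eMode (β : ℝ) (n : ℤ) (y : ℝ) :
    starRingEnd ℂ (eMode β n y) = Complex.exp (-(Complex.I * (β + n)) * y) := by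
  rw [eMode, ← Complex.exp_conj]
  congr 1
  simp

lemma continuous_conj_eMode (β : ℝ) (n : ℤ) : Continuous fun y => starRingEnd ℂ (eMode β n y) :=
  Complex.continuous_conj.comp (continuous_eMode β n)

/-- The difference of the integrands is `J + L`, where `J` is the `x`-derivative of `U g'` times the
conjugate exponential and `L` is a multiple of the `y`-derivative of `U` times that exponential,
which is periodic because the quasiperiodic factors cancel. The alternative in `hM` admits compact
support of either `U` or `g`: the first serves test functions, the second the far field. -/
lemma integral_by_parts_strip {β : ℝ} {n : ℤ} {U : ℝ × ℝ → ℂ} {g g' g'' : ℝ → ℂ} {M : ℝ}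
    (hU : ContDiff ℝ ∞ U)
    (hper : ∀ x : ℝ, U (x, 2 * Real.pi) = Complex.exp (2 * Real.pi * Complex.I * β) * U (x, 0))
    (hg : ∀ x, HasDerivAt g (g' x) x) (hg' : ∀ x, HasDerivAt g' (g'' x) x) (hg'' : Continuous g'')
    (hM : ∀ x, M < |x| → (∀ y ∈ Ioo 0 (2 * Real.pi), U (x, y) = 0 ∧ dX U (x, y) = 0 ∧
      dY U (x, y) = 0) ∨ (g x = 0 ∧ g' x = 0 ∧ g'' x = 0)) :
    ∫ p, (dX U p * g' p.1 - Complex.I * (β + n) * (dY U p * g p.1)) *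
        starRingEnd ℂ (eMode β n p.2) ∂stripMeasure =
      ∫ p, U p * (-g'' p.1 + (β + n) ^ 2 * g p.1) * starRingEnd ℂ (eMode β n p.2)
        ∂stripMeasure := by
  have hUc := hU.continuous
  have hXc := (contDiff_dX hU).continuous
  have hYc := (contDiff_dY hU).continuous
  have hgc : Continuous g := continuous_iff_continuousAt.mpr fun x => (hg x).continuousAt
  have hgc' : Continuous g' := continuous_iff_continuousAt.mpr fun x => (hg' x).continuousAt
  have hec := continuous_conj_eMode β n
  set J : ℝ × ℝ → ℂ := fun p => (dX U p * g' p.1 + U p * g'' p.1) *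
    starRingEnd ℂ (eMode β n p.2) with hJ
  set L : ℝ × ℝ → ℂ := fun p => g p.1 * (-(Complex.I * (β + n)) *
    (dY U p * starRingEnd ℂ (eMode β n p.2) +
      U p * (-(Complex.I * (β + n)) * starRingEnd ℂ (eMode β n p.2)))) with hL
  have hJi : Integrable J stripMeasure := by
    refine integrable_strip_of_support (M := M) (by simp only [hJ]; fun_prop) fun x y hx hy => ?_
    simp only [hJ]
    rcases hM x hx with h | h
    · simp [(h y hy).1, (h y hy).2.1]
    · simp [h.2.1, h.2.2]
  have hLi : Integrable L stripMeasure := by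
    refine integrable_strip_of_support (M := M) (by simp only [hL]; fun_prop) fun x y hx hy => ?_
    simp only [hL]
    rcases hM x hx with h | h
    · simp [(h y hy).1, (h y hy).2.2]
    · simp [h.1]
  have hJ0 : ∫ p, J p ∂stripMeasure = 0 := by
    rw [integral_strip_symm hJi]
    refine setIntegral_eq_zero_of_forall_eq_zero fun y hy => ?_
    have : ∫ x : ℝ, (dX U (x, y) * g' x + U (x, y) * g'' x) = 0 := by
      refine integral_deriv_eq_zero_of_support (g := fun x => U (x, y) * g' x) (M := M)
        (fun x => (hasDerivAt_dX' hU x y).mul (hg' x)) (by fun_prop) fun x hx => ?_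
      rcases hM x hx with h | h
      · simp [(h y hy).1, (h y hy).2.1]
      · simp [h.2.1, h.2.2]
    simp only [hJ]
    rw [integral_mul_const, this, zero_mul]
  have hL0 : ∫ p, L p ∂stripMeasure = 0 := by
    rw [integral_strip hLi]
    have h0 : ∀ x, ∫ y in (0 : ℝ)..(2 * Real.pi), (dY U (x, y) * starRingEnd ℂ (eMode β n y) +
        U (x, y) * (-(Complex.I * (β + n)) * starRingEnd ℂ (eMode β n y))) = 0 := by
      intro x
      have hd : ∀ y : ℝ, HasDerivAt (fun y => U (x, y) * starRingEnd ℂ (eMode β n y))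
          (dY U (x, y) * starRingEnd ℂ (eMode β n y) +
          U (x, y) * (-(Complex.I * (β + n)) * starRingEnd ℂ (eMode β n y))) y := by
        intro y
        simp only [conj_eMode]
        exact (hasDerivAt_dY' hU x y).mul (hasDerivAt_cexp_mul _ y)
      rw [intervalIntegral.integral_eq_sub_of_hasDerivAt (fun y _ => hd y)
        (Continuous.intervalIntegrable (by fun_prop) _ _), hper, eMode_two_pi, map_mul]
      have e : Complex.exp (2 * Real.pi * Complex.I * β) *
          starRingEnd ℂ (Complex.exp (2 * Real.pi * Complex.I * β)) = 1 := by
        rw [Complex.mul_conj, Complex.normSq_eq_norm_sq,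
          show 2 * (Real.pi : ℂ) * Complex.I * β = (2 * Real.pi * β : ℝ) * Complex.I by
            push_cast; ring, Complex.norm_exp_ofReal_mul_I]
        simp
      linear_combination (U (x, 0) * starRingEnd ℂ (eMode β n 0)) * e
    have h1 : ∀ x, ∫ y in (0 : ℝ)..(2 * Real.pi), L (x, y) = 0 := by
      intro x
      simp only [hL]
      rw [intervalIntegral.integral_const_mul, intervalIntegral.integral_const_mul, h0, mul_zero,
        mul_zero]
    simp only [h1, integral_zero]
  have hLHS : Integrable (fun p => (dX U p * g' p.1 - Complex.I * (β + n) * (dY U p * g p.1)) *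
        starRingEnd ℂ (eMode β n p.2)) stripMeasure := by
    refine integrable_strip_of_support (M := M) (by fun_prop) fun x y hx hy => ?_
    rcases hM x hx with h | h
    · simp [(h y hy).2.1, (h y hy).2.2]
    · simp [h.1, h.2.1]
  have hRHS : Integrable (fun p => U p * (-g'' p.1 + (β + n) ^ 2 * g p.1) *
      starRingEnd ℂ (eMode β n p.2)) stripMeasure := by
    refine integrable_strip_of_support (M := M) (by fun_prop) fun x y hx hy => ?_
    rcases hM x hx with h | h
    · simp [(h y hy).1]
    · simp [h.1, h.2.2]
  have hsum : ∫ p, (J p + L p) ∂stripMeasure = 0 := by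
    rw [integral_add hJi hLi, hJ0, hL0, add_zero]
  rw [← sub_eq_zero, ← integral_sub hLHS hRHS, ← hsum]
  refine integral_congr_ae (Eventually.of_forall fun p => ?_)
  simp only [hJ, hL]
  linear_combination (-(β + n) ^ 2 * U p * g p.1 * starRingEnd ℂ (eMode β n p.2)) *
    Complex.I_sq

lemma integral_test_mode {β : ℝ} {n : ℤ} {Φ : ℝ × ℝ → ℂ} (hΦ : IsTest β Φ) {g g' g'' : ℝ → ℂ}
    (hg : ∀ x, HasDerivAt g (g' x) x) (hg' : ∀ x, HasDerivAt g' (g'' x) x)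
    (hg'' : Continuous g'') :
    ∫ p, (g' p.1 * eMode β n p.2 * starRingEnd ℂ (dX Φ p) +
        Complex.I * (β + n) * g p.1 * eMode β n p.2 * starRingEnd ℂ (dY Φ p)) ∂stripMeasure =
      ∫ p, (-g'' p.1 + (β + n) ^ 2 * g p.1) * eMode β n p.2 * starRingEnd ℂ (Φ p)
        ∂stripMeasure := by
  obtain ⟨M, -, hM⟩ := hΦ.exists_support
  have hconj : ∀ {h : ℝ → ℂ} {h' : ℂ} {x : ℝ}, HasDerivAt h h' x →
      HasDerivAt (fun x => starRingEnd ℂ (h x)) (starRingEnd ℂ h') x := fun hh =>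
    (Complex.conjCLE.toContinuousLinearMap.hasFDerivAt).comp_hasDerivAt _ hh
  have := congrArg (starRingEnd ℂ) (integral_by_parts_strip (n := n) hΦ.1 hΦ.2.1
    (fun x => hconj (hg x)) (fun x => hconj (hg' x)) (Complex.continuous_conj.comp hg'')
    (M := M) fun x hx => Or.inl fun y hy => hM x y hx hy)
  rw [← integral_conj, ← integral_conj] at this
  refine Eq.trans ?_ (this.trans ?_) <;>
  · refine integral_congr_ae (Eventually.of_forall fun p => ?_)
    simp only [map_mul, map_sub, map_add, map_neg, map_pow, Complex.conj_conj, Complex.conj_I,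
      Complex.conj_ofReal, map_intCast]
    ring

/-! ### The modes of a consistent vector -/

lemma continuous_of_eq_zero_off_Icc {u : ℝ → ℂ} {R : ℝ} (hu : ContinuousOn u (Icc (-R) R))
    (h0 : ∀ x, R ≤ |x| → u x = 0) : Continuous u := by
  rcases lt_or_ge R 0 with hR | hR
  · have : u = fun _ => 0 := funext fun x => h0 x (hR.le.trans (abs_nonneg x))
    rw [this]
    exact continuous_const
  · have h1 : u = fun x => u (max (-R) (min x R)) := by
      ext x
      by_cases hx : x ∈ Icc (-R) R
      · rw [min_eq_left hx.2, max_eq_right hx.1]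
      · have hx' : R < |x| := by
          rw [mem_Icc, ← abs_le] at hx
          exact not_le.mp hx
        rw [h0 x hx'.le, h0]
        rcases lt_abs.mp hx' with h | h
        · rw [min_eq_right h.le, max_eq_right (by linarith)]
          exact le_abs_self R
        · rw [max_eq_left ((min_le_left _ _).trans (by linarith)), abs_neg]
          exact le_abs_self R
    rw [h1]
    refine hu.comp_continuous (by fun_prop) fun x => ⟨le_max_left _ _, max_le (by linarith) ?_⟩
    exact min_le_right _ _

/-- By continuity the coefficient vanishes at the endpoints `±ρ` too. This makes the components of a
consistent vector continuous on the whole line, with no jump at `±ρ`. -/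
lemma IsProfile.fourierY_eq_zero_of_le {f : ℝ × ℝ → ℝ} {ρ : ℝ} (hf : IsProfile f ρ) (j : ℤ)
    {x : ℝ} (hx : ρ ≤ |x|) : fourierY f j x = 0 := by
  have hcl : IsClosed {x | fourierY f j x = 0} := isClosed_eq (hf.continuous_fourierY j)
    continuous_const
  have h1 : Ioi ρ ⊆ {x | fourierY f j x = 0} := fun x hx =>
    hf.fourierY_eq_zero j fun h => absurd h.2 (not_le.mpr hx)
  have h2 : Iio (-ρ) ⊆ {x | fourierY f j x = 0} := fun x hx =>
    hf.fourierY_eq_zero j fun h => absurd h.1 (not_le.mpr hx)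
  have h1' := hcl.closure_subset_iff.mpr h1
  have h2' := hcl.closure_subset_iff.mpr h2
  rw [closure_Ioi] at h1'
  rw [closure_Iio] at h2'
  rcases le_abs.mp hx with h | h
  · exact h1' h
  · exact h2' (mem_Iic.mpr (by linarith))

lemma IsConsistent.eq_zero_of_le {f : ℝ × ℝ → ℝ} {ρ ε μ β : ℝ} {A : ℤ → ℝ → ℂ}
    (hf : IsProfile f ρ) (hA : IsConsistent f ε μ β A) (n : ℤ) {x : ℝ} (hx : ρ ≤ |x|) :
    A n x = 0 := by
  rw [hA n x]
  simp [hf.fourierY_eq_zero_of_le _ hx]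

lemma IsConsistent.continuous_vecFn {f : ℝ × ℝ → ℝ} {ρ ε μ β : ℝ} {a : Vec ρ}
    (hf : IsProfile f ρ) (hA : IsConsistent f ε μ β (vecFn a)) (n : ℤ) :
    Continuous (vecFn a n) :=
  continuous_of_eq_zero_off_Icc (continuousOn_extZero _) fun _ hx => hA.eq_zero_of_le hf n hx

lemma vecFn_eq_zero {ρ : ℝ} (a : Vec ρ) (n : ℤ) (x : ℝ) (hx : x ∉ Icc (-ρ) ρ) :
    vecFn a n x = 0 := extZero_of_notMem _ hx

/-- The derivative of `modeOf`. -/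
def modeOfDeriv (ρ μ β : ℝ) (A : ℤ → ℝ → ℂ) (n : ℤ) (x : ℝ) : ℂ :=
  (if n = 0 then Complex.I * kProp μ β * Complex.exp (Complex.I * kProp μ β * x) else 0) +
    expSolDeriv (modeExp μ β n) ρ (A n) x

/-- The reflection coefficient determined by `A₀`. -/
def reflOf (μ β : ℝ) (A : ℤ → ℝ → ℂ) : ℂ :=
  Complex.I / (2 * kProp μ β) * ∫ ξ : ℝ, Complex.exp (Complex.I * kProp μ β * ξ) * A 0 ξ

/-- The transmission coefficient determined by `A₀`. -/
def transOf (μ β : ℝ) (A : ℤ → ℝ → ℂ) : ℂ :=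
  1 + Complex.I / (2 * kProp μ β) *
    ∫ ξ : ℝ, Complex.exp (-(Complex.I * kProp μ β * ξ)) * A 0 ξ

section Modes

variable {b d ρ μ β : ℝ} {A : ℤ → ℝ → ℂ}

lemma modeOf_eq (h : GoodParam b d μ β) (n : ℤ) (hA : Continuous (A n))
    (hs : ∀ x, x ∉ Icc (-ρ) ρ → A n x = 0) (x : ℝ) :
    modeOf μ β A n x = (if n = 0 then Complex.exp (Complex.I * kProp μ β * x) else 0) +
      expSol (modeExp μ β n) ρ (A n) x := by
  have : green n μ β = expKer (modeExp μ β n) := funext fun x => green_eq_expKer h n x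
  rw [modeOf, this, lineConv_expKer hA hs]

lemma hasDerivAt_modeOf (h : GoodParam b d μ β) (hμ : 0 < μ) (n : ℤ) (hA : Continuous (A n))
    (hs : ∀ x, x ∉ Icc (-ρ) ρ → A n x = 0) (x : ℝ) :
    HasDerivAt (modeOf μ β A n) (modeOfDeriv ρ μ β A n x) x := by
  have e : modeOf μ β A n = _ := funext fun x => modeOf_eq h n hA hs x
  rw [e]
  refine HasDerivAt.add ?_ (hasDerivAt_expSol (h.modeExp_ne_zero hμ n) hA x)
  split_ifs
  · exact hasDerivAt_cexp_mul _ x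
  · exact hasDerivAt_const x 0

lemma hasDerivAt_modeOfDeriv (h : GoodParam b d μ β) (hμ : 0 < μ) (n : ℤ) (hA : Continuous (A n))
    (hs : ∀ x, x ∉ Icc (-ρ) ρ → A n x = 0) (x : ℝ) :
    HasDerivAt (modeOfDeriv ρ μ β A n)
      ((((β + n) ^ 2 - omegaSq μ β : ℝ) : ℂ) * modeOf μ β A n x - A n x) x := by
  have h2 := hasDerivAt_expSolDeriv (R := ρ) (h.modeExp_ne_zero hμ n) hA x
  have h1 : HasDerivAt (fun x : ℝ => if n = 0 then Complex.I * kProp μ β *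
      Complex.exp (Complex.I * kProp μ β * x) else 0) (modeExp μ β n ^ 2 *
      if n = 0 then Complex.exp (Complex.I * kProp μ β * x) else 0) x := by
    split_ifs with h0
    · refine ((hasDerivAt_cexp_mul _ x).const_mul _).congr_deriv ?_
      rw [h0, modeExp_zero]
      ring
    · rw [mul_zero]
      exact hasDerivAt_const x 0
  refine (h1.add h2).congr_deriv ?_
  rw [modeOf_eq h n hA hs, ← h.modeExp_sq]
  ring

/-- To the right of the support the convolution is a pure outgoing exponential; its amplitude
together with the incident wave is the transmission coefficient. -/
lemma modeOf_zero_of_ge (h : GoodParam b d μ β) (hρ : 0 ≤ ρ) (hA : Continuous (A 0))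
    (hs : ∀ x, x ∉ Icc (-ρ) ρ → A 0 x = 0) {x : ℝ} (hx : ρ ≤ x) :
    modeOf μ β A 0 x = transOf μ β A * Complex.exp (Complex.I * kProp μ β * x) := by
  have hk : (kProp μ β : ℂ) ≠ 0 := by exact_mod_cast h.kProp_pos.ne'
  rw [modeOf_eq h 0 hA hs, if_pos rfl, expSol_of_ge hA hs hx, leftInt_self hs hρ, modeExp_zero,
    transOf, neg_mul, neg_neg]
  have e : 1 / (2 * -(Complex.I * (kProp μ β : ℂ))) = Complex.I / (2 * kProp μ β) := by
    field_simp
    rw [Complex.I_sq]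
  rw [e]
  simp only [neg_mul]
  ring

lemma modeOf_zero_of_le (h : GoodParam b d μ β) (hρ : 0 ≤ ρ) (hA : Continuous (A 0))
    (hs : ∀ x, x ∉ Icc (-ρ) ρ → A 0 x = 0) {x : ℝ} (hx : x ≤ -ρ) :
    modeOf μ β A 0 x = Complex.exp (Complex.I * kProp μ β * x) +
      reflOf μ β A * Complex.exp (-(Complex.I * kProp μ β) * x) := by
  have hk : (kProp μ β : ℂ) ≠ 0 := by exact_mod_cast h.kProp_pos.ne'
  rw [modeOf_eq h 0 hA hs, if_pos rfl, expSol_of_le hA hs hx, rightInt_neg_self hs hρ,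
    modeExp_zero, reflOf]
  have e : 1 / (2 * -(Complex.I * (kProp μ β : ℂ))) = Complex.I / (2 * kProp μ β) := by
    field_simp
    rw [Complex.I_sq]
  rw [e]
  simp only [neg_mul, neg_neg]
  ring

end Modes

/-! ### The far field -/

/-- The profile in `x` of the far field. -/
def farProfile (k : ℝ) (r t : ℂ) (x : ℝ) : ℂ :=
  Real.smoothTransition x * (t * Complex.exp (Complex.I * k * x)) +
    Real.smoothTransition (-x) *
      (Complex.exp (Complex.I * k * x) + r * Complex.exp (-(Complex.I * k) * x))

lemma contDiff_cexp_mul (c : ℂ) : ContDiff ℝ ∞ fun x : ℝ => Complex.exp (c * x) :=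
  (contDiff_const.mul Complex.ofRealCLM.contDiff).cexp

lemma contDiff_farProfile (k : ℝ) (r t : ℂ) : ContDiff ℝ ∞ (farProfile k r t) := by
  have h1 : ContDiff ℝ ∞ fun x : ℝ => (Real.smoothTransition x : ℂ) :=
    Complex.ofRealCLM.contDiff.comp contDiff_smoothTransition
  have h2 : ContDiff ℝ ∞ fun x : ℝ => (Real.smoothTransition (-x) : ℂ) := h1.comp contDiff_neg
  exact (h1.mul (contDiff_const.mul (contDiff_cexp_mul _))).add
    (h2.mul ((contDiff_cexp_mul _).add (contDiff_const.mul (contDiff_cexp_mul _))))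

lemma farProfile_of_ge {k : ℝ} {r t : ℂ} {x : ℝ} (hx : 1 ≤ x) :
    farProfile k r t x = t * Complex.exp (Complex.I * k * x) := by
  rw [farProfile, Real.smoothTransition.one_of_one_le hx,
    Real.smoothTransition.zero_of_nonpos (by linarith)]
  simp

lemma farProfile_of_le {k : ℝ} {r t : ℂ} {x : ℝ} (hx : x ≤ -1) :
    farProfile k r t x =
      Complex.exp (Complex.I * k * x) + r * Complex.exp (-(Complex.I * k) * x) := by
  rw [farProfile, Real.smoothTransition.one_of_one_le (x := -x) (by linarith),
    Real.smoothTransition.zero_of_nonpos (by linarith)]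
  simp

lemma farField_eq (μ β : ℝ) (r t : ℂ) :
    farField μ β r t = fun p => farProfile (kProp μ β) r t p.1 * eMode β 0 p.2 := by
  ext p
  have e1 : Complex.exp (Complex.I * (β * p.2 + kProp μ β * p.1)) =
      Complex.exp (Complex.I * kProp μ β * p.1) * eMode β 0 p.2 := by
    rw [eMode, ← Complex.exp_add]
    push_cast
    ring_nf
  have e2 : Complex.exp (Complex.I * (β * p.2 - kProp μ β * p.1)) =
      Complex.exp (-(Complex.I * kProp μ β) * p.1) * eMode β 0 p.2 := by
    rw [eMode, ← Complex.exp_add]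
    push_cast
    ring_nf
  rw [farField, e1, e2, farProfile]
  ring

lemma contDiff_farField (μ β : ℝ) (r t : ℂ) : ContDiff ℝ ∞ (farField μ β r t) := by
  rw [farField_eq]
  exact ((contDiff_farProfile _ _ _).comp contDiff_fst).mul
    ((contDiff_eMode β 0).comp contDiff_snd)

/-! ### The scattered part decays -/

lemma exists_le_exp_of_support {g : ℝ → ℂ} (hg : Continuous g) {M : ℝ}
    (hM : ∀ x, M < |x| → g x = 0) (c : ℝ) :
    ∃ C, 0 ≤ C ∧ ∀ x, ‖g x‖ ≤ C * Real.exp (-(c * |x|)) := by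
  obtain ⟨C, hC0, hC⟩ := exists_le_expWeight (g := fun p => g p.1) (hg.comp continuous_fst)
    (fun x _ hx _ => hM x hx) c
  exact ⟨C, hC0, fun x => hC (x, 1) ⟨one_pos, by linarith [Real.pi_gt_three]⟩⟩

/-- The modes of the difference of the wave and the far field. -/
def modeDiff (μ β : ℝ) (A : ℤ → ℝ → ℂ) (n : ℤ) (x : ℝ) : ℂ :=
  modeOf μ β A n x - if n = 0 then farProfile (kProp μ β) (reflOf μ β A) (transOf μ β A) x else 0

/-- The derivatives of `modeDiff`. -/
def modeDiffDeriv (ρ μ β : ℝ) (A : ℤ → ℝ → ℂ) (n : ℤ) (x : ℝ) : ℂ :=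
  modeOfDeriv ρ μ β A n x -
    if n = 0 then deriv (farProfile (kProp μ β) (reflOf μ β A) (transOf μ β A)) x else 0

section Decay

variable {b d ρ μ β : ℝ} {a : Vec ρ}

lemma continuous_modeOfDeriv (h : GoodParam b d μ β) (hμ : 0 < μ) {A : ℤ → ℝ → ℂ} (n : ℤ)
    (hA : Continuous (A n)) (hs : ∀ x, x ∉ Icc (-ρ) ρ → A n x = 0) :
    Continuous (modeOfDeriv ρ μ β A n) :=
  continuous_iff_continuousAt.mpr fun x => (hasDerivAt_modeOfDeriv h hμ n hA hs x).continuousAt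

lemma continuous_modeOf (h : GoodParam b d μ β) (hμ : 0 < μ) {A : ℤ → ℝ → ℂ} (n : ℤ)
    (hA : Continuous (A n)) (hs : ∀ x, x ∉ Icc (-ρ) ρ → A n x = 0) :
    Continuous (modeOf μ β A n) :=
  continuous_iff_continuousAt.mpr fun x => (hasDerivAt_modeOf h hμ n hA hs x).continuousAt

lemma hasDerivAt_modeDiff (h : GoodParam b d μ β) (hμ : 0 < μ) {A : ℤ → ℝ → ℂ} (n : ℤ)
    (hA : Continuous (A n)) (hs : ∀ x, x ∉ Icc (-ρ) ρ → A n x = 0) (x : ℝ) :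
    HasDerivAt (modeDiff μ β A n) (modeDiffDeriv ρ μ β A n x) x := by
  refine (hasDerivAt_modeOf h hμ n hA hs x).sub ?_
  split_ifs
  · exact ((contDiff_farProfile _ _ _).differentiable (by simp) x).hasDerivAt
  · exact hasDerivAt_const x 0

lemma continuous_modeDiffDeriv (h : GoodParam b d μ β) (hμ : 0 < μ) {A : ℤ → ℝ → ℂ} (n : ℤ)
    (hA : Continuous (A n)) (hs : ∀ x, x ∉ Icc (-ρ) ρ → A n x = 0) :
    Continuous (modeDiffDeriv ρ μ β A n) := by
  refine (continuous_modeOfDeriv h hμ n hA hs).sub ?_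
  split_ifs
  · exact (contDiff_farProfile _ _ _).continuous_deriv (by simp)
  · exact continuous_const

lemma modeDiff_zero_of_gt (h : GoodParam b d μ β) (hρ : 0 ≤ ρ) {A : ℤ → ℝ → ℂ}
    (hA : Continuous (A 0)) (hs : ∀ x, x ∉ Icc (-ρ) ρ → A 0 x = 0) {x : ℝ}
    (hx : max ρ 1 < |x|) : modeDiff μ β A 0 x = 0 := by
  obtain ⟨h1, h2⟩ := max_lt_iff.mp hx
  rw [modeDiff, if_pos rfl, sub_eq_zero]
  rcases le_total 0 x with h0 | h0
  · rw [abs_of_nonneg h0] at h1 h2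
    rw [modeOf_zero_of_ge h hρ hA hs h1.le, farProfile_of_ge h2.le]
  · rw [abs_of_nonpos h0] at h1 h2
    rw [modeOf_zero_of_le h hρ hA hs (by linarith), farProfile_of_le (by linarith)]

lemma summable_norm_sq_vec (a : Vec ρ) : Summable fun n => ‖a n‖ ^ 2 := by
  have h := (lp.memℓp a).summable (p := 2) (by norm_num)
  simpa using h

lemma GoodParam.abs_beta_add_le (h : GoodParam b d μ β) {n : ℤ} (hn : n ≠ 0) :
    |β + n| ≤ 2 * |(n : ℝ)| := by
  have h1 := GoodParam.one_le_abs_cast hn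
  have h2 := abs_add_le β n
  rw [abs_of_pos h.beta_pos] at h2
  linarith [h.beta_lt]

/-- The norms `‖a_n‖` are only square summable. Dividing by `κ ≥ c|n|` turns them into the summable
`‖a_n‖/|n|`. The mode itself gains two powers of `|n|`, so one is left after multiplication by `β +
n`. -/
lemma exists_bound_modes (h : GoodParam b d μ β) (hμ : 0 < μ) (hρ : 0 ≤ ρ) (a : Vec ρ)
    (hA : ∀ n, Continuous (vecFn a n)) : ∃ C : ℤ → ℝ, Summable C ∧ ∀ n, n ≠ 0 → ∀ x,
      ‖modeOf μ β (vecFn a) n x‖ ≤ C n * Real.exp (-(minRate b μ * |x|)) ∧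
      ‖modeOfDeriv ρ μ β (vecFn a) n x‖ ≤ C n * Real.exp (-(minRate b μ * |x|)) ∧
      ‖Complex.I * (β + n) * modeOf μ β (vecFn a) n x‖ ≤
        C n * Real.exp (-(minRate b μ * |x|)) := by
  set c := minRate b μ with hc
  have hc0 : 0 < c := h.minRate_pos hμ
  set Q := Real.exp (c * ρ) * (1 / c + 2 / c ^ 2) with hQ
  have hs2 : Summable fun n : ℤ => 1 / (n : ℝ) ^ 2 :=
    (Real.summable_one_div_int_pow (p := 2)).mpr (by norm_num)
  refine ⟨fun n => Q * (‖a n‖ ^ 2 + 1 / (n : ℝ) ^ 2), ((summable_norm_sq_vec a).add hs2).mul_left Q,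
    fun n hn x => ?_⟩
  have hn1 := GoodParam.one_le_abs_cast hn
  set κ := decayRate μ β n with hκ
  have hκ1 : c * |(n : ℝ)| ≤ κ := h.minRate_mul_le hn
  have hκc : c ≤ κ := le_trans (le_mul_of_one_le_right hc0.le hn1) hκ1
  have hκ0 : 0 < κ := hc0.trans_le hκc
  have hN : ∀ x, ‖vecFn a n x‖ ≤ ‖a n‖ := fun x => norm_extZero_le _ _
  have e1 : modeOf μ β (vecFn a) n x = expSol κ ρ (vecFn a n) x := by
    rw [modeOf_eq h n (hA n) (vecFn_eq_zero a n), if_neg hn, zero_add, modeExp_of_ne hn]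
  have e2 : modeOfDeriv ρ μ β (vecFn a) n x = expSolDeriv κ ρ (vecFn a n) x := by
    rw [modeOfDeriv, if_neg hn, zero_add, modeExp_of_ne hn]
  have b1 := norm_expSol_le hρ hκ0 hc0.le hκc (hA n) (vecFn_eq_zero a n) hN x
  have b2 := norm_expSolDeriv_le hρ hκ0 hc0.le hκc (hA n) (vecFn_eq_zero a n) hN x
  have he : Real.exp (c * (ρ - |x|)) = Real.exp (c * ρ) * Real.exp (-(c * |x|)) := by
    rw [← Real.exp_add]; ring_nf
  rw [← e1] at b1
  rw [← e2] at b2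
  set N := ‖a n‖ with hNdef
  set m := |(n : ℝ)| with hm
  have hm0 : 0 < m := by linarith
  have hN0 : 0 ≤ N := norm_nonneg _
  -- The inequality `xy ≤ x² + y²` makes `‖a_n‖/|n|` summable.
  have hNm : N / m ≤ N ^ 2 + 1 / (n : ℝ) ^ 2 := by
    rw [← sq_abs (n : ℝ), ← hm]
    have := sq_nonneg (N - 1 / m)
    have h3 : N / m = N * (1 / m) := by ring
    have h4 : 1 / m ^ 2 = (1 / m) ^ 2 := by ring
    rw [h3, h4]
    nlinarith [mul_nonneg hN0 (one_div_nonneg.mpr hm0.le)]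
  have q1 : N / κ ≤ 1 / c * (N / m) := by
    calc N / κ ≤ N / (c * m) := by gcongr
      _ = _ := by field_simp
  have q2 : N / κ ^ 2 ≤ 1 / c ^ 2 * (N / m ^ 2) := by
    calc N / κ ^ 2 ≤ N / (c * m) ^ 2 := by gcongr
      _ = _ := by field_simp
  have q3 : N / m ^ 2 * m = N / m := by field_simp
  have q4 : N / m ^ 2 ≤ N / m := by
    rw [← q3]
    exact le_mul_of_one_le_right (by positivity) hn1
  have hcc : 0 ≤ 1 / c := by positivity
  have hcc2 : 0 ≤ 1 / c ^ 2 := by positivity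
  have hNm0 : 0 ≤ N / m := by positivity
  have hEE : 0 < Real.exp (c * ρ) := Real.exp_pos _
  have fin : ∀ {X : ℝ}, X ≤ (1 / c + 2 / c ^ 2) * (N / m) → X * Real.exp (c * (ρ - |x|)) ≤
      Q * (N ^ 2 + 1 / (n : ℝ) ^ 2) * Real.exp (-(c * |x|)) := by
    intro X hX
    have hpos : 0 ≤ 1 / c + 2 / c ^ 2 := by positivity
    calc X * Real.exp (c * (ρ - |x|)) ≤
          (1 / c + 2 / c ^ 2) * (N ^ 2 + 1 / (n : ℝ) ^ 2) * Real.exp (c * (ρ - |x|)) := by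
          gcongr
          exact hX.trans (mul_le_mul_of_nonneg_left hNm hpos)
      _ = _ := by rw [he, hQ]; ring
  have e3 : 2 / c ^ 2 = 2 * (1 / c ^ 2) := by ring
  refine ⟨b1.trans (fin ?_), b2.trans (fin ?_), ?_⟩
  · rw [e3]
    nlinarith [mul_le_mul_of_nonneg_left q4 hcc2, mul_nonneg hcc hNm0, mul_nonneg hcc2 hNm0]
  · rw [e3]
    nlinarith [mul_nonneg hcc2 hNm0]
  · have hb : ‖Complex.I * ((β : ℂ) + n)‖ = |β + n| := by
      rw [norm_mul, Complex.norm_I, one_mul, ← Real.norm_eq_abs, ← Complex.norm_real]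
      push_cast
      rfl
    rw [norm_mul, hb]
    have hb2 := h.abs_beta_add_le hn
    calc |β + n| * ‖modeOf μ β (vecFn a) n x‖ ≤
          2 * m * (N / κ ^ 2 * Real.exp (c * (ρ - |x|))) := by gcongr
      _ = (2 * m * (N / κ ^ 2)) * Real.exp (c * (ρ - |x|)) := by ring
      _ ≤ _ := by
          refine fin ?_
          calc 2 * m * (N / κ ^ 2) ≤ 2 * m * (1 / c ^ 2 * (N / m ^ 2)) := by gcongr
            _ = 2 / c ^ 2 * (N / m) := by rw [← q3]; ring
            _ ≤ _ := by
                rw [add_mul]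
                linarith [mul_nonneg hcc hNm0]

/-- Removing the far field affects only the mode `0`, which then has compact support and is bounded
by any exponential weight. -/
lemma exists_bound_modeDiff (h : GoodParam b d μ β) (hμ : 0 < μ) (hρ : 0 ≤ ρ) (a : Vec ρ)
    (hA : ∀ n, Continuous (vecFn a n)) : ∃ C : ℤ → ℝ, Summable C ∧ ∀ n x,
      ‖modeDiff μ β (vecFn a) n x‖ ≤ C n * Real.exp (-(minRate b μ * |x|)) ∧
      ‖modeDiffDeriv ρ μ β (vecFn a) n x‖ ≤ C n * Real.exp (-(minRate b μ * |x|)) ∧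
      ‖Complex.I * (β + n) * modeDiff μ β (vecFn a) n x‖ ≤
        C n * Real.exp (-(minRate b μ * |x|)) := by
  obtain ⟨C, hC, hb⟩ := exists_bound_modes h hμ hρ a hA
  have hd := hasDerivAt_modeDiff h hμ 0 (hA 0) (vecFn_eq_zero a 0)
  have hz : ∀ x, max ρ 1 < |x| → modeDiff μ β (vecFn a) 0 x = 0 := fun x hx =>
    modeDiff_zero_of_gt h hρ (hA 0) (vecFn_eq_zero a 0) hx
  have hz' : ∀ x, max ρ 1 < |x| → modeDiffDeriv ρ μ β (vecFn a) 0 x = 0 := fun x hx => by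
    have : modeDiff μ β (vecFn a) 0 =ᶠ[𝓝 x] fun _ => 0 := by
      filter_upwards [(isOpen_lt continuous_const continuous_abs).mem_nhds hx] with t ht
      exact hz t ht
    rw [← (hd x).deriv, this.deriv_eq, deriv_const]
  obtain ⟨C₁, h1, hC₁⟩ := exists_le_exp_of_support
    (continuous_iff_continuousAt.mpr fun x => (hd x).continuousAt) hz (minRate b μ)
  obtain ⟨C₂, h2, hC₂⟩ := exists_le_exp_of_support
    (continuous_modeDiffDeriv h hμ 0 (hA 0) (vecFn_eq_zero a 0)) hz' (minRate b μ)
  set C₀ := (1 + ‖Complex.I * ((β : ℂ) + ((0 : ℤ) : ℂ))‖) * C₁ + C₂ with hC₀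
  refine ⟨fun n => if n = 0 then C₀ else C n, ?_, fun n x => ?_⟩
  · refine hC.congr_cofinite ?_
    filter_upwards [(Set.finite_singleton (0 : ℤ)).compl_mem_cofinite] with n hn
    rw [if_neg (by simpa using hn)]
  · by_cases hn : n = 0
    · subst hn
      have hE := Real.exp_pos (-(minRate b μ * |x|))
      have a1 := hC₁ x
      have a2 := hC₂ x
      have hL := norm_nonneg (Complex.I * ((β : ℂ) + ((0 : ℤ) : ℂ)))
      set L := ‖Complex.I * ((β : ℂ) + ((0 : ℤ) : ℂ))‖
      set E := Real.exp (-(minRate b μ * |x|))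
      have p1 : 0 ≤ L * C₁ * E := by positivity
      have p2 : 0 ≤ C₁ * E := by positivity
      have p3 : 0 ≤ C₂ * E := by positivity
      beta_reduce
      rw [if_pos rfl, hC₀]
      refine ⟨by linarith, by linarith, ?_⟩
      rw [norm_mul]
      have := mul_le_mul_of_nonneg_left a1 hL
      linarith
    · beta_reduce
      rw [if_neg hn, modeDiff, modeDiffDeriv, if_neg hn, if_neg hn, sub_zero, sub_zero]
      exact hb n hn x

end Decay

/-! ### Discrete convolutions -/

/-- The shear `(m, n) ↦ (n, m - n)`. -/
def shearEquiv : ℤ × ℤ ≃ ℤ × ℤ where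
  toFun x := (x.2, x.1 - x.2)
  invFun x := (x.1 + x.2, x.1)
  left_inv x := by simp
  right_inv x := by simp

/-- The product of two absolutely convergent sums is a sum over `ℤ × ℤ`; the shear reindexes it, and
summation over the fibres gives the convolution. Applied pointwise it turns `∑ f_{m-n} Ψ_n` into the
product of `f` and `Ψ`. -/
lemma hasSum_discrete_convolution {𝕜 : Type*} [NormedField 𝕜] [CompleteSpace 𝕜] {P F E G : ℤ → 𝕜}
    (hP : Summable fun n => ‖P n‖) (hF : Summable fun n => ‖F n‖) (hE : ∀ n, ‖E n‖ = 1)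
    (hG : ∀ n, ‖G n‖ = 1) (hEG : ∀ n j, E (n + j) = E n * G j) :
    HasSum (fun m => (∑' n, P n * F (m - n)) * E m)
      ((∑' n, P n * E n) * ∑' j, F j * G j) := by
  have hp : Summable fun n => ‖P n * E n‖ := by simpa [norm_mul, hE] using hP
  have hq : Summable fun n => ‖F n * G n‖ := by simpa [norm_mul, hG] using hF
  have h1 : HasSum (fun x : ℤ × ℤ => P x.1 * E x.1 * (F x.2 * G x.2))
      ((∑' n, P n * E n) * ∑' j, F j * G j) := by
    have hs := summable_mul_of_summable_norm hp hq
    have h := hp.of_norm.tsum_mul_tsum hq.of_norm hs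
    rw [h]
    exact hs.hasSum
  have h2 : HasSum (fun x : ℤ × ℤ => P x.2 * F (x.1 - x.2) * E x.1)
      ((∑' n, P n * E n) * ∑' j, F j * G j) := by
    rw [← shearEquiv.hasSum_iff] at h1
    convert h1 using 1
    funext x
    have : E x.1 = E x.2 * G (x.1 - x.2) := by rw [← hEG, add_sub_cancel]
    simp only [Function.comp, shearEquiv, Equiv.coe_fn_mk]
    rw [this]
    ring
  have h3 : ∀ m, HasSum (fun n => P n * F (m - n) * E m) ((∑' n, P n * F (m - n)) * E m) := by
    intro m
    have h4 : Summable fun n => P n * F (m - n) * E m := h2.summable.prod_factor m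
    have hEm : E m ≠ 0 := by
      rw [← norm_ne_zero_iff, hE]
      exact one_ne_zero
    rw [summable_mul_right_iff hEm] at h4
    exact h4.hasSum.mul_right _
  exact HasSum.prod_fiberwise h2 h3

/-! ### Integration of mode series -/

section SeriesIntegral

variable {β : ℝ} {B : ℤ → ℝ} {g : ℤ → ℝ → ℂ}

lemma summable_norm_of_ne_zero {X : Type*} [SeminormedAddCommGroup X] {u : ℤ → X}
    (hB : Summable B) (h : ∀ n, n ≠ 0 → ‖u n‖ ≤ B n) : Summable fun n => ‖u n‖ := by
  refine Summable.of_norm_bounded_eventually hB ?_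
  filter_upwards [(Set.finite_singleton (0 : ℤ)).compl_mem_cofinite] with n hn
  rw [norm_norm]
  exact h n (by simpa using hn)

lemma hasSum_modeSeries_of_ne_zero (hB : Summable B) {p : ℝ × ℝ}
    (hg : ∀ n, n ≠ 0 → ‖g n p.1‖ ≤ B n) :
    HasSum (fun n => g n p.1 * eMode β n p.2) (modeSeries β g p) := by
  refine (summable_norm_of_ne_zero (u := fun n => g n p.1 * eMode β n p.2) hB
    fun n hn => ?_).of_norm.hasSum
  rw [norm_mul, norm_eMode, mul_one]
  exact hg n hn

/-- No bound is asked of the mode `0`, since a single term does not affect summability; its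
integrability comes from the bounded support of `θ`. -/
lemma hasSum_integral_modeSeries (hB : Summable B) (hgc : ∀ n, Continuous (g n))
    (hg : ∀ n, n ≠ 0 → ∀ x, ‖g n x‖ ≤ B n) {θ : ℝ × ℝ → ℂ} (hθ : Continuous θ) {M : ℝ}
    (hM : ∀ x y : ℝ, M < |x| → y ∈ Ioo 0 (2 * Real.pi) → θ (x, y) = 0) :
    (∀ n, Integrable (fun p => g n p.1 * eMode β n p.2 * θ p) stripMeasure) ∧
    Integrable (fun p => modeSeries β g p * θ p) stripMeasure ∧
    HasSum (fun n => ∫ p, g n p.1 * eMode β n p.2 * θ p ∂stripMeasure)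
      (∫ p, modeSeries β g p * θ p ∂stripMeasure) := by
  have hi : ∀ n, Integrable (fun p => g n p.1 * eMode β n p.2 * θ p) stripMeasure := by
    intro n
    have := hgc n
    refine integrable_strip_of_support (M := M) (by fun_prop) fun x y hx hy => ?_
    rw [hM x y hx hy, mul_zero]
  have hθi : Integrable θ stripMeasure := integrable_strip_of_support hθ hM
  have hs : Summable fun n => ∫ p, ‖g n p.1 * eMode β n p.2 * θ p‖ ∂stripMeasure := by
    refine (summable_norm_of_ne_zero (hB.mul_right (∫ p, ‖θ p‖ ∂stripMeasure))
      fun n hn => ?_).of_norm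
    rw [Real.norm_of_nonneg (integral_nonneg fun _ => norm_nonneg _), ← integral_const_mul]
    refine integral_mono (hi n).norm (hθi.norm.const_mul _) fun p => ?_
    simp only [norm_mul, norm_eMode, mul_one]
    exact mul_le_mul_of_nonneg_right (hg n hn p.1) (norm_nonneg _)
  have hsum : ∀ p, ∑' n, g n p.1 * eMode β n p.2 * θ p = modeSeries β g p * θ p := fun p => by
    rw [tsum_mul_right, modeSeries]
  have h1 := hasSum_integral_of_summable_integral_norm hi hs
  simp only [hsum] at h1
  refine ⟨hi, ?_, h1⟩
  have hcont : Continuous (modeSeries β g) := by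
    have e : modeSeries β g = fun p => g 0 p.1 * eMode β 0 p.2 +
        ∑' n, (if n = 0 then 0 else g n p.1 * eMode β n p.2) := by
      ext p
      exact (hasSum_modeSeries_of_ne_zero hB fun n hn => hg n hn p.1).summable.tsum_eq_add_tsum_ite 0
    rw [e]
    have hg0 := hgc 0
    refine Continuous.add (by fun_prop) (continuous_tsum (u := fun n => |B n|) (fun n => ?_)
      hB.abs fun n p => ?_)
    · have := hgc n
      split_ifs <;> fun_prop
    · split_ifs with hn
      · rw [norm_zero]
        exact abs_nonneg _
      · rw [norm_mul, norm_eMode, mul_one]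
        exact (hg n hn p.1).trans (le_abs_self _)
  refine integrable_strip_of_support (M := M) (hcont.mul hθ) fun x y hx hy => ?_
  rw [hM x y hx hy, mul_zero]

end SeriesIntegral

/-! ### Existence of solutions -/

section Existence

variable {f : ℝ × ℝ → ℝ} {b d ρ ε μ β : ℝ} {a : Vec ρ}

lemma eMode_add (β : ℝ) (n j : ℤ) (y : ℝ) :
    eMode β (n + j) y = eMode β n y * Complex.exp (Complex.I * j * y) := by
  rw [eMode, eMode, ← Complex.exp_add]
  push_cast
  ring_nf

lemma norm_exp_I_int_mul' (j : ℤ) (y : ℝ) : ‖Complex.exp (Complex.I * j * y)‖ = 1 := by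
  rw [show Complex.I * j * y = ((j * y : ℝ) : ℂ) * Complex.I by push_cast; ring,
    Complex.norm_exp_ofReal_mul_I]

lemma exp_neg_mul_abs_le_one {c : ℝ} (hc : 0 < c) (x : ℝ) : Real.exp (-(c * |x|)) ≤ 1 := by
  rw [Real.exp_le_one_iff, neg_nonpos]
  positivity

lemma exists_uniform_bound_modes (h : GoodParam b d μ β) (hμ : 0 < μ) (hρ : 0 ≤ ρ) (a : Vec ρ)
    (hA : ∀ n, Continuous (vecFn a n)) : ∃ B : ℤ → ℝ, Summable B ∧ ∀ n, n ≠ 0 → ∀ x,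
      ‖modeOf μ β (vecFn a) n x‖ ≤ B n ∧ ‖modeOfDeriv ρ μ β (vecFn a) n x‖ ≤ B n ∧
      ‖Complex.I * (β + n) * modeOf μ β (vecFn a) n x‖ ≤ B n := by
  obtain ⟨C, hC, hb⟩ := exists_bound_modes h hμ hρ a hA
  refine ⟨fun n => |C n|, hC.abs, fun n hn x => ?_⟩
  have h1 : C n * Real.exp (-(minRate b μ * |x|)) ≤ |C n| :=
    (mul_le_mul_of_nonneg_right (le_abs_self _) (Real.exp_nonneg _)).trans
      (mul_le_of_le_one_right (abs_nonneg _) (exp_neg_mul_abs_le_one (h.minRate_pos hμ) x))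
  obtain ⟨p, q, r⟩ := hb n hn x
  exact ⟨p.trans h1, q.trans h1, r.trans h1⟩

lemma zCoef_mul_two_pi (ε μ β : ℝ) :
    zCoef ε μ β * (2 * Real.pi) = ((ε * omegaSq μ β : ℝ) : ℂ) := by
  have : (Real.pi : ℂ) ≠ 0 := by exact_mod_cast Real.pi_ne_zero
  rw [zCoef, gam]
  push_cast
  field_simp
  ring

/-- Self-consistency says that `A` collects the modes of `ε ω² f Ψ`; the constant comes from `2γ ·
2π = ω²`. -/
lemma IsConsistent.hasSum (hf : IsProfile f ρ) (h : GoodParam b d μ β) (hμ : 0 < μ)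
    (hA : IsConsistent f ε μ β (vecFn a)) (p : ℝ × ℝ) :
    HasSum (fun m => vecFn a m p.1 * eMode β m p.2)
      (((ε * omegaSq μ β : ℝ) : ℂ) * f p * modeSeries β (modeOf μ β (vecFn a)) p) := by
  obtain ⟨B, hB, hb⟩ := exists_uniform_bound_modes h hμ hf.pos.le a fun n => hA.continuous_vecFn hf n
  obtain ⟨C, hC0, hC⟩ := hf.exists_fourierY_bound
  have h1 := hasSum_discrete_convolution (P := fun n => modeOf μ β (vecFn a) n p.1)
    (F := fun j => fourierY f j p.1) (E := fun n => eMode β n p.2)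
    (G := fun j => Complex.exp (Complex.I * j * p.2))
    (summable_norm_of_ne_zero hB fun n hn => (hb n hn p.1).1)
    (Summable.of_nonneg_of_le (fun _ => norm_nonneg _) (fun j => hC j p.1)
      (summable_div_one_add_sq C)) (fun n => norm_eMode β n p.2)
    (fun j => norm_exp_I_int_mul' j p.2) (fun n j => eMode_add β n j p.2)
  rw [(hf.hasSum_fourierY p.1 p.2).tsum_eq] at h1
  have e1 : (fun m => vecFn a m p.1 * eMode β m p.2) = fun m => zCoef ε μ β *
      ((∑' n, modeOf μ β (vecFn a) n p.1 * fourierY f (m - n) p.1) * eMode β m p.2) :=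
    funext fun m => by rw [hA m p.1, mul_assoc]
  have e2 : ((ε * omegaSq μ β : ℝ) : ℂ) * f p * modeSeries β (modeOf μ β (vecFn a)) p =
      zCoef ε μ β * ((∑' n, modeOf μ β (vecFn a) n p.1 * eMode β n p.2) *
        (2 * Real.pi * f (p.1, p.2))) := by
    rw [← zCoef_mul_two_pi, modeSeries]
    ring
  rw [e1, e2]
  exact h1.mul_left _

/-- Membership in `Vec ρ` gives only square summability. Self-consistency writes `A` as a
convolution of the summable bounds for the modes with those for `f_j`, which is summable. -/
lemma IsConsistent.exists_bound (hf : IsProfile f ρ) (h : GoodParam b d μ β) (hμ : 0 < μ)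
    (hA : IsConsistent f ε μ β (vecFn a)) :
    ∃ D : ℤ → ℝ, Summable D ∧ ∀ m x, ‖vecFn a m x‖ ≤ D m := by
  have hAc := fun n => hA.continuous_vecFn hf n
  obtain ⟨B, hB, hb⟩ := exists_uniform_bound_modes h hμ hf.pos.le a hAc
  obtain ⟨C, hC0, hC⟩ := hf.exists_fourierY_bound
  obtain ⟨B₀, hB₀⟩ := (isCompact_Icc (a := -ρ) (b := ρ)).exists_bound_of_continuousOn
    (continuous_modeOf h hμ 0 (hAc 0) (vecFn_eq_zero a 0)).continuousOn
  set B' : ℤ → ℝ := fun n => if n = 0 then B₀ else B n with hB'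
  have hB's : Summable B' := by
    refine hB.congr_cofinite ?_
    filter_upwards [(Set.finite_singleton (0 : ℤ)).compl_mem_cofinite] with n hn
    simp only [hB']
    rw [if_neg (by simpa using hn)]
  have hb' : ∀ n, ∀ x ∈ Icc (-ρ) ρ, ‖modeOf μ β (vecFn a) n x‖ ≤ B' n := by
    intro n x hx
    simp only [hB']
    split_ifs with hn
    · rw [hn]
      exact hB₀ x hx
    · exact (hb n hn x).1
  have hB'0 : ∀ n, 0 ≤ B' n := fun n =>
    (norm_nonneg _).trans (hb' n 0 ⟨by linarith [hf.pos], hf.pos.le⟩)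
  set F : ℤ → ℝ := fun j => C / (1 + (j : ℝ) ^ 2) with hF
  have hF0 : ∀ j, 0 ≤ F j := fun j => by positivity
  have hFs : Summable F := summable_div_one_add_sq C
  have h1 := hasSum_discrete_convolution (P := B') (F := F) (E := fun _ => 1) (G := fun _ => 1)
    hB's.norm hFs.norm (by simp) (by simp) (by simp)
  simp only [mul_one] at h1
  refine ⟨fun m => ‖zCoef ε μ β‖ * ∑' n, B' n * F (m - n), h1.summable.mul_left _, fun m x => ?_⟩
  have hsm : Summable fun n => B' n * F (m - n) := by
    refine Summable.of_nonneg_of_le (fun n => mul_nonneg (hB'0 n) (hF0 _)) (fun n => ?_)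
      (hB's.mul_right C)
    refine mul_le_mul_of_nonneg_left (div_le_self hC0 ?_) (hB'0 n)
    nlinarith [sq_nonneg ((m - n : ℤ) : ℝ)]
  rw [hA m x, norm_mul]
  refine mul_le_mul_of_nonneg_left (tsum_of_norm_bounded hsm.hasSum fun n => ?_) (norm_nonneg _)
  rw [norm_mul]
  by_cases hx : x ∈ Icc (-ρ) ρ
  · exact mul_le_mul (hb' n x hx) (hC _ x) (norm_nonneg _) (hB'0 n)
  · rw [hf.fourierY_eq_zero _ hx, norm_zero, mul_zero]
    exact mul_nonneg (hB'0 n) (hF0 _)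

lemma modeSeries_eq_add {g w : ℤ → ℝ → ℂ} {H : ℝ → ℂ} {p : ℝ × ℝ}
    (hw : HasSum (fun n => w n p.1 * eMode β n p.2) (modeSeries β w p))
    (hg : ∀ n, g n p.1 = w n p.1 + if n = 0 then H p.1 else 0) :
    modeSeries β g p = modeSeries β w p + H p.1 * eMode β 0 p.2 := by
  have h1 := hw.add (hasSum_ite_eq (0 : ℤ) (H p.1 * eMode β 0 p.2))
  rw [← h1.tsum_eq, modeSeries]
  congr 1
  funext n
  rw [hg]
  split_ifs with hn
  · rw [hn]
    ring
  · ring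

lemma memH1_modeSeries_sub_farField (h : GoodParam b d μ β) (hμ : 0 < μ) (hρ : 0 ≤ ρ)
    (hAc : ∀ n, Continuous (vecFn a n)) :
    MemH1 β
      (modeSeries β (modeOf μ β (vecFn a)) -
        farField μ β (reflOf μ β (vecFn a)) (transOf μ β (vecFn a)))
      (modeSeries β (modeOfDeriv ρ μ β (vecFn a)) -
        dX (farField μ β (reflOf μ β (vecFn a)) (transOf μ β (vecFn a))))
      (modeSeries β (fun n x => Complex.I * (β + n) * modeOf μ β (vecFn a) n x) -
        dY (farField μ β (reflOf μ β (vecFn a)) (transOf μ β (vecFn a)))) := by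
  obtain ⟨C, hC, hb⟩ := exists_bound_modeDiff h hμ hρ a hAc
  have hc := h.minRate_pos hμ
  have hd := fun n => hasDerivAt_modeDiff h hμ n (hAc n) (vecFn_eq_zero a n)
  have hdc := fun n => continuous_modeDiffDeriv h hμ n (hAc n) (vecFn_eq_zero a n)
  have hcont : ∀ n, Continuous (modeDiff μ β (vecFn a) n) := fun n =>
    continuous_iff_continuousAt.mpr fun x => (hd n x).continuousAt
  have b0 := fun n x => (hb n x).1
  have b1 := fun n x => (hb n x).2.1
  have b2 := fun n x => (hb n x).2.2
  have key := (wApprox_modeSeries (β := β) hc hC hd hdc b0 b1 b2).memH1 (by positivity)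
    (continuous_modeSeries hc hC hcont b0) (continuous_modeSeries hc hC hdc b1)
    (continuous_modeSeries hc hC (fun n => continuous_const.mul (hcont n)) b2)
  set H := farProfile (kProp μ β) (reflOf μ β (vecFn a)) (transOf μ β (vecFn a)) with hH
  rw [farField_eq, dX_mul_eMode, dY_mul_eMode, ← hH]
  have e0 : modeSeries β (modeOf μ β (vecFn a)) - (fun p => H p.1 * eMode β 0 p.2) =
      modeSeries β (modeDiff μ β (vecFn a)) := by
    ext p
    rw [Pi.sub_apply, sub_eq_iff_eq_add]
    exact modeSeries_eq_add (hasSum_modeSeries hc hC b0 p) fun n => by rw [modeDiff, sub_add_cancel]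
  have e1 : modeSeries β (modeOfDeriv ρ μ β (vecFn a)) - (fun p => deriv H p.1 * eMode β 0 p.2) =
      modeSeries β (modeDiffDeriv ρ μ β (vecFn a)) := by
    ext p
    rw [Pi.sub_apply, sub_eq_iff_eq_add]
    exact modeSeries_eq_add (hasSum_modeSeries hc hC b1 p) fun n => by
      rw [modeDiffDeriv, sub_add_cancel]
  have e2 : modeSeries β (fun n x => Complex.I * (β + n) * modeOf μ β (vecFn a) n x) -
      (fun p => Complex.I * (β + (0 : ℤ)) * H p.1 * eMode β 0 p.2) =
      modeSeries β (fun n x => Complex.I * (β + n) * modeDiff μ β (vecFn a) n x) := by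
    ext p
    rw [Pi.sub_apply, sub_eq_iff_eq_add]
    refine modeSeries_eq_add (H := fun x => Complex.I * (β + (0 : ℤ)) * H x)
      (hasSum_modeSeries hc hC b2 p) fun n => ?_
    rw [modeDiff]
    split_ifs with hn
    · rw [hn]
      ring
    · ring
  rw [e0, e1, e2]
  exact key

/-- The equation `-Ψ_n'' + (β+n)² Ψ_n = ω² Ψ_n + A_n` is integrated against the test function for
each `n` and then summed over `n`, the sum of the `A_n` being `ε ω² f Ψ`. -/
lemma IsConsistent.weak_equation (hf : IsProfile f ρ) (h : GoodParam b d μ β) (hμ : 0 < μ)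
    (hA : IsConsistent f ε μ β (vecFn a)) {Φ : ℝ × ℝ → ℂ} (hΦ : IsTest β Φ) :
    ∫ p, (modeSeries β (modeOfDeriv ρ μ β (vecFn a)) p * starRingEnd ℂ (dX Φ p) +
        modeSeries β (fun n x => Complex.I * (β + n) * modeOf μ β (vecFn a) n x) p *
          starRingEnd ℂ (dY Φ p)) ∂stripMeasure =
      omegaSq μ β * ∫ p, (1 + ε * f p) * modeSeries β (modeOf μ β (vecFn a)) p *
        starRingEnd ℂ (Φ p) ∂stripMeasure := by
  have hAc := fun n => hA.continuous_vecFn hf n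
  obtain ⟨B, hB, hb⟩ := exists_uniform_bound_modes h hμ hf.pos.le a hAc
  obtain ⟨D, hD, hDb⟩ := hA.exists_bound hf h hμ
  obtain ⟨M, -, hM⟩ := hΦ.exists_support
  have hmc := fun n => continuous_modeOf h hμ n (hAc n) (vecFn_eq_zero a n)
  have hdc := fun n => continuous_modeOfDeriv h hμ n (hAc n) (vecFn_eq_zero a n)
  have cc : ∀ {θ : ℝ × ℝ → ℂ}, Continuous θ → Continuous fun p => starRingEnd ℂ (θ p) :=
    fun hθ => Complex.continuous_conj.comp hθ
  have hcX := cc (contDiff_dX hΦ.1).continuous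
  have hcY := cc (contDiff_dY hΦ.1).continuous
  have hc0 := cc hΦ.1.continuous
  obtain ⟨iX, IX, sX⟩ := hasSum_integral_modeSeries (β := β) hB hdc
    (fun n hn x => (hb n hn x).2.1) hcX (M := M) fun x y hx hy => by
      rw [(hM x y hx hy).2.1, map_zero]
  obtain ⟨iY, IY, sY⟩ := hasSum_integral_modeSeries (β := β) hB
    (g := fun n x => Complex.I * (β + n) * modeOf μ β (vecFn a) n x)
    (fun n => continuous_const.mul (hmc n))
    (fun n hn x => (hb n hn x).2.2) hcY (M := M) fun x y hx hy => by
      rw [(hM x y hx hy).2.2, map_zero]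
  obtain ⟨i0, I0, s0⟩ := hasSum_integral_modeSeries (β := β) hB hmc
    (fun n hn x => (hb n hn x).1) hc0 (M := M) fun x y hx hy => by
      rw [(hM x y hx hy).1, map_zero]
  obtain ⟨iA, IA, sA⟩ := hasSum_integral_modeSeries (β := β) hD hAc
    (fun n _ x => hDb n x) hc0 (M := M) fun x y hx hy => by
      rw [(hM x y hx hy).1, map_zero]
  have hL := sX.add sY
  have hR := (s0.mul_left (omegaSq μ β : ℂ)).add sA
  have hmode : ∀ n, (∫ p, modeOfDeriv ρ μ β (vecFn a) n p.1 * eMode β n p.2 *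
        starRingEnd ℂ (dX Φ p) ∂stripMeasure) +
      (∫ p, Complex.I * (β + n) * modeOf μ β (vecFn a) n p.1 * eMode β n p.2 *
        starRingEnd ℂ (dY Φ p) ∂stripMeasure) =
      omegaSq μ β * (∫ p, modeOf μ β (vecFn a) n p.1 * eMode β n p.2 *
        starRingEnd ℂ (Φ p) ∂stripMeasure) +
      ∫ p, vecFn a n p.1 * eMode β n p.2 * starRingEnd ℂ (Φ p) ∂stripMeasure := by
    intro n
    rw [← integral_add (iX n) (iY n), ← integral_const_mul, ← integral_add ((i0 n).const_mul _)
      (iA n), integral_test_mode hΦ (hasDerivAt_modeOf h hμ n (hAc n) (vecFn_eq_zero a n))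
      (hasDerivAt_modeOfDeriv h hμ n (hAc n) (vecFn_eq_zero a n))
      ((continuous_const.mul (hmc n)).sub (hAc n))]
    refine integral_congr_ae (Eventually.of_forall fun p => ?_)
    beta_reduce
    push_cast
    ring
  have hEq := hL.unique ((funext hmode) ▸ hR)
  rw [integral_add IX IY, hEq, ← integral_const_mul, ← integral_add (I0.const_mul _) IA,
    ← integral_const_mul]
  refine integral_congr_ae (Eventually.of_forall fun p => ?_)
  beta_reduce
  rw [show modeSeries β (vecFn a) p = _ from (hA.hasSum hf h hμ p).tsum_eq]
  push_cast
  ring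

theorem IsConsistent.isScatteringSolution (hf : IsProfile f ρ) (h : GoodParam b d μ β)
    (hμ : 0 < μ) (hA : IsConsistent f ε μ β (vecFn a)) :
    IsScatteringSolution f ε μ β (modeSeries β (modeOf μ β (vecFn a))) (reflOf μ β (vecFn a))
      (transOf μ β (vecFn a)) :=
  ⟨_, _, memH1_modeSeries_sub_farField h hμ hf.pos.le fun n => hA.continuous_vecFn hf n,
    fun _ hΦ => hA.weak_equation hf h hμ hΦ⟩

end Existence

/-! ### Solutions tested with single modes -/

section Holder

variable {α : Type*} [MeasurableSpace α] {m : Measure α} {u v θ : α → ℂ}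

lemma integrable_mul_of_memLp_two (hu : MemLp u 2 m) (hθ : MemLp θ 2 m) :
    Integrable (fun p => u p * θ p) m :=
  hu.integrable_mul hθ

lemma norm_integral_mul_le (hu : MemLp u 2 m) (hθ : MemLp θ 2 m) :
    ‖∫ p, u p * θ p ∂m‖ ≤ (eLpNorm u 2 m).toReal * (eLpNorm θ 2 m).toReal := by
  have h1 : ‖∫ p, u p * θ p ∂m‖ₑ ≤ eLpNorm u 2 m * eLpNorm θ 2 m := by
    refine (enorm_integral_le_lintegral_enorm _).trans ?_
    have h2 := eLpNorm_smul_le_mul_eLpNorm (p := 2) (q := 2) (r := 1)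
      hθ.aestronglyMeasurable hu.aestronglyMeasurable
    rw [eLpNorm_one_eq_lintegral_enorm] at h2
    exact h2
  have h3 := ENNReal.toReal_mono (ENNReal.mul_ne_top hu.eLpNorm_ne_top hθ.eLpNorm_ne_top) h1
  rwa [ENNReal.toReal_mul, toReal_enorm] at h3

lemma tendsto_integral_mul_of_eLpNorm {φ : ℕ → α → ℂ} (hφ : ∀ k, MemLp (φ k) 2 m)
    (hv : MemLp v 2 m) (hθ : MemLp θ 2 m)
    (hlim : Tendsto (fun k => eLpNorm (φ k - v) 2 m) atTop (𝓝 0)) :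
    Tendsto (fun k => ∫ p, φ k p * θ p ∂m) atTop (𝓝 (∫ p, v p * θ p ∂m)) := by
  rw [tendsto_iff_norm_sub_tendsto_zero]
  have h0 : Tendsto (fun k => (eLpNorm (φ k - v) 2 m).toReal * (eLpNorm θ 2 m).toReal) atTop
      (𝓝 0) := by
    have := ((ENNReal.tendsto_toReal ENNReal.zero_ne_top).comp hlim).mul_const
      (eLpNorm θ 2 m).toReal
    simpa using this
  refine squeeze_zero (fun _ => norm_nonneg _) (fun k => ?_) h0
  rw [← integral_sub (integrable_mul_of_memLp_two (hφ k) hθ) (integrable_mul_of_memLp_two hv hθ)]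
  simp only [← sub_mul]
  exact norm_integral_mul_le ((hφ k).sub hv) hθ

end Holder

lemma memLp_strip_of_support {g : ℝ × ℝ → ℂ} (hg : Continuous g) {M : ℝ}
    (hM : ∀ x y : ℝ, M < |x| → y ∈ Ioo 0 (2 * Real.pi) → g (x, y) = 0) :
    MemLp g 2 stripMeasure := by
  obtain ⟨C, -, hC⟩ := exists_le_expWeight hg hM 1
  exact memLp_of_le_expWeight hg.aestronglyMeasurable one_pos hC

section ModeEquation

variable {f : ℝ × ℝ → ℝ} {ε μ β : ℝ} {Ψ : ℝ × ℝ → ℂ} {r t : ℂ}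

lemma farField_two_pi (μ β : ℝ) (r t : ℂ) (x : ℝ) : farField μ β r t (x, 2 * Real.pi) =
    Complex.exp (2 * Real.pi * Complex.I * β) * farField μ β r t (x, 0) := by
  rw [farField_eq]
  simp only [eMode_two_pi]
  ring

/-- The identity for the approximating test functions passes to the limit, because each factor built
from `g` lies in `L²`. -/
lemma MemH1.integral_by_parts {v vx vy : ℝ × ℝ → ℂ} (hv : MemH1 β v vx vy) (n : ℤ)
    {g g' g'' : ℝ → ℂ} {M : ℝ} (hg : ∀ x, HasDerivAt g (g' x) x)
    (hg' : ∀ x, HasDerivAt g' (g'' x) x) (hg'' : Continuous g'')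
    (hM : ∀ x, M < |x| → g x = 0 ∧ g' x = 0 ∧ g'' x = 0) :
    (∫ p, vx p * (g' p.1 * starRingEnd ℂ (eMode β n p.2)) ∂stripMeasure) -
        Complex.I * (β + n) * ∫ p, vy p * (g p.1 * starRingEnd ℂ (eMode β n p.2)) ∂stripMeasure =
      ∫ p, v p * ((-g'' p.1 + (β + n) ^ 2 * g p.1) * starRingEnd ℂ (eMode β n p.2))
        ∂stripMeasure := by
  obtain ⟨hv0, hv1, hv2, φ, hφ, l0, l1, l2⟩ := hv
  have hgc : Continuous g := continuous_iff_continuousAt.mpr fun x => (hg x).continuousAt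
  have hgc' : Continuous g' := continuous_iff_continuousAt.mpr fun x => (hg' x).continuousAt
  have t1 : MemLp (fun p : ℝ × ℝ => g' p.1 * starRingEnd ℂ (eMode β n p.2)) 2 stripMeasure :=
    memLp_strip_of_support (M := M) (by fun_prop) fun x y hx _ => by simp [(hM x hx).2.1]
  have t2 : MemLp (fun p : ℝ × ℝ => g p.1 * starRingEnd ℂ (eMode β n p.2)) 2 stripMeasure :=
    memLp_strip_of_support (M := M) (by fun_prop) fun x y hx _ => by simp [(hM x hx).1]
  have t3 : MemLp (fun p : ℝ × ℝ => (-g'' p.1 + (β + n) ^ 2 * g p.1) *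
      starRingEnd ℂ (eMode β n p.2)) 2 stripMeasure :=
    memLp_strip_of_support (M := M) (by fun_prop) fun x y hx _ => by simp [(hM x hx).1, (hM x hx).2.2]
  have mem : ∀ k, MemLp (φ k) 2 stripMeasure ∧ MemLp (dX (φ k)) 2 stripMeasure ∧
      MemLp (dY (φ k)) 2 stripMeasure := fun k => by
    obtain ⟨M', -, hM'⟩ := (hφ k).exists_support
    exact ⟨memLp_strip_of_support (hφ k).1.continuous fun x y hx hy => (hM' x y hx hy).1,
      memLp_strip_of_support (contDiff_dX (hφ k).1).continuous
        fun x y hx hy => (hM' x y hx hy).2.1,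
      memLp_strip_of_support (contDiff_dY (hφ k).1).continuous
        fun x y hx hy => (hM' x y hx hy).2.2⟩
  have L1 := tendsto_integral_mul_of_eLpNorm (fun k => (mem k).2.1) hv1 t1 l1
  have L2 := tendsto_integral_mul_of_eLpNorm (fun k => (mem k).2.2) hv2 t2 l2
  have L0 := tendsto_integral_mul_of_eLpNorm (fun k => (mem k).1) hv0 t3 l0
  refine tendsto_nhds_unique ((L1.sub (L2.const_mul (Complex.I * (β + n)))).congr fun k => ?_) L0
  have := integral_by_parts_strip (n := n) (hφ k).1 (hφ k).2.1 hg hg' hg'' fun x hx =>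
    Or.inr (hM x hx)
  rw [← integral_const_mul, ← integral_sub (integrable_mul_of_memLp_two (mem k).2.1 t1)
    ((integrable_mul_of_memLp_two (mem k).2.2 t2).const_mul _)]
  refine Eq.trans ?_ (this.trans ?_) <;>
  · refine integral_congr_ae (Eventually.of_forall fun p => ?_)
    beta_reduce
    ring

lemma farField_integral_by_parts (μ β : ℝ) (r t : ℂ) (n : ℤ)
    {g g' g'' : ℝ → ℂ} {M : ℝ} (hg : ∀ x, HasDerivAt g (g' x) x)
    (hg' : ∀ x, HasDerivAt g' (g'' x) x) (hg'' : Continuous g'')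
    (hM : ∀ x, M < |x| → g x = 0 ∧ g' x = 0 ∧ g'' x = 0) :
    (∫ p, dX (farField μ β r t) p * (g' p.1 * starRingEnd ℂ (eMode β n p.2)) ∂stripMeasure) -
        Complex.I * (β + n) * ∫ p, dY (farField μ β r t) p *
          (g p.1 * starRingEnd ℂ (eMode β n p.2)) ∂stripMeasure =
      ∫ p, farField μ β r t p * ((-g'' p.1 + (β + n) ^ 2 * g p.1) *
        starRingEnd ℂ (eMode β n p.2)) ∂stripMeasure := by
  have hgc : Continuous g := continuous_iff_continuousAt.mpr fun x => (hg x).continuousAt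
  have hgc' : Continuous g' := continuous_iff_continuousAt.mpr fun x => (hg' x).continuousAt
  have hF := contDiff_farField μ β r t
  have hFX := (contDiff_dX hF).continuous
  have hFY := (contDiff_dY hF).continuous
  have := integral_by_parts_strip (n := n) hF (farField_two_pi μ β r t) hg hg' hg'' fun x hx =>
    Or.inr (hM x hx)
  rw [← integral_const_mul, ← integral_sub]
  · refine Eq.trans ?_ (this.trans ?_) <;>
    · refine integral_congr_ae (Eventually.of_forall fun p => ?_)
      beta_reduce
      ring
  · exact integrable_strip_of_support (M := M) (by fun_prop) fun x y hx _ => by simp [(hM x hx).2.1]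
  · exact (integrable_strip_of_support (M := M) (by fun_prop)
      fun x y hx _ => by simp [(hM x hx).1]).const_mul _

lemma integrable_solution_mul {Ψx Ψy : ℝ × ℝ → ℂ}
    (hv : MemH1 β (Ψ - farField μ β r t) Ψx Ψy) {θ : ℝ × ℝ → ℂ} (hθ : Continuous θ) {M : ℝ}
    (hM : ∀ x y : ℝ, M < |x| → y ∈ Ioo 0 (2 * Real.pi) → θ (x, y) = 0) :
    Integrable (fun p => Ψ p * θ p) stripMeasure := by
  have h1 := integrable_mul_of_memLp_two hv.1 (memLp_strip_of_support hθ hM)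
  have h2 : Integrable (fun p => farField μ β r t p * θ p) stripMeasure :=
    integrable_strip_of_support ((contDiff_farField μ β r t).continuous.mul hθ)
      fun x y hx hy => by rw [hM x y hx hy, mul_zero]
  refine (h1.add h2).congr (Eventually.of_forall fun p => ?_)
  simp only [Pi.add_apply, Pi.sub_apply]
  ring

/-- The test function is the conjugate of `g` times the exponential. `Ψ` is split into its part in
`H₁^β` and the far field so that both derivatives can be moved onto `g`. -/
lemma IsScatteringSolution.mode_equation (hS : IsScatteringSolution f ε μ β Ψ r t) (n : ℤ)
    {g g' g'' : ℝ → ℂ} {M : ℝ} (hgs : ContDiff ℝ ∞ g) (hg : ∀ x, HasDerivAt g (g' x) x)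
    (hg' : ∀ x, HasDerivAt g' (g'' x) x) (hg'' : Continuous g'')
    (hM : ∀ x, M < |x| → g x = 0 ∧ g' x = 0 ∧ g'' x = 0) :
    ∫ p, Ψ p * ((-g'' p.1 + (β + n) ^ 2 * g p.1) * starRingEnd ℂ (eMode β n p.2))
        ∂stripMeasure =
      omegaSq μ β * ∫ p, (1 + ε * f p) * Ψ p * (g p.1 * starRingEnd ℂ (eMode β n p.2))
        ∂stripMeasure := by
  obtain ⟨Ψx, Ψy, hv, hw⟩ := hS
  have hgc' : Continuous g' := continuous_iff_continuousAt.mpr fun x => (hg' x).continuousAt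
  have hgc := hgs.continuous
  obtain ⟨gc, hgce⟩ : ∃ gc : ℝ → ℂ, gc = fun x => starRingEnd ℂ (g x) := ⟨_, rfl⟩
  have hcs : ContDiff ℝ ∞ gc := hgce ▸ Complex.conjCLE.contDiff.comp hgs
  have hder : deriv gc = fun x => starRingEnd ℂ (g' x) := by
    rw [hgce]
    exact funext fun x => ((Complex.conjCLE.toContinuousLinearMap.hasFDerivAt).comp_hasDerivAt x
      (hg x)).deriv
  have key := hw (fun p => gc p.1 * eMode β n p.2) (isTest_mul_eMode hcs (M := M) fun x hx => by
    simp [hgce, (hM x hx).1])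
  rw [dX_mul_eMode, dY_mul_eMode, hder, hgce] at key
  have hFc := (contDiff_farField μ β r t).continuous
  have hFX := (contDiff_dX (contDiff_farField μ β r t)).continuous
  have hFY := (contDiff_dY (contDiff_farField μ β r t)).continuous
  have s1 : ∀ x y : ℝ, M < |x| → y ∈ Ioo 0 (2 * Real.pi) →
      g' (x, y).1 * starRingEnd ℂ (eMode β n (x, y).2) = 0 := fun x y hx _ => by
    simp [(hM x hx).2.1]
  have s2 : ∀ x y : ℝ, M < |x| → y ∈ Ioo 0 (2 * Real.pi) →
      g (x, y).1 * starRingEnd ℂ (eMode β n (x, y).2) = 0 := fun x y hx _ => by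
    simp [(hM x hx).1]
  have s3 : ∀ x y : ℝ, M < |x| → y ∈ Ioo 0 (2 * Real.pi) → (-g'' (x, y).1 +
      (β + n) ^ 2 * g (x, y).1) * starRingEnd ℂ (eMode β n (x, y).2) = 0 := fun x y hx _ => by
    simp [(hM x hx).1, (hM x hx).2.2]
  have m1 := memLp_strip_of_support (g := fun p => g' p.1 * starRingEnd ℂ (eMode β n p.2))
    (by fun_prop) s1
  have m2 := memLp_strip_of_support (g := fun p => g p.1 * starRingEnd ℂ (eMode β n p.2))
    (by fun_prop) s2
  have split : ∀ {V F θ : ℝ × ℝ → ℂ}, MemLp (V - F) 2 stripMeasure → Continuous F →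
      Continuous θ → (∀ x y : ℝ, M < |x| → y ∈ Ioo 0 (2 * Real.pi) → θ (x, y) = 0) →
      Integrable (fun p => V p * θ p) stripMeasure ∧
      ∫ p, V p * θ p ∂stripMeasure =
        (∫ p, (V - F) p * θ p ∂stripMeasure) + ∫ p, F p * θ p ∂stripMeasure := by
    intro V F θ hV hF hθ h0
    have i1 := integrable_mul_of_memLp_two hV (memLp_strip_of_support hθ h0)
    have i2 : Integrable (fun p => F p * θ p) stripMeasure :=
      integrable_strip_of_support (hF.mul hθ) fun x y hx hy => by rw [h0 x y hx hy, mul_zero]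
    have e : (fun p => V p * θ p) = fun p => (V - F) p * θ p + F p * θ p := by
      ext p
      simp only [Pi.sub_apply]
      ring
    rw [e]
    exact ⟨i1.add i2, integral_add i1 i2⟩
  have S1 := split (θ := fun p => g' p.1 * starRingEnd ℂ (eMode β n p.2)) hv.2.1 hFX
    (by fun_prop) s1
  have S2 := split (θ := fun p => g p.1 * starRingEnd ℂ (eMode β n p.2)) hv.2.2.1 hFY
    (by fun_prop) s2
  have S3 := split (θ := fun p => (-g'' p.1 + (β + n) ^ 2 * g p.1) *
    starRingEnd ℂ (eMode β n p.2)) hv.1 hFc (by fun_prop) s3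
  have I1 := hv.integral_by_parts n hg hg' hg'' hM
  have I2 := farField_integral_by_parts μ β r t n hg hg' hg'' hM
  have hL : ∫ p, (Ψx p * starRingEnd ℂ (starRingEnd ℂ (g' p.1) * eMode β n p.2) +
      Ψy p * starRingEnd ℂ (Complex.I * (β + n) * starRingEnd ℂ (g p.1) * eMode β n p.2))
        ∂stripMeasure = (∫ p, Ψx p * (g' p.1 * starRingEnd ℂ (eMode β n p.2)) ∂stripMeasure) -
      Complex.I * (β + n) * ∫ p, Ψy p * (g p.1 * starRingEnd ℂ (eMode β n p.2))
        ∂stripMeasure := by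
    rw [← integral_const_mul, ← integral_sub S1.1 (S2.1.const_mul _)]
    refine integral_congr_ae (Eventually.of_forall fun p => ?_)
    simp only [map_mul, map_add, Complex.conj_conj, Complex.conj_I, Complex.conj_ofReal,
      map_intCast]
    ring
  rw [S3.2, ← I1, ← I2]
  rw [hL, S1.2, S2.2] at key
  have hR : ∀ p, (1 + ε * f p) * Ψ p * starRingEnd ℂ (starRingEnd ℂ (g p.1) * eMode β n p.2) =
      (1 + ε * f p) * Ψ p * (g p.1 * starRingEnd ℂ (eMode β n p.2)) := fun p => by
    rw [map_mul, Complex.conj_conj]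
  simp only [hR] at key
  rw [← key]
  ring

end ModeEquation

/-! ### The modes of a solution -/

/-- Outside `[-R, R]` the function is an exponential whose modulus does not grow when `Re s ≥ 0`, so
its values there are dominated by those at `±R`. -/
lemma exists_bound_expSol {s : ℂ} {R : ℝ} {a : ℝ → ℂ} (hs : s ≠ 0) (hre : 0 ≤ s.re) (hR : 0 ≤ R)
    (ha : Continuous a) (hsupp : ∀ x, x ∉ Icc (-R) R → a x = 0) :
    ∃ W : ℝ, 0 ≤ W ∧ ∀ x, ‖expSol s R a x‖ ≤ W ∧ ‖expSolDeriv s R a x‖ ≤ W := by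
  have c0 : Continuous (expSol s R a) :=
    continuous_iff_continuousAt.mpr fun x => (hasDerivAt_expSol hs ha x).continuousAt
  have c1 : Continuous (expSolDeriv s R a) :=
    continuous_iff_continuousAt.mpr fun x => (hasDerivAt_expSolDeriv hs ha x).continuousAt
  obtain ⟨W₀, h₀⟩ := (isCompact_Icc (a := -R) (b := R)).exists_bound_of_continuousOn c0.continuousOn
  obtain ⟨W₁, h₁⟩ := (isCompact_Icc (a := -R) (b := R)).exists_bound_of_continuousOn c1.continuousOn
  have hRm : R ∈ Icc (-R) R := ⟨by linarith, le_rfl⟩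
  have hRm' : -R ∈ Icc (-R) R := ⟨le_rfl, by linarith⟩
  have w0 : 0 ≤ W₀ := (norm_nonneg _).trans (h₀ R hRm)
  have w1 : 0 ≤ W₁ := (norm_nonneg _).trans (h₁ R hRm)
  have hexp : ∀ {y z : ℂ} {c : ℂ}, y.re ≤ z.re →
      ‖1 / (2 * s) * (Complex.exp y * c)‖ ≤ ‖1 / (2 * s) * (Complex.exp z * c)‖ := by
    intro y z c hyz
    rw [norm_mul, norm_mul, norm_mul, norm_mul, Complex.norm_exp, Complex.norm_exp]
    gcongr
  have b0 : ∀ x, ‖expSol s R a x‖ ≤ W₀ := by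
    intro x
    by_cases hx : x ∈ Icc (-R) R
    · exact h₀ x hx
    · rcases le_or_gt R x with hx' | hx'
      · refine le_trans ?_ (h₀ R hRm)
        rw [expSol_of_ge ha hsupp hx', expSol_of_ge ha hsupp le_rfl]
        refine hexp ?_
        simp only [Complex.neg_re, Complex.re_mul_ofReal]
        nlinarith
      · have hx'' : x ≤ -R := by
          by_contra! hc
          exact hx ⟨hc.le, hx'.le⟩
        refine le_trans ?_ (h₀ (-R) hRm')
        rw [expSol_of_le ha hsupp hx'', expSol_of_le ha hsupp le_rfl]
        refine hexp ?_
        simp only [Complex.re_mul_ofReal]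
        nlinarith
  refine ⟨W₀ + W₁ + ‖s‖ * W₀, by positivity, fun x => ⟨?_, ?_⟩⟩
  · linarith [b0 x, mul_nonneg (norm_nonneg s) w0]
  · have hsw := mul_le_mul_of_nonneg_left (b0 x) (norm_nonneg s)
    by_cases hx : x ∈ Icc (-R) R
    · linarith [h₁ x hx, mul_nonneg (norm_nonneg s) w0]
    · rcases le_or_gt R x with hx' | hx'
      · rw [expSolDeriv_of_ge hs hsupp hx', norm_mul, norm_neg]
        linarith
      · have hx'' : x ≤ -R := by
          by_contra! hc
          exact hx ⟨hc.le, hx'.le⟩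
        rw [expSolDeriv_of_le hs hsupp hx'', norm_mul]
        linarith

lemma GoodParam.modeExp_re_nonneg {b d μ β : ℝ} (h : GoodParam b d μ β) (hμ : 0 < μ) (n : ℤ) :
    0 ≤ (modeExp μ β n).re := by
  rcases eq_or_ne n 0 with rfl | hn
  · rw [modeExp_zero]
    simp
  · rw [modeExp_of_ne hn, Complex.ofReal_re]
    exact le_trans (mul_nonneg (h.minRate_pos hμ).le (abs_nonneg _)) (h.minRate_mul_le hn)

/-- The test factors live in bands of fixed area and are uniformly bounded, hence bounded in `L²`.
Since `v` is an `L²` limit of functions vanishing for large `|x|`, its pairing with bands moving to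
infinity tends to zero. -/
lemma MemH1.tendsto_integral_tail {β : ℝ} {v vx vy : ℝ × ℝ → ℂ} (hv : MemH1 β v vx vy) (n : ℤ)
    {q : ℕ → ℝ → ℂ} (hq : ∀ N, Continuous (q N)) {W : ℝ} (hW : ∀ N x, ‖q N x‖ ≤ W)
    (h0 : ∀ (N : ℕ) (x : ℝ), |x| < N ∨ (N : ℝ) + 1 < |x| → q N x = 0) :
    Tendsto (fun N => ∫ p, v p * (q N p.1 * starRingEnd ℂ (eMode β n p.2)) ∂stripMeasure) atTop
      (𝓝 0) := by
  obtain ⟨hv0, -, -, φ, hφ, l0, -, -⟩ := hv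
  set θ : ℕ → ℝ × ℝ → ℂ := fun N p => q N p.1 * starRingEnd ℂ (eMode β n p.2) with hθ
  have hθc : ∀ N, Continuous (θ N) := fun N => by
    have := hq N
    simp only [hθ]
    fun_prop
  have hθm : ∀ N, MemLp (θ N) 2 stripMeasure := fun N =>
    memLp_strip_of_support (hθc N) (M := N + 1) fun x y hx _ => by
      simp [hθ, h0 N x (Or.inr hx)]
  -- The set `N ≤ |x| ≤ N + 1` consists of two pieces of width 1, each of area `2π` in the strip.
  set L : ENNReal := (2 * ENNReal.ofReal (2 * Real.pi)) ^ (2 : ENNReal).toReal⁻¹ *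
    ENNReal.ofReal W with hL
  have hLtop : L ≠ ⊤ := by
    refine ENNReal.mul_ne_top (ENNReal.rpow_ne_top_of_nonneg (by positivity) ?_) ENNReal.ofReal_ne_top
    exact ENNReal.mul_ne_top (by simp) ENNReal.ofReal_ne_top
  have hθL : ∀ N, eLpNorm (θ N) 2 stripMeasure ≤ L := by
    intro N
    set S : Set ℝ := Icc (N : ℝ) (N + 1) ∪ Icc (-((N : ℝ) + 1)) (-N) with hS
    have hsub : Function.support (θ N) ⊆ S ×ˢ univ := by
      intro p hp
      refine ⟨?_, mem_univ _⟩
      by_contra hpS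
      refine hp ?_
      have : |p.1| < N ∨ (N : ℝ) + 1 < |p.1| := by
        by_contra! hc
        refine hpS ?_
        rcases le_total 0 p.1 with h | h
        · rw [abs_of_nonneg h] at hc
          exact Or.inl ⟨hc.1, hc.2⟩
        · rw [abs_of_nonpos h] at hc
          exact Or.inr ⟨by linarith [hc.2], by linarith [hc.1]⟩
      simp [hθ, h0 N p.1 this]
    have hSm : MeasurableSet (S ×ˢ (univ : Set ℝ)) :=
      (measurableSet_Icc.union measurableSet_Icc).prod MeasurableSet.univ
    rw [← eLpNorm_restrict_eq_of_support_subset hsub]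
    refine (eLpNorm_le_of_ae_bound (C := W) (Eventually.of_forall fun p => ?_)).trans ?_
    · simp only [hθ]
      rw [norm_mul, RCLike.norm_conj, norm_eMode, mul_one]
      exact hW N p.1
    · rw [hL, Measure.restrict_apply_univ]
      gcongr
      rw [stripMeasure_eq_prod, Measure.prod_prod, Measure.restrict_apply_univ, Real.volume_Ioo,
        sub_zero]
      gcongr
      refine (measure_union_le _ _).trans ?_
      rw [Real.volume_Icc, Real.volume_Icc]
      have e1 : (N : ℝ) + 1 - N = 1 := by ring
      have e2 : -(N : ℝ) - -((N : ℝ) + 1) = 1 := by ring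
      rw [e1, e2, ENNReal.ofReal_one, one_add_one_eq_two]
  have hmem : ∀ k, MemLp (φ k) 2 stripMeasure := fun k => by
    obtain ⟨M, -, hM⟩ := (hφ k).exists_support
    exact memLp_strip_of_support (hφ k).1.continuous fun x y hx hy => (hM x y hx hy).1
  rw [Metric.tendsto_atTop]
  intro δ hδ
  have hlim : Tendsto (fun k => (eLpNorm (φ k - v) 2 stripMeasure).toReal * L.toReal) atTop
      (𝓝 0) := by
    have := ((ENNReal.tendsto_toReal ENNReal.zero_ne_top).comp l0).mul_const L.toReal
    simpa using this
  obtain ⟨k, hk⟩ := (hlim.eventually (gt_mem_nhds hδ)).exists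
  obtain ⟨M, -, hM⟩ := (hφ k).exists_support
  obtain ⟨N₀, hN₀⟩ := exists_nat_gt M
  refine ⟨N₀, fun N hN => ?_⟩
  have hN' : M < N := hN₀.trans_le (by exact_mod_cast hN)
  have hz : ∫ p, φ k p * θ N p ∂stripMeasure = 0 := by
    rw [← integral_zero (ℝ × ℝ) ℂ (μ := stripMeasure)]
    refine integral_congr_ae ?_
    filter_upwards [ae_stripMeasure_mem] with p hp
    rcases lt_or_ge |p.1| N with h | h
    · simp [hθ, h0 N p.1 (Or.inl h)]
    · rw [show φ k p = 0 from (hM p.1 p.2 (hN'.trans_le h) hp).1, zero_mul]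
  have e : ∫ p, v p * θ N p ∂stripMeasure = -∫ p, (φ k - v) p * θ N p ∂stripMeasure := by
    simp only [Pi.sub_apply, sub_mul]
    rw [integral_sub (integrable_mul_of_memLp_two (hmem k) (hθm N))
      (integrable_mul_of_memLp_two hv0 (hθm N)), hz, zero_sub, neg_neg]
  rw [dist_zero_right, e, norm_neg]
  refine (norm_integral_mul_le ((hmem k).sub hv0) (hθm N)).trans_lt (lt_of_le_of_lt ?_ hk)
  exact mul_le_mul_of_nonneg_left (ENNReal.toReal_mono hLtop (hθL N)) ENNReal.toReal_nonneg

lemma integral_eMode_mul_conj (β : ℝ) (m n : ℤ) :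
    ∫ y in (0 : ℝ)..(2 * Real.pi), eMode β m y * starRingEnd ℂ (eMode β n y) =
      if m = n then 2 * Real.pi else 0 := by
  have e : ∀ y : ℝ, eMode β m y * starRingEnd ℂ (eMode β n y) =
      Complex.exp (Complex.I * (m - n) * y) := fun y => by
    rw [conj_eMode, eMode, ← Complex.exp_add]
    ring_nf
  simp only [e]
  split_ifs with h
  · rw [h, sub_self]
    simp
  · have hne : Complex.I * ((m : ℂ) - n) ≠ 0 :=
      mul_ne_zero Complex.I_ne_zero (sub_ne_zero.mpr (by exact_mod_cast h))
    rw [integral_exp_mul_complex hne]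
    have : Complex.exp (Complex.I * (m - n) * (2 * Real.pi : ℝ)) = 1 := by
      rw [Complex.exp_eq_one_iff]
      exact ⟨m - n, by push_cast; ring⟩
    rw [this]
    simp

lemma deriv_farProfile_of_gt {k : ℝ} {r t : ℂ} {x : ℝ} (hx : 1 < x) :
    deriv (farProfile k r t) x = Complex.I * k * farProfile k r t x := by
  have : farProfile k r t =ᶠ[𝓝 x] fun x => t * Complex.exp (Complex.I * k * x) := by
    filter_upwards [Ioi_mem_nhds hx] with y hy using farProfile_of_ge (le_of_lt hy)
  rw [this.deriv_eq, ((hasDerivAt_cexp_mul _ x).const_mul t).deriv, farProfile_of_ge hx.le]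
  ring

lemma deriv_farProfile_of_lt {k : ℝ} {r t : ℂ} {x : ℝ} (hx : x < -1) :
    deriv (farProfile k r t) x = Complex.I * k * Complex.exp (Complex.I * k * x) -
      Complex.I * k * (farProfile k r t x - Complex.exp (Complex.I * k * x)) := by
  have : farProfile k r t =ᶠ[𝓝 x] fun x => Complex.exp (Complex.I * k * x) +
      r * Complex.exp (-(Complex.I * k) * x) := by
    filter_upwards [Iio_mem_nhds hx] with y hy using farProfile_of_le (le_of_lt hy)
  have hd : HasDerivAt (fun x : ℝ => Complex.exp (Complex.I * k * x) +
      r * Complex.exp (-(Complex.I * k) * x)) _ x :=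
    (hasDerivAt_cexp_mul _ x).add ((hasDerivAt_cexp_mul _ x).const_mul r)
  rw [this.deriv_eq, hd.deriv, farProfile_of_le hx.le]
  ring

/-! ### A solution tested with the outgoing solutions of the mode equations -/

/-- The commutator of `d²/dx²` with the cut-off, applied to `expSol s R ψ`. -/
def cutoffError (s : ℂ) (R : ℝ) (ψ : ℝ → ℂ) (N x : ℝ) : ℂ :=
  2 * ((deriv (cutoff N) x : ℝ) : ℂ) * expSolDeriv s R ψ x +
    ((deriv (deriv (cutoff N)) x : ℝ) : ℂ) * expSol s R ψ x

section CutoffError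

variable {s : ℂ} {R : ℝ} {ψ : ℝ → ℂ}

lemma hasDerivAt_cutoff_mul_expSol (hs : s ≠ 0) (hψ : Continuous ψ) (N x : ℝ) :
    HasDerivAt (fun x => (cutoff N x : ℂ) * expSol s R ψ x)
      (((deriv (cutoff N) x : ℝ) : ℂ) * expSol s R ψ x + cutoff N x * expSolDeriv s R ψ x) x :=
  (hasDerivAt_cutoff N x).ofReal_comp.mul (hasDerivAt_expSol hs hψ x)

lemma hasDerivAt_deriv_cutoff_mul_expSol (hs : s ≠ 0) (hψ : Continuous ψ) (N x : ℝ) :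
    HasDerivAt (fun x => ((deriv (cutoff N) x : ℝ) : ℂ) * expSol s R ψ x +
        cutoff N x * expSolDeriv s R ψ x)
      (cutoffError s R ψ N x + cutoff N x * (s ^ 2 * expSol s R ψ x - ψ x)) x := by
  refine (((hasDerivAt_deriv_cutoff N x).ofReal_comp.mul (hasDerivAt_expSol hs hψ x)).add
    ((hasDerivAt_cutoff N x).ofReal_comp.mul (hasDerivAt_expSolDeriv hs hψ x))).congr_deriv ?_
  rw [cutoffError]
  ring

lemma continuous_expSol (hs : s ≠ 0) (hψ : Continuous ψ) : Continuous (expSol s R ψ) :=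
  continuous_iff_continuousAt.mpr fun x => (hasDerivAt_expSol hs hψ x).continuousAt

lemma continuous_expSolDeriv (hs : s ≠ 0) (hψ : Continuous ψ) : Continuous (expSolDeriv s R ψ) :=
  continuous_iff_continuousAt.mpr fun x => (hasDerivAt_expSolDeriv hs hψ x).continuousAt

lemma continuous_deriv_deriv_cutoff (N : ℝ) : Continuous (deriv (deriv (cutoff N))) :=
  ((contDiff_infty_iff_deriv (𝕜 := ℝ)).mp (contDiff_deriv_cutoff N)).2.continuous

lemma continuous_cutoffError (hs : s ≠ 0) (hψ : Continuous ψ) (N : ℝ) :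
    Continuous (cutoffError s R ψ N) := by
  have c0 := continuous_expSol (R := R) hs hψ
  have c1 := continuous_expSolDeriv (R := R) hs hψ
  have c2 := (contDiff_deriv_cutoff N).continuous
  have c3 := continuous_deriv_deriv_cutoff N
  unfold cutoffError
  fun_prop

lemma cutoffError_eq_zero {N x : ℝ} (h : |x| < N ∨ N + 1 < |x|) : cutoffError s R ψ N x = 0 := by
  rw [cutoffError]
  rcases h with h | h
  · rw [deriv_cutoff_eq_zero_of_lt h, deriv_deriv_cutoff_eq_zero_of_lt h]
    simp
  · rw [deriv_cutoff_eq_zero_of_gt h, deriv_deriv_cutoff_eq_zero_of_gt h]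
    simp

lemma exists_bound_cutoffError (hs : s ≠ 0) (hre : 0 ≤ s.re) (hR : 0 ≤ R) (hψ : Continuous ψ)
    (hsupp : ∀ x, x ∉ Icc (-R) R → ψ x = 0) :
    ∃ W : ℝ, ∀ N x : ℝ, ‖cutoffError s R ψ N x‖ ≤ W := by
  obtain ⟨W, hW0, hW⟩ := exists_bound_expSol hs hre hR hψ hsupp
  obtain ⟨D, hD0, hD⟩ := exists_bound_deriv_cutoff
  refine ⟨2 * D * W + D * W, fun N x => ?_⟩
  rw [cutoffError]
  refine (norm_add_le _ _).trans ?_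
  rw [norm_mul, norm_mul, norm_mul, Complex.norm_real, Complex.norm_real, Complex.norm_two,
    Real.norm_eq_abs, Real.norm_eq_abs]
  gcongr
  exacts [(hD N x).1, (hW x).2, (hD N x).2, (hW x).1]

/-- Green's identity for the truncated `expSol` and `e^{-sx}`: the exponential solves the
homogeneous equation, so only the source `ψ` is seen, and the boundary terms vanish by truncation.
-/
lemma integral_exp_mul_cutoffError (hs : s ≠ 0) (hψ : Continuous ψ)
    (hsupp : ∀ x, x ∉ Icc (-R) R → ψ x = 0) {N : ℝ} (hN : R ≤ N) :
    ∫ x : ℝ, Complex.exp (-s * x) * cutoffError s R ψ N x =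
      ∫ x : ℝ, Complex.exp (-s * x) * ψ x := by
  have hE := fun x => hasDerivAt_cexp_mul (-s) x
  have cE : Continuous fun x : ℝ => Complex.exp (-s * x) := (contDiff_cexp_mul (-s)).continuous
  have cq := continuous_cutoffError (R := R) hs hψ N
  have hcψ : ∀ x, (cutoff N x : ℂ) * ψ x = ψ x := fun x => by
    by_cases hx : x ∈ Icc (-R) R
    · rw [cutoff_eq_one ((abs_le.mpr hx).trans hN), Complex.ofReal_one, one_mul]
    · rw [hsupp x hx, mul_zero]
  have d : ∀ x : ℝ, HasDerivAt (fun x : ℝ => Complex.exp (-s * x) *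
        (((deriv (cutoff N) x : ℝ) : ℂ) * expSol s R ψ x + cutoff N x * expSolDeriv s R ψ x) -
        (-s * Complex.exp (-s * x)) * (cutoff N x * expSol s R ψ x))
      (Complex.exp (-s * x) * cutoffError s R ψ N x - Complex.exp (-s * x) * ψ x) x := fun x => by
    refine (((hE x).mul (hasDerivAt_deriv_cutoff_mul_expSol hs hψ N x)).sub
      (((hE x).const_mul (-s)).mul (hasDerivAt_cutoff_mul_expSol hs hψ N x))).congr_deriv ?_
    linear_combination (-Complex.exp (-s * x)) * hcψ x
  have hq0 : ∀ x, N + 1 < |x| → cutoffError s R ψ N x = 0 := fun x hx =>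
    cutoffError_eq_zero (Or.inr hx)
  have hψ0 : ∀ x, N + 1 < |x| → ψ x = 0 := fun x hx => by
    rw [← hcψ, cutoff_eq_zero hx.le]
    simp
  have hi : ∀ {g : ℝ → ℂ}, Continuous g → (∀ x, N + 1 < |x| → g x = 0) →
      Integrable fun x : ℝ => Complex.exp (-s * x) * g x := fun hg h0 =>
    (cE.mul hg).integrable_of_hasCompactSupport
      (HasCompactSupport.intro (isCompact_Icc (a := -(N + 1)) (b := N + 1)) fun x hx => by
        have : N + 1 < |x| := by
          by_contra! h
          exact hx (abs_le.mp h)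
        simp [h0 x this])
  have := integral_deriv_eq_zero_of_support (M := N + 1) d (by fun_prop) fun x hx => by
    simp [hq0 x hx, hψ0 x hx, deriv_cutoff_eq_zero_of_gt hx, cutoff_eq_zero hx.le]
  rw [integral_sub (hi cq hq0) (hi hψ hψ0)] at this
  exact sub_eq_zero.mp this

/-- Once `e^{ik₀x}` is subtracted, the far field is outgoing on both sides and has the same
logarithmic derivative there as `expSol`. The product with the commutator is therefore an exact
derivative of a compactly supported function and integrates to zero, so only the incident wave
contributes. -/
lemma integral_farProfile_mul_cutoffError {k : ℝ} (hs : s = -(Complex.I * k)) (hs0 : s ≠ 0)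
    (r t : ℂ) (hψ : Continuous ψ) (hsupp : ∀ x, x ∉ Icc (-R) R → ψ x = 0) {N : ℝ} (hN : R ≤ N)
    (hN1 : 1 < N) :
    ∫ x : ℝ, farProfile k r t x * cutoffError s R ψ N x =
      ∫ x : ℝ, Complex.exp (Complex.I * k * x) * ψ x := by
  have hsk : -s = Complex.I * k := by rw [hs, neg_neg]
  have cF := (contDiff_farProfile k r t).continuous
  have cF' : Continuous (deriv (farProfile k r t)) :=
    ((contDiff_infty_iff_deriv (𝕜 := ℝ)).mp (contDiff_farProfile k r t)).2.continuous
  have dF : ∀ x, HasDerivAt (farProfile k r t) (deriv (farProfile k r t) x) x := fun x =>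
    ((contDiff_farProfile k r t).differentiable (by simp) x).hasDerivAt
  have cE : Continuous fun x : ℝ => Complex.exp (-s * x) := (contDiff_cexp_mul (-s)).continuous
  have cq := continuous_cutoffError (R := R) hs0 hψ N
  have c0 := continuous_expSol (R := R) hs0 hψ
  have c1 := continuous_expSolDeriv (R := R) hs0 hψ
  have c2 := (contDiff_deriv_cutoff N).continuous
  have c3 := continuous_deriv_deriv_cutoff N
  have d := fun x => ((hasDerivAt_deriv_cutoff N x).ofReal_comp.mul
    ((dF x).sub (hasDerivAt_cexp_mul (-s) x))).mul (hasDerivAt_expSol (R := R) hs0 hψ x)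
  have z := integral_deriv_eq_zero_of_support (M := N + 1) d (by fun_prop) fun x hx => by
    simp [deriv_cutoff_eq_zero_of_gt hx, deriv_deriv_cutoff_eq_zero_of_gt hx]
  have e : ∀ x : ℝ, (farProfile k r t x - Complex.exp (-s * x)) * cutoffError s R ψ N x =
      (((deriv (deriv (cutoff N)) x : ℝ) : ℂ) * (farProfile k r t x - Complex.exp (-s * x)) +
        ((deriv (cutoff N) x : ℝ) : ℂ) * (deriv (farProfile k r t) x - -s * Complex.exp (-s * x))) *
        expSol s R ψ x + ((deriv (cutoff N) x : ℝ) : ℂ) * (farProfile k r t x - Complex.exp (-s * x)) *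
        expSolDeriv s R ψ x := by
    intro x
    rcases lt_or_ge |x| N with hx | hx
    · rw [cutoffError_eq_zero (Or.inl hx), deriv_cutoff_eq_zero_of_lt hx,
        deriv_deriv_cutoff_eq_zero_of_lt hx]
      simp
    · rw [cutoffError, hsk]
      rcases le_abs.mp hx with hx | hx
      · rw [deriv_farProfile_of_gt (by linarith), expSolDeriv_of_ge hs0 hsupp (hN.trans hx), hsk]
        ring
      · rw [deriv_farProfile_of_lt (by linarith), expSolDeriv_of_le hs0 hsupp (by linarith),
          ← hsk]
        ring
  have hi : ∀ {g : ℝ → ℂ}, Continuous g → Integrable fun x : ℝ => g x * cutoffError s R ψ N x :=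
    fun hg => (hg.mul cq).integrable_of_hasCompactSupport
      (HasCompactSupport.intro (isCompact_Icc (a := -(N + 1)) (b := N + 1)) fun x hx => by
        have : N + 1 < |x| := by
          by_contra! h
          exact hx (abs_le.mp h)
        simp [cutoffError_eq_zero (Or.inr this)])
  have z' : ∫ x : ℝ, (farProfile k r t x - Complex.exp (-s * x)) * cutoffError s R ψ N x = 0 := by
    simp only [e]
    exact z
  simp only [sub_mul] at z'
  rw [integral_sub (hi cF) (hi cE), integral_exp_mul_cutoffError hs0 hψ hsupp hN] at z'
  rw [sub_eq_zero.mp z', hsk]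

end CutoffError

/-! ### The identity satisfied by each mode of a solution. -/

section ModeIdentity

variable {f : ℝ × ℝ → ℝ} {ρ ε μ β b d : ℝ} {Ψ : ℝ × ℝ → ℂ} {r t : ℂ}

lemma integral_farField_mul_eMode (μ β : ℝ) (r t : ℂ) (n : ℤ) {q : ℝ → ℂ} (hq : Continuous q)
    {M : ℝ} (hM : ∀ x, M < |x| → q x = 0) :
    ∫ p, farField μ β r t p * (q p.1 * starRingEnd ℂ (eMode β n p.2)) ∂stripMeasure =
      if n = 0 then 2 * Real.pi * ∫ x : ℝ, farProfile (kProp μ β) r t x * q x else 0 := by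
  have hi : Integrable (fun p => farField μ β r t p * (q p.1 * starRingEnd ℂ (eMode β n p.2)))
      stripMeasure :=
    integrable_strip_of_support (M := M)
      ((contDiff_farField μ β r t).continuous.mul (by fun_prop)) fun x y hx _ => by
        simp [hM x hx]
  rw [integral_strip hi]
  have e : ∀ x : ℝ, ∫ y in (0 : ℝ)..(2 * Real.pi),
      farField μ β r t (x, y) * (q (x, y).1 * starRingEnd ℂ (eMode β n (x, y).2)) =
      (if (0 : ℤ) = n then 2 * Real.pi else 0) * (farProfile (kProp μ β) r t x * q x) := fun x => by
    rw [← integral_eMode_mul_conj β 0 n, ← intervalIntegral.integral_mul_const, farField_eq]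
    congr 1
    ext y
    ring
  simp only [e]
  rw [integral_const_mul]
  by_cases hn : n = 0
  · simp [hn]
  · simp [hn, Ne.symm hn]

/-- The solution is tested with the cut-off times `expSol`, which solves `-w'' + s² w = ψ`. The
cut-off equals 1 on the supports of `ψ` and of `f`, so it is visible only through its commutator. -/
lemma IsScatteringSolution.mode_identity_of_cutoff (hf : IsProfile f ρ) (h : GoodParam b d μ β)
    (hμ : 0 < μ) (hS : IsScatteringSolution f ε μ β Ψ r t) (n : ℤ) {ψ : ℝ → ℂ} {R : ℝ}
    (hψ : ContDiff ℝ ∞ ψ) (hsupp : ∀ x, x ∉ Icc (-R) R → ψ x = 0) {N : ℝ}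
    (hRN : R ≤ N) (hρN : ρ ≤ N) :
    ∫ p, Ψ p * (ψ p.1 * starRingEnd ℂ (eMode β n p.2)) ∂stripMeasure =
      (∫ p, Ψ p * (cutoffError (modeExp μ β n) R ψ N p.1 * starRingEnd ℂ (eMode β n p.2))
        ∂stripMeasure) + ε * omegaSq μ β *
        ∫ p, f p * Ψ p * (expSol (modeExp μ β n) R ψ p.1 * starRingEnd ℂ (eMode β n p.2))
          ∂stripMeasure := by
  set s := modeExp μ β n with hs
  have hs0 : s ≠ 0 := h.modeExp_ne_zero hμ n
  have hψc := hψ.continuous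
  have hs2 : s ^ 2 = (β + n) ^ 2 - omegaSq μ β := by
    rw [hs, h.modeExp_sq]
    push_cast
    ring
  have cw := continuous_expSol (R := R) hs0 hψc
  have cq := continuous_cutoffError (R := R) hs0 hψc N
  have cc := (contDiff_cutoff N).continuous
  have cf := hf.smooth.continuous
  have cE := continuous_conj_eMode β n
  have hψ0 : ∀ x, N + 1 < |x| → ψ x = 0 := fun x hx => hsupp x fun hc => by
    have := abs_le.mpr hc
    linarith
  have hcψ : ∀ x, (cutoff N x : ℂ) * ψ x = ψ x := fun x => by
    by_cases hx : x ∈ Icc (-R) R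
    · rw [cutoff_eq_one ((abs_le.mpr hx).trans hRN), Complex.ofReal_one, one_mul]
    · rw [hsupp x hx, mul_zero]
  have hcf : ∀ p, (f p : ℂ) * cutoff N p.1 = f p := fun p => by
    rcases lt_or_ge ρ |p.1| with hx | hx
    · rw [show f p = 0 from hf.support p.1 p.2 hx]
      simp
    · rw [cutoff_eq_one (hx.trans hρN), Complex.ofReal_one, mul_one]
  have key := hS.mode_equation n (M := N + 1)
    (g := fun x => (cutoff N x : ℂ) * expSol s R ψ x)
    ((Complex.ofRealCLM.contDiff.comp (contDiff_cutoff N)).mul (contDiff_expSol hs0 hψ))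
    (hasDerivAt_cutoff_mul_expSol hs0 hψc N) (hasDerivAt_deriv_cutoff_mul_expSol hs0 hψc N)
    (by fun_prop) (fun x hx => by
      simp [cutoffError_eq_zero (Or.inr hx), hψ0 x hx, deriv_cutoff_eq_zero_of_gt hx,
        cutoff_eq_zero hx.le])
  obtain ⟨Ψx, Ψy, hv, -⟩ := hS
  have int : ∀ {θ : ℝ × ℝ → ℂ}, Continuous θ → (∀ x y : ℝ, N + 1 < |x| → θ (x, y) = 0) →
      Integrable (fun p => Ψ p * θ p) stripMeasure := fun hθ h0 =>
    integrable_solution_mul hv hθ fun x y hx _ => h0 x y hx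
  have i1 := int (θ := fun p => ψ p.1 * starRingEnd ℂ (eMode β n p.2)) (by fun_prop)
    fun x y hx => by simp [hψ0 x hx]
  have i2 := int (θ := fun p => cutoffError s R ψ N p.1 * starRingEnd ℂ (eMode β n p.2))
    (by fun_prop) fun x y hx => by simp [cutoffError_eq_zero (Or.inr hx)]
  have i3 := int (θ := fun p => cutoff N p.1 * expSol s R ψ p.1 * starRingEnd ℂ (eMode β n p.2))
    (by fun_prop) fun x y hx => by simp [cutoff_eq_zero hx.le]
  have i4 := int (θ := fun p => f p * (expSol s R ψ p.1 * starRingEnd ℂ (eMode β n p.2)))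
    (by fun_prop) fun x y hx => by
      rw [← hcf, cutoff_eq_zero hx.le]
      simp
  have eL : ∀ p : ℝ × ℝ, Ψ p * ((-(cutoffError s R ψ N p.1 +
      cutoff N p.1 * (s ^ 2 * expSol s R ψ p.1 - ψ p.1)) +
      (β + n) ^ 2 * (cutoff N p.1 * expSol s R ψ p.1)) * starRingEnd ℂ (eMode β n p.2)) =
      Ψ p * (ψ p.1 * starRingEnd ℂ (eMode β n p.2)) -
      Ψ p * (cutoffError s R ψ N p.1 * starRingEnd ℂ (eMode β n p.2)) +
      omegaSq μ β *
        (Ψ p * (cutoff N p.1 * expSol s R ψ p.1 * starRingEnd ℂ (eMode β n p.2))) := fun p => by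
    rw [hs2]
    linear_combination Ψ p * starRingEnd ℂ (eMode β n p.2) * hcψ p.1
  have eR : ∀ p : ℝ × ℝ, (1 + ε * f p) * Ψ p *
      ((cutoff N p.1 : ℂ) * expSol s R ψ p.1 * starRingEnd ℂ (eMode β n p.2)) =
      Ψ p * (cutoff N p.1 * expSol s R ψ p.1 * starRingEnd ℂ (eMode β n p.2)) +
      ε * (Ψ p * (f p * (expSol s R ψ p.1 * starRingEnd ℂ (eMode β n p.2)))) := fun p => by
    linear_combination ε * Ψ p * expSol s R ψ p.1 * starRingEnd ℂ (eMode β n p.2) * hcf p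
  simp only [eL, eR] at key
  have i12 : Integrable (fun p => Ψ p * (ψ p.1 * starRingEnd ℂ (eMode β n p.2)) -
      Ψ p * (cutoffError s R ψ N p.1 * starRingEnd ℂ (eMode β n p.2))) stripMeasure := i1.sub i2
  rw [integral_add i12 (i3.const_mul _), integral_sub i1 i2, integral_const_mul,
    integral_add i3 (i4.const_mul _), integral_const_mul] at key
  have e5 : ∫ p, f p * Ψ p * (expSol s R ψ p.1 * starRingEnd ℂ (eMode β n p.2)) ∂stripMeasure =
      ∫ p, Ψ p * (f p * (expSol s R ψ p.1 * starRingEnd ℂ (eMode β n p.2))) ∂stripMeasure := by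
    refine integral_congr_ae (Eventually.of_forall fun p => ?_)
    beta_reduce
    ring
  rw [e5]
  linear_combination key

/-- Let the cut-off recede to infinity: the commutator paired with the `H₁^β` part tends to zero,
and paired with the far field it has a value independent of the cut-off. -/
lemma IsScatteringSolution.mode_identity (hf : IsProfile f ρ) (h : GoodParam b d μ β)
    (hμ : 0 < μ) (hS : IsScatteringSolution f ε μ β Ψ r t) (n : ℤ) {ψ : ℝ → ℂ} {R : ℝ}
    (hR : 0 ≤ R) (hψ : ContDiff ℝ ∞ ψ) (hsupp : ∀ x, x ∉ Icc (-R) R → ψ x = 0) :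
    ∫ p, Ψ p * (ψ p.1 * starRingEnd ℂ (eMode β n p.2)) ∂stripMeasure =
      (if n = 0 then 2 * Real.pi * ∫ x : ℝ, Complex.exp (Complex.I * kProp μ β * x) * ψ x
        else 0) + ε * omegaSq μ β *
        ∫ p, f p * Ψ p * (expSol (modeExp μ β n) R ψ p.1 * starRingEnd ℂ (eMode β n p.2))
          ∂stripMeasure := by
  have hs0 := h.modeExp_ne_zero hμ n
  obtain ⟨W, hW⟩ := exists_bound_cutoffError hs0 (h.modeExp_re_nonneg hμ n) hR hψ.continuous hsupp
  have cq := fun N : ℝ => continuous_cutoffError (R := R) hs0 hψ.continuous N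
  obtain ⟨Ψx, Ψy, hv, -⟩ := id hS
  have lim := hv.tendsto_integral_tail n (fun N : ℕ => cq N) (fun N x => hW N x)
    fun N x hx => cutoffError_eq_zero hx
  refine sub_eq_zero.mp (tendsto_nhds_unique (tendsto_const_nhds.congr' ?_) lim)
  obtain ⟨N₀, hN₀⟩ := exists_nat_gt (R + ρ + 1)
  have hρ := hf.pos
  filter_upwards [eventually_ge_atTop N₀] with N hN
  have hN' : R + ρ + 1 < N := hN₀.trans_le (by exact_mod_cast hN)
  rw [hS.mode_identity_of_cutoff hf h hμ n hψ hsupp (N := N) (by linarith) (by linarith)]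
  have hq0 : ∀ x : ℝ, (N : ℝ) + 1 < |x| → cutoffError (modeExp μ β n) R ψ N x = 0 :=
    fun x hx => cutoffError_eq_zero (Or.inr hx)
  have hfar : (if n = 0 then 2 * Real.pi * ∫ x : ℝ, Complex.exp (Complex.I * kProp μ β * x) * ψ x
      else 0 : ℂ) = ∫ p, farField μ β r t p *
        (cutoffError (modeExp μ β n) R ψ N p.1 * starRingEnd ℂ (eMode β n p.2)) ∂stripMeasure := by
    rw [integral_farField_mul_eMode μ β r t n (cq N) hq0]
    split_ifs with hn
    · subst hn
      rw [integral_farProfile_mul_cutoffError (modeExp_zero μ β) hs0 r t hψ.continuous hsupp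
        (by linarith) (by linarith)]
    · rfl
  have hc := cq N
  have hθ : Continuous fun p : ℝ × ℝ =>
      cutoffError (modeExp μ β n) R ψ N p.1 * starRingEnd ℂ (eMode β n p.2) := by fun_prop
  rw [hfar, add_sub_add_right_eq_sub, ← integral_sub]
  · refine integral_congr_ae (Eventually.of_forall fun p => ?_)
    simp only [Pi.sub_apply]
    ring
  · exact integrable_solution_mul hv hθ (M := N + 1) fun x y hx _ => by simp [hq0 x hx]
  · exact integrable_strip_of_support ((contDiff_farField μ β r t).continuous.mul hθ)
      (M := N + 1) fun x y hx _ => by simp [hq0 x hx]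

end ModeIdentity

/-! ### The modes of a solution satisfy the integral equations -/

section Kernel

variable {s : ℂ} {g : ℝ → ℂ}

lemma continuous_expKer (s : ℂ) : Continuous (expKer s) := by
  unfold expKer
  fun_prop

lemma expKer_sub_comm (s : ℂ) (x ξ : ℝ) : expKer s (x - ξ) = expKer s (ξ - x) := by
  rw [expKer, expKer, abs_sub_comm]

lemma norm_expKer_le (hre : 0 ≤ s.re) (x : ℝ) : ‖expKer s x‖ ≤ 1 / (2 * ‖s‖) := by
  rw [expKer, norm_div, norm_mul, Complex.norm_two, Complex.norm_exp]
  gcongr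
  rw [Real.exp_le_one_iff, Complex.neg_re, Complex.re_mul_ofReal]
  have := mul_nonneg hre (abs_nonneg x)
  linarith

lemma continuous_lineConv_expKer (hre : 0 ≤ s.re) (hg : Integrable g) :
    Continuous (lineConv (expKer s) g) := by
  have hk := continuous_expKer s
  refine continuous_of_dominated (bound := fun ξ => 1 / (2 * ‖s‖) * ‖g ξ‖) (fun x => ?_)
    (fun x => Eventually.of_forall fun ξ => ?_) (hg.norm.const_mul _)
    (Eventually.of_forall fun ξ => by fun_prop)
  · exact (by fun_prop : Continuous fun ξ => expKer s (x - ξ)).aestronglyMeasurable.mul hg.1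
  · rw [norm_mul]
    gcongr
    exact norm_expKer_le hre _

lemma norm_lineConv_expKer_le (hre : 0 ≤ s.re) (hg : Integrable g) (x : ℝ) :
    ‖lineConv (expKer s) g x‖ ≤ 1 / (2 * ‖s‖) * ∫ ξ, ‖g ξ‖ := by
  rw [lineConv, ← integral_const_mul]
  refine norm_integral_le_of_norm_le (hg.norm.const_mul _) (Eventually.of_forall fun ξ => ?_)
  rw [norm_mul]
  gcongr
  exact norm_expKer_le hre _

lemma integral_lineConv_mul {ψ : ℝ → ℂ} (hre : 0 ≤ s.re) (hψ : Integrable ψ) (hg : Integrable g) :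
    ∫ x, lineConv (expKer s) ψ x * g x = ∫ x, ψ x * lineConv (expKer s) g x := by
  have hk := continuous_expKer s
  have hi : Integrable (Function.uncurry fun x ξ : ℝ => expKer s (x - ξ) * (g x * ψ ξ))
      (volume.prod volume) :=
    (hg.mul_prod hψ).bdd_mul (c := 1 / (2 * ‖s‖))
      (by fun_prop : Continuous fun z : ℝ × ℝ => expKer s (z.1 - z.2)).aestronglyMeasurable
      (Eventually.of_forall fun z => norm_expKer_le hre _)
  have := integral_integral_swap hi
  have e1 : ∀ x, lineConv (expKer s) ψ x * g x = ∫ ξ, expKer s (x - ξ) * (g x * ψ ξ) := fun x => by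
    rw [lineConv, ← integral_mul_const]
    congr 1
    ext ξ
    ring
  have e2 : ∀ ξ, ψ ξ * lineConv (expKer s) g ξ = ∫ x, expKer s (x - ξ) * (g x * ψ ξ) := fun ξ => by
    rw [lineConv, ← integral_const_mul]
    congr 1
    ext x
    rw [expKer_sub_comm]
    ring
  simp only [e1, e2]
  exact this

end Kernel

/-- The coefficient `∫_0^{2π} u(x, y) e^{-i(β+n)y} dy`. -/
def solMode (β : ℝ) (u : ℝ × ℝ → ℂ) (n : ℤ) (x : ℝ) : ℂ :=
  ∫ y in Ioo (0 : ℝ) (2 * Real.pi), u (x, y) * starRingEnd ℂ (eMode β n y)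

/-- `u` is integrable on bounded parts of the strip. -/
def LocIntegrableStrip (u : ℝ × ℝ → ℂ) : Prop :=
  ∀ (θ : ℝ × ℝ → ℂ) (M : ℝ), Continuous θ → (∀ x y : ℝ, M < |x| → θ (x, y) = 0) →
    Integrable (fun p => u p * θ p) stripMeasure

/-! ### Fourier coefficients in `y` of a locally integrable function on the strip. -/

section SolMode

variable {β : ℝ} {u : ℝ × ℝ → ℂ} {n : ℤ}

lemma integral_mul_solMode {g : ℝ → ℂ}
    (hu : Integrable (fun p => u p * (g p.1 * starRingEnd ℂ (eMode β n p.2))) stripMeasure) :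
    Integrable (fun x => g x * solMode β u n x) ∧
    ∫ p, u p * (g p.1 * starRingEnd ℂ (eMode β n p.2)) ∂stripMeasure =
      ∫ x, g x * solMode β u n x := by
  rw [stripMeasure_eq_prod] at hu ⊢
  have e : ∀ x : ℝ, ∫ y in Ioo (0 : ℝ) (2 * Real.pi),
      u (x, y) * (g x * starRingEnd ℂ (eMode β n y)) = g x * solMode β u n x := fun x => by
    rw [solMode, ← integral_const_mul]
    congr 1
    ext y
    ring
  have h1 := hu.integral_prod_left
  have h2 := integral_prod _ hu
  simp only [e] at h1 h2
  exact ⟨h1, h2⟩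

lemma LocIntegrableStrip.integral_mul_solMode (hu : LocIntegrableStrip u) {g : ℝ → ℂ}
    (hg : Continuous g) {M : ℝ} (hM : ∀ x, M < |x| → g x = 0) :
    Integrable (fun x => g x * solMode β u n x) ∧
    ∫ p, u p * (g p.1 * starRingEnd ℂ (eMode β n p.2)) ∂stripMeasure =
      ∫ x, g x * solMode β u n x :=
  RBScattering.integral_mul_solMode (hu _ M (by fun_prop) fun x y hx => by simp [hM x hx])

lemma LocIntegrableStrip.locallyIntegrable_solMode (hu : LocIntegrableStrip u) :
    LocallyIntegrable (solMode β u n) := by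
  rw [locallyIntegrable_iff]
  intro k hk
  obtain ⟨M, hM⟩ := hk.isBounded.exists_norm_le
  have hc := (contDiff_cutoff M).continuous
  have h := (hu.integral_mul_solMode (β := β) (n := n) (g := fun x => (cutoff M x : ℂ))
    (by fun_prop) (M := M + 1) fun x hx => by simp [cutoff_eq_zero hx.le]).1
  refine (h.integrableOn (s := k)).congr_fun (fun x hx => ?_) hk.measurableSet
  beta_reduce
  rw [cutoff_eq_one (hM x hx), Complex.ofReal_one, one_mul]

lemma LocIntegrableStrip.integrable_profile_mul {f : ℝ × ℝ → ℝ} {ρ : ℝ} (hf : IsProfile f ρ)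
    (hu : LocIntegrableStrip u) : Integrable (fun p => f p * u p) stripMeasure := by
  have cf := hf.smooth.continuous
  refine (hu (fun p => f p) ρ (by fun_prop) fun x y hx => by simp [hf.support x y hx]).congr
    (Eventually.of_forall fun p => mul_comm _ _)

lemma integrable_solMode (hu : Integrable u stripMeasure) : Integrable (solMode β u n) := by
  have := (integral_mul_solMode (g := fun _ => 1) (β := β) (n := n) (u := u) (by
    refine (hu.bdd_mul (c := 1) (f := fun p => starRingEnd ℂ (eMode β n p.2))
      (by fun_prop : Continuous fun p : ℝ × ℝ =>
        starRingEnd ℂ (eMode β n p.2)).aestronglyMeasurable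
      (Eventually.of_forall fun p => ?_)).congr (Eventually.of_forall fun p => ?_)
    · rw [RCLike.norm_conj, norm_eMode]
    · beta_reduce
      ring)).1
  simpa using this

lemma integral_norm_solMode_le (hu : Integrable u stripMeasure) :
    ∫ x, ‖solMode β u n x‖ ≤ ∫ p, ‖u p‖ ∂stripMeasure := by
  rw [stripMeasure_eq_prod] at hu
  rw [stripMeasure_eq_prod, integral_prod _ hu.norm]
  refine integral_mono ((integrable_solMode (stripMeasure_eq_prod ▸ hu)).norm)
    hu.norm.integral_prod_left fun x => ?_
  refine (norm_integral_le_integral_norm _).trans_eq ?_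
  congr 1
  ext y
  rw [norm_mul, RCLike.norm_conj, norm_eMode, mul_one]

end SolMode

section SolutionModes

variable {f : ℝ × ℝ → ℝ} {ρ ε μ β b d : ℝ} {Ψ : ℝ × ℝ → ℂ} {r t : ℂ}

lemma IsScatteringSolution.locIntegrableStrip (hS : IsScatteringSolution f ε μ β Ψ r t) :
    LocIntegrableStrip Ψ := by
  obtain ⟨Ψx, Ψy, hv, -⟩ := hS
  exact fun θ M hθ h0 => integrable_solution_mul hv hθ fun x y hx _ => h0 x y hx

/-- The mode identity holds for every test function `ψ`. Moving the convolution from `ψ` onto the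
source, the kernel being even, it says that the two sides agree as distributions, hence almost
everywhere. -/
lemma IsScatteringSolution.solMode_ae_eq (hf : IsProfile f ρ) (h : GoodParam b d μ β)
    (hμ : 0 < μ) (hS : IsScatteringSolution f ε μ β Ψ r t) (n : ℤ) :
    ∀ᵐ x, solMode β Ψ n x =
      2 * Real.pi * ((if n = 0 then Complex.exp (Complex.I * kProp μ β * x) else 0) +
        lineConv (green n μ β) (fun ξ => zCoef ε μ β * solMode β (fun p => f p * Ψ p) n ξ) x) := by
  set s := modeExp μ β n with hs
  have hre : 0 ≤ s.re := h.modeExp_re_nonneg hμ n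
  have hL := hS.locIntegrableStrip
  set B := solMode β (fun p => f p * Ψ p) n with hB
  have hBi : Integrable B := integrable_solMode (hL.integrable_profile_mul hf)
  have hg : green n μ β = expKer s := funext fun x => green_eq_expKer h n x
  have hz : Integrable fun ξ => zCoef ε μ β * B ξ := hBi.const_mul _
  have hconv : lineConv (green n μ β) (fun ξ => zCoef ε μ β * B ξ) =
      fun x => zCoef ε μ β * lineConv (expKer s) B x := by
    ext x
    rw [hg, lineConv, lineConv, ← integral_const_mul]
    congr 1
    ext ξ
    ring
  have hcB := continuous_lineConv_expKer hre hBi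
  have hE : Continuous fun x : ℝ =>
      (if n = 0 then Complex.exp (Complex.I * kProp μ β * x) else 0 : ℂ) := by
    split_ifs <;> fun_prop
  rw [hconv]
  set Q : ℝ → ℂ := fun x => 2 * Real.pi *
    ((if n = 0 then Complex.exp (Complex.I * kProp μ β * x) else 0) +
      zCoef ε μ β * lineConv (expKer s) B x) with hQ
  have hQc : Continuous Q := by fun_prop
  have hloc : LocallyIntegrable (fun x => solMode β Ψ n x - Q x) :=
    hL.locallyIntegrable_solMode.sub hQc.locallyIntegrable
  have key := ae_eq_zero_of_integral_contDiff_smul_eq_zero hloc fun φ hφ hφc => ?_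
  · filter_upwards [key] with x hx using sub_eq_zero.mp hx
  obtain ⟨R₀, hR₀⟩ := hφc.isCompact.isBounded.exists_norm_le
  set R := max R₀ 0 with hR
  have hR0 : 0 ≤ R := le_max_right _ _
  set ψ : ℝ → ℂ := fun x => (φ x : ℂ) with hψ
  have hψs : ContDiff ℝ ∞ ψ := Complex.ofRealCLM.contDiff.comp hφ
  have hψc := hψs.continuous
  have hφ0 : ∀ x, x ∉ Icc (-R) R → φ x = 0 := fun x hx => by
    by_contra hne
    exact hx (abs_le.mp ((hR₀ x (subset_tsupport _ hne)).trans (le_max_left _ _)))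
  have hψ0 : ∀ x, x ∉ Icc (-R) R → ψ x = 0 := fun x hx => by simp [hψ, hφ0 x hx]
  have hψ0' : ∀ x, R < |x| → ψ x = 0 := fun x hx => hψ0 x fun hc =>
    absurd (abs_le.mpr hc) (not_le.mpr hx)
  have hψi : ∀ {g : ℝ → ℂ}, Continuous g → Integrable fun x => ψ x * g x := fun hg =>
    (hψc.mul hg).integrable_of_hasCompactSupport
      (HasCompactSupport.intro (isCompact_Icc (a := -R) (b := R)) fun x hx => by simp [hψ0 x hx])
  have hψi1 : Integrable ψ := by simpa using hψi (g := fun _ => 1) continuous_const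
  have hid := hS.mode_identity hf h hμ n hR0 hψs hψ0
  obtain ⟨i1, e1⟩ := hL.integral_mul_solMode (β := β) (n := n) hψc hψ0'
  have hw : lineConv (expKer s) ψ = expSol s R ψ := funext fun x => lineConv_expKer hψc hψ0 x
  have e2 : ∫ p, f p * Ψ p * (expSol s R ψ p.1 * starRingEnd ℂ (eMode β n p.2)) ∂stripMeasure =
      ∫ x, ψ x * lineConv (expKer s) B x := by
    rw [← integral_lineConv_mul hre hψi1 hBi, hw]
    refine (integral_mul_solMode (u := fun p => f p * Ψ p) ?_).2
    have cf := hf.smooth.continuous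
    have cw := continuous_expSol (R := R) (h.modeExp_ne_zero hμ n) hψc
    refine (hL (fun p => f p * (expSol s R ψ p.1 * starRingEnd ℂ (eMode β n p.2))) ρ
      (by fun_prop) fun x y hx => by simp [hf.support x y hx]).congr
      (Eventually.of_forall fun p => ?_)
    beta_reduce
    ring
  rw [e1, e2] at hid
  have e3 : ∀ x, φ x • (solMode β Ψ n x - Q x) = ψ x * solMode β Ψ n x - ψ x * Q x := fun x => by
    rw [Complex.real_smul, mul_sub]
  simp only [e3]
  rw [integral_sub i1 (hψi hQc), hid, sub_eq_zero]
  have e4 : ∫ x, ψ x * Q x = 2 * Real.pi * (∫ x : ℝ, ψ x *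
      (if n = 0 then Complex.exp (Complex.I * kProp μ β * x) else 0)) +
      2 * Real.pi * zCoef ε μ β * ∫ x, ψ x * lineConv (expKer s) B x := by
    rw [← integral_const_mul, ← integral_const_mul,
      ← integral_add ((hψi hE).const_mul _) ((hψi hcB).const_mul _)]
    refine integral_congr_ae (Eventually.of_forall fun x => ?_)
    simp only [hQ]
    ring
  rw [e4, mul_comm (2 * (Real.pi : ℂ)) (zCoef ε μ β), zCoef_mul_two_pi]
  congr 1
  · split_ifs
    · congr 2
      ext x
      ring
    · simp
  · push_cast
    rfl

end SolutionModes

/-! ### Sections of solutions and uniqueness -/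

section Sections

variable {β : ℝ} {u : ℝ × ℝ → ℂ}

lemma memLp_two_sections (hu : MemLp u 2 stripMeasure) :
    ∀ᵐ x : ℝ, MemLp (fun y => u (x, y)) 2 (volume.restrict (Ioo 0 (2 * Real.pi))) := by
  rw [stripMeasure_eq_prod] at hu
  have h1 := ((memLp_two_iff_integrable_sq_norm hu.1).mp hu).prod_right_ae
  filter_upwards [h1, hu.1.prodMk_left] with x hx hm
  exact (memLp_two_iff_integrable_sq_norm hm).mpr hx

lemma memLp_two_of_continuous {g : ℝ → ℂ} (hg : Continuous g) :
    MemLp g 2 (volume.restrict (Ioo 0 (2 * Real.pi))) := by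
  obtain ⟨C, hC⟩ := (isCompact_Icc (a := (0 : ℝ)) (b := 2 * Real.pi)).exists_bound_of_continuousOn
    hg.continuousOn
  refine MemLp.of_bound hg.aestronglyMeasurable C ?_
  filter_upwards [ae_restrict_mem measurableSet_Ioo] with y hy using hC y (Ioo_subset_Icc_self hy)

lemma IsScatteringSolution.memLp_sections {f : ℝ × ℝ → ℝ} {ε μ : ℝ} {r t : ℂ}
    (hS : IsScatteringSolution f ε μ β u r t) :
    ∀ᵐ x : ℝ, MemLp (fun y => u (x, y)) 2 (volume.restrict (Ioo 0 (2 * Real.pi))) := by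
  obtain ⟨Ψx, Ψy, hv, -⟩ := hS
  filter_upwards [memLp_two_sections hv.1] with x hx
  have hc := (contDiff_farField μ β r t).continuous
  refine (memLp_congr_ae (Eventually.of_forall fun y => ?_)).mp
    (hx.add (memLp_two_of_continuous (g := fun y => farField μ β r t (x, y)) (by fun_prop)))
  simp

lemma integrable_mul_conj_eMode {g : ℝ → ℂ}
    (hg : Integrable g (volume.restrict (Ioo 0 (2 * Real.pi)))) (n : ℤ) :
    Integrable (fun y => g y * starRingEnd ℂ (eMode β n y))
      (volume.restrict (Ioo 0 (2 * Real.pi))) := by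
  refine (hg.bdd_mul (c := 1) (continuous_conj_eMode β n).aestronglyMeasurable
    (Eventually.of_forall fun y => ?_)).congr (Eventually.of_forall fun y => mul_comm _ _)
  rw [RCLike.norm_conj, norm_eMode]

lemma setIntegral_eMode_mul_conj (β : ℝ) (m n : ℤ) :
    ∫ y in Ioo 0 (2 * Real.pi), eMode β m y * starRingEnd ℂ (eMode β n y) =
      if m = n then 2 * Real.pi else 0 := by
  rw [← integral_eMode_mul_conj, intervalIntegral.integral_of_le (by positivity),
    integral_Ioc_eq_integral_Ioo]

lemma solMode_modeSeries {g : ℤ → ℝ → ℂ} {x : ℝ} {B : ℤ → ℝ} (hB : Summable B)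
    (hg : ∀ n, n ≠ 0 → ‖g n x‖ ≤ B n) (n : ℤ) :
    solMode β (modeSeries β g) n x = 2 * Real.pi * g n x := by
  have hn : ∀ (i : ℤ) (y : ℝ), ‖g i x * eMode β i y * starRingEnd ℂ (eMode β n y)‖ = ‖g i x‖ :=
    fun i y => by rw [norm_mul, norm_mul, RCLike.norm_conj, norm_eMode, norm_eMode, mul_one, mul_one]
  have h := hasSum_integral_of_summable_integral_norm
    (μ := volume.restrict (Ioo 0 (2 * Real.pi)))
    (F := fun i y => g i x * eMode β i y * starRingEnd ℂ (eMode β n y)) (fun i => ?_) ?_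
  · have e1 : ∀ i : ℤ, ∫ y in Ioo 0 (2 * Real.pi),
        g i x * eMode β i y * starRingEnd ℂ (eMode β n y) =
        if i = n then 2 * Real.pi * g n x else 0 := fun i => by
      simp only [mul_assoc]
      rw [integral_const_mul, setIntegral_eMode_mul_conj]
      split_ifs with hi
      · rw [hi]
        push_cast
        ring
      · simp
    simp only [e1] at h
    rw [(hasSum_ite_eq n (2 * Real.pi * g n x)).unique h, solMode]
    congr 1
    ext y
    rw [tsum_mul_right]
    rfl
  · exact (memLp_two_of_continuous (by fun_prop)).integrable (by norm_num)
  · simp only [hn, integral_const]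
    exact (summable_norm_of_ne_zero hB hg).mul_left _

/-- The Fourier series of `f(x, ·)` converges absolutely and uniformly in `y`, so it may be
integrated term by term against an integrable section; each term shifts the index of the mode. -/
lemma IsProfile.hasSum_solMode_profile_mul {f : ℝ × ℝ → ℝ} {ρ : ℝ} (hf : IsProfile f ρ) {x : ℝ}
    (hu : Integrable (fun y => u (x, y)) (volume.restrict (Ioo 0 (2 * Real.pi)))) (m : ℤ) :
    HasSum (fun n => solMode β u n x * fourierY f (m - n) x)
      (2 * Real.pi * solMode β (fun p => f p * u p) m x) := by
  obtain ⟨C, hC0, hC⟩ := hf.exists_fourierY_bound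
  have e0 : ∀ (j : ℤ) (y : ℝ), fourierY f j x * Complex.exp (Complex.I * j * y) *
      (u (x, y) * starRingEnd ℂ (eMode β m y)) =
      fourierY f j x * (u (x, y) * starRingEnd ℂ (eMode β (m - j) y)) := fun j y => by
    have : Complex.exp (Complex.I * j * y) * starRingEnd ℂ (eMode β m y) =
        starRingEnd ℂ (eMode β (m - j) y) := by
      rw [conj_eMode, conj_eMode, ← Complex.exp_add]
      congr 1
      push_cast
      ring
    rw [← this]
    ring
  have h := hasSum_integral_of_summable_integral_norm
    (μ := volume.restrict (Ioo 0 (2 * Real.pi)))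
    (F := fun j y => fourierY f j x * Complex.exp (Complex.I * j * y) *
      (u (x, y) * starRingEnd ℂ (eMode β m y))) (fun j => ?_) ?_
  · have e1 : ∀ j : ℤ, ∫ y in Ioo 0 (2 * Real.pi),
        fourierY f j x * Complex.exp (Complex.I * j * y) *
        (u (x, y) * starRingEnd ℂ (eMode β m y)) = fourierY f j x * solMode β u (m - j) x :=
      fun j => by
        simp only [e0]
        rw [integral_const_mul, solMode]
    simp only [e1] at h
    have e2 : ∫ y in Ioo 0 (2 * Real.pi), ∑' j : ℤ,
        fourierY f j x * Complex.exp (Complex.I * j * y) *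
        (u (x, y) * starRingEnd ℂ (eMode β m y)) =
        2 * Real.pi * solMode β (fun p => f p * u p) m x := by
      rw [solMode, ← integral_const_mul]
      congr 1
      ext y
      rw [tsum_mul_right, (hf.hasSum_fourierY x y).tsum_eq]
      ring
    rw [e2] at h
    refine (Equiv.subLeft m).hasSum_iff.mp (h.congr_fun fun j => ?_)
    simp only [Function.comp, Equiv.subLeft_apply, sub_sub_cancel]
    ring
  · simp only [e0]
    exact (integrable_mul_conj_eMode hu (m - j)).const_mul _
  · have hle : ∀ j : ℤ, ∫ y in Ioo 0 (2 * Real.pi),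
        ‖fourierY f j x * Complex.exp (Complex.I * j * y) *
          (u (x, y) * starRingEnd ℂ (eMode β m y))‖ =
        ‖fourierY f j x‖ * ∫ y in Ioo 0 (2 * Real.pi), ‖u (x, y)‖ := fun j => by
      rw [← integral_const_mul]
      congr 1
      ext y
      rw [norm_mul, norm_mul, norm_mul, norm_exp_I_int_mul, RCLike.norm_conj, norm_eMode, mul_one,
        mul_one]
    simp only [hle]
    refine Summable.mul_right _ ?_
    exact Summable.of_norm_bounded (summable_div_one_add_sq C) fun j => by
      rw [norm_norm]
      exact hC j x

/-- After removal of the factor `e^{iβy}` these are ordinary Fourier coefficients, and Parseval's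
identity gives `∫ |g|² = 0`. -/
lemma ae_eq_zero_of_forall_mode_eq_zero {g : ℝ → ℂ}
    (hg : MemLp g 2 (volume.restrict (Ioo 0 (2 * Real.pi))))
    (h0 : ∀ n : ℤ, ∫ y in Ioo 0 (2 * Real.pi), g y * starRingEnd ℂ (eMode β n y) = 0) :
    ∀ᵐ y ∂volume.restrict (Ioo 0 (2 * Real.pi)), g y = 0 := by
  have hpi : (0 : ℝ) < 2 * Real.pi := by positivity
  have hres : volume.restrict (Ioc 0 (2 * Real.pi)) = volume.restrict (Ioo 0 (2 * Real.pi)) :=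
    Measure.restrict_congr_set Ioo_ae_eq_Ioc.symm
  set w : ℝ → ℂ := fun y => starRingEnd ℂ (eMode β 0 y) * g y with hw
  have hwn : ∀ y, ‖w y‖ = ‖g y‖ := fun y => by
    simp only [hw]
    rw [norm_mul, RCLike.norm_conj, norm_eMode, one_mul]
  have hwm : MemLp w 2 (volume.restrict (Ioc 0 (2 * Real.pi))) := by
    rw [hres]
    exact (memLp_congr_norm ((continuous_conj_eMode β 0).aestronglyMeasurable.mul hg.1) hg.1
      (Eventually.of_forall hwn)).mpr hg
  have hc : ∀ n : ℤ, fourierCoeffOn hpi w n = 0 := fun n => by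
    rw [fourierCoeffOn_eq_integral, intervalIntegral.integral_of_le hpi.le, hres]
    have : ∀ y : ℝ, (fourier (-n)) (y : AddCircle (2 * Real.pi - 0)) • w y =
        g y * starRingEnd ℂ (eMode β n y) := fun y => by
      rw [fourier_coe_apply, smul_eq_mul]
      simp only [hw]
      rw [conj_eMode, conj_eMode, ← mul_assoc, ← Complex.exp_add, mul_comm]
      congr 2
      have : (Real.pi : ℂ) ≠ 0 := by exact_mod_cast Real.pi_ne_zero
      push_cast
      field_simp
      ring
    simp only [this, h0 n, smul_zero]
  have hs := hasSum_sq_fourierCoeffOn hpi hwm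
  simp only [hc, norm_zero, ne_eq, OfNat.ofNat_ne_zero, not_false_eq_true, zero_pow] at hs
  have h1 := hs.unique hasSum_zero
  rw [smul_eq_mul, mul_eq_zero] at h1
  have h2 : ∫ y in (0 : ℝ)..(2 * Real.pi), ‖w y‖ ^ 2 = 0 :=
    h1.resolve_left (by rw [sub_zero]; positivity)
  rw [intervalIntegral.integral_of_le hpi.le] at h2
  rw [integral_eq_zero_iff_of_nonneg (fun y => by positivity)
    ((memLp_two_iff_integrable_sq_norm hwm.1).mp hwm), hres] at h2
  filter_upwards [h2] with y hy
  rw [Pi.zero_apply, hwn] at hy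
  simpa using hy

end Sections

/-! ### Every solution is the wave of a consistent vector. -/

section Uniqueness

variable {f : ℝ × ℝ → ℝ} {ρ ε μ β b d : ℝ} {Ψ : ℝ × ℝ → ℂ} {r t : ℂ}

/-- The passage from sections to the product needs a measurable set of equality, hence the
measurable representatives. -/
lemma ae_eq_stripMeasure_of_sections {u v : ℝ × ℝ → ℂ} (hu : AEStronglyMeasurable u stripMeasure)
    (hv : AEStronglyMeasurable v stripMeasure)
    (h : ∀ᵐ x : ℝ, ∀ᵐ y ∂volume.restrict (Ioo 0 (2 * Real.pi)), u (x, y) = v (x, y)) :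
    u =ᵐ[stripMeasure] v := by
  rw [stripMeasure_eq_prod] at hu hv ⊢
  have h1 := Measure.ae_ae_of_ae_prod hu.ae_eq_mk
  have h2 := Measure.ae_ae_of_ae_prod hv.ae_eq_mk
  have key : hu.mk u =ᵐ[volume.prod (volume.restrict (Ioo 0 (2 * Real.pi)))] hv.mk v := by
    refine (Measure.ae_prod_iff_ae_ae (measurableSet_eq_fun hu.stronglyMeasurable_mk.measurable
      hv.stronglyMeasurable_mk.measurable)).mpr ?_
    filter_upwards [h, h1, h2] with x hx hx1 hx2
    filter_upwards [hx, hx1, hx2] with y hy hy1 hy2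
    rw [← hy1, ← hy2, hy]
  exact hu.ae_eq_mk.trans (key.trans hv.ae_eq_mk.symm)

lemma IsScatteringSolution.aestronglyMeasurable (hS : IsScatteringSolution f ε μ β Ψ r t) :
    AEStronglyMeasurable Ψ stripMeasure := by
  obtain ⟨Ψx, Ψy, hv, -⟩ := hS
  have h := hv.1.1.add (contDiff_farField μ β r t).continuous.aestronglyMeasurable
  rwa [sub_add_cancel] at h

/-- The modes of a solution are those of a consistent vector. -/
lemma IsScatteringSolution.exists_isConsistent (hf : IsProfile f ρ) (h : GoodParam b d μ β)
    (hμ : 0 < μ) (hS : IsScatteringSolution f ε μ β Ψ r t) :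
    ∃ a : Vec ρ, IsConsistent f ε μ β (vecFn a) ∧
      ∀ n, ∀ᵐ x, solMode β Ψ n x = 2 * Real.pi * modeOf μ β (vecFn a) n x := by
  have hL := hS.locIntegrableStrip
  have hfi := hL.integrable_profile_mul hf
  set A : ℤ → ℝ → ℂ := fun n ξ => zCoef ε μ β * solMode β (fun p => f p * Ψ p) n ξ with hA
  have hAi : ∀ n, Integrable (A n) := fun n => (integrable_solMode hfi).const_mul _
  set D := ‖zCoef ε μ β‖ * ∫ p, ‖(f p : ℂ) * Ψ p‖ ∂stripMeasure with hD
  have hAD : ∀ n, ∫ ξ, ‖A n ξ‖ ≤ D := fun n => by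
    simp only [hA, norm_mul (zCoef ε μ β)]
    rw [integral_const_mul]
    exact mul_le_mul_of_nonneg_left (integral_norm_solMode_le hfi) (norm_nonneg _)
  have hD0 : 0 ≤ D := by positivity
  have hg : ∀ n, green n μ β = expKer (modeExp μ β n) := fun n =>
    funext fun x => green_eq_expKer h n x
  have hre := h.modeExp_re_nonneg hμ
  have hQc : ∀ n, Continuous (modeOf μ β A n) := fun n => by
    have h1 : Continuous (lineConv (green n μ β) (A n)) :=
      hg n ▸ continuous_lineConv_expKer (hre n) (hAi n)
    have h2 : Continuous fun x : ℝ =>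
        (if n = 0 then Complex.exp (Complex.I * kProp μ β * x) else 0 : ℂ) := by
      split_ifs <;> fun_prop
    exact h2.add h1
  set c := minRate b μ with hc
  have hc0 : 0 < c := h.minRate_pos hμ
  have hQb : ∀ n : ℤ, n ≠ 0 → ∀ x, ‖modeOf μ β A n x‖ ≤ D / (2 * c) * (1 / |(n : ℝ)|) := by
    intro n hn x
    have hn0 : 0 < |(n : ℝ)| := abs_pos.mpr (by exact_mod_cast hn)
    have hs : c * |(n : ℝ)| ≤ ‖modeExp μ β n‖ := by
      rw [modeExp_of_ne hn, Complex.norm_real]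
      exact (h.minRate_mul_le hn).trans (le_abs_self _)
    rw [modeOf, if_neg hn, zero_add, hg]
    refine (norm_lineConv_expKer_le (hre n) (hAi n) x).trans ?_
    calc _ ≤ 1 / (2 * (c * |(n : ℝ)|)) * D := by
          gcongr
          exact hAD n
      _ = _ := by field_simp
  have hs2 : Summable fun n : ℤ => 1 / (n : ℝ) ^ 2 :=
    (Real.summable_one_div_int_pow (p := 2)).mpr (by norm_num)
  -- The sources `A_n` are so far only uniformly bounded in `L¹`. Convolution with `G_n` makes them
  -- continuous and of size `1/|n|`, which is square summable.
  let p : Vec ρ := ⟨fun n => restrIcc (modeOf μ β A n) (hQc n).continuousOn, by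
    refine memℓp_gen ?_
    refine Summable.of_norm_bounded_eventually (hs2.mul_left ((D / (2 * c)) ^ 2)) ?_
    filter_upwards [(Set.finite_singleton (0 : ℤ)).compl_mem_cofinite] with n hn
    have hn' : n ≠ 0 := by simpa using hn
    have hle : ‖restrIcc (ρ := ρ) (modeOf μ β A n) (hQc n).continuousOn‖ ≤
        D / (2 * c) * (1 / |(n : ℝ)|) :=
      (ContinuousMap.norm_le _ (by positivity)).mpr fun x => hQb n hn' x
    simp only [ENNReal.toReal_ofNat, Real.rpow_ofNat, norm_pow, norm_norm]
    rw [← sq_abs (n : ℝ), ← one_div_pow, ← mul_pow]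
    gcongr⟩
  have hp : ∀ (n : ℤ) (x : ℝ), x ∈ Icc (-ρ) ρ → vecFn p n x = modeOf μ β A n x := fun n x hx =>
    extZero_of_mem _ hx
  have hsol := fun n => hS.solMode_ae_eq hf h hμ n
  -- The sources `A_m` satisfy the self-consistency equation only almost everywhere; `a` is defined
  -- by its right-hand side. Convolutions do not see the difference, so `a` has the same modes and
  -- is consistent at every point.
  set a : Vec ρ := zCoef ε μ β • hf.mulVec p with ha
  have haf : ∀ m x, vecFn a m x =
      zCoef ε μ β * ∑' n, modeOf μ β A n x * fourierY f (m - n) x := fun m x => by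
    rw [ha, vecFn_smul, hf.vecFn_mulVec]
    congr 2
    ext n
    by_cases hx : x ∈ Icc (-ρ) ρ
    · rw [hp n x hx]
    · rw [hf.fourierY_eq_zero _ hx, mul_zero, mul_zero]
  have hpi : (2 * Real.pi : ℂ) ≠ 0 := by exact_mod_cast Real.two_pi_pos.ne'
  have hAa : ∀ m, A m =ᵐ[volume] vecFn a m := fun m => by
    filter_upwards [ae_all_iff.mpr hsol, hS.memLp_sections] with x hx hm
    have hsum := hf.hasSum_solMode_profile_mul (hm.integrable (by norm_num)) m (β := β)
    simp only [hx, mul_assoc (2 * (Real.pi : ℂ))] at hsum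
    have h3 := (hasSum_mul_left_iff hpi).mp hsum
    rw [haf]
    simp only [hA]
    rw [← h3.tsum_eq]
    rfl
  have hmode : modeOf μ β (vecFn a) = modeOf μ β A := by
    ext n x
    rw [modeOf, modeOf, lineConv, lineConv]
    congr 1
    refine integral_congr_ae ?_
    filter_upwards [hAa n] with ξ hξ
    rw [hξ]
  refine ⟨a, fun m x => ?_, fun n => ?_⟩
  · rw [hmode, haf]
  · filter_upwards [hsol n] with x hx
    rw [hx, hmode]
    rfl

lemma IsConsistent.solMode_eq (hf : IsProfile f ρ) (h : GoodParam b d μ β) (hμ : 0 < μ)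
    {a : Vec ρ} (hA : IsConsistent f ε μ β (vecFn a)) (n : ℤ) (x : ℝ) :
    solMode β (modeSeries β (modeOf μ β (vecFn a))) n x =
      2 * Real.pi * modeOf μ β (vecFn a) n x := by
  obtain ⟨B, hB, hb⟩ := exists_uniform_bound_modes h hμ hf.pos.le a fun n => hA.continuous_vecFn hf n
  exact solMode_modeSeries hB (fun n hn => (hb n hn x).1) n

/-- For almost every `x` the section of the difference is in `L²` and all its Fourier coefficients
vanish. -/
theorem IsScatteringSolution.exists_ae_eq (hf : IsProfile f ρ) (h : GoodParam b d μ β)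
    (hμ : 0 < μ) (hS : IsScatteringSolution f ε μ β Ψ r t) :
    ∃ a : Vec ρ, IsConsistent f ε μ β (vecFn a) ∧
      Ψ =ᵐ[stripMeasure] modeSeries β (modeOf μ β (vecFn a)) := by
  obtain ⟨a, hA, hmode⟩ := hS.exists_isConsistent hf h hμ
  refine ⟨a, hA, ?_⟩
  have hS' := hA.isScatteringSolution hf h hμ
  refine ae_eq_stripMeasure_of_sections hS.aestronglyMeasurable hS'.aestronglyMeasurable ?_
  filter_upwards [hS.memLp_sections, hS'.memLp_sections, ae_all_iff.mpr hmode] with x h1 h2 h3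
  have key := ae_eq_zero_of_forall_mode_eq_zero (β := β) (h1.sub h2) fun n => ?_
  · filter_upwards [key] with y hy using sub_eq_zero.mp hy
  · simp only [Pi.sub_apply, sub_mul]
    rw [integral_sub (integrable_mul_conj_eMode (h1.integrable (by norm_num)) n)
      (integrable_mul_conj_eMode (h2.integrable (by norm_num)) n)]
    have e1 := h3 n
    have e2 := hA.solMode_eq hf h hμ n x
    rw [← e2] at e1
    exact sub_eq_zero.mpr e1

/-- Equal waves have equal Fourier coefficients for almost every `x`, hence equal modes by
continuity, and self-consistency recovers the vector from its modes. -/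
lemma IsConsistent.eq_of_ae_eq (hf : IsProfile f ρ) (h : GoodParam b d μ β) (hμ : 0 < μ)
    {a a' : Vec ρ} (hA : IsConsistent f ε μ β (vecFn a)) (hA' : IsConsistent f ε μ β (vecFn a'))
    (heq : modeSeries β (modeOf μ β (vecFn a)) =ᵐ[stripMeasure]
      modeSeries β (modeOf μ β (vecFn a'))) : a = a' := by
  have hpi : (2 * Real.pi : ℂ) ≠ 0 := by exact_mod_cast Real.two_pi_pos.ne'
  rw [stripMeasure_eq_prod] at heq
  have hsec := Measure.ae_ae_of_ae_prod heq
  have hm : ∀ n, modeOf μ β (vecFn a) n = modeOf μ β (vecFn a') n := fun n => by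
    refine Continuous.ae_eq_iff_eq volume
      (continuous_modeOf h hμ n (hA.continuous_vecFn hf n) (vecFn_eq_zero a n))
      (continuous_modeOf h hμ n (hA'.continuous_vecFn hf n) (vecFn_eq_zero a' n)) |>.mp ?_
    filter_upwards [hsec] with x hx
    refine mul_left_cancel₀ hpi ?_
    rw [← hA.solMode_eq hf h hμ n x, ← hA'.solMode_eq hf h hμ n x, solMode, solMode]
    refine integral_congr_ae ?_
    filter_upwards [hx] with y hy
    rw [hy]
  refine vecFn_injective ?_
  ext m x
  rw [hA m x, hA' m x]
  simp only [hm]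

end Uniqueness

/-! ### The coefficients are determined by the solution -/

section Coefficients

variable {f : ℝ × ℝ → ℝ} {ε μ β : ℝ} {Ψ Ψ' : ℝ × ℝ → ℂ} {r t r' t' : ℂ}

/-- A function of constant nonzero modulus on a set of infinite measure is not square integrable. -/
lemma eq_zero_of_memLp_of_norm_eq {w : ℝ × ℝ → ℂ} {z : ℂ} {S : Set ℝ} (hS : volume S = ⊤)
    (hw : MemLp w 2 stripMeasure) (hz : ∀ x ∈ S, ∀ y, ‖w (x, y)‖ = ‖z‖) : z = 0 := by
  by_contra hne
  have h := hw.meas_ge_lt_top (by norm_num) (by norm_num) (ε := ‖z‖₊) (by simpa using hne)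
  refine absurd (lt_of_le_of_lt (measure_mono (s := S ×ˢ univ) fun p hp => ?_) h) ?_
  · rw [Set.mem_ofPred_eq, ← NNReal.coe_le_coe, coe_nnnorm, coe_nnnorm, ← hz p.1 hp.1 p.2]
  · rw [stripMeasure_eq_prod, Measure.prod_prod, hS, Measure.restrict_apply_univ, Real.volume_Ioo,
      ENNReal.top_mul]
    · simp
    · simp [Real.pi_pos]

/-- The difference of the two far fields is in `L²`, yet its modulus is constant, `|r - r'|` for `x
≤ -1` and `|t - t'|` for `x ≥ 1`. -/
lemma IsScatteringSolution.coefficients_unique (hS : IsScatteringSolution f ε μ β Ψ r t)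
    (hS' : IsScatteringSolution f ε μ β Ψ' r' t') (heq : Ψ =ᵐ[stripMeasure] Ψ') :
    r = r' ∧ t = t' := by
  obtain ⟨_, _, hv, -⟩ := hS
  obtain ⟨_, _, hv', -⟩ := hS'
  have hw : MemLp (farField μ β r t - farField μ β r' t') 2 stripMeasure := by
    refine (memLp_congr_ae ?_).mp (hv'.1.sub hv.1)
    filter_upwards [heq] with p hp
    simp only [Pi.sub_apply, hp]
    ring
  have hexp : ∀ x : ℝ, ‖Complex.exp (Complex.I * kProp μ β * x)‖ = 1 ∧
      ‖Complex.exp (-(Complex.I * kProp μ β) * x)‖ = 1 := fun x => by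
    constructor <;> simp [Complex.norm_exp]
  constructor
  · refine sub_eq_zero.mp (eq_zero_of_memLp_of_norm_eq Real.volume_Iic hw (S := Iic (-1))
      fun x hx y => ?_)
    rw [Pi.sub_apply, farField_eq, farField_eq]
    simp only
    rw [farProfile_of_le hx, farProfile_of_le hx, ← sub_mul, add_sub_add_left_eq_sub, ← sub_mul,
      norm_mul, norm_mul, norm_eMode, (hexp x).2, mul_one, mul_one]
  · refine sub_eq_zero.mp (eq_zero_of_memLp_of_norm_eq Real.volume_Ici hw (S := Ici 1)
      fun x hx y => ?_)
    rw [Pi.sub_apply, farField_eq, farField_eq]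
    simp only
    rw [farProfile_of_ge hx, farProfile_of_ge hx, ← sub_mul, ← sub_mul,
      norm_mul, norm_mul, norm_eMode, (hexp x).1, mul_one, mul_one]

end Coefficients

/-! ### The scattering problem on the curve -/

lemma waveC_eq (f : ℝ × ℝ → ℝ) (ρ ε μ β : ℝ) (C : ℂ) :
    waveC f ρ ε μ β C = modeSeries β (modeOf μ β (vecA f ρ ε μ β C)) := by
  ext p
  rw [waveC, modeSeries, ← tsum_mul_left]
  congr 1
  ext n
  have : eMode β n p.2 =
      Complex.exp (Complex.I * β * p.2) * Complex.exp (Complex.I * n * p.2) := by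
    rw [eMode, ← Complex.exp_add]
    ring_nf
  rw [this, modePsi, modeOf]
  ring

namespace IsProfile

variable {f : ℝ × ℝ → ℝ} {ρ b d ε ν μ β : ℝ}

/-- With `μ = εν` the factor `2γε/(2μ)` is `γ/ν`, so the scalar map takes `C` to `CγF/ν`. It is
written as `C` minus the defect to expose the condition for a fixed point. -/
lemma integral_ampVec_of_funR_eq_zero (hf : IsProfile f ρ) (h : GoodParam b d (ε * ν) β)
    (hz : hf.Small (kerBound b d ρ) (zCoef ε (ε * ν) β)) (hε : 0 < ε) (hν : 0 < ν)
    (hR : funR f ρ ε (ε * ν) β = 0) (C : ℂ) :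
    ∫ x, vecFn (hf.ampVec ε (ε * ν) β C) (-1) x =
      C - C * ((ν - gam (ε * ν) β * funF f ρ ε (ε * ν) β) / ν) := by
  have hε' : (ε : ℂ) ≠ 0 := by exact_mod_cast hε.ne'
  have hν' : (ν : ℂ) ≠ 0 := by exact_mod_cast hν.ne'
  rw [hf.integral_ampVec_neg_one h hz, hR, zCoef]
  push_cast
  field_simp
  ring

/-- With `R = 0` the scalar equation for `C` has no inhomogeneous term, which leaves the alternative
between `C = 0` and `ν = γF`. -/
lemma exists_ampVec_of_isConsistent (hf : IsProfile f ρ) (h : GoodParam b d (ε * ν) β)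
    (hz : hf.Small (kerBound b d ρ) (zCoef ε (ε * ν) β)) (hε : 0 < ε) (hν : 0 < ν)
    (hR : funR f ρ ε (ε * ν) β = 0) {a : Vec ρ} (ha : IsConsistent f ε (ε * ν) β (vecFn a)) :
    ∃ C : ℂ, a = hf.ampVec ε (ε * ν) β C ∧
      C * (ν - gam (ε * ν) β * funF f ρ ε (ε * ν) β) = 0 := by
  have hν' : (ν : ℂ) ≠ 0 := by exact_mod_cast hν.ne'
  have e := (hf.isConsistent_iff h (mul_pos hε hν).ne' hz a).mp ha
  refine ⟨_, e, ?_⟩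
  have h2 := hf.integral_ampVec_of_funR_eq_zero h hz hε hν hR (∫ ξ, vecFn a (-1) ξ)
  rw [← e, eq_comm, sub_eq_self, mul_div_assoc', div_eq_zero_iff] at h2
  exact h2.resolve_right hν'

lemma isConsistent_ampVec (hf : IsProfile f ρ) (h : GoodParam b d (ε * ν) β)
    (hz : hf.Small (kerBound b d ρ) (zCoef ε (ε * ν) β)) (hε : 0 < ε) (hν : 0 < ν)
    (hR : funR f ρ ε (ε * ν) β = 0) {C : ℂ}
    (hC : C * (ν - gam (ε * ν) β * funF f ρ ε (ε * ν) β) = 0) :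
    IsConsistent f ε (ε * ν) β (vecFn (hf.ampVec ε (ε * ν) β C)) := by
  rw [hf.isConsistent_iff h (mul_pos hε hν).ne' hz,
    hf.integral_ampVec_of_funR_eq_zero h hz hε hν hR, mul_div_assoc', hC, zero_div, sub_zero]

lemma isScatteringSolution_waveC (hf : IsProfile f ρ) (h : GoodParam b d μ β) (hμ : 0 < μ)
    (hz : hf.Small (kerBound b d ρ) (zCoef ε μ β)) {C : ℂ}
    (hA : IsConsistent f ε μ β (vecFn (hf.ampVec ε μ β C))) :
    IsScatteringSolution f ε μ β (waveC f ρ ε μ β C) (reflC f ρ ε μ β C)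
      (transC f ρ ε μ β C) := by
  have := hA.isScatteringSolution hf h hμ
  rw [← hf.vecA_eq h hz, ← waveC_eq] at this
  exact this

lemma norm_reflC_le (hf : IsProfile f ρ) (h : GoodParam b d μ β)
    (hz : hf.Small (kerBound b d ρ) (zCoef ε μ β)) (hε : 0 < ε) (hR : funR f ρ ε μ β = 0) (C : ℂ) :
    ‖reflC f ρ ε μ β C‖ ≤ hf.coefBound d * ε := by
  rw [hf.reflC_eq h hz hR]
  exact hf.norm_coef_le h hz hε fun x => by simp [Complex.norm_exp]

lemma norm_transC_sub_one_le (hf : IsProfile f ρ) (h : GoodParam b d μ β)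
    (hz : hf.Small (kerBound b d ρ) (zCoef ε μ β)) (hε : 0 < ε) (hR : funR f ρ ε μ β = 0) (C : ℂ) :
    ‖transC f ρ ε μ β C - 1‖ ≤ hf.coefBound d * ε := by
  rw [hf.transC_eq h hz hR, add_sub_cancel_left]
  exact hf.norm_coef_le h hz hε fun x => by simp [Complex.norm_exp]

lemma exists_ae_eq_waveC (hf : IsProfile f ρ) (h : GoodParam b d (ε * ν) β)
    (hz : hf.Small (kerBound b d ρ) (zCoef ε (ε * ν) β)) (hε : 0 < ε) (hν : 0 < ν)
    (hR : funR f ρ ε (ε * ν) β = 0) {Ψ : ℝ × ℝ → ℂ} {r t : ℂ}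
    (hS : IsScatteringSolution f ε (ε * ν) β Ψ r t) :
    ∃ C : ℂ, C * (ν - gam (ε * ν) β * funF f ρ ε (ε * ν) β) = 0 ∧
      Ψ =ᵐ[stripMeasure] waveC f ρ ε (ε * ν) β C ∧
      r = reflC f ρ ε (ε * ν) β C ∧ t = transC f ρ ε (ε * ν) β C := by
  have hμ := mul_pos hε hν
  obtain ⟨a, ha, heq⟩ := hS.exists_ae_eq hf h hμ
  obtain ⟨C, rfl, hC⟩ := hf.exists_ampVec_of_isConsistent h hz hε hν hR ha
  rw [← hf.vecA_eq h hz, ← waveC_eq] at heq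
  exact ⟨C, hC, heq, hS.coefficients_unique (hf.isScatteringSolution_waveC h hμ hz ha) heq⟩

theorem nonuniqueScattering (hf : IsProfile f ρ) (h : GoodParam b d (ε * ν) β)
    (hz : hf.Small (kerBound b d ρ) (zCoef ε (ε * ν) β)) (hε : 0 < ε) (hν : 0 < ν)
    (hR : funR f ρ ε (ε * ν) β = 0)
    (h0 : (ν : ℂ) - gam (ε * ν) β * funF f ρ ε (ε * ν) β = 0) :
    NonuniqueScattering f ρ ε (ε * ν) β (hf.coefBound d) := by
  have hμ := mul_pos hε hν
  have hcons : ∀ C, IsConsistent f ε (ε * ν) β (vecFn (hf.ampVec ε (ε * ν) β C)) := fun C =>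
    hf.isConsistent_ampVec h hz hε hν hR (by rw [h0, mul_zero])
  have hr : ∀ C, reflC f ρ ε (ε * ν) β 0 = reflC f ρ ε (ε * ν) β C := fun C => by
    rw [hf.reflC_eq h hz hR, hf.reflC_eq h hz hR]
  have ht : ∀ C, transC f ρ ε (ε * ν) β 0 = transC f ρ ε (ε * ν) β C := fun C => by
    rw [hf.transC_eq h hz hR, hf.transC_eq h hz hR]
  refine ⟨_, _, fun C => ⟨hr C, ht C⟩, fun C => ?_, fun C C' heq => ?_, fun Ψ r t hS => ?_,
    hf.norm_reflC_le h hz hε hR 0, hf.norm_transC_sub_one_le h hz hε hR 0⟩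
  · rw [hr C, ht C]
    exact hf.isScatteringSolution_waveC h hμ hz (hcons C)
  -- At the trapped value `C` is recovered from the wave as the integral of the component `A_{-1}`.
  · rw [waveC_eq, waveC_eq, hf.vecA_eq h hz, hf.vecA_eq h hz] at heq
    have e := (hcons C).eq_of_ae_eq hf h hμ (hcons C') heq
    have e1 := hf.integral_ampVec_of_funR_eq_zero h hz hε hν hR C
    have e2 := hf.integral_ampVec_of_funR_eq_zero h hz hε hν hR C'
    rw [h0, zero_div, mul_zero, sub_zero] at e1 e2
    rw [← e1, ← e2, e]
  · obtain ⟨C, -, heq, hrC, htC⟩ := hf.exists_ae_eq_waveC h hz hε hν hR hS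
    exact ⟨⟨C, heq⟩, hrC.trans (hr C).symm, htC.trans (ht C).symm⟩

theorem uniqueScattering (hf : IsProfile f ρ) (h : GoodParam b d (ε * ν) β)
    (hz : hf.Small (kerBound b d ρ) (zCoef ε (ε * ν) β)) (hε : 0 < ε) (hν : 0 < ν)
    (hR : funR f ρ ε (ε * ν) β = 0)
    (h0 : (ν : ℂ) - gam (ε * ν) β * funF f ρ ε (ε * ν) β ≠ 0) :
    UniqueScattering f ρ ε (ε * ν) β (hf.coefBound d) := by
  refine ⟨hf.isScatteringSolution_waveC h (mul_pos hε hν) hz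
    (hf.isConsistent_ampVec h hz hε hν hR (zero_mul _)), fun Ψ r t hS => ?_,
    hf.norm_reflC_le h hz hε hR 0, hf.norm_transC_sub_one_le h hz hε hR 0⟩
  obtain ⟨C, hC, heq, hr, ht⟩ := hf.exists_ae_eq_waveC h hz hε hν hR hS
  obtain rfl : C = 0 := (mul_eq_zero.mp hC).resolve_right h0
  exact ⟨heq, hr, ht⟩

end IsProfile

end RBScattering

end

theorem mainTheorem6
    (f : ℝ × ℝ → ℝ) (ρ : ℝ) (hρ : 0 < ρ)
    (hf : ContDiff ℝ ∞ f)
    (hper : ∀ x y : ℝ, f (x, y + 2 * Real.pi) = f (x, y))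
    (hsupp : ∀ x y : ℝ, ρ < |x| → f (x, y) = 0)
    (hevenx : ∀ x y : ℝ, f (-x, y) = f (x, y))
    (heveny : ∀ x y : ℝ, f (x, -y) = f (x, y))
    (hpos : 0 < ∫ x : ℝ, ∫ y in (0 : ℝ)..(2 * Real.pi), f (x, y))
    (β00 : ℝ) (hβ0 : 0 < β00) (hβ1 : β00 < 1 / 2)
    (hroot : RBScattering.fourierXY f 1 (Real.sqrt (1 - 2 * β00)) = 0)
    (hsimple : deriv (RBScattering.fourierXY f 1) (Real.sqrt (1 - 2 * β00)) ≠ 0) :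
    ∃ (β₀ : ℝ → ℝ → ℝ) (νtr : ℝ → ℝ) (ε₀ μ₀ η K : ℝ),
      0 < ε₀ ∧ 0 < μ₀ ∧ 0 < η ∧
      (∀ ε μ β : ℝ, |ε| < ε₀ → |μ| < μ₀ → |β - β00| < η →
        0 < β ∧ β < 1 / 2 ∧ β ^ 2 < RBScattering.omegaSq μ β ∧
          RBScattering.OneSubOpTBijective f ρ ε μ β) ∧
      RBScattering.IsCurve f ρ β00 ε₀ μ₀ η β₀ ∧
      RBScattering.IsTrappedValue f ρ β00 ε₀ μ₀ β₀ νtr ∧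
      ∀ ε ν : ℝ, 0 < ε → ε < ε₀ → 0 < ν → ε * ν < μ₀ →
        (ν = νtr ε →
          RBScattering.NonuniqueScattering f ρ ε (ε * ν) (β₀ ε (ε * ν)) K) ∧
        (ν ≠ νtr ε →
          RBScattering.UniqueScattering f ρ ε (ε * ν) (β₀ ε (ε * ν)) K) := by
  have hp : RBScattering.IsProfile f ρ := ⟨hρ, hf, hper, hsupp, hevenx, heveny⟩
  obtain ⟨β₀, νtr, ε₀, μ₀, η, b, d, hε₀, hμ₀, hη, hbox, hcurve, htrap⟩ :=
    hp.exists_curve hpos hβ0 hβ1 hroot hsimple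
  refine ⟨β₀, νtr, ε₀, μ₀, η, hp.coefBound d, hε₀, hμ₀, hη, fun ε μ β h1 h2 h3 => ?_, hcurve,
    htrap, fun ε ν h1 h2 h3 h4 => ?_⟩
  · obtain ⟨h, hz⟩ := hbox ε μ β h1 h2 h3
    exact ⟨h.beta_pos, h.beta_lt, h.sq_lt_omegaSq, hp.oneSubOpTBijective h hz⟩
  · have hε : |ε| < ε₀ := by rwa [abs_of_pos h1]
    have hμ : |ε * ν| < μ₀ := by rwa [abs_of_pos (mul_pos h1 h3)]
    obtain ⟨hβ, hR⟩ := hcurve.2.2 ε (ε * ν) hε hμ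
    obtain ⟨h, hz⟩ := hbox ε (ε * ν) _ hε hμ hβ
    have hR0 := (hR _ hβ).mpr rfl
    have hν := (htrap.2 ε h1 h2).2.2 ν h3 h4
    exact ⟨fun e => hp.nonuniqueScattering h hz h1 h3 hR0 (hν.mpr e),
      fun e => hp.uniqueScattering h hz h1 h3 hR0 fun h0 => e (hν.mp h0)⟩
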